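/- Let $G,H$ be Hopf algebras over $\mathbb C$, $\pi:G\to H$ a Hopf algebra map, and let $M=G^H=\{g\in G: g_{(1)}\otimes\pi(g_{(2)})=g\otimes 1\}$ be the associated quantum homogeneous space, with its left $G$-coaction given by the coproduct. Assume that $G$ is faithfully flat as a right $M$-module. Let $\varepsilon$ be the counit, $M^+=M\cap\ker\varepsilon$, $m^+=m-\varepsilon(m)1$, and for a left $M$-module $E$ put $\Phi(E)=E/M^+E$. For a subobject $W\subseteq E$ we also write $\Phi(W)$ for its image in $\Phi(E)$. Let $(\Omega^1(M),\mathrm d)$ be a left-covariant first-order differential calculus over $M$: an $M$-bimodule spanned by the elements $a\,\mathrm db$, where $\mathrm d:M\to\Omega^1(M)$ satisfies the Leibniz rule, with a left $G$-coaction for which $a\,\mathrm db\mapsto a_{(1)}b_{(1)}\otimes a_{(2)}\mathrm db_{(2)}$. Let $N=\{\sum a_i\otimes b_i\in M\otimes M:\sum a_ib_i=0,\ \sum a_i\,\mathrm db_i=0\}$ be the corresponding sub-bimodule of the universal calculus, $I=\{\sum\varepsilon(a_i)b_i^+:\sum a_i\otimes b_i\in N\}$, and let $V_M=M^+/I$ be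 the cotangent space. It is a right $M$-module by multiplication and a right $H$-comodule by $[m]\mapsto[(m_{(2)})^+]\otimes S(\pi(m_{(1)}))$, and $\sigma:\Phi(\Omega^1(M))\to V_M$, $[a\,\mathrm db]\mapsto[\varepsilon(a)b^+]$, is an isomorphism. Let $\Omega^\bullet$ be the maximal prolongation, that is, the quotient of the tensor algebra of the $M$-bimodule $\Omega^1(M)$ by the two-sided ideal generated by $\mathrm dN=\{\sum \mathrm da_i\otimes_M\mathrm db_i:\sum a_i\otimes b_i\in N\}$, and let $\Omega^k$ be its part of degree $k$. **(1)** The map $W\mapsto\sigma(\Phi(W))$ gives a bijection from the decompositions $\Omega^1(M)=\Omega^{(1,0)}\oplus\Omega^{(0,1)}$ into left-covariant sub-bimodules (sub-bimodules which are left $G$-subcomodules) onto the decompositions $V_M=V^{(1,0)}\oplus V^{(0,1)}$ into right $M$-submodules which are right $H$-subcomodules. Assume from now on that $\Omega^1(M)$ belongs to ${}^G_M\mathcal M_0$, i.e. $\Omega^1(M)M^+\subseteq M^+\Omega^1(M)$. Then the same map is a bijection onto the decompositions of $V_M$ into right $H$-subcomodules. There is also the isomorphism $\sigma^2:\Phi(\Omega^1(M)\otimes_M\Omega^1(M))\to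 V_M\otimes V_M$, $[\omega\otimes_M\omega']\mapsto\sigma[\omega]\otimes\sigma[\omega']$. Put $I^2_M=\sigma^2(\Phi(\mathrm dN))$ and $V^2_M=V_M^{\otimes2}/I^2_M$. Then $\sigma^2$ descends to an isomorphism $\Phi(\Omega^2)\to V_M^2$, also denoted $\sigma^2$; put $\wedge_\sigma=\sigma^2\circ\Phi(\wedge)\circ(\sigma^2)^{-1}:V_M\otimes V_M\to V^2_M$. Fix a decomposition $\Omega^1(M)=\Omega^{(1,0)}\oplus\Omega^{(0,1)}$ into left-covariant sub-bimodules. Let $V^{(1,0)}=\sigma(\Phi(\Omega^{(1,0)}))$ and $V^{(0,1)}=\sigma(\Phi(\Omega^{(0,1)}))$. Let $V_M^{\otimes(2,0)}$, $V_M^{\otimes(1,1)}$ and $V_M^{\otimes(0,2)}$ be the images under $\sigma^2\circ\Phi$ of $\Omega^{(1,0)}\otimes_M\Omega^{(1,0)}$, of $\Omega^{(1,0)}\otimes_M\Omega^{(0,1)}\oplus\Omega^{(0,1)}\otimes_M\Omega^{(1,0)}$, and of $\Omega^{(0,1)}\otimes_M\Omega^{(0,1)}$. Let $V^{(1,1)}=\sigma^2(\Phi(\Omega^{(1,1)}))\subseteq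 V_M^2$, where $\Omega^{(1,1)}\subseteq\Omega^2$ is the image under $\wedge$ of $\Omega^{(1,0)}\otimes_M\Omega^{(0,1)}\oplus\Omega^{(0,1)}\otimes_M\Omega^{(1,0)}$. **(2)** The decomposition extends to an $\mathbb N_0^2$-algebra grading $\Omega^\bullet=\bigoplus_{(p,q)}\Omega^{(p,q)}$ with $\Omega^k=\bigoplus_{p+q=k}\Omega^{(p,q)}$ for all $k$ if and only if $I^2_M$ is homogeneous with respect to $V_M^{\otimes2}=V_M^{\otimes(2,0)}\oplus V_M^{\otimes(1,1)}\oplus V_M^{\otimes(0,2)}$. **(3)** Suppose such a grading is given. If the wedge condition holds, i.e. $\wedge$ restricts to isomorphisms $\Omega^{(p,0)}\otimes_M\Omega^{(0,q)}\to\Omega^{(p,q)}$ and $\Omega^{(0,q)}\otimes_M\Omega^{(p,0)}\to\Omega^{(p,q)}$ for all $p,q\ge0$, then $\wedge_\sigma$ restricts to isomorphisms $$V^{(1,0)}\otimes V^{(0,1)}\to V^{(1,1)}\qquad\text{and}\qquad V^{(0,1)}\otimes V^{(1,0)}\to V^{(1,1)}.$$ Conversely, if these two restrictions of $\wedge_\sigma$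 are isomorphisms, and the antipode of $G$ is bijective or $V_M$ is finite-dimensional, then the wedge condition holds. -/

import Mathlib

open scoped TensorProduct

universe u

set_option linter.unusedSectionVars false

noncomputable section

namespace QHom

/-! ### Bimodules over a complex algebra -/

section Bimodules

variable (A : Type*) [Ring A] [Algebra ℂ A]
variable (E : Type*) [AddCommGroup E] [Module ℂ E] [Module A E] [IsScalarTower ℂ A E]
  [Module Aᵐᵒᵖ E]
variable (F : Type*) [AddCommGroup F] [Module ℂ F] [Module A F] [IsScalarTower ℂ A F]

/-- The submodule of `E ⊗ F` generated by the elements `e a ⊗ f - e ⊗ a f`. -/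
def balanced : Submodule A (E ⊗[ℂ] F) :=
  Submodule.span A {t | ∃ (e : E) (a : A) (f : F),
    t = (MulOpposite.op a • e) ⊗ₜ[ℂ] f - e ⊗ₜ[ℂ] (a • f)}

/-- The tensor product `E ⊗_A F` over the (noncommutative) algebra `A` of an `A`-bimodule `E` and a
left `A`-module `F`, with its left `A`-module structure. -/
abbrev BTensor : Type _ := (E ⊗[ℂ] F) ⧸ balanced A E F

variable {F}

/-- The map `id ⊗_A f : E ⊗_A F → E ⊗_A F'` induced by a left `A`-module map `f : F → F'`. -/
def BTensor.map {F' : Type*} [AddCommGroup F'] [Module ℂ F'] [Module A F']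
    [IsScalarTower ℂ A F'] (f : F →ₗ[A] F') : BTensor A E F →ₗ[A] BTensor A E F' :=
  Submodule.mapQ _ _ (TensorProduct.AlgebraTensorModule.map LinearMap.id (f.restrictScalars ℂ)) <| by
    rw [balanced, Submodule.span_le]
    rintro _ ⟨e, a, x, rfl⟩
    refine Submodule.subset_span ⟨e, a, f x, ?_⟩
    simp

variable {A E} in
/-- The canonical `ℂ`-linear projection `E ⊗ F → E ⊗_A F`. -/
def BTensor.mk : (E ⊗[ℂ] F) →ₗ[ℂ] BTensor A E F := (balanced A E F).mkQ.restrictScalars ℂ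

end Bimodules

/-! ### The fibre functor `Φ(E) = E / A⁺E` of an augmented algebra `(A, ε)` -/

section Fibre

variable {A : Type*} [Ring A] [Algebra ℂ A] (ε : A →ₐ[ℂ] ℂ)
variable (E : Type*) [AddCommGroup E] [Module ℂ E] [Module A E] [IsScalarTower ℂ A E]
variable {F : Type*} [AddCommGroup F] [Module ℂ F] [Module A F] [IsScalarTower ℂ A F]

/-- The subspace `A⁺E`, where `A⁺ = ker ε`. -/
def augSub : Submodule ℂ E := Submodule.span ℂ {x | ∃ (a : A) (e : E), ε a = 0 ∧ x = a • e}

/-- `Φ(E) = E / A⁺E`. -/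
abbrev Phi : Type _ := E ⧸ augSub ε E

variable {E}

/-- The class of an element of `E` in `Φ(E)`. -/
def Phi.mk : E →ₗ[ℂ] Phi ε E := (augSub ε E).mkQ

/-- The map `Φ(E) → Φ(F)` to which a module map `E → F` descends. -/
def Phi.map (f : E →ₗ[A] F) : Phi ε E →ₗ[ℂ] Phi ε F :=
  Submodule.mapQ _ _ (f.restrictScalars ℂ) <| by
    rw [augSub, Submodule.span_le]
    rintro _ ⟨a, e, ha, rfl⟩
    exact Submodule.subset_span ⟨a, f e, ha, by simp⟩

/-- For a subobject `W ⊆ E`, the space `Φ(W)` seen as a subspace of `Φ(E)`. -/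
def Phi.image (W : Submodule ℂ E) : Submodule ℂ (Phi ε E) := W.map (Phi.mk ε)

theorem Phi.mk_smul (a : A) (e : E) : Phi.mk ε (a • e) = ε a • Phi.mk ε e := by
  rw [← map_smul, ← sub_eq_zero, ← map_sub]
  refine (Submodule.Quotient.mk_eq_zero _).2 (Submodule.subset_span ⟨a - algebraMap ℂ A (ε a), e, ?_, ?_⟩)
  · simp
  · simp [sub_smul, algebraMap_smul]

theorem Phi.mk_surjective : Function.Surjective (Phi.mk ε : E →ₗ[ℂ] Phi ε E) :=
  Submodule.mkQ_surjective _

end Fibre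

/-! ### Quantum homogeneous spaces -/

section Space

variable {G H : Type*} [Ring G] [HopfAlgebra ℂ G] [Ring H] [HopfAlgebra ℂ H] (π : G →ₐc[ℂ] H)

/-- The homogeneous right coaction `g ↦ g₁ ⊗ π(g₂)` of `H` on `G`. -/
def rightCoact : G →ₐ[ℂ] G ⊗[ℂ] H :=
  (Algebra.TensorProduct.map (AlgHom.id ℂ G) (π : G →ₐ[ℂ] H)).comp (Bialgebra.comulAlgHom ℂ G)

/-- The quantum homogeneous space `M = G^H = {g | g₁ ⊗ π(g₂) = g ⊗ 1}`. -/
def coinv : Subalgebra ℂ G := AlgHom.equalizer (rightCoact π) Algebra.TensorProduct.includeLeft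

/-- The counit restricted to `M`. -/
def counitM : coinv π →ₐ[ℂ] ℂ := (Bialgebra.counitAlgHom ℂ G).comp (coinv π).val

/-- `G` is a right `M`-module by right multiplication. -/
instance rightModule : Module (coinv π)ᵐᵒᵖ G :=
  Module.compHom G (RingHom.op ((coinv π).val : coinv π →+* G))

/-- `G` is a faithfully flat right `M`-module: `G ⊗_M -` preserves and reflects exact sequences of
left `M`-modules. -/
def IsFaithfullyFlatRight {G H : Type u} [Ring G] [HopfAlgebra ℂ G] [Ring H] [HopfAlgebra ℂ H]
    (π : G →ₐc[ℂ] H) : Prop :=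
  ∀ (F₁ F₂ F₃ : Type u) [AddCommGroup F₁] [AddCommGroup F₂] [AddCommGroup F₃]
    [Module ℂ F₁] [Module ℂ F₂] [Module ℂ F₃]
    [Module (coinv π) F₁] [Module (coinv π) F₂] [Module (coinv π) F₃]
    [IsScalarTower ℂ (coinv π) F₁] [IsScalarTower ℂ (coinv π) F₂] [IsScalarTower ℂ (coinv π) F₃]
    (f : F₁ →ₗ[coinv π] F₂) (g : F₂ →ₗ[coinv π] F₃),
    Function.Exact f g ↔
      Function.Exact (BTensor.map (coinv π) G f) (BTensor.map (coinv π) G g)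

theorem exists_coactM (m : coinv π) :
    ∃ t, (coinv π).val.toLinearMap.lTensor G t = Coalgebra.comul (R := ℂ) (m : G) := by
  let f : G →ₗ[ℂ] G ⊗[ℂ] H :=
    (rightCoact π).toLinearMap - (Algebra.TensorProduct.includeLeft : G →ₐ[ℂ] G ⊗[ℂ] H).toLinearMap
  have hex : Function.Exact (coinv π).val.toLinearMap f := by
    intro g
    constructor
    · intro hg
      exact ⟨⟨g, sub_eq_zero.1 hg⟩, rfl⟩
    · rintro ⟨x, rfl⟩
      exact sub_eq_zero.2 x.2
  refine ((Module.Flat.lTensor_exact G hex) _).1 ?_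
  have hm : (π : G →ₗ[ℂ] H).lTensor G (Coalgebra.comul (R := ℂ) (m : G)) = (m : G) ⊗ₜ 1 := by
    have := m.2
    exact this
  have e1 : ((rightCoact π).toLinearMap.lTensor G) (Coalgebra.comul (R := ℂ) (m : G)) =
      TensorProduct.assoc ℂ G G H ((Coalgebra.comul (R := ℂ)).rTensor H
        ((π : G →ₗ[ℂ] H).lTensor G (Coalgebra.comul (R := ℂ) (m : G)))) := by
    have h1 : (rightCoact π).toLinearMap = (π : G →ₗ[ℂ] H).lTensor G ∘ₗ Coalgebra.comul := rfl
    rw [h1, LinearMap.lTensor_comp, LinearMap.comp_apply, ← Coalgebra.coassoc_apply]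
    have : ∀ t : G ⊗[ℂ] G, ((π : G →ₗ[ℂ] H).lTensor G).lTensor G
        (TensorProduct.assoc ℂ G G G ((Coalgebra.comul (R := ℂ)).rTensor G t)) =
        TensorProduct.assoc ℂ G G H
        ((Coalgebra.comul (R := ℂ)).rTensor H ((π : G →ₗ[ℂ] H).lTensor G t)) := by
      intro t
      induction t with
      | zero => simp
      | add x y hx hy => simp only [map_add, hx, hy]
      | tmul x y =>
        simp only [LinearMap.rTensor_tmul, LinearMap.lTensor_tmul]
        generalize (Coalgebra.comul (R := ℂ) x) = s
        induction s with
        | zero => simp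
        | add x y hx hy => simp only [map_add, TensorProduct.add_tmul, hx, hy]
        | tmul x y => simp
    exact this _
  have e2 : ∀ t : G ⊗[ℂ] G,
      ((Algebra.TensorProduct.includeLeft : G →ₐ[ℂ] G ⊗[ℂ] H).toLinearMap.lTensor G) t =
      TensorProduct.assoc ℂ G G H (t ⊗ₜ 1) := by
    intro t
    induction t with
    | zero => simp
    | add x y hx hy => simp only [map_add, TensorProduct.add_tmul, hx, hy]
    | tmul x y => simp
  simp only [f, LinearMap.lTensor_sub, LinearMap.sub_apply, e1, e2]
  rw [hm]
  simp

theorem lTensor_val_injective :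
    Function.Injective ((coinv π).val.toLinearMap.lTensor G) :=
  Module.Flat.lTensor_preserves_injective_linearMap _ Subtype.val_injective

/-- The left `G`-coaction `Δ : M → G ⊗ M` to which the comultiplication of `G` restricts. -/
def coactM : coinv π →ₗ[ℂ] G ⊗[ℂ] coinv π :=
  (LinearEquiv.ofInjective _ (lTensor_val_injective π)).symm.toLinearMap ∘ₗ
    LinearMap.codRestrict _ (Coalgebra.comul ∘ₗ (coinv π).val.toLinearMap) (exists_coactM π)

theorem lTensor_val_coactM (m : coinv π) :
    (coinv π).val.toLinearMap.lTensor G (coactM π m) = Coalgebra.comul (R := ℂ) (m : G) := by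
  have := LinearEquiv.ofInjective_symm_apply (f := (coinv π).val.toLinearMap.lTensor G)
    (h := lTensor_val_injective π) ⟨_, exists_coactM π m⟩
  exact this

theorem coactM_mul (m n : coinv π) : coactM π (m * n) = coactM π m * coactM π n := by
  apply lTensor_val_injective π
  have : ∀ t, (coinv π).val.toLinearMap.lTensor G t =
      Algebra.TensorProduct.map (AlgHom.id ℂ G) (coinv π).val t := fun _ => rfl
  rw [lTensor_val_coactM, this, map_mul, ← this, ← this, lTensor_val_coactM, lTensor_val_coactM]
  simp

theorem coactM_one : coactM π 1 = 1 := by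
  apply lTensor_val_injective π
  rw [lTensor_val_coactM]
  simp [Algebra.TensorProduct.one_def]

/-- `M⁺ = M ∩ ker ε`. -/
def plusM : Submodule ℂ (coinv π) := LinearMap.ker (counitM π).toLinearMap

/-- `m ↦ m⁺ = m - ε(m) 1`. -/
def toPlus : coinv π →ₗ[ℂ] plusM π :=
  LinearMap.codRestrict _ (LinearMap.id - (Algebra.linearMap ℂ (coinv π)) ∘ₗ (counitM π).toLinearMap)
    (by intro m; simp [plusM])

theorem coe_toPlus (m : coinv π) :
    (toPlus π m : coinv π) = m - algebraMap ℂ (coinv π) (counitM π m) := rfl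

/-- The right `H`-coaction `m ↦ m₂ ⊗ S(π(m₁))` on `M⁺`. (For `m ∈ M⁺` this equals
`(m₂)⁺ ⊗ S(π(m₁))`, since `1 ⊗ S(π(m)) = 0`.) -/
def coactPlus : plusM π →ₗ[ℂ] plusM π ⊗[ℂ] H :=
  (TensorProduct.comm ℂ H (plusM π)).toLinearMap ∘ₗ
    TensorProduct.map (HopfAlgebraStruct.antipode ℂ ∘ₗ (π : G →ₗ[ℂ] H)) (toPlus π) ∘ₗ
    coactM π ∘ₗ (plusM π).subtype

/-- The right `M`-action on `M⁺` by multiplication. -/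
def actPlus (m : coinv π) : plusM π →ₗ[ℂ] plusM π :=
  LinearMap.restrict (LinearMap.mulRight ℂ m) (by
    intro x hx
    have : counitM π x = 0 := hx
    simp [plusM, this])

/-- The left action of `G ⊗ M` on `G ⊗ E`, `(g ⊗ m)(g' ⊗ e) = g g' ⊗ m e`. -/
def tensorAct (E : Type*) [AddCommGroup E] [Module ℂ E] [Module (coinv π) E]
    [IsScalarTower ℂ (coinv π) E] :
    G ⊗[ℂ] coinv π →ₗ[ℂ] G ⊗[ℂ] E →ₗ[ℂ] G ⊗[ℂ] E :=
  TensorProduct.map₂ (LinearMap.mul ℂ G) (Algebra.lsmul ℂ ℂ E).toLinearMap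

end Space

/-! ### Left-covariant first-order calculi -/

section Calculus

variable {G H : Type*} [Ring G] [HopfAlgebra ℂ G] [Ring H] [HopfAlgebra ℂ H] (π : G →ₐc[ℂ] H)
variable (Ω : Type*) [AddCommGroup Ω] [Module ℂ Ω]
  [Module (coinv π) Ω] [IsScalarTower ℂ (coinv π) Ω]
  [Module (coinv π)ᵐᵒᵖ Ω] [IsScalarTower ℂ (coinv π)ᵐᵒᵖ Ω]
  [SMulCommClass (coinv π) (coinv π)ᵐᵒᵖ Ω]

/-- The structure of a left-covariant first-order differential calculus over `M` on the
`M`-bimodule `Ω`. -/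
structure CovariantCalculus where
  /-- the exterior derivative -/
  d : coinv π →ₗ[ℂ] Ω
  leibniz : ∀ a b : coinv π, d (a * b) = a • d b + MulOpposite.op b • d a
  span_d : Submodule.span ℂ {ω : Ω | ∃ a b : coinv π, ω = a • d b} = ⊤
  /-- the left `G`-coaction -/
  coact : Ω →ₗ[ℂ] G ⊗[ℂ] Ω
  counit_coact : ∀ ω, (TensorProduct.lid ℂ Ω) ((Coalgebra.counit (R := ℂ)).rTensor Ω (coact ω)) = ω
  coassoc : ∀ ω, TensorProduct.assoc ℂ G G Ω ((Coalgebra.comul (R := ℂ)).rTensor Ω (coact ω)) =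
    coact.lTensor G (coact ω)
  coact_smul_d : ∀ a b : coinv π,
    coact (a • d b) = tensorAct π Ω (coactM π a) (d.lTensor G (coactM π b))

namespace CovariantCalculus

variable {π Ω} (C : CovariantCalculus π Ω)

/-- The map `M ⊗ M → Ω`, `a ⊗ b ↦ a db`. -/
def formMap : coinv π ⊗[ℂ] coinv π →ₗ[ℂ] Ω :=
  TensorProduct.lift ((Algebra.lsmul ℂ ℂ Ω).toLinearMap.compl₂ C.d)

theorem formMap_tmul (a b : coinv π) : C.formMap (a ⊗ₜ b) = a • C.d b := by simp [formMap]

/-- The sub-bimodule `N` of the universal calculus `ker(M ⊗ M → M)` which defines the calculus: the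
elements `∑ aᵢ d_u bᵢ` for which `∑ aᵢ dbᵢ = 0` in `Ω`. -/
def N : Submodule ℂ (coinv π ⊗[ℂ] coinv π) :=
  LinearMap.ker (LinearMap.mul' ℂ (coinv π)) ⊓ LinearMap.ker C.formMap

/-- The map `∑ aᵢ ⊗ bᵢ ↦ ∑ ε(aᵢ) bᵢ⁺`. -/
def _root_.QHom.sigmaU (π : G →ₐc[ℂ] H) : coinv π ⊗[ℂ] coinv π →ₗ[ℂ] plusM π :=
  TensorProduct.lift ((LinearMap.lsmul ℂ (plusM π)).compl₁₂ (counitM π).toLinearMap (toPlus π))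

theorem sigmaU_tmul (a b : coinv π) :
    sigmaU π (a ⊗ₜ b) = counitM π a • toPlus π b := by simp [sigmaU]

/-- The subobject `σ(Φ(N)) = {∑ ε(aᵢ) bᵢ⁺ | ∑ aᵢ d_u bᵢ ∈ N}` of `M⁺` corresponding to the calculus. -/
def I : Submodule ℂ (plusM π) := C.N.map (sigmaU π)

/-- The cotangent space `V_M = M⁺ / σ(Φ(N))`. -/
abbrev V : Type _ := plusM π ⧸ C.I

/-- `M⁺ → Φ(Ω)`, `m ↦ [dm]`. -/
def preJ : plusM π →ₗ[ℂ] Phi (counitM π) Ω := Phi.mk (counitM π) ∘ₗ C.d ∘ₗ (plusM π).subtype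

theorem d_one : C.d 1 = 0 := by
  have := C.leibniz 1 1
  simpa using this

theorem d_toPlus (m : coinv π) : C.d (toPlus π m : coinv π) = C.d m := by
  have : C.d (algebraMap ℂ (coinv π) (counitM π m)) = 0 := by
    rw [Algebra.algebraMap_eq_smul_one, map_smul, C.d_one, smul_zero]
  rw [coe_toPlus, map_sub, this, sub_zero]

theorem preJ_sigmaU (t : coinv π ⊗[ℂ] coinv π) :
    C.preJ (sigmaU π t) = Phi.mk (counitM π) (C.formMap t) := by
  induction t with
  | zero => simp
  | add x y hx hy => simp only [map_add, hx, hy]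
  | tmul a b => simp [sigmaU_tmul, formMap_tmul, preJ, Phi.mk_smul, d_toPlus]

theorem exists_rep (ω : Ω) : ∃ t, LinearMap.mul' ℂ (coinv π) t = 0 ∧ C.formMap t = ω := by
  have h : ω ∈ Submodule.span ℂ {ω : Ω | ∃ a b : coinv π, ω = a • C.d b} := by
    rw [C.span_d]; trivial
  induction h using Submodule.span_induction with
  | mem x hx =>
    obtain ⟨a, b, rfl⟩ := hx
    exact ⟨a ⊗ₜ b - (a * b) ⊗ₜ 1, by simp, by simp [formMap_tmul, d_one]⟩
  | zero => exact ⟨0, by simp, by simp⟩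
  | add x y _ _ hx hy =>
    obtain ⟨s, hs, hs'⟩ := hx
    obtain ⟨t, ht, ht'⟩ := hy
    exact ⟨s + t, by simp [hs, ht], by simp [hs', ht']⟩
  | smul c x _ hx =>
    obtain ⟨s, hs, hs'⟩ := hx
    exact ⟨c • s, by simp [hs], by simp [hs']⟩

theorem smul_tensor (m : coinv π) (t : coinv π ⊗[ℂ] coinv π) :
    LinearMap.mul' ℂ (coinv π) (m • t) = m * LinearMap.mul' ℂ (coinv π) t ∧
    C.formMap (m • t) = m • C.formMap t ∧ sigmaU π (m • t) = counitM π m • sigmaU π t := by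
  induction t with
  | zero => simp
  | add x y hx hy =>
    simp only [smul_add, map_add, hx.1, hx.2.1, hx.2.2, hy.1, hy.2.1, hy.2.2, mul_add, and_self]
  | tmul a b =>
    refine ⟨?_, ?_, ?_⟩
    · simp [TensorProduct.smul_tmul', mul_assoc]
    · simp [TensorProduct.smul_tmul', formMap_tmul, mul_smul]
    · simp [TensorProduct.smul_tmul', sigmaU_tmul, mul_smul]

theorem I_eq_ker : C.I = LinearMap.ker C.preJ := by
  apply le_antisymm
  · rintro _ ⟨t, ht, rfl⟩
    have h2 : C.formMap t = 0 := ht.2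
    rw [LinearMap.mem_ker, preJ_sigmaU, h2, map_zero]
  · intro n hn
    have hn' : C.d (n : coinv π) ∈ augSub (counitM π) Ω := (Submodule.Quotient.mk_eq_zero _).1 hn
    have key : ∀ ω ∈ augSub (counitM π) Ω, ∃ t, LinearMap.mul' ℂ (coinv π) t = 0 ∧
        C.formMap t = ω ∧ sigmaU π t = 0 := by
      intro ω hω
      induction hω using Submodule.span_induction with
      | mem x hx =>
        obtain ⟨a, e, ha, rfl⟩ := hx
        obtain ⟨t, ht, ht'⟩ := C.exists_rep e
        obtain ⟨h1, h2, h3⟩ := C.smul_tensor a t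
        exact ⟨a • t, by rw [h1, ht, mul_zero], by rw [h2, ht'], by rw [h3, ha, zero_smul]⟩
      | zero => exact ⟨0, by simp⟩
      | add x y _ _ hx hy =>
        obtain ⟨s, hs, hs', hs''⟩ := hx
        obtain ⟨t, ht, ht', ht''⟩ := hy
        exact ⟨s + t, by simp [hs, ht], by simp [hs', ht'], by simp [hs'', ht'']⟩
      | smul c x _ hx =>
        obtain ⟨s, hs, hs', hs''⟩ := hx
        exact ⟨c • s, by simp [hs], by simp [hs'], by simp [hs'']⟩
    obtain ⟨t, h1, h2, h3⟩ := key _ hn'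
    have hn0 : counitM π (n : coinv π) = 0 := n.2
    refine ⟨1 ⊗ₜ (n : coinv π) - (n : coinv π) ⊗ₜ 1 - t, ⟨?_, ?_⟩, ?_⟩
    · simp [h1]
    · simp [h2, formMap_tmul, d_one]
    · have : toPlus π (n : coinv π) = n := by
        ext; simp [coe_toPlus, hn0]
      simp [h3, sigmaU_tmul, hn0, this]

/-- `V_M → Φ(Ω)`, `[m] ↦ [dm]`. -/
def J : C.V →ₗ[ℂ] Phi (counitM π) Ω := C.I.liftQ C.preJ C.I_eq_ker.le

theorem J_injective : Function.Injective C.J := by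
  rw [← LinearMap.ker_eq_bot, J, Submodule.ker_liftQ_eq_bot _ _ _ C.I_eq_ker.ge]

theorem J_surjective : Function.Surjective C.J := by
  intro x
  obtain ⟨ω, rfl⟩ := Phi.mk_surjective _ x
  obtain ⟨t, -, rfl⟩ := C.exists_rep ω
  exact ⟨C.I.mkQ (sigmaU π t), by rw [← preJ_sigmaU]; simp [J]⟩

/-- The isomorphism `σ : Φ(Ω) ≃ V_M`, `[a db] ↦ [ε(a) b⁺]`. -/
def sigma : Phi (counitM π) Ω ≃ₗ[ℂ] C.V :=
  (LinearEquiv.ofBijective C.J ⟨C.J_injective, C.J_surjective⟩).symm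

theorem sigma_apply (a b : coinv π) :
    C.sigma (Phi.mk (counitM π) (a • C.d b)) = C.I.mkQ (counitM π a • toPlus π b) := by
  rw [sigma, LinearEquiv.symm_apply_eq]
  simp [J, preJ, Phi.mk_smul, d_toPlus]

/-! #### The structure of `V_M` as a right `M`-module and right `H`-comodule -/

/-- The right action `[v] ◁ m = [v m]` on `V_M`. -/
def actV (m : coinv π) : C.V →ₗ[ℂ] C.V :=
  Submodule.mapQ C.I C.I (actPlus π m) <| by
    rw [I_eq_ker]
    intro n hn
    have hn' : C.d (n : coinv π) ∈ augSub (counitM π) Ω := (Submodule.Quotient.mk_eq_zero _).1 hn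
    refine (Submodule.Quotient.mk_eq_zero _).2 ?_
    have h1 : C.d ((actPlus π m n : plusM π) : coinv π) =
        (n : coinv π) • C.d m + MulOpposite.op m • C.d (n : coinv π) := by
      rw [← C.leibniz]; rfl
    have h2 : ∀ ω ∈ augSub (counitM π) Ω, MulOpposite.op m • ω ∈ augSub (counitM π) Ω := by
      intro ω hω
      induction hω using Submodule.span_induction with
      | mem x hx =>
        obtain ⟨a, e, ha, rfl⟩ := hx
        exact Submodule.subset_span ⟨a, MulOpposite.op m • e, ha, (smul_comm _ _ _).symm⟩
      | zero => simp
      | add x y _ _ hx hy => rw [smul_add]; exact add_mem hx hy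
      | smul c x _ hx => rw [smul_comm]; exact Submodule.smul_mem _ _ hx
    change C.d ((actPlus π m n : plusM π) : coinv π) ∈ _
    rw [h1]
    exact add_mem (Submodule.subset_span ⟨n, C.d m, n.2, rfl⟩) (h2 _ hn')

/-- `Ω → Φ(Ω) ⊗ H`, `ω ↦ [ω₀] ⊗ S(π(ω₋₁))`. -/
def coactPhi : Ω →ₗ[ℂ] Phi (counitM π) Ω ⊗[ℂ] H :=
  (TensorProduct.comm ℂ H (Phi (counitM π) Ω)).toLinearMap ∘ₗ
    TensorProduct.map (HopfAlgebraStruct.antipode ℂ ∘ₗ (π : G →ₗ[ℂ] H)) (Phi.mk (counitM π)) ∘ₗ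
    C.coact

theorem coact_smul (m : coinv π) (ω : Ω) :
    C.coact (m • ω) = tensorAct π Ω (coactM π m) (C.coact ω) := by
  have hmul : ∀ (x y : G ⊗[ℂ] coinv π) (z : G ⊗[ℂ] Ω),
      tensorAct π Ω (x * y) z = tensorAct π Ω x (tensorAct π Ω y z) := by
    intro x y z
    induction x with
    | zero => simp
    | add x x' hx hx' => simp only [add_mul, map_add, LinearMap.add_apply, hx, hx']
    | tmul a b =>
      induction y with
      | zero => simp
      | add y y' hy hy' => simp only [mul_add, map_add, LinearMap.add_apply, hy, hy']
      | tmul c e =>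
        induction z with
        | zero => simp
        | add z z' hz hz' => simp only [map_add, hz, hz']
        | tmul g w => simp [tensorAct, mul_assoc]
  have h : ω ∈ Submodule.span ℂ {ω : Ω | ∃ a b : coinv π, ω = a • C.d b} := by
    rw [C.span_d]; trivial
  induction h using Submodule.span_induction with
  | mem x hx =>
    obtain ⟨a, b, rfl⟩ := hx
    rw [← mul_smul, C.coact_smul_d, C.coact_smul_d, coactM_mul, hmul]
  | zero => simp
  | add x y _ _ hx hy => rw [smul_add, map_add, map_add, map_add, hx, hy]
  | smul c x _ hx => rw [smul_comm m c x, LinearMap.map_smul C.coact, hx, LinearMap.map_smul C.coact,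
      LinearMap.map_smul]

theorem counit_tensorAct (x : G ⊗[ℂ] coinv π) (z : G ⊗[ℂ] Ω) :
    TensorProduct.map (HopfAlgebraStruct.antipode ℂ ∘ₗ (π : G →ₗ[ℂ] H)) (Phi.mk (counitM π))
      (tensorAct π Ω x z) =
    TensorProduct.map₂ (LinearMap.mul ℂ H).flip (LinearMap.lsmul ℂ (Phi (counitM π) Ω))
      (TensorProduct.map (HopfAlgebraStruct.antipode ℂ ∘ₗ (π : G →ₗ[ℂ] H))
        (counitM π).toLinearMap x)
      (TensorProduct.map (HopfAlgebraStruct.antipode ℂ ∘ₗ (π : G →ₗ[ℂ] H))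
        (Phi.mk (counitM π)) z) := by
  induction x with
  | zero => simp
  | add x x' hx hx' => simp only [map_add, LinearMap.add_apply, hx, hx']
  | tmul a b =>
    induction z with
    | zero => simp
    | add z z' hz hz' => simp only [map_add, hz, hz']
    | tmul g w =>
      simp [tensorAct, Phi.mk_smul, HopfAlgebra.antipode_mul_antidistrib]

theorem _root_.QHom.counit_coactM (π : G →ₐc[ℂ] H) (m : coinv π) :
    (counitM π).toLinearMap.lTensor G (coactM π m) = (m : G) ⊗ₜ[ℂ] (1 : ℂ) := by
  have h1 : (counitM π).toLinearMap = Coalgebra.counit ∘ₗ (coinv π).val.toLinearMap := rfl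
  rw [h1, LinearMap.lTensor_comp, LinearMap.comp_apply, lTensor_val_coactM,
    Coalgebra.lTensor_counit_comul]

theorem _root_.QHom.map_coe (π : G →ₐc[ℂ] H) (m : coinv π) : π (m : G) = algebraMap ℂ H (counitM π m) := by
  have h : (π : G →ₗ[ℂ] H).lTensor G (Coalgebra.comul (R := ℂ) (m : G)) = (m : G) ⊗ₜ 1 := m.2
  have h2 := congrArg (fun t => TensorProduct.lid ℂ H ((Coalgebra.counit (R := ℂ)).rTensor H t)) h
  have h3 : ∀ t : G ⊗[ℂ] G, TensorProduct.lid ℂ H ((Coalgebra.counit (R := ℂ)).rTensor H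
      ((π : G →ₗ[ℂ] H).lTensor G t)) =
      π (TensorProduct.lid ℂ G ((Coalgebra.counit (R := ℂ)).rTensor G t)) := by
    intro t
    induction t with
    | zero => simp
    | add x y hx hy => simp only [map_add, hx, hy]
    | tmul x y => simp
  simp only [h3, Coalgebra.rTensor_counit_comul] at h2
  simp only [TensorProduct.lid_tmul, one_smul, LinearMap.rTensor_tmul] at h2
  rw [h2, Algebra.algebraMap_eq_smul_one]
  rfl

theorem augSub_le_ker_coactPhi : augSub (counitM π) Ω ≤ LinearMap.ker C.coactPhi := by
  refine Submodule.span_le.2 ?_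
  rintro _ ⟨a, e, ha, rfl⟩
  have h1 : TensorProduct.map (HopfAlgebraStruct.antipode ℂ ∘ₗ (π : G →ₗ[ℂ] H))
      (counitM π).toLinearMap (coactM π a) = 0 := by
    have : TensorProduct.map (HopfAlgebraStruct.antipode ℂ ∘ₗ (π : G →ₗ[ℂ] H))
      (counitM π).toLinearMap = (HopfAlgebraStruct.antipode ℂ ∘ₗ (π : G →ₗ[ℂ] H)).rTensor ℂ ∘ₗ
        (counitM π).toLinearMap.lTensor G := by
      rw [LinearMap.rTensor_comp_lTensor]
    rw [this, LinearMap.comp_apply, counit_coactM, LinearMap.rTensor_tmul]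
    simp [map_coe, ha]
  change C.coactPhi (a • e) = 0
  simp only [coactPhi, LinearMap.comp_apply, coact_smul, counit_tensorAct, h1]
  simp

theorem J_coact (n : plusM π) :
    C.J.rTensor H (C.I.mkQ.rTensor H (coactPlus π n)) = C.coactPhi (C.d (n : coinv π)) := by
  have h1 : C.coact (C.d (n : coinv π)) = C.d.lTensor G (coactM π n) := by
    have := C.coact_smul_d 1 n
    rw [one_smul, coactM_one] at this
    rw [this]
    generalize C.d.lTensor G (coactM π n) = z
    rw [Algebra.TensorProduct.one_def]
    induction z with
    | zero => simp
    | add z z' hz hz' => simp only [map_add, hz, hz']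
    | tmul g w => simp [tensorAct]
  simp only [coactPhi, coactPlus, LinearMap.comp_apply, h1, Submodule.subtype_apply]
  generalize coactM π (n : coinv π) = z
  induction z with
  | zero => simp
  | add z z' hz hz' => simp only [map_add, hz, hz']
  | tmul g w => simp [J, preJ, d_toPlus]

/-- The right `H`-coaction `[m] ↦ [m₂] ⊗ S(π(m₁))` on `V_M`. -/
def coactV : C.V →ₗ[ℂ] C.V ⊗[ℂ] H :=
  C.I.liftQ (C.I.mkQ.rTensor H ∘ₗ coactPlus π) <| by
    intro n hn
    have hinj : Function.Injective (C.J.rTensor H) :=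
      Module.Flat.rTensor_preserves_injective_linearMap _ C.J_injective
    refine hinj ?_
    rw [LinearMap.comp_apply, J_coact, map_zero]
    rw [I_eq_ker] at hn
    exact C.augSub_le_ker_coactPhi ((Submodule.Quotient.mk_eq_zero _).1 hn)

/-! #### Subobjects and decompositions -/

/-- `W ⊆ Ω` is a left-covariant sub-bimodule. -/
structure IsCovariantSubbimodule (W : Submodule ℂ Ω) : Prop where
  smul_mem : ∀ (m : coinv π), ∀ ω ∈ W, m • ω ∈ W
  op_smul_mem : ∀ (m : coinv π), ∀ ω ∈ W, MulOpposite.op m • ω ∈ W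
  coact_mem : ∀ ω ∈ W, C.coact ω ∈ LinearMap.range (W.subtype.lTensor G)

/-- `W ⊆ V_M` is a right `H`-subcomodule. -/
def IsSubcomodule (W : Submodule ℂ C.V) : Prop :=
  ∀ v ∈ W, C.coactV v ∈ LinearMap.range (W.subtype.rTensor H)

/-- `W ⊆ V_M` is a right `M`-submodule. -/
def IsRightSubmodule (W : Submodule ℂ C.V) : Prop :=
  ∀ (m : coinv π), ∀ v ∈ W, C.actV m v ∈ W

/-- The decompositions `Ω = Ω⁽¹⁰⁾ ⊕ Ω⁽⁰¹⁾` into left-covariant sub-bimodules. -/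
def formDecompositions : Set (Submodule ℂ Ω × Submodule ℂ Ω) :=
  {p | C.IsCovariantSubbimodule p.1 ∧ C.IsCovariantSubbimodule p.2 ∧ IsCompl p.1 p.2}

/-- The decompositions `V_M = V⁽¹⁰⁾ ⊕ V⁽⁰¹⁾` into right `H`-subcomodules. -/
def comoduleDecompositions : Set (Submodule ℂ C.V × Submodule ℂ C.V) :=
  {p | C.IsSubcomodule p.1 ∧ C.IsSubcomodule p.2 ∧ IsCompl p.1 p.2}

/-- The decompositions `V_M = V⁽¹⁰⁾ ⊕ V⁽⁰¹⁾` into right `M`-submodules which are also right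
`H`-subcomodules. -/
def cotangentDecompositions : Set (Submodule ℂ C.V × Submodule ℂ C.V) :=
  {p ∈ C.comoduleDecompositions | C.IsRightSubmodule p.1 ∧ C.IsRightSubmodule p.2}

/-- The subspace `σ(Φ(W))` of `V_M` corresponding to `W ⊆ Ω`. -/
def toV (W : Submodule ℂ Ω) : Submodule ℂ C.V :=
  (Phi.image (counitM π) W).map C.sigma.toLinearMap

/-- `Ω` belongs to the subcategory `ᴳ_M M₀` of covariant bimodules with `Ω M⁺ ⊆ M⁺ Ω`. -/
def _root_.QHom.IsInM0 (π : G →ₐc[ℂ] H) (Ω : Type*) [AddCommGroup Ω] [Module ℂ Ω]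
    [Module (coinv π) Ω] [Module (coinv π)ᵐᵒᵖ Ω] : Prop :=
  ∀ (m : coinv π) (ω : Ω), counitM π m = 0 → MulOpposite.op m • ω ∈ augSub (counitM π) Ω

/-! #### Two-forms and the cotangent space in degree two -/

/-- `Ω ⊗_M Ω`. -/
abbrev _root_.QHom.Omega2T (π : G →ₐc[ℂ] H) (Ω : Type*) [AddCommGroup Ω] [Module ℂ Ω]
    [Module (coinv π) Ω] [IsScalarTower ℂ (coinv π) Ω] [Module (coinv π)ᵐᵒᵖ Ω] : Type _ :=
  BTensor (coinv π) Ω Ω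

/-- The map `∑ aᵢ ⊗ bᵢ ↦ ∑ daᵢ ⊗_M dbᵢ`, which restricts to the exterior derivative
`∑ aᵢ d_u bᵢ ↦ ∑ daᵢ ⊗_M dbᵢ` on universal one-forms. -/
def dTensor : coinv π ⊗[ℂ] coinv π →ₗ[ℂ] Omega2T π Ω :=
  BTensor.mk ∘ₗ TensorProduct.map C.d C.d

theorem smul_dTensor (m : coinv π) (t : coinv π ⊗[ℂ] coinv π) :
    m • C.dTensor t = C.dTensor (m • t) - BTensor.mk (C.d m ⊗ₜ C.formMap t) := by
  induction t with
  | zero => simp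
  | add x y hx hy =>
    simp only [smul_add, map_add, TensorProduct.tmul_add, hx, hy]
    abel
  | tmul a b =>
    have h1 : BTensor.mk (A := coinv π) ((MulOpposite.op a • C.d m) ⊗ₜ[ℂ] C.d b) =
        BTensor.mk (A := coinv π) (C.d m ⊗ₜ[ℂ] (a • C.d b)) :=
      (Submodule.Quotient.eq _).2 (Submodule.subset_span ⟨_, _, _, rfl⟩)
    rw [formMap_tmul, ← h1]
    have h2 : m • C.dTensor (a ⊗ₜ b) = BTensor.mk (A := coinv π) ((m • C.d a) ⊗ₜ[ℂ] C.d b) := rfl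
    have h3 : C.dTensor (m • a ⊗ₜ b) = BTensor.mk (A := coinv π) (C.d (m * a) ⊗ₜ[ℂ] C.d b) := rfl
    rw [h2, h3, C.leibniz, TensorProduct.add_tmul, map_add]
    abel

/-- `dN ⊆ Ω ⊗_M Ω`, the degree two part of the ideal generated by `dN` in the tensor algebra. -/
def dN : Submodule (coinv π) (Omega2T π Ω) where
  __ := C.N.map C.dTensor
  smul_mem' := by
    rintro m _ ⟨t, ht, rfl⟩
    have h1 : LinearMap.mul' ℂ (coinv π) t = 0 := ht.1
    have h2 : C.formMap t = 0 := ht.2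
    obtain ⟨h3, h4, -⟩ := C.smul_tensor m t
    refine ⟨m • t, ⟨?_, ?_⟩, ?_⟩
    · change LinearMap.mul' ℂ (coinv π) (m • t) = 0
      rw [h3, h1, mul_zero]
    · change C.formMap (m • t) = 0
      rw [h4, h2, smul_zero]
    · rw [smul_dTensor, h2]
      simp

/-- The degree two forms `Ω² = (Ω ⊗_M Ω) / dN` of the maximal prolongation. -/
abbrev Omega2 : Type _ := Omega2T π Ω ⧸ C.dN

/-- The wedge map `∧ : Ω ⊗_M Ω → Ω²`. -/
def wedge2 : Omega2T π Ω →ₗ[coinv π] C.Omega2 := C.dN.mkQ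

theorem _root_.QHom.IsInM0.mk_op_smul (h0 : IsInM0 π Ω) (m : coinv π) (ω : Ω) :
    Phi.mk (counitM π) (MulOpposite.op m • ω) = counitM π m • Phi.mk (counitM π) ω := by
  have h := h0 (m - algebraMap ℂ _ (counitM π m)) ω (by simp)
  have h1 := (Submodule.Quotient.mk_eq_zero _).2 h
  change Phi.mk (counitM π) _ = 0 at h1
  rw [MulOpposite.op_sub, sub_smul, map_sub, sub_eq_zero] at h1
  rw [h1, ← map_smul]
  congr 1
  rw [Algebra.algebraMap_eq_smul_one, MulOpposite.op_smul, smul_assoc, MulOpposite.op_one, one_smul]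

section Degree2

variable (h0 : IsInM0 π Ω)

/-- The map `[ω ⊗_M ω'] ↦ [ω] ⊗ [ω']` from `Φ(Ω ⊗_M Ω)` to `Φ(Ω) ⊗ Φ(Ω)`. -/
def mu : Phi (counitM π) (Omega2T π Ω) →ₗ[ℂ] Phi (counitM π) Ω ⊗[ℂ] Phi (counitM π) Ω :=
  let f : Ω ⊗[ℂ] Ω →ₗ[ℂ] Phi (counitM π) Ω ⊗[ℂ] Phi (counitM π) Ω :=
    TensorProduct.map (Phi.mk (counitM π)) (Phi.mk (counitM π))
  have hf : ∀ (m : coinv π) (t : Ω ⊗[ℂ] Ω), f (m • t) = counitM π m • f t := by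
    intro m t
    induction t with
    | zero => simp
    | add x y hx hy => simp only [smul_add, map_add, hx, hy]
    | tmul a b => simp [f, TensorProduct.smul_tmul', Phi.mk_smul]
  (augSub (counitM π) (Omega2T π Ω)).liftQ
    ((((balanced (coinv π) Ω Ω).restrictScalars ℂ).liftQ f (by
      intro t ht
      have ht' : t ∈ Submodule.span (coinv π) _ := ht
      induction ht' using Submodule.span_induction with
      | mem x hx =>
        obtain ⟨e, a, w, rfl⟩ := hx
        simp [f, h0.mk_op_smul, Phi.mk_smul, TensorProduct.smul_tmul]
      | zero => simp
      | add x y hx' hy' hx hy =>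
        rw [LinearMap.mem_ker, map_add, LinearMap.mem_ker.1 (hx hx'), LinearMap.mem_ker.1 (hy hy'),
          add_zero]
      | smul c x hx' hx => rw [LinearMap.mem_ker, hf, LinearMap.mem_ker.1 (hx hx'), smul_zero])) ∘ₗ
      (Submodule.Quotient.restrictScalarsEquiv ℂ (balanced (coinv π) Ω Ω)).symm.toLinearMap) (by
    rw [augSub, Submodule.span_le]
    rintro _ ⟨a, e, ha, rfl⟩
    obtain ⟨t, rfl⟩ := Submodule.mkQ_surjective _ e
    change f (a • t) = 0
    rw [hf, ha, zero_smul])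

theorem mu_mk (ω ω' : Ω) :
    mu h0 (Phi.mk (counitM π) (BTensor.mk (ω ⊗ₜ ω'))) =
      Phi.mk (counitM π) ω ⊗ₜ Phi.mk (counitM π) ω' := rfl

/-- The inverse `[ω] ⊗ [ω'] ↦ [ω ⊗_M ω']` of `mu`. -/
def muInv : Phi (counitM π) Ω ⊗[ℂ] Phi (counitM π) Ω →ₗ[ℂ] Phi (counitM π) (Omega2T π Ω) :=
  let f : Ω →ₗ[ℂ] Ω →ₗ[ℂ] Phi (counitM π) (Omega2T π Ω) :=
    (TensorProduct.mk ℂ Ω Ω).compr₂ (Phi.mk (counitM π) ∘ₗ BTensor.mk)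
  have h1 : ∀ (m : coinv π) (x y : Ω), f (m • x) y = counitM π m • f x y := by
    intro m x y
    exact Phi.mk_smul (counitM π) m (BTensor.mk (A := coinv π) (x ⊗ₜ[ℂ] y))
  have h2 : ∀ (m : coinv π) (x y : Ω), f x (m • y) = f (MulOpposite.op m • x) y := by
    intro m x y
    have h : BTensor.mk (A := coinv π) ((MulOpposite.op m • x) ⊗ₜ[ℂ] y) =
        BTensor.mk (A := coinv π) (x ⊗ₜ[ℂ] (m • y)) :=
      (Submodule.Quotient.eq _).2 (Submodule.subset_span ⟨_, _, _, rfl⟩)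
    exact (congrArg (Phi.mk (counitM π)) h).symm
  have h3 : ∀ x ∈ augSub (counitM π) Ω, f x = 0 := by
    intro x hx
    have : augSub (counitM π) Ω ≤ LinearMap.ker f := by
      rw [augSub, Submodule.span_le]
      rintro _ ⟨a, e, ha, rfl⟩
      refine LinearMap.mem_ker.2 (LinearMap.ext fun y => ?_)
      rw [h1, ha, zero_smul, LinearMap.zero_apply]
    exact this hx
  TensorProduct.lift <| (augSub (counitM π) Ω).liftQ
    (LinearMap.flip ((augSub (counitM π) Ω).liftQ f.flip (by
      rw [augSub, Submodule.span_le]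
      rintro _ ⟨a, e, ha, rfl⟩
      refine LinearMap.mem_ker.2 (LinearMap.ext fun y => ?_)
      change f y (a • e) = 0
      rw [h2, h3 _ (h0 a y ha), LinearMap.zero_apply]))) (by
    intro x hx
    refine LinearMap.mem_ker.2 (LinearMap.ext fun y => ?_)
    obtain ⟨y, rfl⟩ := Submodule.mkQ_surjective _ y
    have := congrArg (fun g => g y) (h3 x hx)
    exact this)

theorem muInv_mk (ω ω' : Ω) :
    muInv h0 (Phi.mk (counitM π) ω ⊗ₜ Phi.mk (counitM π) ω') =
      Phi.mk (counitM π) (BTensor.mk (ω ⊗ₜ ω')) := rfl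

/-- The isomorphism `σ² : Φ(Ω ⊗_M Ω) ≃ V_M ⊗ V_M`, `[ω ⊗_M ω'] ↦ σ[ω] ⊗ σ[ω']`. -/
def sigmaTwo : Phi (counitM π) (Omega2T π Ω) ≃ₗ[ℂ] C.V ⊗[ℂ] C.V :=
  (LinearEquiv.ofLinearMap (mu h0) (muInv h0)
    (by
      refine TensorProduct.ext' fun x y => ?_
      obtain ⟨x, rfl⟩ := Phi.mk_surjective _ x
      obtain ⟨y, rfl⟩ := Phi.mk_surjective _ y
      rfl)
    (by
      refine LinearMap.ext fun z => ?_
      obtain ⟨z, rfl⟩ := Phi.mk_surjective _ z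
      obtain ⟨z, rfl⟩ := Submodule.mkQ_surjective _ z
      induction z with
      | zero => simp
      | add x y hx hy => simp only [map_add, hx, hy]
      | tmul x y => rfl) :
    Phi (counitM π) (Omega2T π Ω) ≃ₗ[ℂ] Phi (counitM π) Ω ⊗[ℂ] Phi (counitM π) Ω).trans (TensorProduct.congr C.sigma C.sigma)

/-- `I² = σ²(Φ(dN))`. -/
def ITwo : Submodule ℂ (C.V ⊗[ℂ] C.V) :=
  (Phi.image (counitM π) (C.dN.restrictScalars ℂ)).map (C.sigmaTwo h0).toLinearMap

/-- `V²_M = V_M^{⊗2} / I²`. -/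
abbrev VTwo : Type _ := (C.V ⊗[ℂ] C.V) ⧸ C.ITwo h0

/-- The map `σ² : Φ(Ω²) → V²_M` to which `σ² : Φ(Ω ⊗_M Ω) → V_M ⊗ V_M` descends. -/
def sigmaTwoBar : Phi (counitM π) C.Omega2 →ₗ[ℂ] C.VTwo h0 :=
  (augSub (counitM π) C.Omega2).liftQ
    (((C.dN.restrictScalars ℂ).liftQ
      ((C.ITwo h0).mkQ ∘ₗ (C.sigmaTwo h0).toLinearMap ∘ₗ Phi.mk (counitM π)) (by
        intro x hx
        refine (Submodule.Quotient.mk_eq_zero _).2 ?_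
        exact ⟨_, ⟨x, hx, rfl⟩, rfl⟩)) ∘ₗ
      (Submodule.Quotient.restrictScalarsEquiv ℂ C.dN).symm.toLinearMap) (by
    rw [augSub, Submodule.span_le]
    rintro _ ⟨a, e, ha, rfl⟩
    obtain ⟨t, rfl⟩ := Submodule.mkQ_surjective _ e
    change (C.ITwo h0).mkQ (C.sigmaTwo h0 (Phi.mk (counitM π) (a • t))) = 0
    rw [Phi.mk_smul, ha, zero_smul, map_zero, map_zero])

/-- `∧_σ = σ² ∘ Φ(∧) ∘ (σ²)⁻¹ : V_M ⊗ V_M → V²_M`. -/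
def wedgeSigma : C.V ⊗[ℂ] C.V →ₗ[ℂ] C.VTwo h0 :=
  C.sigmaTwoBar h0 ∘ₗ Phi.map (counitM π) C.wedge2 ∘ₗ (C.sigmaTwo h0).symm.toLinearMap

end Degree2

/-- The image of `X ⊗ Y` in `Ω ⊗_M Ω`, for `X, Y ⊆ Ω`. -/
def _root_.QHom.subTensor (π : G →ₐc[ℂ] H) {Ω : Type*} [AddCommGroup Ω] [Module ℂ Ω]
    [Module (coinv π) Ω] [IsScalarTower ℂ (coinv π) Ω] [Module (coinv π)ᵐᵒᵖ Ω]
    (X Y : Submodule ℂ Ω) : Submodule ℂ (Omega2T π Ω) :=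
  (Submodule.map₂ (TensorProduct.mk ℂ Ω Ω) X Y).map BTensor.mk

section Decomposition

variable (h0 : IsInM0 π Ω) (X Y : Submodule ℂ Ω)

/-- `V_M^{⊗(2,0)} = σ²(Φ(Ω^{⊗(2,0)}))`, for a decomposition `Ω = X ⊕ Y` with `X = Ω⁽¹⁰⁾` and
`Y = Ω⁽⁰¹⁾`, where `Ω^{⊗(2,0)} = X ⊗_M X`. -/
def V20 : Submodule ℂ (C.V ⊗[ℂ] C.V) :=
  (Phi.image (counitM π) (subTensor π X X)).map (C.sigmaTwo h0).toLinearMap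

/-- `V_M^{⊗(1,1)} = σ²(Φ(Ω^{⊗(1,1)}))`, where `Ω^{⊗(1,1)} = X ⊗_M Y ⊕ Y ⊗_M X`. -/
def V11 : Submodule ℂ (C.V ⊗[ℂ] C.V) :=
  (Phi.image (counitM π) (subTensor π X Y ⊔ subTensor π Y X)).map (C.sigmaTwo h0).toLinearMap

/-- `V_M^{⊗(0,2)} = σ²(Φ(Ω^{⊗(0,2)}))`, where `Ω^{⊗(0,2)} = Y ⊗_M Y`. -/
def V02 : Submodule ℂ (C.V ⊗[ℂ] C.V) :=
  (Phi.image (counitM π) (subTensor π Y Y)).map (C.sigmaTwo h0).toLinearMap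

/-- `I²` is homogeneous with respect to
`V_M^{⊗2} = V_M^{⊗(2,0)} ⊕ V_M^{⊗(1,1)} ⊕ V_M^{⊗(0,2)}`. -/
def IsHomogeneousITwo : Prop :=
  C.ITwo h0 = (C.ITwo h0 ⊓ C.V20 h0 X) ⊔ (C.ITwo h0 ⊓ C.V11 h0 X Y) ⊔ (C.ITwo h0 ⊓ C.V02 h0 Y)

/-- `V_M^{(1,1)} = σ²(Φ(Ω^{(1,1)})) ⊆ V²_M`, where `Ω^{(1,1)} ⊆ Ω²` is the image of
`Ω^{⊗(1,1)}` under the wedge map. -/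
def VTwo11 : Submodule ℂ (C.VTwo h0) :=
  (Phi.image (counitM π) ((subTensor π X Y ⊔ subTensor π Y X).map
    (C.wedge2.restrictScalars ℂ))).map (C.sigmaTwoBar h0)

/-- The restriction `∧_σ : V₁ ⊗ V₂ → V²_M`, for `V₁, V₂ ⊆ V_M`. -/
def wedgeSigmaRes (V₁ V₂ : Submodule ℂ C.V) : V₁ ⊗[ℂ] V₂ →ₗ[ℂ] C.VTwo h0 :=
  C.wedgeSigma h0 ∘ₗ TensorProduct.map V₁.subtype V₂.subtype

end Decomposition

end CovariantCalculus

/-- The linear map `f` is an isomorphism onto the subspace `W`. -/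
def IsIsoOnto {V W : Type*} [AddCommMonoid V] [Module ℂ V] [AddCommMonoid W] [Module ℂ W]
    (f : V →ₗ[ℂ] W) (U : Submodule ℂ W) : Prop :=
  Function.Injective f ∧ LinearMap.range f = U

/-- The quotient of `P ⊗ Q` by the subspace spanned by `S`. -/
abbrev TensorQuot (P Q : Type*) [AddCommGroup P] [AddCommGroup Q] [Module ℂ P] [Module ℂ Q]
    (S : Set (P ⊗[ℂ] Q)) : Type _ := (P ⊗[ℂ] Q) ⧸ Submodule.span ℂ S

/-- The linear map on `TensorQuot P Q S` defined by a bilinear map which vanishes on `S`. -/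
def TensorQuot.lift {P Q W : Type*} [AddCommGroup P] [AddCommGroup Q] [AddCommGroup W]
    [Module ℂ P] [Module ℂ Q] [Module ℂ W] (S : Set (P ⊗[ℂ] Q)) (f : P →ₗ[ℂ] Q →ₗ[ℂ] W)
    (hf : ∀ t ∈ S, TensorProduct.lift f t = 0) : TensorQuot P Q S →ₗ[ℂ] W :=
  Submodule.liftQ _ (TensorProduct.lift f) (Submodule.span_le.2 hf)

/-! ### The maximal prolongation -/

/-- The relations presenting the tensor algebra `⨁ₖ Ω^{⊗_M k}` of the `M`-bimodule `Ω` by the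
generators `M ⊕ Ω`: products of elements of `M` with elements of `M` or `Ω` are the given ones. -/
inductive TensorRel : TensorAlgebra ℂ (coinv π × Ω) → TensorAlgebra ℂ (coinv π × Ω) → Prop
  | one : TensorRel (TensorAlgebra.ι ℂ (1, 0)) 1
  | mul (a b : coinv π) :
      TensorRel (TensorAlgebra.ι ℂ (a, 0) * TensorAlgebra.ι ℂ (b, 0)) (TensorAlgebra.ι ℂ (a * b, 0))
  | smul (a : coinv π) (ω : Ω) :
      TensorRel (TensorAlgebra.ι ℂ (a, 0) * TensorAlgebra.ι ℂ (0, ω)) (TensorAlgebra.ι ℂ (0, a • ω))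
  | op_smul (a : coinv π) (ω : Ω) :
      TensorRel (TensorAlgebra.ι ℂ (0, ω) * TensorAlgebra.ι ℂ (a, 0))
        (TensorAlgebra.ι ℂ (0, MulOpposite.op a • ω))

/-- The tensor algebra `⨁ₖ Ω^{⊗_M k}` of the `M`-bimodule `Ω`. -/
def BimodTensorAlgebra : Type _ := RingQuot (TensorRel π Ω)

instance : Ring (BimodTensorAlgebra π Ω) := inferInstanceAs (Ring (RingQuot (TensorRel π Ω)))

instance : Algebra ℂ (BimodTensorAlgebra π Ω) :=
  inferInstanceAs (Algebra ℂ (RingQuot (TensorRel π Ω)))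

/-- The projection from the free algebra on the generators. -/
def toBimodTensorAlgebra : TensorAlgebra ℂ (coinv π × Ω) →ₐ[ℂ] BimodTensorAlgebra π Ω :=
  RingQuot.mkAlgHom ℂ (TensorRel π Ω)

/-- The inclusion of `M` in the tensor algebra of `Ω`. -/
def inM : coinv π →ₗ[ℂ] BimodTensorAlgebra π Ω :=
  (toBimodTensorAlgebra π Ω).toLinearMap ∘ₗ TensorAlgebra.ι ℂ ∘ₗ LinearMap.inl ℂ _ _

/-- The inclusion of `Ω` in the tensor algebra of `Ω`. -/
def inForms : Ω →ₗ[ℂ] BimodTensorAlgebra π Ω :=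
  (toBimodTensorAlgebra π Ω).toLinearMap ∘ₗ TensorAlgebra.ι ℂ ∘ₗ LinearMap.inr ℂ _ _

namespace CovariantCalculus

variable {π Ω} (C : CovariantCalculus π Ω)

/-- The map `∑ aᵢ ⊗ bᵢ ↦ ∑ daᵢ ⊗ dbᵢ` into the tensor algebra of `Ω`. -/
def dAlg : coinv π ⊗[ℂ] coinv π →ₗ[ℂ] BimodTensorAlgebra π Ω :=
  TensorProduct.lift
    ((LinearMap.mul ℂ (BimodTensorAlgebra π Ω)).compl₁₂ (inForms π Ω ∘ₗ C.d) (inForms π Ω ∘ₗ C.d))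

/-- The relations `dN = 0`. -/
def ProlongationRel (x y : BimodTensorAlgebra π Ω) : Prop := x ∈ C.N.map C.dAlg ∧ y = 0

/-- The maximal prolongation of the calculus: the quotient of the tensor algebra of `Ω` by the ideal
generated by `dN`. -/
def MaximalProlongation : Type _ := RingQuot C.ProlongationRel

instance : Ring C.MaximalProlongation := inferInstanceAs (Ring (RingQuot C.ProlongationRel))

instance : Algebra ℂ C.MaximalProlongation :=
  inferInstanceAs (Algebra ℂ (RingQuot C.ProlongationRel))

/-- The projection from the tensor algebra of `Ω`. -/
def toMaximalProlongation : BimodTensorAlgebra π Ω →ₐ[ℂ] C.MaximalProlongation :=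
  RingQuot.mkAlgHom ℂ C.ProlongationRel

/-- The map `M → Ω•`. -/
def ofM : coinv π →ₗ[ℂ] C.MaximalProlongation :=
  C.toMaximalProlongation.toLinearMap ∘ₗ inM π Ω

/-- The map `Ω → Ω•`. -/
def ofForms : Ω →ₗ[ℂ] C.MaximalProlongation :=
  C.toMaximalProlongation.toLinearMap ∘ₗ inForms π Ω

/-- The `k`-forms `Ωᵏ = M · Ω ∧ ⋯ ∧ Ω` in the maximal prolongation. -/
def degree (k : ℕ) : Submodule ℂ C.MaximalProlongation :=
  LinearMap.range C.ofM * LinearMap.range C.ofForms ^ k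

/-- `𝒜` is an `ℕ × ℕ`-algebra grading of the maximal prolongation which extends the decomposition
`Ω = X ⊕ Y` and satisfies `Ωᵏ = ⨁_{p+q=k} 𝒜(p,q)`. -/
structure IsBigrading (X Y : Submodule ℂ Ω) (𝒜 : ℕ × ℕ → Submodule ℂ C.MaximalProlongation) :
    Prop where
  one_mem : 1 ∈ 𝒜 0
  mul_mem : ∀ i j, ∀ x ∈ 𝒜 i, ∀ y ∈ 𝒜 j, x * y ∈ 𝒜 (i + j)
  isInternal : DirectSum.IsInternal 𝒜
  degree_eq : ∀ k, C.degree k = ⨆ i ∈ {i : ℕ × ℕ | i.1 + i.2 = k}, 𝒜 i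
  extends10 : 𝒜 (1, 0) = X.map C.ofForms
  extends01 : 𝒜 (0, 1) = Y.map C.ofForms

/-- The elements `x m ⊗ y - x ⊗ m y` of `X ⊗ Y`, for `M`-sub-bimodules `X, Y` of `Ω•`. -/
def balancedSet (X Y : Submodule ℂ C.MaximalProlongation) : Set (X ⊗[ℂ] Y) :=
  {t | ∃ (x x' : X) (y y' : Y) (m : coinv π),
    (x' : C.MaximalProlongation) = x * C.ofM m ∧ (y' : C.MaximalProlongation) = C.ofM m * y ∧
      t = x' ⊗ₜ y - x ⊗ₜ y'}

/-- For `M`-sub-bimodules `X, Y` of `Ω•`, the tensor product `X ⊗_M Y`. -/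
abbrev FormTensor (X Y : Submodule ℂ C.MaximalProlongation) : Type _ :=
  TensorQuot X Y (C.balancedSet X Y)

/-- The wedge map `∧ : X ⊗_M Y → Ω•`. -/
def wedge (X Y : Submodule ℂ C.MaximalProlongation) : C.FormTensor X Y →ₗ[ℂ] C.MaximalProlongation :=
  TensorQuot.lift _ ((LinearMap.mul ℂ C.MaximalProlongation).compl₁₂ X.subtype Y.subtype) <| by
    rintro _ ⟨x, x', y, y', m, hx, hy, rfl⟩
    rw [map_sub, TensorProduct.lift.tmul, TensorProduct.lift.tmul]
    simp [hx, hy, mul_assoc]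

/-- The maps `∧_σ : V⁽¹⁰⁾ ⊗ V⁽⁰¹⁾ → V⁽¹¹⁾` and `∧_σ : V⁽⁰¹⁾ ⊗ V⁽¹⁰⁾ → V⁽¹¹⁾` are isomorphisms, for the
decomposition `V⁽¹⁰⁾ = σ(Φ(X))`, `V⁽⁰¹⁾ = σ(Φ(Y))` of `V_M`. -/
def WedgeSigmaCondition (h0 : IsInM0 π Ω) (X Y : Submodule ℂ Ω) : Prop :=
  IsIsoOnto (C.wedgeSigmaRes h0 (C.toV X) (C.toV Y)) (C.VTwo11 h0 X Y) ∧
    IsIsoOnto (C.wedgeSigmaRes h0 (C.toV Y) (C.toV X)) (C.VTwo11 h0 X Y)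

/-- The wedge condition in the definition of an almost complex structure: `∧` restricts to
isomorphisms `Ω^{(p,0)} ⊗_M Ω^{(0,q)} ≃ Ω^{(p,q)}` and `Ω^{(0,q)} ⊗_M Ω^{(p,0)} ≃ Ω^{(p,q)}`. -/
def WedgeCondition (𝒜 : ℕ × ℕ → Submodule ℂ C.MaximalProlongation) : Prop :=
  ∀ p q : ℕ, IsIsoOnto (C.wedge (𝒜 (p, 0)) (𝒜 (0, q))) (𝒜 (p, q)) ∧
    IsIsoOnto (C.wedge (𝒜 (0, q)) (𝒜 (p, 0))) (𝒜 (p, q))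

end CovariantCalculus

end Calculus

end QHom

end

/-! Everything over `M` is compared with its fibre at the counit by one descent principle,
`RelHopf.le_of_le_sup_augSub`. Let `F` be a left `M`-module with compatible left `G`-coaction, `W` a
submodule stable under the coaction and `Z` a subcomodule with `Z ⊆ W + M⁺F`; then `Z ⊆ W`. Indeed
the map `g ⊗ x ↦ g S(x₋₁) ⊗ [x₀]` from `G ⊗ F` to `G ⊗_M (F/W)` kills `G ⊗ W` and `G ⊗ M⁺F`, hence
kills the coaction of every `z ∈ Z`. But it sends that coaction to `1 ⊗ [z]`, and faithful flatness
turns `1 ⊗ [z] = 0` into `z ∈ W`.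

Decompositions. Injectivity of the correspondence is descent. For surjectivity, `Ω` is embedded in
`G ⊗ V` by `ρ(ω) = ω₋₁ ⊗ σ[ω₀]`, and a subspace `U` of `V` is sent to `ρ⁻¹(G ⊗ U)`. For
complementary subcomodules these spaces of forms are complementary provided that the image of `ρ` is
stable under `id ⊗ P` for every `H`-colinear `P` (`exists_rho_eq`). The twist `g ⊗ v ↦ [g S(v₋₁)] ⊗
v₀` carries the image of `ρ` to `[1] ⊗ V` and the image of `(id ⊗ P) ρ` to `H`-coinvariant vectors
in `Φ(G) ⊗ V`. Since `M = G^H` and `G` is faithfully flat, the coinvariants of `Φ(G)` are the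
multiples of `[1]` (`eq_smul_mk_one_of_deltaR`), so the two images agree in the fibre, and descent
applies. If `Ω M⁺ ⊆ M⁺ Ω`, then `M` acts on `V` from the right by the counit and every subspace is a
submodule.

Bigradings. Let `relTwo` be the preimage of `dN` in `Ω ⊗ Ω`. A grading by `ℕ × ℕ` amounts to a
coaction of the monoid algebra; the universal property of the maximal prolongation produces one as
soon as the projections on the components of `Ω ⊗ Ω` preserve `relTwo`. Conversely a bigrading
separates the components of a relation, because products of one-forms satisfy no relations beyond
`relTwo` (`mem_relTwo_iff`). This last fact is descent again, its fibre version being read off from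
a representation of `Ω•` on `ℂ ⊕ V ⊕ V²_M`. Stability of `relTwo` is in turn equivalent to
homogeneity of `I²`, by descent.

The wedge condition. From forms to fibres only bidegree `(1, 1)` is needed. For the converse put `U
= V^{(1,0)}` and `W = V^{(0,1)}`. The two isomorphisms give mutually inverse maps `τ : W ⊗ U → U ⊗
W` and `θ`, each the identity modulo `I²`. Writing `g ▷ b = g₁ b S(g₂)`, one has `ω b = (ω₋₁ ▷ b)
ω₀` (`op_smul_eq_sum`). Differentiating this expresses `τ` and `θ`, up to sign, by the coaction
(`tmul_add_mem_ITwo`). As `relTwo` is a subcomodule, `τ` moves `U` past the quadratic relations of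
`W`. It moves `W` past the relations of `U` because `θ` does the opposite and can be inverted on
relations, by the inverse antipode or by counting dimensions. Hence `U` and `W` act on the twisted
tensor product of the quadratic algebras `T(U)/(R_U)` and `T(W)/(R_W)` (`exists_twisted_rep`), so
`Ω•` acts there with `M` acting by the counit. A product `x y` of forms generated by `Ω^{(1,0)}` and
`Ω^{(0,1)}` sends `1 ⊗ 1` to the tensor of their images, which determine `[x] ⊗ [y]`
(`map_mk_eq_zero`). So multiplication is injective on fibres, and by descent over `M`
(`wedge_injective`). Surjectivity holds because `Ω^{(0,1)} Ω^{(1,0)} ⊆ Ω^{(1,0)} Ω^{(0,1)}` lets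
factors be sorted. -/

noncomputable section

namespace QHom

/-! ### Instance shortcuts for linear maps, fibres and cotangent spaces. -/

section Shortcuts

variable {E F : Type*} [AddCommMonoid E] [Module ℂ E] [AddCommMonoid F] [Module ℂ F]

scoped instance : AddMonoidHomClass (E →ₗ[ℂ] F) E F := inferInstance
scoped instance : AddHomClass (E →ₗ[ℂ] F) E F := inferInstance
scoped instance : ZeroHomClass (E →ₗ[ℂ] F) E F := inferInstance
scoped instance : AddMonoidHomClass (E ≃ₗ[ℂ] F) E F := inferInstance
scoped instance : AddHomClass (E ≃ₗ[ℂ] F) E F := inferInstance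
scoped instance : ZeroHomClass (E ≃ₗ[ℂ] F) E F := inferInstance

end Shortcuts

section ModuleShortcuts

variable {G H : Type*} [Ring G] [HopfAlgebra ℂ G] [Ring H] [HopfAlgebra ℂ H] {π : G →ₐc[ℂ] H}
variable {E : Type*} [AddCommGroup E] [Module ℂ E]

scoped instance : IsScalarTower ℂ (coinv π) G := inferInstance
scoped instance : IsScalarTower ℂ (coinv π) (G ⊗[ℂ] E) := inferInstance

variable [Module (coinv π) E] [IsScalarTower ℂ (coinv π) E]

scoped instance : AddCommGroup (BTensor (coinv π) G E) := inferInstance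
scoped instance : AddCommMonoid (BTensor (coinv π) G E) := inferInstance
scoped instance : Module ℂ (BTensor (coinv π) G E) := inferInstance

scoped instance : AddCommGroup (Phi (counitM π) E) := inferInstance
scoped instance : AddCommMonoid (Phi (counitM π) E) := inferInstance
scoped instance : Module ℂ (Phi (counitM π) E) := inferInstance

variable {Ω : Type*} [AddCommGroup Ω] [Module ℂ Ω]
  [Module (coinv π) Ω] [IsScalarTower ℂ (coinv π) Ω]
  [Module (coinv π)ᵐᵒᵖ Ω] [IsScalarTower ℂ (coinv π)ᵐᵒᵖ Ω]
  [SMulCommClass (coinv π) (coinv π)ᵐᵒᵖ Ω] (C : CovariantCalculus π Ω)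

scoped instance : AddCommGroup C.V := inferInstance
scoped instance : AddCommMonoid C.V := inferInstance
scoped instance : Module ℂ C.V := inferInstance

end ModuleShortcuts

/-! ### Relative Hopf modules and the subspaces `G ⊗ W`. -/

section RelHopf

variable {G H : Type*} [Ring G] [HopfAlgebra ℂ G] [Ring H] [HopfAlgebra ℂ H] (π : G →ₐc[ℂ] H)

theorem op_smul_eq (m : coinv π) (g : G) : MulOpposite.op m • g = g * (m : G) := rfl

theorem coinv_smul_eq (m : coinv π) (g : G) : m • g = (m : G) * g := rfl

/-- Linear maps out of a tensor product agree at the image of `coactM` if they do so after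
embedding `M` in `G`. -/
theorem lift_coactM {P : Type*} [AddCommGroup P] [Module ℂ P] (f : G ⊗[ℂ] coinv π →ₗ[ℂ] P)
    (f' : G ⊗[ℂ] G →ₗ[ℂ] P) (h : ∀ (g : G) (m : coinv π), f (g ⊗ₜ m) = f' (g ⊗ₜ (m : G)))
    (m : coinv π) : f (coactM π m) = f' (Coalgebra.comul (R := ℂ) (m : G)) := by
  have : f = f' ∘ₗ (coinv π).val.toLinearMap.lTensor G := TensorProduct.ext' h
  rw [← lTensor_val_coactM, this, LinearMap.comp_apply]

/-- A relative Hopf module: a left `M`-module with a compatible left `G`-coaction. -/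
structure RelHopf (F : Type*) [AddCommGroup F] [Module ℂ F] [Module (coinv π) F]
    [IsScalarTower ℂ (coinv π) F] where
  /-- the coaction -/
  coact : F →ₗ[ℂ] G ⊗[ℂ] F
  counit_coact : ∀ x, TensorProduct.lid ℂ F ((Coalgebra.counit (R := ℂ)).rTensor F (coact x)) = x
  coassoc : ∀ x, TensorProduct.assoc ℂ G G F ((Coalgebra.comul (R := ℂ)).rTensor F (coact x)) =
    coact.lTensor G (coact x)
  coact_smul : ∀ (m : coinv π) (x : F), coact (m • x) = tensorAct π F (coactM π m) (coact x)

variable {π} in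
theorem coinv_smul_tmul {F : Type*} [AddCommGroup F] [Module ℂ F] (m : coinv π) (g : G) (x : F) :
    m • (g ⊗ₜ[ℂ] x) = ((m : G) * g) ⊗ₜ[ℂ] x := rfl

variable {π} in
theorem tensorAct_tmul {F : Type*} [AddCommGroup F] [Module ℂ F] [Module (coinv π) F]
    [IsScalarTower ℂ (coinv π) F] (g h : G) (m : coinv π) (x : F) :
    tensorAct π F (g ⊗ₜ m) (h ⊗ₜ x) = (g * h) ⊗ₜ (m • x) := rfl

/-- The space `G ⊗ W` as a subspace of `G ⊗ F`. -/
def gTensor (G : Type*) [Ring G] [Algebra ℂ G] {F : Type*} [AddCommGroup F] [Module ℂ F]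
    (W : Submodule ℂ F) : Submodule ℂ (G ⊗[ℂ] F) := LinearMap.range (W.subtype.lTensor G)

/-- Right exactness of the tensor product; it replaces membership in `G ⊗ W` by the vanishing of a
linear map. -/
theorem gTensor_eq_ker {F : Type*} [AddCommGroup F] [Module ℂ F] (W : Submodule ℂ F) :
    gTensor G W = LinearMap.ker (W.mkQ.lTensor G) := by
  have := lTensor_exact G (f := W.subtype) (g := W.mkQ)
    (by rw [LinearMap.exact_iff]; simp) W.mkQ_surjective
  rw [LinearMap.exact_iff] at this
  exact this.symm

/-- Flatness over `ℂ`. For a colinear `f` this makes the kernel a subcomodule, which is how several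
of the subcomodules fed into descent are produced. -/
theorem gTensor_ker {F F' : Type*} [AddCommGroup F] [Module ℂ F] [AddCommGroup F'] [Module ℂ F']
    (f : F →ₗ[ℂ] F') : gTensor G (LinearMap.ker f) = LinearMap.ker (f.lTensor G) := by
  have : Function.Exact ((LinearMap.ker f).subtype.lTensor G) (f.lTensor G) :=
    Module.Flat.lTensor_exact G (by rw [LinearMap.exact_iff]; simp)
  rw [LinearMap.exact_iff] at this
  exact this.symm

theorem gTensor_mono {F : Type*} [AddCommGroup F] [Module ℂ F] {W W' : Submodule ℂ F}
    (h : W ≤ W') : gTensor G W ≤ gTensor G W' := by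
  rw [gTensor, gTensor, ← Submodule.subtype_comp_inclusion W W' h, LinearMap.lTensor_comp]
  exact LinearMap.range_comp_le_range _ _

theorem tmul_mem_gTensor {F : Type*} [AddCommGroup F] [Module ℂ F] {W : Submodule ℂ F} (g : G)
    {w : F} (hw : w ∈ W) : g ⊗ₜ w ∈ gTensor G W := ⟨g ⊗ₜ ⟨w, hw⟩, rfl⟩

theorem gTensor_le {F : Type*} [AddCommGroup F] [Module ℂ F] {W : Submodule ℂ F}
    {S : Submodule ℂ (G ⊗[ℂ] F)} (h : ∀ (g : G), ∀ w ∈ W, g ⊗ₜ w ∈ S) : gTensor G W ≤ S := by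
  rintro _ ⟨t, rfl⟩
  induction t with
  | zero => simp
  | add x y hx hy => rw [map_add]; exact add_mem hx hy
  | tmul g w => exact h g w w.2

theorem gTensor_map {F F' : Type*} [AddCommGroup F] [Module ℂ F] [AddCommGroup F'] [Module ℂ F']
    (f : F →ₗ[ℂ] F') (W : Submodule ℂ F) :
    gTensor G (W.map f) = (gTensor G W).map (f.lTensor G) := by
  apply le_antisymm
  · refine gTensor_le ?_
    rintro g _ ⟨w, hw, rfl⟩
    exact ⟨g ⊗ₜ w, tmul_mem_gTensor g hw, rfl⟩
  · rw [Submodule.map_le_iff_le_comap]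
    exact gTensor_le fun g w hw => tmul_mem_gTensor g ⟨w, hw, rfl⟩

-- The antipode axiom, read with the second leg of the coproduct kept in `M`, so that this leg can
-- be moved across `⊗_M`.
variable {π} in
theorem sum_antipode_mul_coactM (m : coinv π) :
    TensorProduct.lift ((LinearMap.mul ℂ G).compl₁₂ (HopfAlgebraStruct.antipode ℂ)
      (coinv π).val.toLinearMap) (coactM π m) = algebraMap ℂ G (counitM π m) := by
  rw [lift_coactM π _ (LinearMap.mul' ℂ G ∘ₗ (HopfAlgebraStruct.antipode ℂ).rTensor G)
    (fun g m => by simp), LinearMap.comp_apply, HopfAlgebra.mul_antipode_rTensor_comul_apply]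
  rfl

end RelHopf

/-! ### Descent from fibres by faithful flatness. -/

section Flat

variable {G H : Type u} [Ring G] [HopfAlgebra ℂ G] [Ring H] [HopfAlgebra ℂ H] {π : G →ₐc[ℂ] H}

theorem BTensor.mk_balanced {F : Type*} [AddCommGroup F] [Module ℂ F] [Module (coinv π) F]
    [IsScalarTower ℂ (coinv π) F] (g : G) (m : coinv π) (x : F) :
    BTensor.mk (A := coinv π) ((g * (m : G)) ⊗ₜ[ℂ] x) =
      BTensor.mk (A := coinv π) (g ⊗ₜ[ℂ] (m • x)) :=
  (Submodule.Quotient.eq _).2 (Submodule.subset_span ⟨g, m, x, rfl⟩)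

/-- The linear map on `G ⊗_M F` induced by a balanced map on `G ⊗ F`. -/
def BTensor.lift {F P : Type*} [AddCommGroup F] [Module ℂ F] [Module (coinv π) F]
    [IsScalarTower ℂ (coinv π) F] [AddCommGroup P] [Module ℂ P] (f : G ⊗[ℂ] F →ₗ[ℂ] P)
    (hf : ∀ (g : G) (m : coinv π) (x : F), f ((g * (m : G)) ⊗ₜ x) = f (g ⊗ₜ (m • x))) :
    BTensor (coinv π) G F →ₗ[ℂ] P :=
  ((balanced (coinv π) G F).restrictScalars ℂ).liftQ f (by
    intro t ht
    have key : ∀ t ∈ balanced (coinv π) G F, ∀ a : coinv π, f (a • t) = 0 := by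
      intro t ht
      induction ht using Submodule.span_induction with
      | mem x hx =>
        obtain ⟨e, m, w, rfl⟩ := hx
        intro a
        rw [smul_sub, coinv_smul_tmul, coinv_smul_tmul, op_smul_eq, ← mul_assoc, map_sub, hf,
          sub_self]
      | zero => simp
      | add x y _ _ hx hy => intro a; rw [smul_add, map_add, hx, hy, add_zero]
      | smul c x _ hx => intro a; exact (congrArg f (mul_smul a c x).symm).trans (hx (a * c))
    have := key t ht 1
    rwa [one_smul] at this) ∘ₗ
    (Submodule.Quotient.restrictScalarsEquiv ℂ (balanced (coinv π) G F)).symm.toLinearMap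

theorem BTensor.lift_mk {F P : Type*} [AddCommGroup F] [Module ℂ F] [Module (coinv π) F]
    [IsScalarTower ℂ (coinv π) F] [AddCommGroup P] [Module ℂ P] (f : G ⊗[ℂ] F →ₗ[ℂ] P)
    (hf : ∀ (g : G) (m : coinv π) (x : F), f ((g * (m : G)) ⊗ₜ x) = f (g ⊗ₜ (m • x)))
    (t : G ⊗[ℂ] F) : BTensor.lift f hf (BTensor.mk t) = f t := rfl

/-- Since `M` acts on `G` from the right, left multiplication by `g` descends to `G ⊗_M F` and
carries `1 ⊗ x` to `g ⊗ x`. -/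
theorem BTensor.mk_tmul_eq_zero {F : Type*} [AddCommGroup F] [Module ℂ F] [Module (coinv π) F]
    [IsScalarTower ℂ (coinv π) F] {x : F}
    (h : BTensor.mk (A := coinv π) ((1 : G) ⊗ₜ[ℂ] x) = 0) (g : G) :
    BTensor.mk (A := coinv π) (g ⊗ₜ[ℂ] x) = 0 := by
  have := congrArg (BTensor.lift (BTensor.mk (A := coinv π) (F := F) ∘ₗ
    (LinearMap.mulLeft ℂ g).rTensor F) (fun a m y => by
      simp [← mul_assoc, BTensor.mk_balanced])) h
  rw [map_zero] at this
  simpa using (BTensor.lift_mk _ _ _).symm.trans this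

/-- If `1 ⊗ x` vanishes, so does every `g ⊗ m x = g m ⊗ x`, and the inclusion of the cyclic module
`M x` becomes zero after `G ⊗_M -`. It also stays injective, so `G ⊗_M M x = 0`, and a faithfully
flat functor kills only the zero module. -/
theorem eq_zero_of_one_tmul (hff : IsFaithfullyFlatRight π) {E : Type u} [AddCommGroup E]
    [Module ℂ E] [Module (coinv π) E] [IsScalarTower ℂ (coinv π) E] (x : E)
    (h : BTensor.mk (A := coinv π) ((1 : G) ⊗ₜ[ℂ] x) = 0) : x = 0 := by
  let E' : Submodule (coinv π) E := Submodule.span (coinv π) {x}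
  have hx : x ∈ E' := Submodule.mem_span_singleton_self x
  have h1 : Function.Exact (0 : E' →ₗ[coinv π] E') E'.subtype := by
    intro y
    simp only [Submodule.coe_subtype, ZeroMemClass.coe_eq_zero, LinearMap.zero_apply,
      Set.mem_range, exists_const]
    exact eq_comm
  have h2 := (hff _ _ _ _ _).1 h1
  have h3 : ∀ z, BTensor.map (coinv π) G E'.subtype z = 0 := by
    intro z
    obtain ⟨z, rfl⟩ := Submodule.mkQ_surjective _ z
    induction z with
    | zero => simp
    | add a b ha hb => rw [map_add, map_add, ha, hb, add_zero]
    | tmul g e =>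
      obtain ⟨m, hm⟩ := Submodule.mem_span_singleton.1 e.2
      have e1 : BTensor.map (coinv π) G E'.subtype ((balanced (coinv π) G E').mkQ (g ⊗ₜ e)) =
          BTensor.mk (A := coinv π) (g ⊗ₜ[ℂ] (e : E)) := rfl
      rw [e1, ← hm, ← BTensor.mk_balanced]
      exact BTensor.mk_tmul_eq_zero h _
  -- As `G ⊗_M E'` is zero, a sequence of zero maps on it is exact; reflecting exactness, the zero
  -- maps on `E'` are exact as well, which says `E' = 0`.
  have h4 : Function.Exact (BTensor.map (coinv π) G (0 : E' →ₗ[coinv π] E'))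
      (BTensor.map (coinv π) G (0 : E' →ₗ[coinv π] E')) := by
    intro z
    rw [← h2 z, h3]
    simp only [iff_true]
    clear h2
    obtain ⟨z, rfl⟩ := Submodule.mkQ_surjective _ z
    induction z with
    | zero => simp
    | add a b ha hb => rw [map_add, map_add, ha, hb, add_zero]
    | tmul g e =>
      change BTensor.mk (A := coinv π) (g ⊗ₜ[ℂ] (0 : E')) = 0
      simp
  have h5 := (hff _ _ _ _ _).2 h4
  obtain ⟨y, hy⟩ := (h5 ⟨x, hx⟩).1 rfl
  exact (congrArg Subtype.val hy).symm

/-- The map `G ⊗ F → G ⊗_M E`, `g ⊗ x ↦ g S(x₋₁) ⊗ p x₀`. -/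
def RelHopf.untwist {F : Type*} [AddCommGroup F] [Module ℂ F] [Module (coinv π) F]
    [IsScalarTower ℂ (coinv π) F] {E : Type*} [AddCommGroup E] [Module ℂ E] [Module (coinv π) E]
    [IsScalarTower ℂ (coinv π) E] (R : RelHopf π F) (p : F →ₗ[coinv π] E) :
    G ⊗[ℂ] F →ₗ[ℂ] BTensor (coinv π) G E :=
  TensorProduct.lift <| (LinearMap.llcomp ℂ F (G ⊗[ℂ] F) _ |>.flip R.coact) ∘ₗ
    (LinearMap.llcomp ℂ (G ⊗[ℂ] F) (G ⊗[ℂ] E) _ BTensor.mk) ∘ₗ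
    (TensorProduct.mapBilinear (RingHom.id ℂ) G F G E).flip (p.restrictScalars ℂ) ∘ₗ
    (LinearMap.llcomp ℂ G G G |>.flip (HopfAlgebraStruct.antipode ℂ)) ∘ₗ LinearMap.mul ℂ G

theorem RelHopf.untwist_tmul {F : Type*} [AddCommGroup F] [Module ℂ F] [Module (coinv π) F]
    [IsScalarTower ℂ (coinv π) F] {E : Type*} [AddCommGroup E] [Module ℂ E] [Module (coinv π) E]
    [IsScalarTower ℂ (coinv π) E] (R : RelHopf π F) (p : F →ₗ[coinv π] E) (g : G) (x : F) :
    R.untwist p (g ⊗ₜ x) = BTensor.mk (TensorProduct.map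
      (LinearMap.mulLeft ℂ g ∘ₗ HopfAlgebraStruct.antipode ℂ) (p.restrictScalars ℂ)
        (R.coact x)) := rfl

section Untwist

variable {F : Type*} [AddCommGroup F] [Module ℂ F] [Module (coinv π) F]
    [IsScalarTower ℂ (coinv π) F] {E : Type*} [AddCommGroup E] [Module ℂ E] [Module (coinv π) E]
    [IsScalarTower ℂ (coinv π) E] (R : RelHopf π F) (p : F →ₗ[coinv π] E)

/-- The term `g S(m₁ x₋₁) ⊗ m₂ x₀` becomes `g S(x₋₁) S(m₁) m₂ ⊗ x₀` when `m₂ ∈ M` is moved across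
`⊗_M`, and `S(m₁) m₂ = ε(m)`. So the map sees its second argument only through the fibre. -/
theorem RelHopf.untwist_smul (g : G) (m : coinv π) (x : F) :
    R.untwist p (g ⊗ₜ (m • x)) = counitM π m • R.untwist p (g ⊗ₜ x) := by
  rw [untwist_tmul, R.coact_smul, untwist_tmul]
  have key : ∀ (s : G ⊗[ℂ] coinv π) (z : G ⊗[ℂ] F),
      BTensor.mk (A := coinv π) (TensorProduct.map
        (LinearMap.mulLeft ℂ g ∘ₗ HopfAlgebraStruct.antipode ℂ) (p.restrictScalars ℂ)
        (tensorAct π F s z)) =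
      BTensor.mk (A := coinv π) (TensorProduct.map
        ((LinearMap.mulRight ℂ (TensorProduct.lift ((LinearMap.mul ℂ G).compl₁₂
          (HopfAlgebraStruct.antipode ℂ) (coinv π).val.toLinearMap) s)) ∘ₗ
        LinearMap.mulLeft ℂ g ∘ₗ HopfAlgebraStruct.antipode ℂ) (p.restrictScalars ℂ) z) := by
    intro s z
    induction z with
    | zero => simp
    | add x y hx hy => simp only [map_add, hx, hy]
    | tmul h y =>
      induction s with
      | zero => simp
      | add x y hx hy =>
        simp only [map_add, LinearMap.add_apply, hx, hy, TensorProduct.map_tmul,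
          LinearMap.comp_apply, LinearMap.mulRight_apply, mul_add, TensorProduct.add_tmul]
      | tmul a b =>
        rw [tensorAct_tmul, TensorProduct.map_tmul, TensorProduct.map_tmul]
        simp only [LinearMap.comp_apply, LinearMap.mulRight_apply, LinearMap.mulLeft_apply,
          HopfAlgebra.antipode_mul_antidistrib, TensorProduct.lift.tmul, LinearMap.compl₁₂_apply,
          LinearMap.restrictScalars_apply, map_smul, LinearMap.mul_apply', AlgHom.toLinearMap_apply,
          Subalgebra.coe_val]
        rw [← mul_assoc, ← mul_assoc, BTensor.mk_balanced]
  rw [key, sum_antipode_mul_coactM, ← map_smul, ← LinearMap.smul_apply, ← TensorProduct.map_smul_left]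
  congr 3
  ext y
  simp [Algebra.algebraMap_eq_smul_one]

theorem RelHopf.untwist_augSub (g : G) {y : F} (hy : y ∈ augSub (counitM π) F) :
    R.untwist p (g ⊗ₜ y) = 0 := by
  induction hy using Submodule.span_induction with
  | mem x hx =>
    obtain ⟨a, e, ha, rfl⟩ := hx
    rw [untwist_smul, ha, zero_smul]
  | zero => simp
  | add x y _ _ hx hy => rw [TensorProduct.tmul_add, map_add, hx, hy, add_zero]
  | smul c x _ hx => rw [TensorProduct.tmul_smul, map_smul, hx, smul_zero]

/-- By coassociativity the left side is `x₋₂ S(x₋₁) ⊗ p x₀`, where the antipode axiom and then the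
counit axiom apply. -/
theorem RelHopf.untwist_coact (x : F) :
    R.untwist p (R.coact x) = BTensor.mk ((1 : G) ⊗ₜ[ℂ] (p x)) := by
  let f : G ⊗[ℂ] (G ⊗[ℂ] F) →ₗ[ℂ] BTensor (coinv π) G E :=
    BTensor.mk ∘ₗ TensorProduct.map (LinearMap.mul' ℂ G) (p.restrictScalars ℂ) ∘ₗ
      (TensorProduct.assoc ℂ G G F).symm.toLinearMap ∘ₗ
      ((HopfAlgebraStruct.antipode ℂ).rTensor F).lTensor G
  have h1 : R.untwist p = f ∘ₗ R.coact.lTensor G := by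
    refine TensorProduct.ext' fun g y => ?_
    rw [untwist_tmul, LinearMap.comp_apply, LinearMap.lTensor_tmul]
    generalize R.coact y = z
    induction z with
    | zero => simp
    | add x y hx hy => simp only [map_add, TensorProduct.tmul_add, hx, hy]
    | tmul h y => simp [f]
  have h2 : f ∘ₗ (TensorProduct.assoc ℂ G G F).toLinearMap ∘ₗ (Coalgebra.comul (R := ℂ)).rTensor F =
      BTensor.mk ∘ₗ (TensorProduct.mk ℂ G E 1) ∘ₗ p.restrictScalars ℂ ∘ₗ
        (TensorProduct.lid ℂ F).toLinearMap ∘ₗ (Coalgebra.counit (R := ℂ)).rTensor F := by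
    refine TensorProduct.ext' fun g y => ?_
    have h3 : ∀ s : G ⊗[ℂ] G, f ((TensorProduct.assoc ℂ G G F) (s ⊗ₜ y)) =
        BTensor.mk ((LinearMap.mul' ℂ G ((HopfAlgebraStruct.antipode ℂ).lTensor G s)) ⊗ₜ[ℂ]
          (p y)) := by
      intro s
      induction s with
      | zero => simp
      | add x y hx hy => simp only [map_add, TensorProduct.add_tmul, hx, hy]
      | tmul a b => simp [f]
    simp only [LinearMap.comp_apply, LinearMap.rTensor_tmul, LinearEquiv.coe_coe, h3,
      HopfAlgebra.mul_antipode_lTensor_comul_apply, TensorProduct.lid_tmul,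
      LinearMap.restrictScalars_apply, TensorProduct.mk_apply]
    rw [Algebra.algebraMap_eq_smul_one, TensorProduct.smul_tmul]
    congr 2
    exact (map_smul (p.restrictScalars ℂ) _ _).symm
  rw [h1, LinearMap.comp_apply, ← R.coassoc]
  have := LinearMap.congr_fun h2 (R.coact x)
  simp only [LinearMap.comp_apply, LinearEquiv.coe_coe, R.counit_coact] at this
  exact this

end Untwist

/-- A subobject of a relative Hopf module contains every subcomodule which it contains up to
`M⁺ F`. -/
theorem RelHopf.le_of_le_sup_augSub (hff : IsFaithfullyFlatRight π) {F : Type u} [AddCommGroup F]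
    [Module ℂ F] [Module (coinv π) F] [IsScalarTower ℂ (coinv π) F] (R : RelHopf π F)
    (W : Submodule (coinv π) F)
    (hW : ∀ w ∈ W, R.coact w ∈ gTensor G (W.restrictScalars ℂ)) (Z : Submodule ℂ F)
    (hZ : ∀ z ∈ Z, R.coact z ∈ gTensor G Z)
    (h : Z ≤ W.restrictScalars ℂ ⊔ augSub (counitM π) F) : Z ≤ W.restrictScalars ℂ := by
  have h1 : ∀ g : G, ∀ w ∈ W, R.untwist W.mkQ (g ⊗ₜ w) = 0 := by
    intro g w hw
    rw [untwist_tmul]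
    have : gTensor G (W.restrictScalars ℂ) ≤ LinearMap.ker (TensorProduct.map
      (LinearMap.mulLeft ℂ g ∘ₗ HopfAlgebraStruct.antipode ℂ) (W.mkQ.restrictScalars ℂ)) := by
      refine gTensor_le fun a y hy => ?_
      rw [LinearMap.mem_ker, TensorProduct.map_tmul, LinearMap.restrictScalars_apply,
        (show W.mkQ y = 0 from (Submodule.Quotient.mk_eq_zero W).2 hy), TensorProduct.tmul_zero]
    rw [LinearMap.mem_ker.1 (this (hW w hw)), map_zero]
  -- Both parts of `z = w + y` die: the first because its coaction stays in `G ⊗ W`, the second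
  -- because only the fibre is seen.
  have h3 : gTensor G Z ≤ LinearMap.ker (R.untwist W.mkQ) := by
    refine gTensor_le fun g z hz => ?_
    obtain ⟨w, hw, y, hy, rfl⟩ := Submodule.mem_sup.1 (h hz)
    rw [LinearMap.mem_ker, TensorProduct.tmul_add, map_add, h1 g w hw, R.untwist_augSub _ g hy, add_zero]
  intro z hz
  -- The coaction of `z` lies in `G ⊗ Z`, so it is killed, while its image is `1 ⊗ [z]`.
  have h4 := LinearMap.mem_ker.1 (h3 (hZ z hz))
  rw [untwist_coact] at h4
  exact (Submodule.Quotient.mk_eq_zero W).1 (eq_zero_of_one_tmul hff _ h4)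

end Flat

/-! ### The antipode and the comultiplication. -/

section Hopf

variable {G : Type*} [Ring G] [HopfAlgebra ℂ G]

/-- In the convolution algebra `Hom(G, G ⊗ G)` the map `Δ ∘ S` is a right inverse of `Δ`, and the
flipped map `S(g₂) ⊗ S(g₁)` is a left inverse; the two must agree. -/
theorem comul_antipode (g : G) : Coalgebra.comul (R := ℂ) (HopfAlgebraStruct.antipode ℂ g) =
    TensorProduct.comm ℂ G G (TensorProduct.map (HopfAlgebraStruct.antipode ℂ)
      (HopfAlgebraStruct.antipode ℂ) (Coalgebra.comul (R := ℂ) g)) := by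
  let q : G ⊗[ℂ] G →ₗ[ℂ] G ⊗[ℂ] G := (TensorProduct.comm ℂ G G).toLinearMap ∘ₗ
    TensorProduct.map (HopfAlgebraStruct.antipode ℂ) (HopfAlgebraStruct.antipode ℂ)
  let Δ : G →ₗ[ℂ] G ⊗[ℂ] G := Coalgebra.comul
  -- `Ψ (a ⊗ b ⊗ c ⊗ d) = S(b) c ⊗ S(a) d`. On an iterated coproduct the inner pair contracts first
  -- and then the outer one; the identities `e3` to `e7` only rebracket the coproduct into the form
  -- where this is visible.
  let Ψ : G ⊗[ℂ] (G ⊗[ℂ] (G ⊗[ℂ] G)) →ₗ[ℂ] G ⊗[ℂ] G :=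
    LinearMap.mul' ℂ (G ⊗[ℂ] G) ∘ₗ q.rTensor (G ⊗[ℂ] G) ∘ₗ
      (TensorProduct.assoc ℂ G G (G ⊗[ℂ] G)).symm.toLinearMap
  have e1 : ∀ (a d : G) (s : G ⊗[ℂ] G), Ψ (a ⊗ₜ (TensorProduct.assoc ℂ G G G (s ⊗ₜ d))) =
      (LinearMap.mul' ℂ G ((HopfAlgebraStruct.antipode ℂ).rTensor G s)) ⊗ₜ
        (HopfAlgebraStruct.antipode ℂ a * d) := by
    intro a d s
    induction s with
    | zero => simp
    | add x y hx hy => simp only [map_add, TensorProduct.tmul_add, TensorProduct.add_tmul, hx, hy]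
    | tmul b c => simp [Ψ, q]
  have e2 : ∀ (a : G) (s : G ⊗[ℂ] G),
      Ψ (a ⊗ₜ (TensorProduct.assoc ℂ G G G (Δ.rTensor G s))) =
      1 ⊗ₜ (HopfAlgebraStruct.antipode ℂ a *
        TensorProduct.lid ℂ G ((Coalgebra.counit (R := ℂ)).rTensor G s)) := by
    intro a s
    induction s with
    | zero => simp
    | add x y hx hy => simp only [map_add, TensorProduct.tmul_add, mul_add, hx, hy]
    | tmul b c =>
      rw [LinearMap.rTensor_tmul, e1, HopfAlgebra.mul_antipode_rTensor_comul_apply,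
        Algebra.algebraMap_eq_smul_one, TensorProduct.smul_tmul]
      simp
  have h1 : (WithConv.toConv (q ∘ₗ Δ)) * (WithConv.toConv Δ) = 1 := by
    apply WithConv.ext
    refine LinearMap.ext fun g => ?_
    have e3 : ∀ s : G ⊗[ℂ] G, LinearMap.mul' ℂ (G ⊗[ℂ] G) (TensorProduct.map (q ∘ₗ Δ) Δ s) =
        Ψ (TensorProduct.assoc ℂ G G (G ⊗[ℂ] G) (TensorProduct.map Δ LinearMap.id
          (Δ.lTensor G s))) := by
      intro s
      induction s with
      | zero => simp
      | add x y hx hy => simp only [map_add, hx, hy]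
      | tmul b c => simp [Ψ, q]
    have e4 : ∀ t : G ⊗[ℂ] (G ⊗[ℂ] G), TensorProduct.assoc ℂ G G (G ⊗[ℂ] G)
        (TensorProduct.map Δ LinearMap.id t) = ((TensorProduct.assoc ℂ G G G).toLinearMap).lTensor G
          (TensorProduct.assoc ℂ G (G ⊗[ℂ] G) G (TensorProduct.map
          ((TensorProduct.assoc ℂ G G G).toLinearMap ∘ₗ Δ.rTensor G) LinearMap.id
          ((TensorProduct.assoc ℂ G G G).symm t))) := by
      intro t
      induction t with
      | zero => simp
      | add x y hx hy => simp only [map_add, hx, hy]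
      | tmul a s =>
        induction s with
        | zero => simp
        | add x y hx hy => simp only [map_add, TensorProduct.tmul_add, hx, hy]
        | tmul b c =>
          simp only [TensorProduct.map_tmul, LinearMap.id_apply, TensorProduct.assoc_symm_tmul,
            LinearMap.comp_apply, LinearMap.rTensor_tmul, LinearEquiv.coe_coe]
          generalize Δ a = s
          induction s with
          | zero => simp
          | add x y hx hy => simp only [map_add, TensorProduct.add_tmul, hx, hy]
          | tmul x y => simp
    have e5 : ∀ s : G ⊗[ℂ] G, ((TensorProduct.assoc ℂ G G G).toLinearMap).lTensor G
          (TensorProduct.assoc ℂ G (G ⊗[ℂ] G) G (TensorProduct.map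
          ((TensorProduct.assoc ℂ G G G).toLinearMap ∘ₗ Δ.rTensor G) LinearMap.id
          (Δ.rTensor G s))) =
        ((TensorProduct.assoc ℂ G G G).toLinearMap ∘ₗ Δ.rTensor G).lTensor G
          (TensorProduct.assoc ℂ G G G (Δ.rTensor G s)) := by
      intro s
      induction s with
      | zero => simp
      | add x y hx hy => simp only [map_add, hx, hy]
      | tmul a b =>
        have := Coalgebra.coassoc_apply (R := ℂ) a
        simp only [LinearMap.rTensor_tmul, TensorProduct.map_tmul, LinearMap.comp_apply,
          LinearMap.id_apply, LinearEquiv.coe_coe]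
        change (LinearMap.lTensor G _) ((TensorProduct.assoc ℂ G (G ⊗[ℂ] G) G)
          (((TensorProduct.assoc ℂ G G G) ((Coalgebra.comul (R := ℂ)).rTensor G
            (Coalgebra.comul (R := ℂ) a))) ⊗ₜ b)) = _
        rw [this]
        change _ = LinearMap.lTensor G _ (TensorProduct.assoc ℂ G G G
          (Coalgebra.comul (R := ℂ) a ⊗ₜ b))
        generalize Coalgebra.comul (R := ℂ) a = s
        induction s with
        | zero => simp
        | add x y hx hy => simp only [map_add, TensorProduct.add_tmul, hx, hy]
        | tmul x y => simp [Δ]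
    have e6 : ∀ s : G ⊗[ℂ] G, Ψ (((TensorProduct.assoc ℂ G G G).toLinearMap ∘ₗ
        Δ.rTensor G).lTensor G (Δ.lTensor G s)) =
        1 ⊗ₜ (LinearMap.mul' ℂ G ((HopfAlgebraStruct.antipode ℂ).rTensor G s)) := by
      intro s
      induction s with
      | zero => simp
      | add x y hx hy => simp only [map_add, TensorProduct.tmul_add, hx, hy]
      | tmul a b =>
        rw [LinearMap.lTensor_tmul, LinearMap.lTensor_tmul, LinearMap.comp_apply]
        refine (e2 a _).trans ?_
        simp [Δ]
    have e7 : Δ.lTensor G (Δ g) = TensorProduct.assoc ℂ G G G (Δ.rTensor G (Δ g)) :=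
      (Coalgebra.coassoc_apply g).symm
    change LinearMap.mul' ℂ (G ⊗[ℂ] G) (TensorProduct.map (q ∘ₗ Δ) Δ (Δ g)) =
      algebraMap ℂ _ (Coalgebra.counit g)
    rw [e3, e4, e7, LinearEquiv.symm_apply_apply, e5, ← e7, e6]
    simp only [Δ, HopfAlgebra.mul_antipode_rTensor_comul_apply]
    rw [Algebra.algebraMap_eq_smul_one, Algebra.algebraMap_eq_smul_one, TensorProduct.tmul_smul]
    rfl
  have h2 := left_inv_eq_right_inv h1 (LinearMap.comul_right_inv (R := ℂ) (C := G))
  exact (LinearMap.congr_fun (congrArg WithConv.ofConv h2) g).symm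

end Hopf

/-! ### The left adjoint action. -/

section Adjoint

variable {G : Type*} [Ring G] [HopfAlgebra ℂ G]

/-- The map `a ⊗ b ↦ (x ↦ a x S(b))`. -/
def conj : G ⊗[ℂ] G →ₗ[ℂ] G →ₗ[ℂ] G :=
  TensorProduct.lift (LinearMap.mk₂ ℂ
    (fun a b => LinearMap.mulRight ℂ (HopfAlgebraStruct.antipode ℂ b) ∘ₗ LinearMap.mulLeft ℂ a)
    (fun a a' b => by ext x; simp [add_mul]) (fun c a b => by ext x; simp)
    (fun a b b' => by ext x; simp [mul_add]) (fun c a b => by ext x; simp))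

theorem conj_tmul (a b x : G) : conj (a ⊗ₜ b) x = a * x * HopfAlgebraStruct.antipode ℂ b := rfl

/-- The left adjoint action `g ▷ x = g₁ x S(g₂)`. -/
def ad : G →ₗ[ℂ] G →ₗ[ℂ] G := conj ∘ₗ Coalgebra.comul

theorem ad_apply (g x : G) : ad g x = conj (Coalgebra.comul (R := ℂ) g) x := rfl

theorem conj_mul (s t : G ⊗[ℂ] G) (x : G) : conj (s * t) x = conj s (conj t x) := by
  induction s with
  | zero => simp
  | add a b ha hb => simp only [add_mul, map_add, LinearMap.add_apply, ha, hb]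
  | tmul a b =>
    induction t with
    | zero => simp
    | add c d hc hd => simp only [mul_add, map_add, LinearMap.add_apply, hc, hd]
    | tmul c d =>
      simp only [Algebra.TensorProduct.tmul_mul_tmul, conj_tmul,
        HopfAlgebra.antipode_mul_antidistrib, mul_assoc]

theorem ad_mul (g h x : G) : ad (g * h) x = ad g (ad h x) := by
  rw [ad_apply, Bialgebra.comul_mul, conj_mul]; rfl

theorem ad_one (x : G) : ad 1 x = x := by
  rw [ad_apply, Bialgebra.comul_one, Algebra.TensorProduct.one_def, conj_tmul]
  simp

theorem comul_coassoc_apply {P : Type*} [AddCommGroup P] [Module ℂ P]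
    (f : G ⊗[ℂ] (G ⊗[ℂ] G) →ₗ[ℂ] P) (f' : G ⊗[ℂ] G →ₗ[ℂ] P)
    (h : ∀ a b : G, f (TensorProduct.assoc ℂ G G G (Coalgebra.comul (R := ℂ) a ⊗ₜ b)) =
      f' (a ⊗ₜ b)) (g : G) :
    f ((Coalgebra.comul (R := ℂ)).lTensor G (Coalgebra.comul (R := ℂ) g)) =
      f' (Coalgebra.comul (R := ℂ) g) := by
  rw [← Coalgebra.coassoc_apply]
  exact LinearMap.congr_fun (f := f ∘ₗ (TensorProduct.assoc ℂ G G G).toLinearMap ∘ₗ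
    (Coalgebra.comul (R := ℂ)).rTensor G) (g := f') (TensorProduct.ext' h) _

/-- `g₁ x S(g₂) g₃ = g x` by the antipode axiom. This is the source of every later rule for
commuting functions past elements of `G` or past forms. -/
theorem sum_ad_mul (x g : G) :
    LinearMap.mul' ℂ G ((ad.flip x).rTensor G (Coalgebra.comul (R := ℂ) g)) = g * x := by
  let f : G ⊗[ℂ] (G ⊗[ℂ] G) →ₗ[ℂ] G := LinearMap.mul' ℂ G ∘ₗ (conj.flip x).rTensor G ∘ₗ
      (TensorProduct.assoc ℂ G G G).symm.toLinearMap
  have h1 : ∀ s, LinearMap.mul' ℂ G ((ad.flip x).rTensor G s) =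
      f (TensorProduct.assoc ℂ G G G ((Coalgebra.comul (R := ℂ)).rTensor G s)) := by
    intro s
    induction s with
    | zero => simp
    | add a b ha hb => simp only [map_add, ha, hb]
    | tmul a b => simp [f, ad_apply]
  have h2 : ∀ s : G ⊗[ℂ] G, f ((Coalgebra.comul (R := ℂ)).lTensor G s) =
      TensorProduct.rid ℂ G ((Coalgebra.counit (R := ℂ)).lTensor G s) * x := by
    intro s
    induction s with
    | zero => simp
    | add a b ha hb => simp only [map_add, add_mul, ha, hb]
    | tmul a b =>
      have h3 : ∀ t : G ⊗[ℂ] G, f (a ⊗ₜ t) =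
          a * x * LinearMap.mul' ℂ G ((HopfAlgebraStruct.antipode ℂ).rTensor G t) := by
        intro t
        induction t with
        | zero => simp
        | add c d hc hd => simp only [map_add, TensorProduct.tmul_add, mul_add, hc, hd]
        | tmul c d => simp [f, conj_tmul, mul_assoc]
      rw [LinearMap.lTensor_tmul, h3, HopfAlgebra.mul_antipode_rTensor_comul_apply]
      simp [Algebra.algebraMap_eq_smul_one]
  rw [h1, Coalgebra.coassoc_apply, h2, Coalgebra.lTensor_counit_comul]
  simp

theorem counit_ad (g x : G) : Coalgebra.counit (R := ℂ) (ad g x) =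
    Coalgebra.counit (R := ℂ) g * Coalgebra.counit (R := ℂ) x := by
  have h : ∀ s : G ⊗[ℂ] G, Coalgebra.counit (R := ℂ) (conj s x) =
      Coalgebra.counit (R := ℂ) (TensorProduct.rid ℂ G ((Coalgebra.counit (R := ℂ)).lTensor G s)) *
        Coalgebra.counit (R := ℂ) x := by
    intro s
    induction s with
    | zero => simp
    | add a b ha hb => simp only [map_add, LinearMap.add_apply, add_mul, ha, hb]
    | tmul a b =>
      rw [conj_tmul, Bialgebra.counit_mul, Bialgebra.counit_mul, HopfAlgebra.counit_antipode]
      simp; ring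
  rw [ad_apply, h, Coalgebra.lTensor_counit_comul]
  simp

end Adjoint

/-! ### The adjoint action on `M` and right multiplication on `G / M⁺G`. -/

section AdjointM

variable {G H : Type*} [Ring G] [HopfAlgebra ℂ G] [Ring H] [HopfAlgebra ℂ H] (π : G →ₐc[ℂ] H)

theorem rightCoact_apply (g : G) :
    rightCoact π g = (π : G →ₗ[ℂ] H).lTensor G (Coalgebra.comul (R := ℂ) g) := rfl

/-- Let `r` be the right coaction and `i(g) = g ⊗ 1`. The convolution products of `r(- ▷ x)` and of
`i(- ▷ x)` with `r` agree: by `(g₁ ▷ x) g₂ = g x` and `r(x) = x ⊗ 1`, both send `g` to `r(g)(x ⊗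
1)`. As `r` is an algebra map, `r ∘ S` is a convolution inverse of it, so `r` cancels. -/
theorem ad_mem_coinv (g : G) (x : coinv π) : ad g (x : G) ∈ coinv π := by
  let r : G →ₗ[ℂ] G ⊗[ℂ] H := (rightCoact π).toLinearMap
  let i : G →ₗ[ℂ] G ⊗[ℂ] H :=
    (Algebra.TensorProduct.includeLeft : G →ₐ[ℂ] G ⊗[ℂ] H).toLinearMap
  have hx : rightCoact π (x : G) = (x : G) ⊗ₜ 1 := x.2
  have hr : ∀ f f' : G →ₗ[ℂ] G, ∀ s : G ⊗[ℂ] G, LinearMap.mul' ℂ (G ⊗[ℂ] H)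
      (TensorProduct.map (r ∘ₗ f) (r ∘ₗ f') s) = r (LinearMap.mul' ℂ G (TensorProduct.map f f' s)) := by
    intro f f' s
    induction s with
    | zero => simp
    | add a b ha hb => simp only [map_add, ha, hb]
    | tmul a b => simp [r]
  have h1 : WithConv.toConv (r ∘ₗ ad.flip (x : G)) * WithConv.toConv r =
      WithConv.toConv (i ∘ₗ ad.flip (x : G)) * WithConv.toConv r := by
    apply WithConv.ext
    refine LinearMap.ext fun g => ?_
    change LinearMap.mul' ℂ (G ⊗[ℂ] H) (TensorProduct.map (r ∘ₗ ad.flip (x : G)) (r ∘ₗ LinearMap.id)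
      (Coalgebra.comul (R := ℂ) g)) = LinearMap.mul' ℂ (G ⊗[ℂ] H)
      (TensorProduct.map (i ∘ₗ ad.flip (x : G)) r (Coalgebra.comul (R := ℂ) g))
    rw [hr]
    change r (LinearMap.mul' ℂ G ((ad.flip (x : G)).rTensor G (Coalgebra.comul (R := ℂ) g))) = _
    rw [sum_ad_mul]
    let f : G ⊗[ℂ] (G ⊗[ℂ] G) →ₗ[ℂ] G ⊗[ℂ] H := TensorProduct.map
      (LinearMap.mul' ℂ G ∘ₗ (ad.flip (x : G)).rTensor G) (π : G →ₗ[ℂ] H) ∘ₗ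
      (TensorProduct.assoc ℂ G G G).symm.toLinearMap
    let f' : G ⊗[ℂ] G →ₗ[ℂ] G ⊗[ℂ] H := TensorProduct.map
      (LinearMap.mulRight ℂ (x : G)) (π : G →ₗ[ℂ] H)
    have h2 : ∀ s : G ⊗[ℂ] G, LinearMap.mul' ℂ (G ⊗[ℂ] H)
        (TensorProduct.map (i ∘ₗ ad.flip (x : G)) r s) =
        f ((Coalgebra.comul (R := ℂ)).lTensor G s) := by
      intro s
      induction s with
      | zero => simp
      | add a b ha hb => simp only [map_add, ha, hb]
      | tmul a b =>
        have : r b = (π : G →ₗ[ℂ] H).lTensor G (Coalgebra.comul (R := ℂ) b) := rfl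
        rw [TensorProduct.map_tmul, this, LinearMap.lTensor_tmul]
        generalize Coalgebra.comul (R := ℂ) b = t
        induction t with
        | zero => simp
        | add c d hc hd => simp only [map_add, TensorProduct.tmul_add, hc, hd]
        | tmul c d => simp [f, i]
    rw [h2, comul_coassoc_apply f f' (fun a b => by
      simp [f, f', ← sum_ad_mul (x : G) a])]
    change rightCoact π (g * (x : G)) = _
    rw [map_mul, hx, rightCoact_apply]
    generalize Coalgebra.comul (R := ℂ) g = t
    induction t with
    | zero => simp
    | add c d hc hd => simp only [map_add, add_mul, hc, hd]
    | tmul c d => simp [f']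
  have h3 : WithConv.toConv r * WithConv.toConv (r ∘ₗ HopfAlgebraStruct.antipode ℂ) = 1 := by
    apply WithConv.ext
    refine LinearMap.ext fun g => ?_
    change LinearMap.mul' ℂ (G ⊗[ℂ] H) (TensorProduct.map (r ∘ₗ LinearMap.id)
      (r ∘ₗ HopfAlgebraStruct.antipode ℂ) (Coalgebra.comul (R := ℂ) g)) =
      algebraMap ℂ _ (Coalgebra.counit g)
    rw [hr]
    change r (LinearMap.mul' ℂ G ((HopfAlgebraStruct.antipode ℂ).lTensor G _)) = _
    rw [HopfAlgebra.mul_antipode_lTensor_comul_apply]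
    exact (rightCoact π).commutes _
  have h4 := congrArg (· * WithConv.toConv (r ∘ₗ HopfAlgebraStruct.antipode ℂ)) h1
  simp only [mul_assoc, h3, mul_one] at h4
  exact LinearMap.congr_fun (congrArg WithConv.ofConv h4) g

/-- The left adjoint action of `G` on `M`. -/
def adM : G →ₗ[ℂ] coinv π →ₗ[ℂ] coinv π :=
  LinearMap.mk₂ ℂ (fun g x => (⟨ad g (x : G), ad_mem_coinv π g x⟩ : coinv π))
    (fun a b x => Subtype.ext (by simp)) (fun c a x => Subtype.ext (by simp))
    (fun a x y => Subtype.ext (by simp)) (fun c a x => Subtype.ext (by simp))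

theorem coe_adM (g : G) (x : coinv π) : ((adM π g x : coinv π) : G) = ad g (x : G) := rfl

theorem adM_mul (g h : G) (x : coinv π) : adM π (g * h) x = adM π g (adM π h x) :=
  Subtype.ext (ad_mul g h (x : G))

theorem adM_one (x : coinv π) : adM π 1 x = x := Subtype.ext (ad_one (x : G))

theorem counitM_adM (g : G) (x : coinv π) :
    counitM π (adM π g x) = Coalgebra.counit (R := ℂ) g * counitM π x := counit_ad g (x : G)

/-- `g m = (g₁ ▷ m) g₂` with `g₁ ▷ m ∈ M`, and `ε(g₁ ▷ m) = ε(g₁) ε(m)`. Thus `M` acts through the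
counit from the right, too, although `M⁺G` is defined by left multiplication. -/
theorem mk_mul_coinv (g : G) (m : coinv π) :
    Phi.mk (counitM π) (g * (m : G)) = counitM π m • Phi.mk (counitM π) g := by
  rw [← sum_ad_mul]
  have : ∀ s : G ⊗[ℂ] G, Phi.mk (counitM π) (LinearMap.mul' ℂ G ((ad.flip (m : G)).rTensor G s)) =
      counitM π m • Phi.mk (counitM π)
        (TensorProduct.lid ℂ G ((Coalgebra.counit (R := ℂ)).rTensor G s)) := by
    intro s
    induction s with
    | zero => simp
    | add a b ha hb => simp only [map_add, smul_add, ha, hb]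
    | tmul a b =>
      have h := Phi.mk_smul (counitM π) (adM π a m) b
      rw [counitM_adM] at h
      simp only [LinearMap.rTensor_tmul, LinearMap.mul'_apply, LinearMap.flip_apply,
        TensorProduct.lid_tmul, map_smul]
      rw [smul_smul, mul_comm]
      exact h
  rw [this, Coalgebra.rTensor_counit_comul]
  simp

/-- `M⁺G` is a right ideal of `G`. -/
theorem mk_mul_eq {g g' : G} (h : G)
    (e : Phi.mk (counitM π) g = Phi.mk (counitM π) g') :
    Phi.mk (counitM π) (g * h) = Phi.mk (counitM π) (g' * h) := by
  have : augSub (counitM π) G ≤ LinearMap.ker (Phi.mk (counitM π) ∘ₗ LinearMap.mulRight ℂ h) := by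
    refine Submodule.span_le.2 ?_
    rintro _ ⟨a, e, ha, rfl⟩
    change Phi.mk (counitM π) ((a : G) * e * h) = 0
    rw [mul_assoc]
    exact (Phi.mk_smul (counitM π) a (e * h)).trans (by rw [ha, zero_smul])
  have h2 := LinearMap.mem_ker.1 (this ((Submodule.Quotient.eq _).1 e))
  simpa [sub_mul, sub_eq_zero] using h2

/-- Write `S(m) = S(m₁) ε(m₂)`. By `mk_mul_coinv` the scalar `ε(m₂)` may be replaced by a right
factor `m₂`, and `S(m₁) m₂ = ε(m)`. The detour is needed because `S(m)` is not known to lie in `M`.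
-/
theorem mk_mul_antipode_coinv (g : G) (m : coinv π) :
    Phi.mk (counitM π) (g * HopfAlgebraStruct.antipode ℂ (m : G)) =
      counitM π m • Phi.mk (counitM π) g := by
  have h1 : (HopfAlgebraStruct.antipode ℂ (m : G)) = TensorProduct.rid ℂ G
      ((HopfAlgebraStruct.antipode ℂ).rTensor ℂ ((counitM π).toLinearMap.lTensor G (coactM π m))) := by
    rw [counit_coactM]; simp
  have h2 : ∀ s : G ⊗[ℂ] coinv π, Phi.mk (counitM π) (g * TensorProduct.rid ℂ G
      ((HopfAlgebraStruct.antipode ℂ).rTensor ℂ ((counitM π).toLinearMap.lTensor G s))) =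
      Phi.mk (counitM π) (g * TensorProduct.lift ((LinearMap.mul ℂ G).compl₁₂
        (HopfAlgebraStruct.antipode ℂ) (coinv π).val.toLinearMap) s) := by
    intro s
    induction s with
    | zero => simp
    | add a b ha hb => simp only [map_add, mul_add, ha, hb]
    | tmul a b =>
      simp [← mul_assoc, mk_mul_coinv]
  rw [h1, h2, sum_antipode_mul_coactM]
  simp [Algebra.algebraMap_eq_smul_one]

end AdjointM

/-! ### Bialgebra maps and antipodes; free relative Hopf modules. -/

section Maps

variable {G H : Type*} [Ring G] [HopfAlgebra ℂ G] [Ring H] [HopfAlgebra ℂ H] (π : G →ₐc[ℂ] H)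

/-- `π ∘ S` is a left and `S ∘ π` a right convolution inverse of `π`. -/
theorem map_antipode (g : G) :
    π (HopfAlgebraStruct.antipode ℂ g) = HopfAlgebraStruct.antipode ℂ (π g) := by
  let p : G →ₗ[ℂ] H := (π : G →ₐ[ℂ] H).toLinearMap
  have hp : ∀ g, Coalgebra.comul (R := ℂ) (p g) = TensorProduct.map p p (Coalgebra.comul g) :=
    fun g => (CoalgHomClass.map_comp_comul_apply π g).symm
  have hc : ∀ g, Coalgebra.counit (R := ℂ) (p g) = Coalgebra.counit (R := ℂ) g :=
    fun g => CoalgHomClass.counit_comp_apply π g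
  have h1 : WithConv.toConv (p ∘ₗ HopfAlgebraStruct.antipode ℂ) * WithConv.toConv p = 1 := by
    apply WithConv.ext
    refine LinearMap.ext fun g => ?_
    have : ∀ s, LinearMap.mul' ℂ H (TensorProduct.map (p ∘ₗ HopfAlgebraStruct.antipode ℂ) p s) =
        p (LinearMap.mul' ℂ G ((HopfAlgebraStruct.antipode ℂ).rTensor G s)) := by
      intro s
      induction s with
      | zero => simp
      | add a b ha hb => simp only [map_add, ha, hb]
      | tmul a b => simp [p]
    change LinearMap.mul' ℂ H (TensorProduct.map (p ∘ₗ HopfAlgebraStruct.antipode ℂ) p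
      (Coalgebra.comul g)) = algebraMap ℂ H (Coalgebra.counit g)
    rw [this, HopfAlgebra.mul_antipode_rTensor_comul_apply]
    exact (π : G →ₐ[ℂ] H).commutes _
  have h2 : WithConv.toConv p * WithConv.toConv (HopfAlgebraStruct.antipode ℂ ∘ₗ p) = 1 := by
    apply WithConv.ext
    refine LinearMap.ext fun g => ?_
    have : ∀ s, LinearMap.mul' ℂ H (TensorProduct.map p (HopfAlgebraStruct.antipode ℂ ∘ₗ p) s) =
        LinearMap.mul' ℂ H ((HopfAlgebraStruct.antipode ℂ).lTensor H (TensorProduct.map p p s)) := by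
      intro s
      induction s with
      | zero => simp
      | add a b ha hb => simp only [map_add, ha, hb]
      | tmul a b => simp [p]
    change LinearMap.mul' ℂ H (TensorProduct.map p (HopfAlgebraStruct.antipode ℂ ∘ₗ p)
      (Coalgebra.comul g)) = algebraMap ℂ H (Coalgebra.counit g)
    rw [this, ← hp, HopfAlgebra.mul_antipode_lTensor_comul_apply, hc]
  have h3 := left_inv_eq_right_inv h1 h2
  exact LinearMap.congr_fun (congrArg WithConv.ofConv h3) g

-- A substitute for Sweedler notation: after replacing the iterated coaction by `Δ ⊗ id`, what
-- remains is an identity of linear maps on `G ⊗ F`, which is tested on pure tensors.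
variable {π} in
theorem RelHopf.coassoc_apply {F : Type*} [AddCommGroup F] [Module ℂ F] [Module (coinv π) F]
    [IsScalarTower ℂ (coinv π) F] (R : RelHopf π F) {P : Type*} [AddCommGroup P] [Module ℂ P]
    (f : G ⊗[ℂ] (G ⊗[ℂ] F) →ₗ[ℂ] P) (f' : G ⊗[ℂ] F →ₗ[ℂ] P)
    (h : ∀ (a : G) (x : F), f (TensorProduct.assoc ℂ G G F (Coalgebra.comul (R := ℂ) a ⊗ₜ x)) =
      f' (a ⊗ₜ x)) (x : F) :
    f (R.coact.lTensor G (R.coact x)) = f' (R.coact x) := by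
  rw [← R.coassoc]
  exact LinearMap.congr_fun (f := f ∘ₗ (TensorProduct.assoc ℂ G G F).toLinearMap ∘ₗ
    (Coalgebra.comul (R := ℂ)).rTensor F) (g := f') (TensorProduct.ext' h) _

variable {π} in
theorem RelHopf.counit_apply {F : Type*} [AddCommGroup F] [Module ℂ F] [Module (coinv π) F]
    [IsScalarTower ℂ (coinv π) F] (R : RelHopf π F) {P : Type*} [AddCommGroup P] [Module ℂ P]
    (f : G ⊗[ℂ] F →ₗ[ℂ] P) (f' : F →ₗ[ℂ] P)
    (h : ∀ (a : G) (x : F), f (a ⊗ₜ x) = Coalgebra.counit (R := ℂ) a • f' x) (x : F) :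
    f (R.coact x) = f' x := by
  conv_rhs => rw [← R.counit_coact x]
  exact LinearMap.congr_fun (f := f) (g := f' ∘ₗ (TensorProduct.lid ℂ F).toLinearMap ∘ₗ
    (Coalgebra.counit (R := ℂ)).rTensor F) (TensorProduct.ext' fun a x => by simp [h]) _

/-- The relative Hopf module `G ⊗ X` for a vector space `X`. -/
def freeRelHopf (X : Type*) [AddCommGroup X] [Module ℂ X] : RelHopf π (G ⊗[ℂ] X) where
  coact := (TensorProduct.assoc ℂ G G X).toLinearMap ∘ₗ (Coalgebra.comul (R := ℂ)).rTensor X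
  counit_coact := by
    intro z
    induction z with
    | zero => simp
    | add a b ha hb => simp only [map_add, ha, hb]
    | tmul g x =>
      have : ∀ s : G ⊗[ℂ] G, TensorProduct.lid ℂ (G ⊗[ℂ] X)
          ((Coalgebra.counit (R := ℂ)).rTensor (G ⊗[ℂ] X) (TensorProduct.assoc ℂ G G X (s ⊗ₜ x))) =
          (TensorProduct.lid ℂ G ((Coalgebra.counit (R := ℂ)).rTensor G s)) ⊗ₜ x := by
        intro s
        induction s with
        | zero => simp
        | add a b ha hb => simp only [map_add, TensorProduct.add_tmul, ha, hb]
        | tmul a b => simp [TensorProduct.smul_tmul']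
      simp [this]
  coassoc := by
    intro z
    induction z with
    | zero => simp
    | add a b ha hb => simp only [map_add, ha, hb]
    | tmul g x =>
      let j : G ⊗[ℂ] (G ⊗[ℂ] G) →ₗ[ℂ] G ⊗[ℂ] (G ⊗[ℂ] (G ⊗[ℂ] X)) :=
        ((TensorProduct.assoc ℂ G G X).toLinearMap ∘ₗ (TensorProduct.mk ℂ _ X).flip x).lTensor G
      have h1 : ∀ s : G ⊗[ℂ] G, TensorProduct.assoc ℂ G G (G ⊗[ℂ] X)
          ((Coalgebra.comul (R := ℂ)).rTensor (G ⊗[ℂ] X)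
            (TensorProduct.assoc ℂ G G X (s ⊗ₜ x))) =
          j (TensorProduct.assoc ℂ G G G ((Coalgebra.comul (R := ℂ)).rTensor G s)) := by
        intro s
        induction s with
        | zero => simp
        | add a b ha hb => simp only [map_add, TensorProduct.add_tmul, ha, hb]
        | tmul a b =>
          simp only [TensorProduct.assoc_tmul, LinearMap.rTensor_tmul]
          generalize Coalgebra.comul (R := ℂ) a = t
          induction t with
          | zero => simp
          | add a b ha hb => simp only [map_add, TensorProduct.add_tmul, ha, hb]
          | tmul a b => simp [j]
      have h2 : ∀ s : G ⊗[ℂ] G, ((TensorProduct.assoc ℂ G G X).toLinearMap ∘ₗ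
          (Coalgebra.comul (R := ℂ)).rTensor X).lTensor G
            (TensorProduct.assoc ℂ G G X (s ⊗ₜ x)) =
          j ((Coalgebra.comul (R := ℂ)).lTensor G s) := by
        intro s
        induction s with
        | zero => simp
        | add a b ha hb => simp only [map_add, TensorProduct.add_tmul, ha, hb]
        | tmul a b => simp [j]
      simp only [LinearMap.comp_apply, LinearMap.rTensor_tmul, LinearEquiv.coe_coe]
      rw [h1, h2, Coalgebra.coassoc_apply]
  coact_smul := by
    intro m z
    rw [← LinearMap.comp_apply]
    induction z with
    | zero => simp
    | add a b ha hb => simp only [smul_add, map_add, ha, hb]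
    | tmul g x =>
      rw [coinv_smul_tmul]
      simp only [LinearMap.comp_apply, LinearMap.rTensor_tmul, LinearEquiv.coe_coe,
        Bialgebra.comul_mul, ← lTensor_val_coactM]
      generalize coactM π m = s
      generalize Coalgebra.comul (R := ℂ) g = t
      induction s with
      | zero => simp
      | add a b ha hb =>
        simp only [map_add, add_mul, TensorProduct.add_tmul, LinearMap.add_apply, ha, hb]
      | tmul a b =>
        induction t with
        | zero => simp
        | add c d hc hd => simp only [map_add, mul_add, TensorProduct.add_tmul, hc, hd]
        | tmul c d =>
          simp [tensorAct_tmul, coinv_smul_tmul]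

theorem freeRelHopf_coact_tmul {X : Type*} [AddCommGroup X] [Module ℂ X] (g : G) (x : X) :
    (freeRelHopf π X).coact (g ⊗ₜ x) =
      TensorProduct.assoc ℂ G G X (Coalgebra.comul (R := ℂ) g ⊗ₜ x) := rfl

theorem freeRelHopf_coact_lTensor {X Y : Type*} [AddCommGroup X] [Module ℂ X] [AddCommGroup Y]
    [Module ℂ Y] (f : X →ₗ[ℂ] Y) (z : G ⊗[ℂ] X) :
    (freeRelHopf π Y).coact (f.lTensor G z) =
      (f.lTensor G).lTensor G ((freeRelHopf π X).coact z) := by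
  induction z with
  | zero => simp
  | add a b ha hb => simp only [map_add, ha, hb]
  | tmul g x =>
    rw [LinearMap.lTensor_tmul, freeRelHopf_coact_tmul, freeRelHopf_coact_tmul]
    generalize Coalgebra.comul (R := ℂ) g = s
    induction s with
    | zero => simp
    | add a b ha hb => simp only [map_add, TensorProduct.add_tmul, ha, hb]
    | tmul a b => simp

/-- By right exactness the kernel is the image of `M⁺G ⊗ X`, and `a g ⊗ x = a (g ⊗ x)`. -/
theorem mem_augSub_tensor {X : Type*} [AddCommGroup X] [Module ℂ X] (z : G ⊗[ℂ] X)
    (hz : (Phi.mk (counitM π) : G →ₗ[ℂ] _).rTensor X z = 0) :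
    z ∈ augSub (counitM π) (G ⊗[ℂ] X) := by
  have h : Function.Exact ((augSub (counitM π) G).subtype.rTensor X)
      ((Phi.mk (counitM π) : G →ₗ[ℂ] _).rTensor X) :=
    rTensor_exact X (by rw [LinearMap.exact_iff]; simp [Phi.mk]) (Phi.mk_surjective _)
  obtain ⟨t, rfl⟩ := (h z).1 hz
  clear hz h
  induction t with
  | zero => simp
  | add a b ha hb => rw [map_add]; exact add_mem ha hb
  | tmul g x =>
    obtain ⟨g, hg⟩ := g
    rw [LinearMap.rTensor_tmul, Submodule.subtype_apply]
    change g ⊗ₜ x ∈ _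
    induction hg using Submodule.span_induction with
    | mem y hy =>
      obtain ⟨a, e, ha, rfl⟩ := hy
      exact Submodule.subset_span ⟨a, e ⊗ₜ x, ha, rfl⟩
    | zero => simp
    | add y y' _ _ h h' => rw [TensorProduct.add_tmul]; exact add_mem h h'
    | smul c y _ h => rw [← TensorProduct.smul_tmul']; exact Submodule.smul_mem _ _ h

end Maps

/-! ### One-forms inside the free module `G ⊗ V`. -/

section Forms

variable {G H : Type*} [Ring G] [HopfAlgebra ℂ G] [Ring H] [HopfAlgebra ℂ H] {π : G →ₐc[ℂ] H}
variable {Ω : Type*} [AddCommGroup Ω] [Module ℂ Ω]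
  [Module (coinv π) Ω] [IsScalarTower ℂ (coinv π) Ω]
  [Module (coinv π)ᵐᵒᵖ Ω] [IsScalarTower ℂ (coinv π)ᵐᵒᵖ Ω]
  [SMulCommClass (coinv π) (coinv π)ᵐᵒᵖ Ω]

namespace CovariantCalculus

variable (C : CovariantCalculus π Ω)

/-- The one-forms as a relative Hopf module. -/
def toRelHopf : RelHopf π Ω where
  coact := C.coact
  counit_coact := C.counit_coact
  coassoc := C.coassoc
  coact_smul := C.coact_smul

/-- The map `ω ↦ σ[ω]`. -/
def sigmaMk : Ω →ₗ[ℂ] C.V := C.sigma.toLinearMap ∘ₗ Phi.mk (counitM π)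

theorem sigmaMk_apply (ω : Ω) : C.sigmaMk ω = C.sigma (Phi.mk (counitM π) ω) := rfl

theorem sigmaMk_smul (m : coinv π) (ω : Ω) :
    C.sigmaMk (m • ω) = counitM π m • C.sigmaMk ω := by
  rw [sigmaMk_apply, Phi.mk_smul, map_smul]; rfl

theorem sigmaMk_surjective : Function.Surjective C.sigmaMk :=
  C.sigma.surjective.comp (Phi.mk_surjective _)

theorem sigmaMk_eq_zero {ω : Ω} : C.sigmaMk ω = 0 ↔ ω ∈ augSub (counitM π) Ω := by
  rw [sigmaMk_apply, LinearEquiv.map_eq_zero_iff]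
  exact Submodule.Quotient.mk_eq_zero _

theorem sigmaMk_smul_d (a b : coinv π) :
    C.sigmaMk (a • C.d b) = counitM π a • C.I.mkQ (toPlus π b) := by
  rw [sigmaMk_apply, sigma_apply, map_smul]

theorem sigmaMk_d (b : coinv π) : C.sigmaMk (C.d b) = C.I.mkQ (toPlus π b) := by
  have := C.sigmaMk_smul_d 1 b
  rwa [one_smul, map_one, one_smul] at this

theorem toV_eq_map (W : Submodule ℂ Ω) : C.toV W = W.map C.sigmaMk := by
  rw [toV, Phi.image, ← Submodule.map_comp]; rfl

/-- The map `Ω → G ⊗ V`, `ω ↦ ω₋₁ ⊗ σ[ω₀]`. -/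
def rho : Ω →ₗ[ℂ] G ⊗[ℂ] C.V := C.sigmaMk.lTensor G ∘ₗ C.coact

theorem rho_apply (ω : Ω) : C.rho ω = C.sigmaMk.lTensor G (C.coact ω) := rfl

/-- The fibre sees `m₂` only through the counit: `m₁ ω₋₁ ⊗ ε(m₂) σ[ω₀] = m ω₋₁ ⊗ σ[ω₀]`. -/
theorem rho_smul (m : coinv π) (ω : Ω) : C.rho (m • ω) = m • C.rho ω := by
  have h : ∀ (s : G ⊗[ℂ] coinv π) (z : G ⊗[ℂ] Ω), C.sigmaMk.lTensor G (tensorAct π Ω s z) =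
      TensorProduct.map (LinearMap.mulLeft ℂ
        (TensorProduct.rid ℂ G ((counitM π).toLinearMap.lTensor G s))) C.sigmaMk z := by
    intro s z
    induction z with
    | zero => simp
    | add x y hx hy => simp only [map_add, hx, hy]
    | tmul g ω =>
      induction s with
      | zero => simp
      | add x y hx hy =>
        simp only [map_add, LinearMap.add_apply, hx, hy, TensorProduct.map_tmul,
          LinearMap.mulLeft_apply, add_mul, TensorProduct.add_tmul]
      | tmul a b =>
        simp [tensorAct_tmul, sigmaMk_smul, TensorProduct.smul_tmul]
  rw [rho_apply, coact_smul, h, counit_coactM, rho_apply]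
  generalize C.coact ω = z
  induction z with
  | zero => simp
  | add x y hx hy => simp only [map_add, smul_add, hx, hy]
  | tmul g ω => simp [coinv_smul_tmul]

theorem counit_rho (ω : Ω) : TensorProduct.lid ℂ C.V
    ((Coalgebra.counit (R := ℂ)).rTensor C.V (C.rho ω)) = C.sigmaMk ω :=
  C.toRelHopf.counit_apply ((TensorProduct.lid ℂ C.V).toLinearMap ∘ₗ
    (Coalgebra.counit (R := ℂ)).rTensor C.V ∘ₗ C.sigmaMk.lTensor G) C.sigmaMk
    (fun a x => by simp) ω

/-- Coassociativity of `Ω`. It makes the kernel and the image of `rho` subcomodules, as descent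
requires. -/
theorem coact_rho (ω : Ω) :
    (freeRelHopf π C.V).coact (C.rho ω) = C.rho.lTensor G (C.coact ω) := by
  rw [rho_apply, freeRelHopf_coact_lTensor]
  change _ = (C.sigmaMk.lTensor G ∘ₗ C.coact).lTensor G (C.coact ω)
  rw [LinearMap.lTensor_comp, LinearMap.comp_apply, ← C.coassoc]
  rfl

/-- Both sides depend only on the class of `ω` in the fibre, so `ω` may be replaced by some `dn`
with `n ∈ M⁺`, where `J_coact` computes the coaction. -/
theorem coactV_sigmaMk (ω : Ω) : C.coactV (C.sigmaMk ω) =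
    TensorProduct.comm ℂ H C.V (TensorProduct.map
      (HopfAlgebraStruct.antipode ℂ ∘ₗ (π : G →ₗ[ℂ] H)) C.sigmaMk (C.coact ω)) := by
  obtain ⟨n, hn⟩ := C.I.mkQ_surjective (C.sigmaMk ω)
  have h1 : C.J (C.sigmaMk ω) = Phi.mk (counitM π) ω := by
    rw [sigmaMk_apply, sigma]
    exact LinearEquiv.apply_symm_apply (LinearEquiv.ofBijective C.J ⟨C.J_injective, C.J_surjective⟩) _
  have h2 : C.J (C.sigmaMk ω) = Phi.mk (counitM π) (C.d (n : coinv π)) := by rw [← hn]; rfl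
  have h3 : C.coactPhi ω = C.coactPhi (C.d (n : coinv π)) := by
    rw [← sub_eq_zero, ← map_sub]
    exact C.augSub_le_ker_coactPhi ((Submodule.Quotient.eq _).1 (h1.symm.trans h2))
  have h4 : C.coactV (C.sigmaMk ω) = C.I.mkQ.rTensor H (coactPlus π n) := by
    rw [← hn]; rfl
  have h5 : ∀ z, C.sigma.toLinearMap.rTensor H (C.J.rTensor H z) = z := by
    intro z
    rw [← LinearMap.comp_apply, ← LinearMap.rTensor_comp]
    have : C.sigma.toLinearMap ∘ₗ C.J = LinearMap.id := by
      refine LinearMap.ext fun v => ?_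
      exact LinearEquiv.symm_apply_apply (LinearEquiv.ofBijective C.J ⟨C.J_injective, C.J_surjective⟩) v
    rw [this]; simp
  rw [h4, ← h5 (C.I.mkQ.rTensor H (coactPlus π n)), J_coact, ← h3]
  simp only [coactPhi, LinearMap.comp_apply]
  generalize C.coact ω = z
  induction z with
  | zero => simp
  | add x y hx hy => simp only [map_add, hx, hy]
  | tmul g ω => simp [sigmaMk_apply]

/-- Left factors act by the counit, so it is enough to treat `db`, with `b` replaced by `b⁺`. Then
`(db⁺) m = d(b⁺ m) - b⁺ dm`, and the last term vanishes in the fibre. -/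
theorem actV_sigmaMk (m : coinv π) (ω : Ω) :
    C.actV m (C.sigmaMk ω) = C.sigmaMk (MulOpposite.op m • ω) := by
  have h : ω ∈ Submodule.span ℂ {ω : Ω | ∃ a b : coinv π, ω = a • C.d b} := by
    rw [C.span_d]; trivial
  induction h using Submodule.span_induction with
  | mem x hx =>
    obtain ⟨a, b, rfl⟩ := hx
    have h1 : MulOpposite.op m • a • C.d b = a • MulOpposite.op m • C.d b :=
      (smul_comm _ _ _).symm
    rw [h1, sigmaMk_smul, sigmaMk_smul, map_smul]
    congr 1
    have h2 : MulOpposite.op m • C.d (toPlus π b : coinv π) = C.d ((toPlus π b : coinv π) * m) -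
        (toPlus π b : coinv π) • C.d m := by rw [C.leibniz]; abel
    have h3 : counitM π (toPlus π b : coinv π) = 0 := (toPlus π b).2
    rw [← C.d_toPlus b, h2, map_sub, sigmaMk_smul, h3, zero_smul, sub_zero, sigmaMk_d, sigmaMk_d]
    have h4 : ∀ x : plusM π, toPlus π (x : coinv π) = x := by
      intro x
      have : counitM π (x : coinv π) = 0 := x.2
      ext; simp [coe_toPlus, this]
    rw [h4]
    have h5 : toPlus π ((toPlus π b : coinv π) * m) = actPlus π m (toPlus π b) := by
      have := h4 (actPlus π m (toPlus π b))
      rw [← this]; rfl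
    rw [h5]; rfl
  | zero => simp
  | add x y _ _ hx hy => rw [smul_add, map_add, map_add, map_add, hx, hy]
  | smul c x _ hx => rw [map_smul, map_smul, smul_comm, map_smul, hx]

end CovariantCalculus

end Forms

/-! ### Injectivity of `rho`. -/

section Injective

variable {G H : Type u} [Ring G] [HopfAlgebra ℂ G] [Ring H] [HopfAlgebra ℂ H] {π : G →ₐc[ℂ] H}
variable {Ω : Type u} [AddCommGroup Ω] [Module ℂ Ω]
  [Module (coinv π) Ω] [IsScalarTower ℂ (coinv π) Ω]
  [Module (coinv π)ᵐᵒᵖ Ω] [IsScalarTower ℂ (coinv π)ᵐᵒᵖ Ω]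
  [SMulCommClass (coinv π) (coinv π)ᵐᵒᵖ Ω]

/-- The kernel is a subcomodule, and applying the counit to `rho ω = 0` puts `ω` in `M⁺Ω`; descent
with `W = 0` does the rest. -/
theorem CovariantCalculus.rho_injective (hff : IsFaithfullyFlatRight π)
    (C : CovariantCalculus π Ω) : Function.Injective C.rho := by
  rw [← LinearMap.ker_eq_bot, eq_bot_iff]
  have := C.toRelHopf.le_of_le_sup_augSub hff ⊥ (by simp) (LinearMap.ker C.rho)
    (fun z hz => by
      rw [gTensor_ker, LinearMap.mem_ker]
      change C.rho.lTensor G (C.coact z) = 0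
      rw [← C.coact_rho, LinearMap.mem_ker.1 hz, map_zero])
    (fun z hz => by
      refine Submodule.mem_sup_right ?_
      rw [← C.sigmaMk_eq_zero, ← C.counit_rho, LinearMap.mem_ker.1 hz]
      simp)
  simpa using this

end Injective

theorem Phi.exists_lift {A : Type*} [Ring A] [Algebra ℂ A] (ε : A →ₐ[ℂ] ℂ) {E : Type*}
    [AddCommGroup E] [Module ℂ E] [Module A E] [IsScalarTower ℂ A E] {P : Type*} [AddCommGroup P]
    [Module ℂ P] (f : E →ₗ[ℂ] P) (hf : ∀ (a : A) (e : E), ε a = 0 → f (a • e) = 0) :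
    ∃ f' : Phi ε E →ₗ[ℂ] P, ∀ e, f' (Phi.mk ε e) = f e :=
  ⟨(augSub ε E).liftQ f (by
    refine Submodule.span_le.2 ?_
    rintro _ ⟨a, e, ha, rfl⟩
    exact hf a e ha), fun _ => rfl⟩

/-! ### Twisting and untwisting `Φ(G) ⊗ V`. -/

section Twist

variable {G H : Type*} [Ring G] [HopfAlgebra ℂ G] [Ring H] [HopfAlgebra ℂ H] (π : G →ₐc[ℂ] H)

theorem mulLeft_add (a b : G) :
    LinearMap.mulLeft ℂ (a + b) = LinearMap.mulLeft ℂ a + LinearMap.mulLeft ℂ b := by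
  ext; simp [add_mul]

theorem mulLeft_smul (c : ℂ) (a : G) :
    LinearMap.mulLeft ℂ (c • a) = c • LinearMap.mulLeft ℂ a := by
  ext; simp

/-- The right `H`-coaction `[g] ↦ [g₁] ⊗ π(g₂)` on `G / M⁺G`. -/
def deltaR : Phi (counitM π) G →ₗ[ℂ] Phi (counitM π) G ⊗[ℂ] H :=
  (augSub (counitM π) G).liftQ
    ((Phi.mk (counitM π) : G →ₗ[ℂ] _).rTensor H ∘ₗ (rightCoact π).toLinearMap) (by
    refine Submodule.span_le.2 ?_
    rintro _ ⟨a, e, ha, rfl⟩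
    have h : rightCoact π (a • e) = (a : G) ⊗ₜ 1 * rightCoact π e := by
      rw [coinv_smul_eq, map_mul]
      congr 1
      exact a.2
    change (Phi.mk (counitM π) : G →ₗ[ℂ] _).rTensor H (rightCoact π (a • e)) = 0
    rw [h]
    generalize rightCoact π e = z
    induction z with
    | zero => simp
    | add x y hx hy => rw [mul_add, map_add, hx, hy, add_zero]
    | tmul g k =>
      have := Phi.mk_smul (counitM π) a g
      rw [ha, zero_smul, coinv_smul_eq] at this
      simp [this])

theorem deltaR_mk (g : G) : deltaR π (Phi.mk (counitM π) g) =
    (Phi.mk (counitM π) : G →ₗ[ℂ] _).rTensor H (rightCoact π g) := rfl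

variable {π}
variable {Ω : Type*} [AddCommGroup Ω] [Module ℂ Ω]
  [Module (coinv π) Ω] [IsScalarTower ℂ (coinv π) Ω]
  [Module (coinv π)ᵐᵒᵖ Ω] [IsScalarTower ℂ (coinv π)ᵐᵒᵖ Ω]
  [SMulCommClass (coinv π) (coinv π)ᵐᵒᵖ Ω]

namespace CovariantCalculus

variable (C : CovariantCalculus π Ω)

theorem exists_lift_sigmaMk {P : Type*} [AddCommGroup P] [Module ℂ P] (f : Ω →ₗ[ℂ] P)
    (hf : ∀ (m : coinv π) (ω : Ω), f (m • ω) = counitM π m • f ω) :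
    ∃ f' : C.V →ₗ[ℂ] P, ∀ ω, f' (C.sigmaMk ω) = f ω :=
  ⟨(augSub (counitM π) Ω).liftQ f (by
    refine Submodule.span_le.2 ?_
    rintro _ ⟨a, e, ha, rfl⟩
    change f _ = 0
    rw [hf, ha, zero_smul]) ∘ₗ C.sigma.symm.toLinearMap, fun ω => by
      rw [sigmaMk_apply, LinearMap.comp_apply, LinearEquiv.coe_coe, LinearEquiv.symm_apply_apply]
      rfl⟩

/-- For `m ω` the antipode contributes `S(ω₋₁) S(m)`, and by `mk_mul_antipode_coinv` the factor
`S(m)` acts as `ε(m)`. Hence the formula passes from `Ω` to its quotient `V`. -/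
theorem exists_twist : ∃ T : C.V →ₗ[ℂ] G →ₗ[ℂ] Phi (counitM π) G ⊗[ℂ] C.V,
    ∀ ω g, T (C.sigmaMk ω) g = (Phi.mk (counitM π) ∘ₗ LinearMap.mulLeft ℂ g ∘ₗ
      HopfAlgebraStruct.antipode ℂ).rTensor C.V (C.rho ω) := by
  obtain ⟨T, hT⟩ := C.exists_lift_sigmaMk
    (P := G →ₗ[ℂ] Phi (counitM π) G ⊗[ℂ] C.V) (LinearMap.mk₂ ℂ
    (fun (ω : Ω) (g : G) => (Phi.mk (counitM π) ∘ₗ LinearMap.mulLeft ℂ g ∘ₗ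
      HopfAlgebraStruct.antipode ℂ).rTensor C.V (C.rho ω))
    (fun x y g => by simp) (fun c x g => by simp)
    (fun x g h => by
      rw [mulLeft_add, LinearMap.add_comp, LinearMap.comp_add, LinearMap.rTensor_add]; rfl)
    (fun c x g => by
      rw [mulLeft_smul, LinearMap.smul_comp, LinearMap.comp_smul, LinearMap.rTensor_smul]
      rfl)) (by
    intro m ω
    ext g
    simp only [LinearMap.mk₂_apply, LinearMap.smul_apply, rho_smul]
    generalize C.rho ω = z
    induction z with
    | zero => simp
    | add x y hx hy => rw [smul_add, map_add, hx, hy, map_add, smul_add]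
    | tmul h v =>
      simp only [coinv_smul_tmul, LinearMap.rTensor_tmul, LinearMap.comp_apply,
        HopfAlgebra.antipode_mul_antidistrib, LinearMap.mulLeft_apply]
      rw [← mul_assoc, mk_mul_antipode_coinv, TensorProduct.smul_tmul'])
  exact ⟨T, fun ω g => by rw [hT]; rfl⟩

/-- The map `v ⊗ g ↦ [g S(v₋₁)] ⊗ v₀`. -/
def twist : C.V →ₗ[ℂ] G →ₗ[ℂ] Phi (counitM π) G ⊗[ℂ] C.V := C.exists_twist.choose

theorem twist_sigmaMk (ω : Ω) (g : G) :
    C.twist (C.sigmaMk ω) g = (Phi.mk (counitM π) ∘ₗ LinearMap.mulLeft ℂ g ∘ₗ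
      HopfAlgebraStruct.antipode ℂ).rTensor C.V (C.rho ω) := C.exists_twist.choose_spec ω g

theorem exists_untwist_bilin : ∃ T : C.V →ₗ[ℂ] G →ₗ[ℂ] Phi (counitM π) G ⊗[ℂ] C.V,
    ∀ ω g, T (C.sigmaMk ω) g =
      (Phi.mk (counitM π) ∘ₗ LinearMap.mulLeft ℂ g).rTensor C.V (C.rho ω) := by
  obtain ⟨T, hT⟩ := C.exists_lift_sigmaMk
    (P := G →ₗ[ℂ] Phi (counitM π) G ⊗[ℂ] C.V) (LinearMap.mk₂ ℂ
    (fun (ω : Ω) (g : G) => (Phi.mk (counitM π) ∘ₗ LinearMap.mulLeft ℂ g).rTensor C.V (C.rho ω))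
    (fun x y g => by simp) (fun c x g => by simp)
    (fun x g h => by rw [mulLeft_add, LinearMap.comp_add, LinearMap.rTensor_add]; rfl)
    (fun c x g => by rw [mulLeft_smul, LinearMap.comp_smul, LinearMap.rTensor_smul]; rfl))
    (by
    intro m ω
    ext g
    simp only [LinearMap.mk₂_apply, LinearMap.smul_apply, rho_smul]
    generalize C.rho ω = z
    induction z with
    | zero => simp
    | add x y hx hy => rw [smul_add, map_add, hx, hy, map_add, smul_add]
    | tmul h v =>
      simp only [coinv_smul_tmul, LinearMap.rTensor_tmul, LinearMap.comp_apply,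
        LinearMap.mulLeft_apply]
      have := mk_mul_eq π h ((mk_mul_coinv π g m).trans (map_smul _ _ _).symm)
      rw [← mul_assoc, this, smul_mul_assoc, map_smul, TensorProduct.smul_tmul'])
  exact ⟨T, fun ω g => LinearMap.congr_fun (hT ω) g⟩

/-- The expression `[g v₋₁] ⊗ v₀` depends only on `[g]` because `M⁺G` is a right ideal, and only on
`v` because `M` acts on `G / M⁺G` by the counit from the right. -/
theorem exists_untwist : ∃ T : Phi (counitM π) G ⊗[ℂ] C.V →ₗ[ℂ] Phi (counitM π) G ⊗[ℂ] C.V,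
    ∀ ω g, T (Phi.mk (counitM π) g ⊗ₜ C.sigmaMk ω) =
      (Phi.mk (counitM π) ∘ₗ LinearMap.mulLeft ℂ g).rTensor C.V (C.rho ω) := by
  obtain ⟨T, hT⟩ := C.exists_untwist_bilin
  obtain ⟨T', hT'⟩ := Phi.exists_lift (counitM π) (E := G)
    (P := C.V →ₗ[ℂ] Phi (counitM π) G ⊗[ℂ] C.V) T.flip (by
    intro a e ha
    refine LinearMap.ext fun v => ?_
    obtain ⟨ω, rfl⟩ := C.sigmaMk_surjective v
    rw [LinearMap.flip_apply, hT]
    have : Phi.mk (counitM π) ∘ₗ LinearMap.mulLeft ℂ (a • e) = 0 := by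
      refine LinearMap.ext fun h => ?_
      rw [LinearMap.comp_apply, LinearMap.mulLeft_apply, coinv_smul_eq, mul_assoc]
      exact (Phi.mk_smul (counitM π) a (e * h)).trans (by rw [ha, zero_smul]; rfl)
    rw [this]; simp)
  refine ⟨TensorProduct.lift T', fun ω g => ?_⟩
  rw [TensorProduct.lift.tmul, hT', LinearMap.flip_apply, hT]

/-- Untwisting is a left inverse modulo `M⁺G`: `g S(v₋₂) v₋₁ ⊗ v₀ = g ⊗ v`. -/
theorem twist_injective {x y : G ⊗[ℂ] C.V}
    (h : TensorProduct.lift C.twist.flip x = TensorProduct.lift C.twist.flip y) :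
    (Phi.mk (counitM π) : G →ₗ[ℂ] _).rTensor C.V x =
      (Phi.mk (counitM π) : G →ₗ[ℂ] _).rTensor C.V y := by
  obtain ⟨T, hT⟩ := C.exists_untwist
  have key : T ∘ₗ TensorProduct.lift C.twist.flip =
      (Phi.mk (counitM π) : G →ₗ[ℂ] _).rTensor C.V := by
    refine TensorProduct.ext' fun g v => ?_
    obtain ⟨ω, rfl⟩ := C.sigmaMk_surjective v
    rw [LinearMap.comp_apply, TensorProduct.lift.tmul, LinearMap.flip_apply, twist_sigmaMk,
      LinearMap.rTensor_tmul]
    let f : G ⊗[ℂ] (G ⊗[ℂ] Ω) →ₗ[ℂ] Phi (counitM π) G ⊗[ℂ] C.V :=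
      TensorProduct.map (Phi.mk (counitM π) ∘ₗ LinearMap.mulLeft ℂ g ∘ₗ LinearMap.mul' ℂ G ∘ₗ
        (HopfAlgebraStruct.antipode ℂ).rTensor G) C.sigmaMk ∘ₗ
      (TensorProduct.assoc ℂ G G Ω).symm.toLinearMap
    have h1 : ∀ z : G ⊗[ℂ] Ω, T ((Phi.mk (counitM π) ∘ₗ LinearMap.mulLeft ℂ g ∘ₗ
        HopfAlgebraStruct.antipode ℂ).rTensor C.V (C.sigmaMk.lTensor G z)) =
        f (C.toRelHopf.coact.lTensor G z) := by
      intro z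
      induction z with
      | zero => simp
      | add x y hx hy => simp only [map_add, hx, hy]
      | tmul a ω =>
        simp only [LinearMap.lTensor_tmul, LinearMap.rTensor_tmul, LinearMap.comp_apply]
        refine (hT _ _).trans ?_
        rw [rho_apply]
        change _ = f (a ⊗ₜ C.coact ω)
        generalize C.coact ω = z
        induction z with
        | zero => simp
        | add x y hx hy => simp only [map_add, TensorProduct.tmul_add, hx, hy]
        | tmul b ω => simp [f]
    rw [rho_apply, h1]
    refine (C.toRelHopf.coassoc_apply f ((Coalgebra.counit (R := ℂ)).smulRight
      (Phi.mk (counitM π) g) |>.rTensor C.V |>.comp (C.sigmaMk.lTensor G)) ?_ ω).trans ?_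
    · intro a x
      simp only [f, LinearMap.comp_apply, LinearEquiv.coe_coe, LinearEquiv.symm_apply_apply,
        TensorProduct.map_tmul, HopfAlgebra.mul_antipode_rTensor_comul_apply]
      simp [Algebra.algebraMap_eq_smul_one]
    · exact C.toRelHopf.counit_apply _ ((TensorProduct.mk ℂ _ _ (Phi.mk (counitM π) g)) ∘ₗ C.sigmaMk)
        (fun a x => by simp [TensorProduct.smul_tmul']) ω
  rw [← key, LinearMap.comp_apply, LinearMap.comp_apply, h]

/-- `ω₋₂ S(ω₋₁)` collapses to the counit. So the twist straightens the image of `rho` into constant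
vectors. -/
theorem twist_rho (ω : Ω) : TensorProduct.lift C.twist.flip (C.rho ω) =
    Phi.mk (counitM π) 1 ⊗ₜ C.sigmaMk ω := by
  let f : G ⊗[ℂ] (G ⊗[ℂ] Ω) →ₗ[ℂ] Phi (counitM π) G ⊗[ℂ] C.V :=
    TensorProduct.map (Phi.mk (counitM π) ∘ₗ LinearMap.mul' ℂ G ∘ₗ
      (HopfAlgebraStruct.antipode ℂ).lTensor G) C.sigmaMk ∘ₗ
    (TensorProduct.assoc ℂ G G Ω).symm.toLinearMap
  have h1 : ∀ z : G ⊗[ℂ] Ω, TensorProduct.lift C.twist.flip (C.sigmaMk.lTensor G z) =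
      f (C.toRelHopf.coact.lTensor G z) := by
    intro z
    induction z with
    | zero => simp
    | add x y hx hy => simp only [map_add, hx, hy]
    | tmul a ω =>
      simp only [LinearMap.lTensor_tmul, TensorProduct.lift.tmul, LinearMap.flip_apply]
      rw [twist_sigmaMk, rho_apply]
      change _ = f (a ⊗ₜ C.coact ω)
      generalize C.coact ω = z
      induction z with
      | zero => simp
      | add x y hx hy => simp only [map_add, TensorProduct.tmul_add, hx, hy]
      | tmul b ω => simp [f]
  rw [rho_apply, h1]
  refine (C.toRelHopf.coassoc_apply f ((Coalgebra.counit (R := ℂ)).smulRight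
    (Phi.mk (counitM π) (1 : G)) |>.rTensor C.V |>.comp (C.sigmaMk.lTensor G)) ?_ ω).trans ?_
  · intro a x
    simp only [f, LinearMap.comp_apply, LinearEquiv.coe_coe, LinearEquiv.symm_apply_apply,
      TensorProduct.map_tmul, HopfAlgebra.mul_antipode_lTensor_comul_apply]
    simp [Algebra.algebraMap_eq_smul_one]
  · exact C.toRelHopf.counit_apply _
      ((TensorProduct.mk ℂ _ _ (Phi.mk (counitM π) (1 : G))) ∘ₗ C.sigmaMk)
      (fun a x => by simp [TensorProduct.smul_tmul']) ω

end CovariantCalculus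

end Twist

/-! ### Coinvariance of twisted forms. -/

section Coinvariance

variable {G H : Type*} [Ring G] [HopfAlgebra ℂ G] [Ring H] [HopfAlgebra ℂ H] {π : G →ₐc[ℂ] H}
variable {Ω : Type*} [AddCommGroup Ω] [Module ℂ Ω]
  [Module (coinv π) Ω] [IsScalarTower ℂ (coinv π) Ω]
  [Module (coinv π)ᵐᵒᵖ Ω] [IsScalarTower ℂ (coinv π)ᵐᵒᵖ Ω]
  [SMulCommClass (coinv π) (coinv π)ᵐᵒᵖ Ω]

namespace CovariantCalculus

variable (C : CovariantCalculus π Ω)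

/-- The map `(a ⊗ b) ⊗ (v ⊗ h) ↦ [a S(v₋₁)] ⊗ π(b) h ⊗ v₀`. -/
def twistCoact : (G ⊗[ℂ] G) ⊗[ℂ] (C.V ⊗[ℂ] H) →ₗ[ℂ] (Phi (counitM π) G ⊗[ℂ] H) ⊗[ℂ] C.V :=
  (TensorProduct.rightComm ℂ (Phi (counitM π) G) C.V H).toLinearMap ∘ₗ
    TensorProduct.map (TensorProduct.lift C.twist.flip)
      (LinearMap.mul' ℂ H ∘ₗ (π : G →ₗ[ℂ] H).rTensor H) ∘ₗ
    (TensorProduct.tensorTensorTensorComm ℂ G G C.V H).toLinearMap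

theorem twistCoact_tmul (a b : G) (v : C.V) (h : H) :
    C.twistCoact ((a ⊗ₜ b) ⊗ₜ (v ⊗ₜ h)) =
      TensorProduct.rightComm ℂ (Phi (counitM π) G) C.V H (C.twist v a ⊗ₜ (π b * h)) := rfl

theorem deltaR_mul_antipode (g h : G) :
    deltaR π (Phi.mk (counitM π) (g * HopfAlgebraStruct.antipode ℂ h)) =
      (Phi.mk (counitM π) : G →ₗ[ℂ] _).rTensor H
        ((π : G →ₗ[ℂ] H).lTensor G (Coalgebra.comul (R := ℂ) g) *
          TensorProduct.comm ℂ H G (TensorProduct.map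
            (HopfAlgebraStruct.antipode ℂ ∘ₗ (π : G →ₗ[ℂ] H)) (HopfAlgebraStruct.antipode ℂ)
            (Coalgebra.comul (R := ℂ) h))) := by
  rw [deltaR_mk, map_mul, rightCoact_apply, rightCoact_apply, comul_antipode]
  congr 2
  generalize Coalgebra.comul (R := ℂ) h = s
  induction s with
  | zero => simp
  | add x y hx hy => simp only [map_add, hx, hy]
  | tmul x y => simp [map_antipode]

/-- The antipode reverses the coproduct, so the `H`-leg is `π(g₂) S(π(v₋₂))`: the product of `π(g₂)`
with the leg produced by the `H`-coaction of `v`. -/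
theorem deltaR_twist (g : G) (v : C.V) : (deltaR π).rTensor C.V (C.twist v g) =
    C.twistCoact (Coalgebra.comul (R := ℂ) g ⊗ₜ C.coactV v) := by
  obtain ⟨ω, rfl⟩ := C.sigmaMk_surjective v
  rw [twist_sigmaMk, coactV_sigmaMk, rho_apply]
  let N : G ⊗[ℂ] G → G ⊗[ℂ] G →ₗ[ℂ] Phi (counitM π) G ⊗[ℂ] H := fun s =>
    (Phi.mk (counitM π) : G →ₗ[ℂ] _).rTensor H ∘ₗ
      LinearMap.mulLeft ℂ ((π : G →ₗ[ℂ] H).lTensor G s) ∘ₗ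
      (TensorProduct.comm ℂ H G).toLinearMap ∘ₗ TensorProduct.map
        (HopfAlgebraStruct.antipode ℂ ∘ₗ (π : G →ₗ[ℂ] H)) (HopfAlgebraStruct.antipode ℂ)
  have hN : ∀ s t, N (s + t) = N s + N t := by
    intro s t
    simp only [N, map_add]
    rw [show LinearMap.mulLeft ℂ ((π : G →ₗ[ℂ] H).lTensor G s + (π : G →ₗ[ℂ] H).lTensor G t) =
      LinearMap.mulLeft ℂ ((π : G →ₗ[ℂ] H).lTensor G s) +
      LinearMap.mulLeft ℂ ((π : G →ₗ[ℂ] H).lTensor G t) by ext; simp [add_mul]]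
    rw [LinearMap.add_comp, LinearMap.comp_add]
  have hN0 : N 0 = 0 := by simp [N]
  let f : G ⊗[ℂ] G → G ⊗[ℂ] (G ⊗[ℂ] Ω) →ₗ[ℂ] (Phi (counitM π) G ⊗[ℂ] H) ⊗[ℂ] C.V := fun s =>
    TensorProduct.map (N s) C.sigmaMk ∘ₗ (TensorProduct.assoc ℂ G G Ω).symm.toLinearMap
  have h1 : ∀ (s : G ⊗[ℂ] G) (z : G ⊗[ℂ] Ω), C.twistCoact (s ⊗ₜ (TensorProduct.comm ℂ H C.V
      (TensorProduct.map (HopfAlgebraStruct.antipode ℂ ∘ₗ (π : G →ₗ[ℂ] H)) C.sigmaMk z))) =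
      f s (C.toRelHopf.coact.lTensor G z) := by
    intro s z
    induction z with
    | zero => simp
    | add x y hx hy => simp only [map_add, TensorProduct.tmul_add, hx, hy]
    | tmul h ω =>
      induction s with
      | zero => simp [f, hN0]
      | add s t hs ht =>
        rw [TensorProduct.add_tmul, map_add, hs, ht]
        simp only [f, hN, TensorProduct.map_add_left, LinearMap.add_comp, LinearMap.add_apply]
      | tmul a b =>
        simp only [TensorProduct.map_tmul, TensorProduct.comm_tmul, twistCoact_tmul,
          LinearMap.lTensor_tmul]
        rw [twist_sigmaMk, rho_apply]
        change _ = f _ (h ⊗ₜ C.coact ω)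
        generalize C.coact ω = z
        induction z with
        | zero => simp
        | add x y hx hy => simp only [map_add, TensorProduct.tmul_add, TensorProduct.add_tmul, hx, hy]
        | tmul k ω => simp [f, N]
  rw [h1]
  exact (C.toRelHopf.coassoc_apply (P := (Phi (counitM π) G ⊗[ℂ] H) ⊗[ℂ] C.V)
    (f (Coalgebra.comul (R := ℂ) g))
    ((deltaR π).rTensor C.V ∘ₗ (Phi.mk (counitM π) ∘ₗ LinearMap.mulLeft ℂ g ∘ₗ
      HopfAlgebraStruct.antipode ℂ).rTensor C.V ∘ₗ C.sigmaMk.lTensor G) (by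
    intro a x
    simp only [f, N, LinearMap.comp_apply, LinearEquiv.coe_coe, LinearEquiv.symm_apply_apply,
      TensorProduct.map_tmul, LinearMap.lTensor_tmul, LinearMap.rTensor_tmul,
      LinearMap.mulLeft_apply, deltaR_mul_antipode]) ω).symm

/-- In the `H`-leg the factors `π(a₂) S(π(a₃))` stand next to each other and cancel. -/
theorem twistCoact_tmul_antipode (a : G) (v : C.V) (F : G ⊗[ℂ] G →ₗ[ℂ] _)
    (hF : ∀ x y, F (x ⊗ₜ y) = C.twistCoact (Coalgebra.comul (R := ℂ) x ⊗ₜ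
      (v ⊗ₜ HopfAlgebraStruct.antipode ℂ (π y)))) : F (Coalgebra.comul (R := ℂ) a) =
    TensorProduct.rightComm ℂ (Phi (counitM π) G) C.V H (C.twist v a ⊗ₜ 1) := by
  let f : G ⊗[ℂ] (G ⊗[ℂ] G) →ₗ[ℂ] (Phi (counitM π) G ⊗[ℂ] H) ⊗[ℂ] C.V :=
    (TensorProduct.rightComm ℂ (Phi (counitM π) G) C.V H).toLinearMap ∘ₗ
    TensorProduct.map (C.twist v) ((π : G →ₗ[ℂ] H) ∘ₗ LinearMap.mul' ℂ G ∘ₗ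
      (HopfAlgebraStruct.antipode ℂ).lTensor G)
  have h1 : ∀ s : G ⊗[ℂ] G, F s =
      f (TensorProduct.assoc ℂ G G G ((Coalgebra.comul (R := ℂ)).rTensor G s)) := by
    intro s
    induction s with
    | zero => simp
    | add x y hx hy => simp only [map_add, hx, hy]
    | tmul x y =>
      rw [hF, LinearMap.rTensor_tmul]
      generalize Coalgebra.comul (R := ℂ) x = s
      induction s with
      | zero => simp
      | add x y hx hy => simp only [map_add, TensorProduct.add_tmul, hx, hy]
      | tmul b c => simp [twistCoact_tmul, f, map_antipode]
  have h2 : ∀ s : G ⊗[ℂ] G, f ((Coalgebra.comul (R := ℂ)).lTensor G s) =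
      TensorProduct.rightComm ℂ (Phi (counitM π) G) C.V H
        (C.twist v (TensorProduct.rid ℂ G ((Coalgebra.counit (R := ℂ)).lTensor G s)) ⊗ₜ 1) := by
    intro s
    induction s with
    | zero => simp
    | add x y hx hy => simp only [map_add, TensorProduct.add_tmul, hx, hy]
    | tmul x y =>
      simp only [LinearMap.lTensor_tmul, f, LinearMap.comp_apply, TensorProduct.map_tmul,
        HopfAlgebra.mul_antipode_lTensor_comul_apply]
      simp [Algebra.algebraMap_eq_smul_one, TensorProduct.smul_tmul']
  rw [h1, Coalgebra.coassoc_apply, h2, Coalgebra.lTensor_counit_comul]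
  simp

/-- As `P` commutes with the `H`-coaction, the `H`-leg is formed from `ω` as if `P` were absent; it
is `π(ω₋₂) S(π(ω₋₁))`, which collapses. -/
theorem deltaR_twist_rho (P : C.V →ₗ[ℂ] C.V) (hP : C.coactV ∘ₗ P = P.rTensor H ∘ₗ C.coactV)
    (ω : Ω) : (deltaR π).rTensor C.V (TensorProduct.lift C.twist.flip (P.lTensor G (C.rho ω))) =
      TensorProduct.rightComm ℂ (Phi (counitM π) G) C.V H
        (TensorProduct.lift C.twist.flip (P.lTensor G (C.rho ω)) ⊗ₜ 1) := by
  have h0 : ∀ v, C.coactV (P v) = P.rTensor H (C.coactV v) := LinearMap.congr_fun hP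
  let F : G ⊗[ℂ] (G ⊗[ℂ] Ω) →ₗ[ℂ] (Phi (counitM π) G ⊗[ℂ] H) ⊗[ℂ] C.V :=
    C.twistCoact ∘ₗ TensorProduct.map Coalgebra.comul (P.rTensor H ∘ₗ
      (TensorProduct.comm ℂ H C.V).toLinearMap ∘ₗ TensorProduct.map
        (HopfAlgebraStruct.antipode ℂ ∘ₗ (π : G →ₗ[ℂ] H)) C.sigmaMk)
  have h1 : ∀ z : G ⊗[ℂ] Ω, (deltaR π).rTensor C.V (TensorProduct.lift C.twist.flip
      (P.lTensor G (C.sigmaMk.lTensor G z))) = F (C.toRelHopf.coact.lTensor G z) := by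
    intro z
    induction z with
    | zero => simp
    | add x y hx hy => simp only [map_add, hx, hy]
    | tmul g ω =>
      simp only [LinearMap.lTensor_tmul, TensorProduct.lift.tmul, LinearMap.flip_apply,
        deltaR_twist, h0, coactV_sigmaMk]
      rfl
  rw [rho_apply, h1]
  refine C.toRelHopf.coassoc_apply (P := (Phi (counitM π) G ⊗[ℂ] H) ⊗[ℂ] C.V) F
    ((TensorProduct.rightComm ℂ (Phi (counitM π) G) C.V H).toLinearMap ∘ₗ
      (TensorProduct.mk ℂ _ H).flip 1 ∘ₗ TensorProduct.lift C.twist.flip ∘ₗ P.lTensor G ∘ₗ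
      C.sigmaMk.lTensor G) ?_ ω
  intro a x
  exact C.twistCoact_tmul_antipode a (P (C.sigmaMk x))
    (F ∘ₗ (TensorProduct.assoc ℂ G G Ω).toLinearMap ∘ₗ (TensorProduct.mk ℂ _ Ω).flip x)
    (fun x y => by simp [F])

end CovariantCalculus

end Coinvariance

/-! ### `G` as a relative Hopf module. -/

section Naturality

variable {G H : Type*} [Ring G] [HopfAlgebra ℂ G] [Ring H] [HopfAlgebra ℂ H] {π : G →ₐc[ℂ] H}

variable (π) in
/-- The algebra `G` as a relative Hopf module. -/
def selfRelHopf : RelHopf π G where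
  coact := Coalgebra.comul
  counit_coact x := by simp
  coassoc x := Coalgebra.coassoc_apply x
  coact_smul m x := by
    rw [coinv_smul_eq, Bialgebra.comul_mul, ← lTensor_val_coactM]
    generalize coactM π m = s
    generalize Coalgebra.comul (R := ℂ) x = t
    induction s with
    | zero => simp
    | add a b ha hb => simp only [map_add, add_mul, LinearMap.add_apply, ha, hb]
    | tmul a b =>
      induction t with
      | zero => simp
      | add c d hc hd => simp only [map_add, mul_add, hc, hd]
      | tmul c d => simp [tensorAct_tmul, coinv_smul_eq]

theorem rightCoact_smul (m : coinv π) (g : G) : rightCoact π (m • g) = m • rightCoact π g := by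
  have h : rightCoact π (m : G) = (m : G) ⊗ₜ 1 := m.2
  rw [coinv_smul_eq, map_mul, h]
  generalize rightCoact π g = z
  induction z with
  | zero => simp
  | add x y hx hy => rw [mul_add, smul_add, hx, hy]
  | tmul x y => simp [coinv_smul_tmul]

end Naturality

/-! ### The coaction and the right action of `M` on forms. -/

section RightAction

variable {G H : Type*} [Ring G] [HopfAlgebra ℂ G] [Ring H] [HopfAlgebra ℂ H] {π : G →ₐc[ℂ] H}
variable {Ω : Type*} [AddCommGroup Ω] [Module ℂ Ω]
  [Module (coinv π) Ω] [IsScalarTower ℂ (coinv π) Ω]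
  [Module (coinv π)ᵐᵒᵖ Ω] [IsScalarTower ℂ (coinv π)ᵐᵒᵖ Ω]
  [SMulCommClass (coinv π) (coinv π)ᵐᵒᵖ Ω]

variable (π Ω) in
/-- The right action of `G ⊗ M` on `G ⊗ Ω`, `(g ⊗ ω)(g' ⊗ m) = g g' ⊗ ω m`. -/
def tensorActR : G ⊗[ℂ] coinv π →ₗ[ℂ] G ⊗[ℂ] Ω →ₗ[ℂ] G ⊗[ℂ] Ω :=
  TensorProduct.map₂ (LinearMap.mul ℂ G).flip
    ((Algebra.lsmul ℂ ℂ Ω : (coinv π)ᵐᵒᵖ →ₐ[ℂ] _).toLinearMap ∘ₗ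
      (MulOpposite.opLinearEquiv ℂ).toLinearMap)

theorem tensorActR_tmul (g h : G) (m : coinv π) (x : Ω) :
    tensorActR π Ω (g ⊗ₜ m) (h ⊗ₜ x) = (h * g) ⊗ₜ (MulOpposite.op m • x) := rfl

namespace CovariantCalculus

variable (C : CovariantCalculus π Ω)

theorem op_smul_smul_d (a b m : coinv π) :
    MulOpposite.op m • a • C.d b = a • C.d (b * m) - (a * b) • C.d m := by
  rw [← smul_comm, C.leibniz, smul_add, mul_smul, add_sub_cancel_left]

/-- Not an axiom of the calculus: it follows from `(a db) m = a d(b m) - a b dm` and the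
multiplicativity of the coaction of `M`. -/
theorem coact_op_smul (m : coinv π) (ω : Ω) :
    C.coact (MulOpposite.op m • ω) = tensorActR π Ω (coactM π m) (C.coact ω) := by
  have key : ∀ s t r : G ⊗[ℂ] coinv π,
      tensorAct π Ω s (C.d.lTensor G (t * r)) - tensorAct π Ω (s * t) (C.d.lTensor G r) =
        tensorActR π Ω r (tensorAct π Ω s (C.d.lTensor G t)) := by
    intro s t r
    induction s with
    | zero => simp
    | add x y hx hy =>
      simp only [map_add, add_mul, LinearMap.add_apply, ← hx, ← hy]
      abel
    | tmul a a' =>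
      induction t with
      | zero => simp
      | add x y hx hy =>
        simp only [map_add, add_mul, mul_add, LinearMap.add_apply, ← hx, ← hy]
        abel
      | tmul b b' =>
        induction r with
        | zero => simp
        | add x y hx hy =>
          simp only [map_add, mul_add, LinearMap.add_apply, ← hx, ← hy]
          abel
        | tmul c c' =>
          simp only [Algebra.TensorProduct.tmul_mul_tmul, LinearMap.lTensor_tmul, tensorAct_tmul,
            tensorActR_tmul, op_smul_smul_d, TensorProduct.tmul_sub, mul_assoc]
  have h : ω ∈ Submodule.span ℂ {ω : Ω | ∃ a b : coinv π, ω = a • C.d b} := by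
    rw [C.span_d]; trivial
  induction h using Submodule.span_induction with
  | mem x hx =>
    obtain ⟨a, b, rfl⟩ := hx
    rw [op_smul_smul_d, map_sub, C.coact_smul_d, C.coact_smul_d, C.coact_smul_d, coactM_mul,
      coactM_mul, key]
  | zero => simp
  | add x y _ _ hx hy => rw [smul_add, map_add, map_add, map_add, hx, hy]
  | smul c x _ hx => rw [smul_comm _ c x, map_smul, hx, map_smul, map_smul]

end CovariantCalculus

end RightAction

/-! ### The coinvariants of `G / M⁺G`. -/

section Coinvariants

variable {G H : Type u} [Ring G] [HopfAlgebra ℂ G] [Ring H] [HopfAlgebra ℂ H] {π : G →ₐc[ℂ] H}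

theorem RelHopf.map_untwist {F F' : Type*} [AddCommGroup F] [Module ℂ F] [Module (coinv π) F]
    [IsScalarTower ℂ (coinv π) F] [AddCommGroup F'] [Module ℂ F'] [Module (coinv π) F']
    [IsScalarTower ℂ (coinv π) F'] (R : RelHopf π F) (R' : RelHopf π F') (k : F →ₗ[coinv π] F')
    (hk : ∀ x, R'.coact (k x) = (k.restrictScalars ℂ).lTensor G (R.coact x)) (g : G) (x : F) :
    BTensor.map (coinv π) G k (R.untwist LinearMap.id (g ⊗ₜ x)) =
      R'.untwist LinearMap.id (g ⊗ₜ k x) := by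
  rw [untwist_tmul, untwist_tmul, hk]
  generalize R.coact x = z
  induction z with
  | zero => simp
  | add a b ha hb => simp only [map_add, ha, hb]
  | tmul a b => rfl

/-- The right `H`-coinvariants of `G / M⁺G` are the multiples of the class of `1`. -/
theorem eq_smul_mk_one_of_deltaR (hff : IsFaithfullyFlatRight π) (x : Phi (counitM π) G)
    (hx : deltaR π x = x ⊗ₜ 1) : ∃ c : ℂ, x = c • Phi.mk (counitM π) (1 : G) := by
  obtain ⟨g, rfl⟩ := Phi.mk_surjective _ x
  let f : coinv π →ₗ[coinv π] G :=
    { toFun := fun m => (m : G), map_add' := fun _ _ => rfl, map_smul' := fun _ _ => rfl }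
  let k : G →ₗ[coinv π] G ⊗[ℂ] H :=
    { toFun := fun g => rightCoact π g - g ⊗ₜ 1
      map_add' := fun a b => by rw [map_add, TensorProduct.add_tmul]; abel
      map_smul' := fun m a => by
        rw [rightCoact_smul, RingHom.id_apply, smul_sub, coinv_smul_tmul, coinv_smul_eq] }
  -- `M → G → G ⊗ H` is exact by the definition of `M`, and faithful flatness keeps it exact after
  -- `G ⊗_M -`.
  have hex : Function.Exact f k := by
    intro a
    constructor
    · intro ha
      exact ⟨⟨a, sub_eq_zero.1 ha⟩, rfl⟩
    · rintro ⟨m, rfl⟩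
      exact sub_eq_zero.2 m.2
  have hk : ∀ a, (freeRelHopf π H).coact (k a) =
      (k.restrictScalars ℂ).lTensor G ((selfRelHopf π).coact a) := by
    intro a
    have h1 : ∀ s : G ⊗[ℂ] G, (k.restrictScalars ℂ).lTensor G s =
        (((π : G →ₗ[ℂ] H).lTensor G).lTensor G ((Coalgebra.comul (R := ℂ)).lTensor G s)) -
          TensorProduct.assoc ℂ G G H (s ⊗ₜ 1) := by
      intro s
      induction s with
      | zero => simp
      | add x y hx hy =>
        simp only [map_add, TensorProduct.add_tmul, hx, hy]
        abel
      | tmul b c =>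
        change b ⊗ₜ (rightCoact π c - c ⊗ₜ 1) = _
        rw [rightCoact_apply, TensorProduct.tmul_sub]
        rfl
    change (freeRelHopf π H).coact (rightCoact π a - a ⊗ₜ 1) = _
    rw [h1, map_sub, freeRelHopf_coact_tmul, rightCoact_apply, freeRelHopf_coact_lTensor]
    congr 2
    exact Coalgebra.coassoc_apply a
  -- Coinvariance of `[g]` puts `k g` in `M⁺(G ⊗ H)`, where untwisting vanishes. By naturality
  -- `S(g₁) ⊗ g₂` is killed by `G ⊗_M k`, hence comes from `G ⊗_M M`.
  have h0 : k g ∈ augSub (counitM π) (G ⊗[ℂ] H) := by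
    apply mem_augSub_tensor
    change (Phi.mk (counitM π) : G →ₗ[ℂ] _).rTensor H (rightCoact π g - g ⊗ₜ 1) = 0
    rw [map_sub, sub_eq_zero]
    exact hx
  have h1 := (selfRelHopf π).map_untwist (freeRelHopf π H) k hk 1 g
  rw [RelHopf.untwist_augSub _ _ _ h0] at h1
  obtain ⟨y, hy⟩ := ((hff _ _ _ f k).1 hex _).1 h1
  obtain ⟨t, rfl⟩ := Submodule.mkQ_surjective _ y
  -- `q(a ⊗ b) = ε(a)[b]` recovers `[g]` from `S(g₁) ⊗ g₂`, whereas on the image of `G ⊗_M M` it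
  -- takes only multiples of `[1]` as values.
  let q : BTensor (coinv π) G G →ₗ[ℂ] Phi (counitM π) G := BTensor.lift
    ((TensorProduct.lid ℂ _).toLinearMap ∘ₗ TensorProduct.map Coalgebra.counit (Phi.mk (counitM π)))
    (fun a m b => by
      have : Coalgebra.counit (R := ℂ) (m : G) = counitM π m := rfl
      simp [Phi.mk_smul, this, smul_smul, mul_comm])
  have h2 : ∀ s : G ⊗[ℂ] G, q (BTensor.mk (TensorProduct.map (LinearMap.mulLeft ℂ (1 : G) ∘ₗ
      HopfAlgebraStruct.antipode ℂ) LinearMap.id s)) = Phi.mk (counitM π)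
        (TensorProduct.lid ℂ G ((Coalgebra.counit (R := ℂ)).rTensor G s)) := by
    intro s
    rw [BTensor.lift_mk]
    induction s with
    | zero => simp
    | add x y hx hy => simp only [map_add, hx, hy]
    | tmul a b => simp [HopfAlgebra.counit_antipode]
  have h3 : q ((selfRelHopf π).untwist LinearMap.id (1 ⊗ₜ g)) = Phi.mk (counitM π) g := by
    refine (h2 (Coalgebra.comul g)).trans ?_
    rw [Coalgebra.rTensor_counit_comul]
    simp
  rw [← h3, ← hy]
  clear hy
  induction t with
  | zero => exact ⟨0, by simp⟩
  | add a b ha hb =>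
    obtain ⟨c, hc⟩ := ha
    obtain ⟨c', hc'⟩ := hb
    exact ⟨c + c', by rw [map_add, map_add, map_add, hc, hc', add_smul]⟩
  | tmul a m =>
    refine ⟨Coalgebra.counit (R := ℂ) a * counitM π m, ?_⟩
    change q (BTensor.mk (A := coinv π) (a ⊗ₜ[ℂ] (m : G))) = _
    rw [BTensor.lift_mk]
    have : (m : G) = m • (1 : G) := by rw [coinv_smul_eq, mul_one]
    rw [this, mul_comm]
    simp [Phi.mk_smul, smul_smul]

/-- The sequence `ℂ → Φ(G) → Φ(G) ⊗ H` which describes the coinvariants of `Φ(G)` stays exact after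
tensoring with a vector space. -/
theorem eq_mk_one_tmul_of_deltaR (hff : IsFaithfullyFlatRight π) {X : Type*} [AddCommGroup X]
    [Module ℂ X] (x : Phi (counitM π) G ⊗[ℂ] X) (hx : (deltaR π).rTensor X x =
      TensorProduct.rightComm ℂ (Phi (counitM π) G) X H (x ⊗ₜ 1)) :
    ∃ v, x = Phi.mk (counitM π) (1 : G) ⊗ₜ v := by
  let f : ℂ →ₗ[ℂ] Phi (counitM π) G := LinearMap.toSpanSingleton ℂ _ (Phi.mk (counitM π) 1)
  let k : Phi (counitM π) G →ₗ[ℂ] Phi (counitM π) G ⊗[ℂ] H :=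
    deltaR π - (TensorProduct.mk ℂ _ H).flip 1
  have hex : Function.Exact f k := by
    intro a
    constructor
    · intro ha
      obtain ⟨c, hc⟩ := eq_smul_mk_one_of_deltaR hff a (sub_eq_zero.1 ha)
      exact ⟨c, hc.symm⟩
    · rintro ⟨c, rfl⟩
      have : deltaR π (Phi.mk (counitM π) (1 : G)) = Phi.mk (counitM π) (1 : G) ⊗ₜ 1 := by
        rw [deltaR_mk, map_one, Algebra.TensorProduct.one_def, LinearMap.rTensor_tmul]
      change deltaR π (c • Phi.mk (counitM π) (1 : G)) -
        (c • Phi.mk (counitM π) (1 : G)) ⊗ₜ 1 = 0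
      rw [map_smul, this, TensorProduct.smul_tmul', sub_self]
  have h1 : k.rTensor X x = 0 := by
    have h2 : ∀ z : Phi (counitM π) G ⊗[ℂ] X, ((TensorProduct.mk ℂ _ H).flip 1).rTensor X z =
        TensorProduct.rightComm ℂ (Phi (counitM π) G) X H (z ⊗ₜ 1) := by
      intro z
      induction z with
      | zero => simp
      | add a b ha hb => simp only [map_add, TensorProduct.add_tmul, ha, hb]
      | tmul a b => rfl
    rw [LinearMap.rTensor_sub]
    change (deltaR π).rTensor X x - ((TensorProduct.mk ℂ _ H).flip 1).rTensor X x = 0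
    rw [hx, h2, sub_self]
  obtain ⟨t, rfl⟩ := ((Module.Flat.rTensor_exact X hex) x).1 h1
  refine ⟨TensorProduct.lid ℂ X t, ?_⟩
  clear hx h1
  induction t with
  | zero => simp
  | add a b ha hb => rw [map_add, map_add, ha, hb, TensorProduct.tmul_add]
  | tmul c v => simp [f, TensorProduct.smul_tmul]

end Coinvariants

/-! ### From subspaces of `V` back to one-forms. -/

section Decompositions

variable {G H : Type u} [Ring G] [HopfAlgebra ℂ G] [Ring H] [HopfAlgebra ℂ H] {π : G →ₐc[ℂ] H}
variable {Ω : Type u} [AddCommGroup Ω] [Module ℂ Ω]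
  [Module (coinv π) Ω] [IsScalarTower ℂ (coinv π) Ω]
  [Module (coinv π)ᵐᵒᵖ Ω] [IsScalarTower ℂ (coinv π)ᵐᵒᵖ Ω]
  [SMulCommClass (coinv π) (coinv π)ᵐᵒᵖ Ω]

namespace CovariantCalculus

variable (C : CovariantCalculus π Ω)

/-- The image of `rho` is stable under the `H`-colinear maps of `V`. -/
theorem exists_rho_eq (hff : IsFaithfullyFlatRight π) (P : C.V →ₗ[ℂ] C.V)
    (hP : C.coactV ∘ₗ P = P.rTensor H ∘ₗ C.coactV) (ω : Ω) :
    ∃ ω', C.rho ω' = P.lTensor G (C.rho ω) := by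
  let W : Submodule (coinv π) (G ⊗[ℂ] C.V) :=
    { LinearMap.range C.rho with
      smul_mem' := by
        rintro m _ ⟨ω, rfl⟩
        exact ⟨m • ω, C.rho_smul m ω⟩ }
  have hW : W.restrictScalars ℂ = (⊤ : Submodule ℂ Ω).map C.rho := by
    rw [Submodule.map_top]; rfl
  have hT : gTensor G (⊤ : Submodule ℂ Ω) = ⊤ := by
    rw [gTensor_eq_ker, eq_top_iff]
    intro z _
    rw [LinearMap.mem_ker]
    have : (⊤ : Submodule ℂ Ω).mkQ = 0 := by ext; simp
    rw [this]; simp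
  have hcoact : ∀ ω, (freeRelHopf π C.V).coact (P.lTensor G (C.rho ω)) =
      (P.lTensor G ∘ₗ C.rho).lTensor G (C.coact ω) := by
    intro ω
    rw [freeRelHopf_coact_lTensor, coact_rho, LinearMap.lTensor_comp, LinearMap.comp_apply]
  -- Descent inside `G ⊗ V`, from the image of `(id ⊗ P) ρ` to the image of `ρ`.
  refine RelHopf.le_of_le_sup_augSub hff (freeRelHopf π C.V) W ?_
    (LinearMap.range (P.lTensor G ∘ₗ C.rho)) ?_ ?_ ⟨ω, rfl⟩
  · rintro _ ⟨ω, rfl⟩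
    rw [coact_rho, hW, gTensor_map, hT]
    exact ⟨_, trivial, rfl⟩
  · rintro _ ⟨ω, rfl⟩
    rw [← Submodule.map_top, gTensor_map, hT]
    exact ⟨_, trivial, (hcoact ω).symm⟩
  · rintro _ ⟨ω, rfl⟩
    -- The twisted vector is coinvariant, hence of the form `[1] ⊗ v`, and this is the twist of some
    -- `rho ω'`; injectivity of the twist compares the two in the fibre.
    obtain ⟨v, hv⟩ := eq_mk_one_tmul_of_deltaR hff _ (C.deltaR_twist_rho P hP ω)
    obtain ⟨ω', rfl⟩ := C.sigmaMk_surjective v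
    rw [← C.twist_rho] at hv
    have h1 := C.twist_injective hv
    rw [← sub_eq_zero, ← map_sub] at h1
    refine Submodule.mem_sup.2 ⟨C.rho ω', ⟨ω', rfl⟩, _, mem_augSub_tensor _ _ h1, ?_⟩
    simp

/-- The forms `ω` with `ω₋₁ ⊗ σ[ω₀] ∈ G ⊗ U`. -/
def formsOf (U : Submodule ℂ C.V) : Submodule ℂ Ω := (gTensor G U).comap C.rho

theorem toV_formsOf_le (U : Submodule ℂ C.V) : C.toV (C.formsOf U) ≤ U := by
  rw [toV_eq_map]
  rintro _ ⟨ω, hω, rfl⟩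
  rw [← C.counit_rho]
  have h : gTensor G U ≤ U.comap ((TensorProduct.lid ℂ C.V).toLinearMap ∘ₗ
      (Coalgebra.counit (R := ℂ)).rTensor C.V) :=
    gTensor_le fun g w hw => by simpa using U.smul_mem _ hw
  exact h hω

/-- Left multiplication touches only the `G`-leg, and stability under the coaction holds because
these forms are the kernel of the colinear map `Ω → G ⊗ (V/U)`. Only the right action, which also
acts on the `V`-leg, needs a condition on `U`. -/
theorem isCovariantSubbimodule_formsOf (U : Submodule ℂ C.V) (hU : C.IsRightSubmodule U) :
    C.IsCovariantSubbimodule (C.formsOf U) where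
  smul_mem m ω hω := by
    rw [formsOf, Submodule.mem_comap, rho_smul]
    have h : gTensor G U ≤ (gTensor G U).comap
        ((LinearMap.mulLeft ℂ (m : G)).rTensor C.V) :=
      gTensor_le fun g w hw => tmul_mem_gTensor _ hw
    have h2 := h hω
    have h3 : ∀ z : G ⊗[ℂ] C.V, m • z = (LinearMap.mulLeft ℂ (m : G)).rTensor C.V z := by
      intro z
      induction z with
      | zero => simp
      | add a b ha hb => simp only [smul_add, map_add, ha, hb]
      | tmul a b => rw [coinv_smul_tmul]; rfl
    rw [h3]
    exact h2
  op_smul_mem m ω hω := by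
    have h1 : ∀ (s : G ⊗[ℂ] coinv π) (z : G ⊗[ℂ] Ω), C.sigmaMk.lTensor G z ∈ gTensor G U →
        C.sigmaMk.lTensor G (tensorActR π Ω s z) ∈ gTensor G U := by
      intro s z hz
      induction s with
      | zero => simp
      | add x y hx hy => rw [map_add, LinearMap.add_apply, map_add]; exact add_mem hx hy
      | tmul g m =>
        have h2 : C.sigmaMk.lTensor G (tensorActR π Ω (g ⊗ₜ m) z) = TensorProduct.map
            (LinearMap.mulRight ℂ g) (C.actV m) (C.sigmaMk.lTensor G z) := by
          clear hz
          induction z with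
          | zero => simp
          | add x y hx hy => simp only [map_add, hx, hy]
          | tmul h ω => simp [tensorActR_tmul, actV_sigmaMk]
        rw [h2]
        have h3 : gTensor G U ≤ (gTensor G U).comap
            (TensorProduct.map (LinearMap.mulRight ℂ g) (C.actV m)) :=
          gTensor_le fun g w hw => tmul_mem_gTensor _ (hU m w hw)
        exact h3 hz
    rw [formsOf, Submodule.mem_comap, rho_apply, coact_op_smul]
    exact h1 _ _ hω
  coact_mem ω hω := by
    change C.coact ω ∈ gTensor G _
    have h : C.formsOf U = LinearMap.ker (U.mkQ.lTensor G ∘ₗ C.rho) := by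
      rw [formsOf, gTensor_eq_ker, LinearMap.ker_comp]
    rw [h, gTensor_ker, LinearMap.mem_ker]
    rw [h, LinearMap.mem_ker] at hω
    rw [LinearMap.lTensor_comp, LinearMap.comp_apply, ← coact_rho, ← freeRelHopf_coact_lTensor]
    rw [LinearMap.comp_apply] at hω
    rw [hω, map_zero]

theorem isSubcomodule_toV (W : Submodule ℂ Ω) (hW : C.IsCovariantSubbimodule W) :
    C.IsSubcomodule (C.toV W) := by
  rw [toV_eq_map]
  rintro _ ⟨ω, hω, rfl⟩
  rw [coactV_sigmaMk]
  have h : gTensor G W ≤ (LinearMap.range ((W.map C.sigmaMk).subtype.rTensor H)).comap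
      ((TensorProduct.comm ℂ H C.V).toLinearMap ∘ₗ TensorProduct.map
        (HopfAlgebraStruct.antipode ℂ ∘ₗ (π : G →ₗ[ℂ] H)) C.sigmaMk) :=
    gTensor_le fun g w hw => ⟨⟨C.sigmaMk w, w, hw, rfl⟩ ⊗ₜ _, rfl⟩
  exact h (hW.coact_mem ω hω)

theorem isRightSubmodule_toV (W : Submodule ℂ Ω) (hW : C.IsCovariantSubbimodule W) :
    C.IsRightSubmodule (C.toV W) := by
  rw [toV_eq_map]
  rintro m _ ⟨ω, hω, rfl⟩
  exact ⟨_, hW.op_smul_mem m ω hω, (C.actV_sigmaMk m ω).symm⟩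

theorem toV_sup (X Y : Submodule ℂ Ω) : C.toV (X ⊔ Y) = C.toV X ⊔ C.toV Y := by
  rw [toV_eq_map, toV_eq_map, toV_eq_map, Submodule.map_sup]

theorem toV_top : C.toV ⊤ = ⊤ := by
  rw [toV_eq_map, Submodule.map_top, LinearMap.range_eq_top.2 C.sigmaMk_surjective]

/-- A subobject of `Ω` which vanishes in `Φ(Ω)` up to another one is contained in it. -/
theorem IsCovariantSubbimodule.le_of_toV_le (hff : IsFaithfullyFlatRight π) {C : CovariantCalculus π Ω}
    {X Y : Submodule ℂ Ω} (hX : C.IsCovariantSubbimodule X) (hY : C.IsCovariantSubbimodule Y)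
    (h : C.toV X ≤ C.toV Y) : X ≤ Y := by
  let Y' : Submodule (coinv π) Ω := { Y with smul_mem' := fun m y hy => hY.smul_mem m y hy }
  refine C.toRelHopf.le_of_le_sup_augSub hff Y' hY.coact_mem X hX.coact_mem ?_
  intro x hx
  have h1 : C.sigmaMk x ∈ C.toV Y := h (by rw [toV_eq_map]; exact ⟨x, hx, rfl⟩)
  rw [toV_eq_map] at h1
  obtain ⟨y, hy, hxy⟩ := h1
  refine Submodule.mem_sup.2 ⟨y, hy, x - y, ?_, by abel⟩
  rw [← C.sigmaMk_eq_zero, map_sub, hxy, sub_self]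

end CovariantCalculus

end Decompositions

/-! ### Projections for a direct sum decomposition. -/

section Projections

theorem map_projection {E E' : Type*} [AddCommGroup E] [Module ℂ E] [AddCommGroup E'] [Module ℂ E']
    {p q : Submodule ℂ E} {p' q' : Submodule ℂ E'} (h : IsCompl p q) (h' : IsCompl p' q')
    (f : E →ₗ[ℂ] E') (hp : p ≤ p'.comap f) (hq : q ≤ q'.comap f) (x : E) :
    f (p.projection q h x) = p'.projection q' h' (f x) := by
  conv_rhs => rw [← Submodule.projection_add_projection_eq_self h x, map_add, map_add]
  rw [Submodule.projection_apply_left h' ⟨_, hp (Submodule.projection_apply_mem h x)⟩,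
    Submodule.projection_apply_right h' ⟨_, hq (Submodule.projection_apply_mem h.symm x)⟩,
    add_zero]

variable {G : Type*} [Ring G] [HopfAlgebra ℂ G] {E : Type*} [AddCommGroup E] [Module ℂ E]
  {p q : Submodule ℂ E} (h : IsCompl p q)

theorem lTensor_projection_of_mem {z : G ⊗[ℂ] E} (hz : z ∈ gTensor G p) :
    (p.projection q h).lTensor G z = z := by
  obtain ⟨t, rfl⟩ := hz
  induction t with
  | zero => simp
  | add x y hx hy => simp only [map_add, hx, hy]
  | tmul g w => simp [Submodule.projection_apply_left h w]

theorem lTensor_projection_of_mem_right {z : G ⊗[ℂ] E} (hz : z ∈ gTensor G q) :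
    (p.projection q h).lTensor G z = 0 := by
  obtain ⟨t, rfl⟩ := hz
  induction t with
  | zero => simp
  | add x y hx hy => simp only [map_add, hx, hy, add_zero]
  | tmul g w => simp [Submodule.projection_apply_right h w]

theorem lTensor_projection_mem (z : G ⊗[ℂ] E) : (p.projection q h).lTensor G z ∈ gTensor G p := by
  induction z with
  | zero => simp
  | add x y hx hy => rw [map_add]; exact add_mem hx hy
  | tmul g e => exact tmul_mem_gTensor g (Submodule.projection_apply_mem h e)

include h in
theorem gTensor_inf_eq_bot {z : G ⊗[ℂ] E} (hp : z ∈ gTensor G p) (hq : z ∈ gTensor G q) : z = 0 := by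
  rw [← lTensor_projection_of_mem h hp, lTensor_projection_of_mem_right h hq]

end Projections

/-! ### The bijections between decompositions of `Ω` and of `V`. -/

section Decompositions

variable {G H : Type u} [Ring G] [HopfAlgebra ℂ G] [Ring H] [HopfAlgebra ℂ H] {π : G →ₐc[ℂ] H}
variable {Ω : Type u} [AddCommGroup Ω] [Module ℂ Ω]
  [Module (coinv π) Ω] [IsScalarTower ℂ (coinv π) Ω]
  [Module (coinv π)ᵐᵒᵖ Ω] [IsScalarTower ℂ (coinv π)ᵐᵒᵖ Ω]
  [SMulCommClass (coinv π) (coinv π)ᵐᵒᵖ Ω]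

namespace CovariantCalculus

variable (C : CovariantCalculus π Ω)

section

variable {C} {X Y : Submodule ℂ Ω} (hX : C.IsCovariantSubbimodule X)
  (hY : C.IsCovariantSubbimodule Y) (h : IsCompl X Y)

include hX hY in
theorem projection_smul (m : coinv π) (ω : Ω) :
    X.projection Y h (m • ω) = m • X.projection Y h ω :=
  (map_projection h h (Algebra.lsmul ℂ ℂ Ω m) (fun x hx => hX.smul_mem m x hx)
    (fun x hx => hY.smul_mem m x hx) ω).symm

include hX hY in
theorem projection_op_smul (m : coinv π) (ω : Ω) :
    X.projection Y h (MulOpposite.op m • ω) = MulOpposite.op m • X.projection Y h ω :=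
  (map_projection h h (Algebra.lsmul ℂ ℂ Ω (MulOpposite.op m)) (fun x hx => hX.op_smul_mem m x hx)
    (fun x hx => hY.op_smul_mem m x hx) ω).symm

include hX hY in
theorem coact_projection (ω : Ω) :
    C.coact (X.projection Y h ω) = (X.projection Y h).lTensor G (C.coact ω) := by
  conv_rhs => rw [← Submodule.projection_add_projection_eq_self h ω, map_add, map_add]
  rw [lTensor_projection_of_mem h (hX.coact_mem _ (Submodule.projection_apply_mem h ω)),
    lTensor_projection_of_mem_right h (hY.coact_mem _ (Submodule.projection_apply_mem h.symm ω)),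
    add_zero]

include hX hY in
theorem projection_mem_augSub {ω : Ω} (hω : ω ∈ augSub (counitM π) Ω) :
    X.projection Y h ω ∈ augSub (counitM π) Ω := by
  induction hω using Submodule.span_induction with
  | mem x hx =>
    obtain ⟨a, e, ha, rfl⟩ := hx
    rw [projection_smul hX hY h]
    exact Submodule.subset_span ⟨a, _, ha, rfl⟩
  | zero => simp
  | add x y _ _ hx hy => rw [map_add]; exact add_mem hx hy
  | smul c x _ hx => rw [map_smul]; exact Submodule.smul_mem _ _ hx

-- The projections of `Ω` are left `M`-linear and so preserve `M⁺Ω`. If `x ∈ X` and `y ∈ Y` have the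
-- same class, projecting `x - y ∈ M⁺Ω` shows `x ∈ M⁺Ω`.
include hX hY h in
theorem isCompl_toV : IsCompl (C.toV X) (C.toV Y) := by
  constructor
  · rw [Submodule.disjoint_def, toV_eq_map, toV_eq_map]
    rintro _ ⟨x, hx, rfl⟩ ⟨y, hy, hxy⟩
    rw [C.sigmaMk_eq_zero]
    have h1 : x - y ∈ augSub (counitM π) Ω := by
      rw [← C.sigmaMk_eq_zero, map_sub, hxy, sub_self]
    have h2 := projection_mem_augSub hX hY h h1
    rwa [map_sub, Submodule.projection_apply_left h ⟨x, hx⟩,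
      Submodule.projection_apply_right h ⟨y, hy⟩, sub_zero] at h2
  · rw [codisjoint_iff, ← toV_sup, h.sup_eq_top, toV_top]

end

theorem coactV_projection {U W : Submodule ℂ C.V} (hU : C.IsSubcomodule U) (hW : C.IsSubcomodule W)
    (h : IsCompl U W) :
    C.coactV ∘ₗ U.projection W h = (U.projection W h).rTensor H ∘ₗ C.coactV := by
  have h1 : ∀ z ∈ LinearMap.range (U.subtype.rTensor H), (U.projection W h).rTensor H z = z := by
    rintro _ ⟨t, rfl⟩
    induction t with
    | zero => simp
    | add x y hx hy => simp only [map_add, hx, hy]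
    | tmul u a => simp [Submodule.projection_apply_left h]
  have h2 : ∀ z ∈ LinearMap.range (W.subtype.rTensor H), (U.projection W h).rTensor H z = 0 := by
    rintro _ ⟨t, rfl⟩
    induction t with
    | zero => simp
    | add x y hx hy => simp only [map_add, hx, hy, add_zero]
    | tmul u a => simp [Submodule.projection_apply_right h]
  refine LinearMap.ext fun v => ?_
  rw [LinearMap.comp_apply, LinearMap.comp_apply]
  conv_rhs => rw [← Submodule.projection_add_projection_eq_self h v, map_add, map_add]
  rw [h1 _ (hU _ (Submodule.projection_apply_mem h v)),
    h2 _ (hW _ (Submodule.projection_apply_mem h.symm v)), add_zero]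

/-- The spaces `G ⊗ U` and `G ⊗ W` meet in zero and `rho` is injective. The forms add up to
everything because the projections of `V` are `H`-colinear, so `exists_rho_eq` lifts both components
of `rho ω` to forms. -/
theorem isCompl_formsOf (hff : IsFaithfullyFlatRight π) {U W : Submodule ℂ C.V}
    (hU : C.IsSubcomodule U) (hW : C.IsSubcomodule W) (h : IsCompl U W) :
    IsCompl (C.formsOf U) (C.formsOf W) := by
  constructor
  · rw [Submodule.disjoint_def]
    intro ω h1 h2
    exact C.rho_injective hff ((gTensor_inf_eq_bot h h1 h2).trans (map_zero _).symm)
  · rw [codisjoint_iff, eq_top_iff]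
    intro ω _
    obtain ⟨x, hx⟩ := C.exists_rho_eq hff _ (C.coactV_projection hU hW h) ω
    obtain ⟨y, hy⟩ := C.exists_rho_eq hff _ (C.coactV_projection hW hU h.symm) ω
    refine Submodule.mem_sup.2 ⟨x, ?_, y, ?_, ?_⟩
    · rw [formsOf, Submodule.mem_comap, hx]
      exact lTensor_projection_mem h _
    · rw [formsOf, Submodule.mem_comap, hy]
      exact lTensor_projection_mem h.symm _
    · apply C.rho_injective hff
      rw [map_add, hx, hy, ← LinearMap.add_apply, ← LinearMap.lTensor_add]
      have : U.projection W h + W.projection U h.symm = LinearMap.id :=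
        LinearMap.ext fun v => Submodule.projection_add_projection_eq_self h v
      rw [this, LinearMap.lTensor_id, LinearMap.id_apply]

theorem eq_of_isCompl_of_le {E : Type*} [AddCommGroup E] [Module ℂ E] {p q p' q' : Submodule ℂ E}
    (h : IsCompl p q) (h' : p' ⊔ q' = ⊤) (hp : p' ≤ p) (hq : q' ≤ q) : p' = p := by
  refine le_antisymm hp fun x hx => ?_
  have hx' : x ∈ p' ⊔ q' := by rw [h']; trivial
  obtain ⟨a, ha, b, hb, rfl⟩ := Submodule.mem_sup.1 hx'
  have : b = 0 := Submodule.disjoint_def.1 h.disjoint b (by simpa using sub_mem hx (hp ha)) (hq hb)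
  rwa [this, add_zero]

theorem bijOn_cotangentDecompositions (hff : IsFaithfullyFlatRight π) :
    Set.BijOn (Prod.map C.toV C.toV) C.formDecompositions C.cotangentDecompositions := by
  refine ⟨?_, ?_, ?_⟩
  · rintro ⟨X, Y⟩ ⟨hX, hY, h⟩
    exact ⟨⟨C.isSubcomodule_toV X hX, C.isSubcomodule_toV Y hY, isCompl_toV hX hY h⟩,
      C.isRightSubmodule_toV X hX, C.isRightSubmodule_toV Y hY⟩
  · rintro ⟨X, Y⟩ ⟨hX, hY, h⟩ ⟨X', Y'⟩ ⟨hX', hY', h'⟩ heq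
    obtain ⟨h1, h2⟩ := Prod.ext_iff.1 heq
    exact Prod.ext (le_antisymm (hX.le_of_toV_le hff hX' h1.le) (hX'.le_of_toV_le hff hX h1.ge))
      (le_antisymm (hY.le_of_toV_le hff hY' h2.le) (hY'.le_of_toV_le hff hY h2.ge))
  · rintro ⟨U, W⟩ ⟨⟨hU, hW, h⟩, hU', hW'⟩
    have hc := C.isCompl_formsOf hff hU hW h
    -- The fibres of the two spaces of forms are contained in `U` and `W`; since they span `V`,
    -- equality is forced.
    have ht : C.toV (C.formsOf U) ⊔ C.toV (C.formsOf W) = ⊤ := by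
      rw [← toV_sup, hc.sup_eq_top, toV_top]
    refine ⟨(C.formsOf U, C.formsOf W), ⟨C.isCovariantSubbimodule_formsOf U hU',
      C.isCovariantSubbimodule_formsOf W hW', hc⟩, Prod.ext ?_ ?_⟩
    · exact eq_of_isCompl_of_le h ht (C.toV_formsOf_le U) (C.toV_formsOf_le W)
    · exact eq_of_isCompl_of_le h.symm ((sup_comm _ _).trans ht) (C.toV_formsOf_le W)
        (C.toV_formsOf_le U)

theorem sigmaMk_op_smul (h0 : IsInM0 π Ω) (m : coinv π) (ω : Ω) :
    C.sigmaMk (MulOpposite.op m • ω) = counitM π m • C.sigmaMk ω := by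
  rw [sigmaMk_apply, h0.mk_op_smul, map_smul]; rfl

/-- Here `M` acts on `V` from the right by the counit, so being a right submodule is no condition.
-/
theorem bijOn_comoduleDecompositions (hff : IsFaithfullyFlatRight π) (h0 : IsInM0 π Ω) :
    Set.BijOn (Prod.map C.toV C.toV) C.formDecompositions C.comoduleDecompositions := by
  have h1 : ∀ U, C.IsRightSubmodule U := by
    intro U m v hv
    obtain ⟨ω, rfl⟩ := C.sigmaMk_surjective v
    rw [actV_sigmaMk, C.sigmaMk_op_smul h0]
    exact U.smul_mem _ hv
  have h2 : C.comoduleDecompositions = C.cotangentDecompositions :=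
    Set.ext fun p => ⟨fun h => ⟨h, h1 _, h1 _⟩, fun h => h.1⟩
  rw [h2]
  exact C.bijOn_cotangentDecompositions hff

end CovariantCalculus

end Decompositions

/-! ### Universal property of the maximal prolongation. -/

section Prolongation

variable {G H : Type*} [Ring G] [HopfAlgebra ℂ G] [Ring H] [HopfAlgebra ℂ H] {π : G →ₐc[ℂ] H}
variable {Ω : Type*} [AddCommGroup Ω] [Module ℂ Ω]
  [Module (coinv π) Ω] [IsScalarTower ℂ (coinv π) Ω]
  [Module (coinv π)ᵐᵒᵖ Ω] [IsScalarTower ℂ (coinv π)ᵐᵒᵖ Ω]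
  [SMulCommClass (coinv π) (coinv π)ᵐᵒᵖ Ω]

namespace CovariantCalculus

variable (C : CovariantCalculus π Ω)

theorem ofM_apply (m : coinv π) : C.ofM m = C.toMaximalProlongation
    (toBimodTensorAlgebra π Ω (TensorAlgebra.ι ℂ (m, 0))) := rfl

theorem ofForms_apply (ω : Ω) : C.ofForms ω = C.toMaximalProlongation
    (toBimodTensorAlgebra π Ω (TensorAlgebra.ι ℂ (0, ω))) := rfl

theorem toBimodTensorAlgebra_rel {x y : TensorAlgebra ℂ (coinv π × Ω)} (h : TensorRel π Ω x y) :
    toBimodTensorAlgebra π Ω x = toBimodTensorAlgebra π Ω y := RingQuot.mkAlgHom_rel ℂ h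

theorem ofM_one : C.ofM 1 = 1 := by
  rw [ofM_apply, toBimodTensorAlgebra_rel TensorRel.one, map_one, map_one]

theorem ofM_mul (a b : coinv π) : C.ofM (a * b) = C.ofM a * C.ofM b := by
  rw [ofM_apply, ← toBimodTensorAlgebra_rel (TensorRel.mul a b), map_mul, map_mul]
  rfl

theorem ofM_mul_ofForms (m : coinv π) (ω : Ω) : C.ofM m * C.ofForms ω = C.ofForms (m • ω) := by
  rw [C.ofForms_apply (m • ω), ← toBimodTensorAlgebra_rel (TensorRel.smul m ω), map_mul, map_mul]
  rfl

theorem ofForms_mul_ofM (m : coinv π) (ω : Ω) :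
    C.ofForms ω * C.ofM m = C.ofForms (MulOpposite.op m • ω) := by
  rw [C.ofForms_apply (MulOpposite.op m • ω), ← toBimodTensorAlgebra_rel (TensorRel.op_smul m ω),
    map_mul, map_mul]
  rfl

/-- The map `ω ⊗ ω' ↦ ω ∧ ω'`. -/
def wedgeForms : Ω ⊗[ℂ] Ω →ₗ[ℂ] C.MaximalProlongation :=
  TensorProduct.lift ((LinearMap.mul ℂ C.MaximalProlongation).compl₁₂ C.ofForms C.ofForms)

theorem wedgeForms_tmul (ω ω' : Ω) :
    C.wedgeForms (ω ⊗ₜ ω') = C.ofForms ω * C.ofForms ω' := rfl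

theorem toMaximalProlongation_dAlg (t : coinv π ⊗[ℂ] coinv π) :
    C.toMaximalProlongation (C.dAlg t) = C.wedgeForms (TensorProduct.map C.d C.d t) := by
  induction t with
  | zero => simp
  | add x y hx hy => simp only [map_add, hx, hy]
  | tmul a b => exact map_mul C.toMaximalProlongation _ _

theorem wedgeForms_d {t : coinv π ⊗[ℂ] coinv π} (ht : t ∈ C.N) :
    C.wedgeForms (TensorProduct.map C.d C.d t) = 0 := by
  have h : C.ProlongationRel (C.dAlg t) 0 := ⟨⟨t, ht, rfl⟩, rfl⟩
  rw [← toMaximalProlongation_dAlg]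
  exact (RingQuot.mkAlgHom_rel ℂ h).trans (map_zero C.toMaximalProlongation)

/-- Algebra maps on the maximal prolongation which agree on `M` and `Ω` are equal. -/
theorem prolongation_hom_ext {Q : Type*} [Ring Q] [Algebra ℂ Q]
    {f g : C.MaximalProlongation →ₐ[ℂ] Q} (h0 : ∀ m, f (C.ofM m) = g (C.ofM m))
    (h1 : ∀ ω, f (C.ofForms ω) = g (C.ofForms ω)) : f = g := by
  have h : (f.comp C.toMaximalProlongation).comp (toBimodTensorAlgebra π Ω) =
      (g.comp C.toMaximalProlongation).comp (toBimodTensorAlgebra π Ω) := by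
    refine TensorAlgebra.hom_ext (LinearMap.ext fun x => ?_)
    have hx : x = (x.1, 0) + (0, x.2) := by simp
    rw [hx, map_add, map_add]
    exact congrArg₂ (· + ·) (h0 x.1) (h1 x.2)
  refine AlgHom.ext fun x => ?_
  obtain ⟨y, rfl⟩ := RingQuot.mkAlgHom_surjective ℂ C.ProlongationRel x
  obtain ⟨z, rfl⟩ := RingQuot.mkAlgHom_surjective ℂ (TensorRel π Ω) y
  exact AlgHom.congr_fun h z

/-- The universal property of the maximal prolongation. -/
theorem exists_prolongation_lift {Q : Type*} [Ring Q] [Algebra ℂ Q] (f : coinv π →ₗ[ℂ] Q)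
    (g : Ω →ₗ[ℂ] Q) (f_one : f 1 = 1) (f_mul : ∀ a b, f (a * b) = f a * f b)
    (hl : ∀ m ω, f m * g ω = g (m • ω)) (hr : ∀ m ω, g ω * f m = g (MulOpposite.op m • ω))
    (hN : ∀ t ∈ C.N, TensorProduct.lift ((LinearMap.mul ℂ Q).compl₁₂ g g)
      (TensorProduct.map C.d C.d t) = 0) :
    ∃ F : C.MaximalProlongation →ₐ[ℂ] Q, (∀ m, F (C.ofM m) = f m) ∧
      ∀ ω, F (C.ofForms ω) = g ω := by
  let F₀ : TensorAlgebra ℂ (coinv π × Ω) →ₐ[ℂ] Q := TensorAlgebra.lift ℂ (f.coprod g)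
  have hF₀ : ∀ m ω, F₀ (TensorAlgebra.ι ℂ (m, ω)) = f m + g ω := fun m ω => by simp [F₀]
  let F₁ : BimodTensorAlgebra π Ω →ₐ[ℂ] Q := RingQuot.liftAlgHom ℂ ⟨F₀, by
    rintro _ _ (_ | ⟨a, b⟩ | ⟨a, ω⟩ | ⟨a, ω⟩)
    · rw [hF₀, map_zero, add_zero, f_one, map_one]
    · rw [map_mul, hF₀, hF₀, hF₀, map_zero, add_zero, add_zero, add_zero, f_mul]
    · rw [map_mul, hF₀, hF₀, hF₀, map_zero, map_zero, add_zero, zero_add, zero_add, hl]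
    · rw [map_mul, hF₀, hF₀, hF₀, map_zero, map_zero, add_zero, zero_add, zero_add, hr]⟩
  have hF₁ : ∀ x, F₁ (toBimodTensorAlgebra π Ω x) = F₀ x :=
    fun x => RingQuot.liftAlgHom_mkAlgHom_apply ℂ _ _ x
  let F₂ : C.MaximalProlongation →ₐ[ℂ] Q := RingQuot.liftAlgHom ℂ ⟨F₁, by
    rintro _ _ ⟨⟨t, ht, rfl⟩, rfl⟩
    rw [map_zero, ← hN t ht]
    clear ht
    induction t with
    | zero => simp
    | add x y hx hy => simp only [map_add, hx, hy]
    | tmul a b =>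
      have h : ∀ ω, F₁ (inForms π Ω ω) = g ω := fun ω =>
        (hF₁ _).trans ((hF₀ 0 ω).trans (by rw [map_zero, zero_add]))
      exact (map_mul F₁ _ _).trans (congrArg₂ (· * ·) (h _) (h _))⟩
  have hF₂ : ∀ x, F₂ (C.toMaximalProlongation x) = F₁ x :=
    fun x => RingQuot.liftAlgHom_mkAlgHom_apply ℂ _ _ x
  refine ⟨F₂, fun m => ?_, fun ω => ?_⟩
  · rw [ofM_apply, hF₂, hF₁, hF₀, map_zero, add_zero]
  · rw [ofForms_apply, hF₂, hF₁, hF₀, map_zero, zero_add]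

/-- A subalgebra of the maximal prolongation which contains `M` and `Ω` is everything. -/
theorem prolongation_mem_of_generators (S : Subalgebra ℂ C.MaximalProlongation)
    (hM : ∀ m, C.ofM m ∈ S) (hΩ : ∀ ω, C.ofForms ω ∈ S) (x : C.MaximalProlongation) : x ∈ S := by
  obtain ⟨y, rfl⟩ := RingQuot.mkAlgHom_surjective ℂ C.ProlongationRel x
  obtain ⟨z, rfl⟩ := RingQuot.mkAlgHom_surjective ℂ (TensorRel π Ω) y
  change C.toMaximalProlongation (toBimodTensorAlgebra π Ω z) ∈ S
  induction z using TensorAlgebra.induction with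
  | algebraMap r =>
    rw [AlgHom.commutes]
    exact (AlgHom.commutes C.toMaximalProlongation r).symm ▸ S.algebraMap_mem r
  | ι v =>
    have hv : v = (v.1, 0) + (0, v.2) := by simp
    rw [hv, map_add, map_add]
    exact (map_add C.toMaximalProlongation _ _).symm ▸ S.add_mem (hM v.1) (hΩ v.2)
  | mul a b ha hb =>
    rw [map_mul]
    exact (map_mul C.toMaximalProlongation _ _).symm ▸ S.mul_mem ha hb
  | add a b ha hb =>
    rw [map_add]
    exact (map_add C.toMaximalProlongation _ _).symm ▸ S.add_mem ha hb

end CovariantCalculus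

end Prolongation

/-! ### Diagonal coactions and tensor products of relative Hopf modules. -/

section Diagonal

variable {G H : Type*} [Ring G] [HopfAlgebra ℂ G] [Ring H] [HopfAlgebra ℂ H] {π : G →ₐc[ℂ] H}

section Maps

variable {E F : Type*} [AddCommGroup E] [Module ℂ E] [AddCommGroup F] [Module ℂ F]

/-- The map `(g ⊗ e) ⊗ (h ⊗ f) ↦ g h ⊗ (e ⊗ f)`. -/
def diagMul : (G ⊗[ℂ] E) ⊗[ℂ] (G ⊗[ℂ] F) →ₗ[ℂ] G ⊗[ℂ] (E ⊗[ℂ] F) :=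
  (LinearMap.mul' ℂ G).rTensor (E ⊗[ℂ] F) ∘ₗ
    (TensorProduct.tensorTensorTensorComm ℂ G E G F).toLinearMap

theorem diagMul_tmul (g h : G) (e : E) (f : F) :
    diagMul ((g ⊗ₜ[ℂ] e) ⊗ₜ[ℂ] (h ⊗ₜ[ℂ] f)) = (g * h) ⊗ₜ (e ⊗ₜ f) := rfl

/-- The diagonal coaction `e ⊗ f ↦ e₋₁ f₋₁ ⊗ (e₀ ⊗ f₀)`. -/
def diagCoact (c : E →ₗ[ℂ] G ⊗[ℂ] E) (c' : F →ₗ[ℂ] G ⊗[ℂ] F) :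
    E ⊗[ℂ] F →ₗ[ℂ] G ⊗[ℂ] (E ⊗[ℂ] F) := diagMul ∘ₗ TensorProduct.map c c'

theorem diagCoact_tmul (c : E →ₗ[ℂ] G ⊗[ℂ] E) (c' : F →ₗ[ℂ] G ⊗[ℂ] F) (e : E) (f : F) :
    diagCoact c c' (e ⊗ₜ f) = diagMul (c e ⊗ₜ c' f) := rfl

/-- Two linear maps out of `(G ⊗ E) ⊗ (G ⊗ F)` are equal if they agree on pure tensors. -/
theorem ext_diag {E F P : Type*} [AddCommMonoid E] [Module ℂ E] [AddCommMonoid F] [Module ℂ F]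
    [AddCommMonoid P] [Module ℂ P] {p q : (G ⊗[ℂ] E) ⊗[ℂ] (G ⊗[ℂ] F) →ₗ[ℂ] P}
    (h : ∀ g e g' f, p ((g ⊗ₜ e) ⊗ₜ (g' ⊗ₜ f)) = q ((g ⊗ₜ e) ⊗ₜ (g' ⊗ₜ f)))
    (z : G ⊗[ℂ] E) (w : G ⊗[ℂ] F) : p (z ⊗ₜ w) = q (z ⊗ₜ w) := by
  induction z with
  | zero => simp
  | add a b ha hb => rw [TensorProduct.add_tmul, map_add, map_add, ha, hb]
  | tmul g e =>
    induction w with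
    | zero => simp
    | add a b ha hb => rw [TensorProduct.tmul_add, map_add, map_add, ha, hb]
    | tmul g' f => exact h g e g' f

theorem lTensor_map_diagMul {E' F' : Type*} [AddCommGroup E'] [Module ℂ E'] [AddCommGroup F']
    [Module ℂ F'] (p : E →ₗ[ℂ] E') (q : F →ₗ[ℂ] F') (z : G ⊗[ℂ] E) (w : G ⊗[ℂ] F) :
    (TensorProduct.map p q).lTensor G (diagMul (z ⊗ₜ w)) =
      diagMul (p.lTensor G z ⊗ₜ q.lTensor G w) :=
  ext_diag (p := (TensorProduct.map p q).lTensor G ∘ₗ diagMul)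
    (q := diagMul ∘ₗ TensorProduct.map (p.lTensor G) (q.lTensor G)) (fun _ _ _ _ => rfl) z w

theorem diagCoact_map {E' F' : Type*} [AddCommGroup E'] [Module ℂ E'] [AddCommGroup F']
    [Module ℂ F'] {c : E →ₗ[ℂ] G ⊗[ℂ] E} {c' : F →ₗ[ℂ] G ⊗[ℂ] F} {b : E' →ₗ[ℂ] G ⊗[ℂ] E'}
    {b' : F' →ₗ[ℂ] G ⊗[ℂ] F'} (p : E →ₗ[ℂ] E') (q : F →ₗ[ℂ] F')
    (hp : ∀ e, b (p e) = p.lTensor G (c e)) (hq : ∀ f, b' (q f) = q.lTensor G (c' f))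
    (t : E ⊗[ℂ] F) : diagCoact b b' (TensorProduct.map p q t) =
      (TensorProduct.map p q).lTensor G (diagCoact c c' t) := by
  induction t with
  | zero => simp
  | add x y hx hy => simp only [map_add, hx, hy]
  | tmul e f =>
    rw [TensorProduct.map_tmul, diagCoact_tmul, diagCoact_tmul, hp, hq, lTensor_map_diagMul]

/-- Flatness is used twice: `z` lifts to `G ⊗ ker p`, and there the lift lies in the kernel of the
restriction of `q`. -/
theorem gTensor_ker_inf {F' F'' : Type*} [AddCommGroup F'] [Module ℂ F'] [AddCommGroup F'']
    [Module ℂ F''] (p : F →ₗ[ℂ] F') (q : F →ₗ[ℂ] F'') {z : G ⊗[ℂ] F} (hp : p.lTensor G z = 0)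
    (hq : q.lTensor G z = 0) : z ∈ gTensor G (LinearMap.ker p ⊓ LinearMap.ker q) := by
  have h1 : z ∈ gTensor G (LinearMap.ker p) := by rw [gTensor_ker]; exact hp
  obtain ⟨t, rfl⟩ := h1
  have h2 : t ∈ gTensor G (LinearMap.ker (q ∘ₗ (LinearMap.ker p).subtype)) := by
    rw [gTensor_ker, LinearMap.mem_ker, LinearMap.lTensor_comp]; exact hq
  have h3 : gTensor G (LinearMap.ker (q ∘ₗ (LinearMap.ker p).subtype)) ≤
      (gTensor G (LinearMap.ker p ⊓ LinearMap.ker q)).comap ((LinearMap.ker p).subtype.lTensor G) :=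
    gTensor_le fun g w hw => tmul_mem_gTensor g ⟨w.2, hw⟩
  exact h3 h2

end Maps

/-- The tensor product of two relative Hopf modules. -/
def RelHopf.tensor {E F : Type*} [AddCommGroup E] [Module ℂ E] [Module (coinv π) E]
    [IsScalarTower ℂ (coinv π) E] [AddCommGroup F] [Module ℂ F] [Module (coinv π) F]
    [IsScalarTower ℂ (coinv π) F] (R : RelHopf π E) (S : RelHopf π F) :
    RelHopf π (E ⊗[ℂ] F) where
  coact := diagCoact R.coact S.coact
  counit_coact x := by
    induction x with
    | zero => simp
    | add x y hx hy => simp only [map_add, hx, hy]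
    | tmul e f =>
      have := ext_diag (p := (TensorProduct.lid ℂ (E ⊗[ℂ] F)).toLinearMap ∘ₗ
        (Coalgebra.counit (R := ℂ)).rTensor (E ⊗[ℂ] F) ∘ₗ diagMul (G := G))
        (q := TensorProduct.map
          ((TensorProduct.lid ℂ E).toLinearMap ∘ₗ (Coalgebra.counit (R := ℂ)).rTensor E)
          ((TensorProduct.lid ℂ F).toLinearMap ∘ₗ (Coalgebra.counit (R := ℂ)).rTensor F))
        (fun g e g' f => by
          simp [diagMul_tmul, TensorProduct.smul_tmul, TensorProduct.tmul_smul, mul_smul]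
          exact smul_comm _ _ _)
        (R.coact e) (S.coact f)
      refine this.trans ?_
      rw [TensorProduct.map_tmul]
      exact congrArg₂ (· ⊗ₜ ·) (R.counit_coact e) (S.counit_coact f)
  coassoc x := by
    induction x with
    | zero => simp
    | add x y hx hy => simp only [map_add, hx, hy]
    | tmul e f =>
      let D : (G ⊗[ℂ] (G ⊗[ℂ] E)) ⊗[ℂ] (G ⊗[ℂ] (G ⊗[ℂ] F)) →ₗ[ℂ] G ⊗[ℂ] (G ⊗[ℂ] (E ⊗[ℂ] F)) :=
        diagMul.lTensor G ∘ₗ diagMul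
      have h1 := ext_diag (p := (TensorProduct.assoc ℂ G G (E ⊗[ℂ] F)).toLinearMap ∘ₗ
        (Coalgebra.comul (R := ℂ)).rTensor (E ⊗[ℂ] F) ∘ₗ diagMul (G := G))
        (q := D ∘ₗ TensorProduct.map
          ((TensorProduct.assoc ℂ G G E).toLinearMap ∘ₗ (Coalgebra.comul (R := ℂ)).rTensor E)
          ((TensorProduct.assoc ℂ G G F).toLinearMap ∘ₗ (Coalgebra.comul (R := ℂ)).rTensor F))
        (fun g e g' f => by
          simp only [LinearMap.comp_apply, diagMul_tmul, LinearMap.rTensor_tmul,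
            TensorProduct.map_tmul, Bialgebra.comul_mul, LinearEquiv.coe_coe]
          generalize Coalgebra.comul (R := ℂ) g = s
          generalize Coalgebra.comul (R := ℂ) g' = t
          induction s with
          | zero => simp
          | add x y hx hy => simp only [add_mul, TensorProduct.add_tmul, map_add, hx, hy]
          | tmul a b =>
            induction t with
            | zero => simp
            | add x y hx hy =>
              simp only [mul_add, TensorProduct.tmul_add, TensorProduct.add_tmul, map_add, hx, hy]
            | tmul c d => rw [Algebra.TensorProduct.tmul_mul_tmul]; rfl)
        (R.coact e) (S.coact f)
      have h2 := ext_diag (p := (diagCoact R.coact S.coact).lTensor G ∘ₗ diagMul (G := G))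
        (q := D ∘ₗ TensorProduct.map (R.coact.lTensor G) (S.coact.lTensor G))
        (fun g e g' f => rfl) (R.coact e) (S.coact f)
      refine h1.trans (Eq.trans ?_ h2.symm)
      exact congrArg₂ (fun x y => D (x ⊗ₜ y)) (R.coassoc e) (S.coassoc f)
  coact_smul m x := by
    induction x with
    | zero => simp
    | add x y hx hy => simp only [smul_add, map_add, hx, hy]
    | tmul e f =>
      change diagMul (R.coact (m • e) ⊗ₜ S.coact f) = tensorAct π _ _ (diagMul _)
      rw [R.coact_smul]
      generalize coactM π m = s
      induction s with
      | zero => simp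
      | add a b ha hb => simp only [map_add, LinearMap.add_apply, TensorProduct.add_tmul, ha, hb]
      | tmul a b =>
        exact ext_diag (p := diagMul ∘ₗ (tensorAct π E (a ⊗ₜ b)).rTensor _)
          (q := tensorAct π _ (a ⊗ₜ b) ∘ₗ diagMul) (fun g e g' f => by
            simp [diagMul_tmul, tensorAct_tmul, mul_assoc, TensorProduct.smul_tmul'])
          (R.coact e) (S.coact f)

/-- `G ⊗ G ⊗ M → G ⊗ G ⊗ G` is injective by flatness, which reduces this to coassociativity of `G`.
-/
theorem coassoc_coactM (m : coinv π) : TensorProduct.assoc ℂ G G (coinv π)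
    ((Coalgebra.comul (R := ℂ)).rTensor (coinv π) (coactM π m)) =
      (coactM π).lTensor G (coactM π m) := by
  have hinj : Function.Injective (((coinv π).val.toLinearMap.lTensor G).lTensor G) :=
    Module.Flat.lTensor_preserves_injective_linearMap _ (lTensor_val_injective π)
  apply hinj
  have h1 := lift_coactM π (((coinv π).val.toLinearMap.lTensor G).lTensor G ∘ₗ
    (TensorProduct.assoc ℂ G G (coinv π)).toLinearMap ∘ₗ
      (Coalgebra.comul (R := ℂ)).rTensor (coinv π))
    ((TensorProduct.assoc ℂ G G G).toLinearMap ∘ₗ (Coalgebra.comul (R := ℂ)).rTensor G)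
    (fun g m => by
      simp only [LinearMap.comp_apply, LinearMap.rTensor_tmul, LinearEquiv.coe_coe]
      generalize Coalgebra.comul (R := ℂ) g = s
      induction s with
      | zero => simp
      | add a b ha hb => simp only [TensorProduct.add_tmul, map_add, ha, hb]
      | tmul a b => rfl) m
  have h2 := lift_coactM π (((coinv π).val.toLinearMap.lTensor G).lTensor G ∘ₗ
    (coactM π).lTensor G) ((Coalgebra.comul (R := ℂ)).lTensor G)
    (fun g m => by
      simp only [LinearMap.comp_apply, LinearMap.lTensor_tmul, lTensor_val_coactM]) m
  exact h1.trans ((Coalgebra.coassoc_apply (R := ℂ) (m : G)).trans h2.symm)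

theorem counit_coact_coactM (m : coinv π) : TensorProduct.lid ℂ (coinv π)
    ((Coalgebra.counit (R := ℂ)).rTensor (coinv π) (coactM π m)) = m := by
  apply Subtype.val_injective
  have h1 := lift_coactM π ((coinv π).val.toLinearMap ∘ₗ (TensorProduct.lid ℂ (coinv π)).toLinearMap ∘ₗ
    (Coalgebra.counit (R := ℂ)).rTensor (coinv π)) ((TensorProduct.lid ℂ G).toLinearMap ∘ₗ
    (Coalgebra.counit (R := ℂ)).rTensor G) (fun g m => by simp) m
  refine h1.trans ?_
  simp

end Diagonal

/-! ### The coaction on the maximal prolongation. -/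

section ProlongationCoaction

variable {G H : Type*} [Ring G] [HopfAlgebra ℂ G] [Ring H] [HopfAlgebra ℂ H] {π : G →ₐc[ℂ] H}
variable {Ω : Type*} [AddCommGroup Ω] [Module ℂ Ω]
  [Module (coinv π) Ω] [IsScalarTower ℂ (coinv π) Ω]
  [Module (coinv π)ᵐᵒᵖ Ω] [IsScalarTower ℂ (coinv π)ᵐᵒᵖ Ω]
  [SMulCommClass (coinv π) (coinv π)ᵐᵒᵖ Ω]

namespace CovariantCalculus

variable (C : CovariantCalculus π Ω)

theorem coact_d (b : coinv π) : C.coact (C.d b) = C.d.lTensor G (coactM π b) := by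
  have := C.coact_smul_d 1 b
  rw [one_smul, coactM_one] at this
  rw [this]
  generalize C.d.lTensor G (coactM π b) = z
  rw [Algebra.TensorProduct.one_def]
  induction z with
  | zero => simp
  | add z z' hz hz' => simp only [map_add, hz, hz']
  | tmul g w => rw [tensorAct_tmul, one_mul, one_smul]

/-- `N` is cut out by the product of `M` and by `a ⊗ b ↦ a db`, and both maps are colinear for the
diagonal coaction. -/
theorem diagCoact_mem_N {t : coinv π ⊗[ℂ] coinv π} (ht : t ∈ C.N) :
    diagCoact (coactM π) (coactM π) t ∈ gTensor G C.N := by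
  have h1 : ∀ t : coinv π ⊗[ℂ] coinv π, (LinearMap.mul' ℂ (coinv π)).lTensor G
      (diagCoact (coactM π) (coactM π) t) = coactM π (LinearMap.mul' ℂ (coinv π) t) := by
    intro t
    induction t with
    | zero => simp
    | add x y hx hy => simp only [map_add, hx, hy]
    | tmul a b =>
      rw [LinearMap.mul'_apply, coactM_mul]
      exact ext_diag (p := (LinearMap.mul' ℂ (coinv π)).lTensor G ∘ₗ diagMul)
        (q := LinearMap.mul' ℂ (G ⊗[ℂ] coinv π)) (fun g e g' f => by simp [diagMul_tmul]) _ _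
  have h2 : ∀ t : coinv π ⊗[ℂ] coinv π, C.formMap.lTensor G
      (diagCoact (coactM π) (coactM π) t) = C.coact (C.formMap t) := by
    intro t
    induction t with
    | zero => simp
    | add x y hx hy => simp only [map_add, hx, hy]
    | tmul a b =>
      rw [formMap_tmul, C.coact_smul_d]
      exact ext_diag (p := C.formMap.lTensor G ∘ₗ diagMul)
        (q := TensorProduct.lift ((tensorAct π Ω).compl₂ (C.d.lTensor G)))
        (fun g e g' f => by simp [diagMul_tmul, formMap_tmul, tensorAct_tmul]) _ _
  refine gTensor_ker_inf _ _ ?_ ?_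
  · rw [h1, ht.1, map_zero]
  · rw [h2, ht.2, map_zero]

theorem lift_mul_ofForms (z w : G ⊗[ℂ] Ω) : C.ofForms.lTensor G z * C.ofForms.lTensor G w =
    C.wedgeForms.lTensor G (diagMul (z ⊗ₜ w)) :=
  ext_diag (p := TensorProduct.lift ((LinearMap.mul ℂ (G ⊗[ℂ] C.MaximalProlongation)).compl₁₂
    (C.ofForms.lTensor G) (C.ofForms.lTensor G))) (q := C.wedgeForms.lTensor G ∘ₗ diagMul)
    (fun g e g' f => by simp [diagMul_tmul, wedgeForms_tmul]) z w

/-- The universal property with values in the algebra `G ⊗ Ω•`; the relations `dN` are respected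
since `N` is a subcomodule and `d` is colinear. -/
theorem exists_prolongation_coact : ∃ F : C.MaximalProlongation →ₐ[ℂ] G ⊗[ℂ] C.MaximalProlongation,
    (∀ m, F (C.ofM m) = C.ofM.lTensor G (coactM π m)) ∧
      ∀ ω, F (C.ofForms ω) = C.ofForms.lTensor G (C.coact ω) := by
  refine C.exists_prolongation_lift (C.ofM.lTensor G ∘ₗ coactM π) (C.ofForms.lTensor G ∘ₗ C.coact)
    ?_ ?_ ?_ ?_ ?_
  · rw [LinearMap.comp_apply, coactM_one, Algebra.TensorProduct.one_def, LinearMap.lTensor_tmul,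
      ofM_one, Algebra.TensorProduct.one_def]
  · intro a b
    rw [LinearMap.comp_apply, coactM_mul]
    exact (ext_diag (p := TensorProduct.lift ((LinearMap.mul ℂ (G ⊗[ℂ] C.MaximalProlongation)).compl₁₂
      (C.ofM.lTensor G) (C.ofM.lTensor G))) (q := C.ofM.lTensor G ∘ₗ LinearMap.mul' ℂ _)
      (fun g e g' f => by simp [ofM_mul]) _ _).symm
  · intro m ω
    rw [LinearMap.comp_apply, LinearMap.comp_apply, LinearMap.comp_apply, C.coact_smul]
    exact ext_diag (p := TensorProduct.lift ((LinearMap.mul ℂ (G ⊗[ℂ] C.MaximalProlongation)).compl₁₂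
      (C.ofM.lTensor G) (C.ofForms.lTensor G)))
      (q := C.ofForms.lTensor G ∘ₗ TensorProduct.lift (tensorAct π Ω))
      (fun g e g' f => by simp [ofM_mul_ofForms, tensorAct_tmul]) _ _
  · intro m ω
    rw [LinearMap.comp_apply, LinearMap.comp_apply, LinearMap.comp_apply, C.coact_op_smul]
    exact ext_diag (p := TensorProduct.lift ((LinearMap.mul ℂ (G ⊗[ℂ] C.MaximalProlongation)).compl₁₂
      (C.ofForms.lTensor G) (C.ofM.lTensor G)))
      (q := C.ofForms.lTensor G ∘ₗ TensorProduct.lift (tensorActR π Ω).flip)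
      (fun g e g' f => by simp [ofForms_mul_ofM, tensorActR_tmul]) _ _
  · intro t ht
    have h1 : ∀ s : Ω ⊗[ℂ] Ω, TensorProduct.lift ((LinearMap.mul ℂ
        (G ⊗[ℂ] C.MaximalProlongation)).compl₁₂ (C.ofForms.lTensor G ∘ₗ C.coact)
        (C.ofForms.lTensor G ∘ₗ C.coact)) s = C.wedgeForms.lTensor G (diagCoact C.coact C.coact s) := by
      intro s
      induction s with
      | zero => simp
      | add x y hx hy => simp only [map_add, hx, hy]
      | tmul a b => exact C.lift_mul_ofForms _ _
    rw [h1, diagCoact_map C.d C.d C.coact_d C.coact_d]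
    have h2 : gTensor G C.N ≤ LinearMap.ker (C.wedgeForms.lTensor G ∘ₗ
        (TensorProduct.map C.d C.d).lTensor G) := by
      refine gTensor_le fun g n hn => ?_
      rw [LinearMap.mem_ker, LinearMap.comp_apply, LinearMap.lTensor_tmul, LinearMap.lTensor_tmul,
        C.wedgeForms_d hn, TensorProduct.tmul_zero]
    exact h2 (C.diagCoact_mem_N ht)

/-- The left `G`-coaction on the maximal prolongation. -/
def prolongationCoact : C.MaximalProlongation →ₐ[ℂ] G ⊗[ℂ] C.MaximalProlongation :=
  C.exists_prolongation_coact.choose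

theorem prolongationCoact_ofM (m : coinv π) :
    C.prolongationCoact (C.ofM m) = C.ofM.lTensor G (coactM π m) :=
  C.exists_prolongation_coact.choose_spec.1 m

theorem prolongationCoact_ofForms (ω : Ω) :
    C.prolongationCoact (C.ofForms ω) = C.ofForms.lTensor G (C.coact ω) :=
  C.exists_prolongation_coact.choose_spec.2 ω

theorem prolongationCoact_wedgeForms (t : Ω ⊗[ℂ] Ω) : C.prolongationCoact (C.wedgeForms t) =
    C.wedgeForms.lTensor G (diagCoact C.coact C.coact t) := by
  induction t with
  | zero => simp
  | add x y hx hy => simp only [map_add, hx, hy]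
  | tmul a b =>
    rw [wedgeForms_tmul, map_mul, prolongationCoact_ofForms, prolongationCoact_ofForms,
      lift_mul_ofForms, diagCoact_tmul]

/-- The map `M → Ω•` as a map of rings. -/
def ofMHom : coinv π →+* C.MaximalProlongation where
  toFun := C.ofM
  map_one' := C.ofM_one
  map_mul' := C.ofM_mul
  map_zero' := map_zero _
  map_add' := map_add _

scoped instance : Module (coinv π) C.MaximalProlongation := Module.compHom _ C.ofMHom

theorem coinv_smul_def (m : coinv π) (x : C.MaximalProlongation) : m • x = C.ofM m * x := rfl

scoped instance : IsScalarTower ℂ (coinv π) C.MaximalProlongation where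
  smul_assoc c m x := by rw [coinv_smul_def, coinv_smul_def, map_smul, smul_mul_assoc]

/-- The maximal prolongation as a relative Hopf module. -/
def prolongationRelHopf : RelHopf π C.MaximalProlongation where
  coact := C.prolongationCoact.toLinearMap
  counit_coact x := by
    -- Written as an equality of algebra maps, the axiom has to be checked on `M` and `Ω` only; the
    -- same device is used for coassociativity.
    let f : C.MaximalProlongation →ₐ[ℂ] C.MaximalProlongation :=
      (Algebra.TensorProduct.lid ℂ C.MaximalProlongation).toAlgHom.comp
        ((Algebra.TensorProduct.map (Bialgebra.counitAlgHom ℂ G) (AlgHom.id ℂ _)).comp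
          C.prolongationCoact)
    have h1 : ∀ x, f x = TensorProduct.lid ℂ _ ((Coalgebra.counit (R := ℂ)).rTensor _
      (C.prolongationCoact x)) := fun _ => rfl
    have h : f = AlgHom.id ℂ _ := by
      apply C.prolongation_hom_ext
      · intro m
        rw [h1, prolongationCoact_ofM, AlgHom.id_apply]
        conv_rhs => rw [← counit_coact_coactM m]
        generalize coactM π m = z
        induction z with
        | zero => simp
        | add a b ha hb => simp only [map_add, ha, hb]
        | tmul a b => simp
      · intro ω
        rw [h1, prolongationCoact_ofForms, AlgHom.id_apply]
        conv_rhs => rw [← C.counit_coact ω]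
        generalize C.coact ω = z
        induction z with
        | zero => simp
        | add a b ha hb => simp only [map_add, ha, hb]
        | tmul a b => simp
    exact AlgHom.congr_fun h x
  coassoc x := by
    let f : C.MaximalProlongation →ₐ[ℂ] G ⊗[ℂ] (G ⊗[ℂ] C.MaximalProlongation) :=
      (Algebra.TensorProduct.assoc ℂ ℂ ℂ G G C.MaximalProlongation).toAlgHom.comp
        ((Algebra.TensorProduct.map (Bialgebra.comulAlgHom ℂ G) (AlgHom.id ℂ _)).comp
          C.prolongationCoact)
    let g : C.MaximalProlongation →ₐ[ℂ] G ⊗[ℂ] (G ⊗[ℂ] C.MaximalProlongation) :=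
      (Algebra.TensorProduct.map (AlgHom.id ℂ G) C.prolongationCoact).comp C.prolongationCoact
    have hf : ∀ x, f x = TensorProduct.assoc ℂ G G _ ((Coalgebra.comul (R := ℂ)).rTensor _
      (C.prolongationCoact x)) := fun _ => rfl
    have hg : ∀ x, g x = C.prolongationCoact.toLinearMap.lTensor G (C.prolongationCoact x) :=
      fun _ => rfl
    have h : f = g := by
      apply C.prolongation_hom_ext
      · intro m
        rw [hf, hg, prolongationCoact_ofM]
        refine (freeRelHopf_coact_lTensor (π := π) C.ofM (coactM π m)).trans ?_
        refine (congrArg _ (coassoc_coactM m)).trans ?_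
        rw [← LinearMap.lTensor_comp_apply, ← LinearMap.lTensor_comp_apply]
        congr 2
        exact LinearMap.ext fun m => (C.prolongationCoact_ofM m).symm
      · intro ω
        rw [hf, hg, prolongationCoact_ofForms]
        refine (freeRelHopf_coact_lTensor (π := π) C.ofForms (C.coact ω)).trans ?_
        refine (congrArg _ (C.coassoc ω)).trans ?_
        rw [← LinearMap.lTensor_comp_apply, ← LinearMap.lTensor_comp_apply]
        congr 2
        exact LinearMap.ext fun m => (C.prolongationCoact_ofForms m).symm
    exact AlgHom.congr_fun h x
  coact_smul m x := by
    rw [coinv_smul_def, AlgHom.toLinearMap_apply, map_mul, prolongationCoact_ofM]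
    exact ext_diag (p := TensorProduct.lift ((LinearMap.mul ℂ (G ⊗[ℂ] C.MaximalProlongation)).comp
      (C.ofM.lTensor G))) (q := TensorProduct.lift (tensorAct π C.MaximalProlongation))
      (fun g e g' f => by simp [tensorAct_tmul, coinv_smul_def]) _ _

end CovariantCalculus

end ProlongationCoaction

/-! ### Subcomodules given by generators. -/

section Generators

variable {G H : Type*} [Ring G] [HopfAlgebra ℂ G] [Ring H] [HopfAlgebra ℂ H] {π : G →ₐc[ℂ] H}
variable {F : Type*} [AddCommGroup F] [Module ℂ F] [Module (coinv π) F]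
  [IsScalarTower ℂ (coinv π) F]

theorem tensorAct_mem_gTensor (W : Submodule (coinv π) F) (s : G ⊗[ℂ] coinv π) {z : G ⊗[ℂ] F}
    (hz : z ∈ gTensor G (W.restrictScalars ℂ)) :
    tensorAct π F s z ∈ gTensor G (W.restrictScalars ℂ) := by
  induction s with
  | zero => simp
  | add x y hx hy => rw [map_add, LinearMap.add_apply]; exact add_mem hx hy
  | tmul g m =>
    have h : gTensor G (W.restrictScalars ℂ) ≤
        (gTensor G (W.restrictScalars ℂ)).comap (tensorAct π F (g ⊗ₜ m)) :=
      gTensor_le fun a w hw => tmul_mem_gTensor _ (W.smul_mem m hw)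
    exact h hz

/-- A submodule generated by elements whose coaction stays in it is a subcomodule. -/
theorem RelHopf.coact_mem_span (R : RelHopf π F) (W : Submodule (coinv π) F) (S : Set F)
    (hS : ∀ s ∈ S, R.coact s ∈ gTensor G (W.restrictScalars ℂ)) (x : F)
    (hx : x ∈ Submodule.span (coinv π) S) : R.coact x ∈ gTensor G (W.restrictScalars ℂ) := by
  induction hx using Submodule.span_induction with
  | mem x hx => exact hS x hx
  | zero => simp
  | add x y _ _ hx hy => rw [map_add]; exact add_mem hx hy
  | smul m x _ hx => rw [R.coact_smul]; exact tensorAct_mem_gTensor W _ hx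

end Generators

/-! ### Representations truncated above degree two. -/

section Truncation

variable {V V₂ : Type*} [AddCommGroup V] [Module ℂ V] [AddCommGroup V₂] [Module ℂ V₂]
  (q : V ⊗[ℂ] V →ₗ[ℂ] V₂)

/-- The left action of `V` on `ℂ ⊕ V ⊕ V₂` defined by a quotient `V₂` of `V ⊗ V`. -/
def truncAct : V →ₗ[ℂ] Module.End ℂ (ℂ × V × V₂) :=
  LinearMap.mk₂ ℂ (fun v x => (0, x.1 • v, q (v ⊗ₜ x.2.1)))
    (fun v w x => by simp [TensorProduct.add_tmul])
    (fun c v x => by simp [← TensorProduct.smul_tmul', smul_comm c])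
    (fun v x y => by simp [TensorProduct.tmul_add, add_smul])
    (fun c v x => by simp [TensorProduct.tmul_smul, mul_smul])

/-- Acting twice moves the `ℂ`-component through `V` into `V₂` and annihilates the other components,
so only `q z` matters. In particular elements killed by `q` act as zero, which makes relations valid
in this representation. -/
theorem lift_truncAct (z : V ⊗[ℂ] V) : TensorProduct.lift
    ((LinearMap.mul ℂ (Module.End ℂ (ℂ × V × V₂))).compl₁₂ (truncAct q) (truncAct q)) z =
      LinearMap.toSpanSingleton ℂ (ℂ × V × V₂) (0, 0, q z) ∘ₗ LinearMap.fst ℂ ℂ (V × V₂) := by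
  refine LinearMap.ext fun x => ?_
  change _ = x.1 • ((0, 0, q z) : ℂ × V × V₂)
  induction z with
  | zero => simp; rfl
  | add z w hz hw =>
    rw [map_add, LinearMap.add_apply, hz, hw]
    simp
  | tmul v w =>
    change ((0, (0 : ℂ) • v, q (v ⊗ₜ (x.1 • w))) : ℂ × V × V₂) = _
    simp

theorem truncAct_comp_zero :
    LinearMap.toSpanSingleton ℂ (ℂ × V × V₂) (0, 0, 0) ∘ₗ LinearMap.fst ℂ ℂ (V × V₂) = 0 :=
  LinearMap.ext fun x => smul_zero x.1

/-- A representation of an algebra on `ℂ ⊕ V ⊕ V₂` through `truncAct` determines the components of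
elements of degrees one and two. -/
theorem exists_components {A : Type*} [Ring A] [Algebra ℂ A]
    (F : A →ₐ[ℂ] Module.End ℂ (ℂ × V × V₂)) :
    ∃ (k₁ : A →ₗ[ℂ] V) (k₂ : A →ₗ[ℂ] V₂),
      (∀ x v, F x = truncAct q v → k₁ x = v) ∧
      (∀ a c x, F a = algebraMap ℂ _ c → k₁ (a * x) = c • k₁ x) ∧
      (∀ a c x, F a = algebraMap ℂ _ c → k₁ (x * a) = c • k₁ x) ∧
      (∀ x z, F x = TensorProduct.lift
        ((LinearMap.mul ℂ (Module.End ℂ (ℂ × V × V₂))).compl₁₂ (truncAct q) (truncAct q)) z →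
          k₂ x = q z) := by
  let e : A →ₗ[ℂ] ℂ × V × V₂ := LinearMap.applyₗ (1, 0, 0) ∘ₗ F.toLinearMap
  have he : ∀ x, e x = F x (1, 0, 0) := fun _ => rfl
  refine ⟨LinearMap.fst ℂ _ _ ∘ₗ LinearMap.snd ℂ _ _ ∘ₗ e,
    LinearMap.snd ℂ _ _ ∘ₗ LinearMap.snd ℂ _ _ ∘ₗ e,
    fun x v h => ?_, fun a c x h => ?_, fun a c x h => ?_, fun x z h => ?_⟩
  · change (e x).2.1 = _
    rw [he, h]
    exact one_smul ℂ _
  · change (e (a * x)).2.1 = c • (e x).2.1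
    rw [he, he, map_mul, h]; rfl
  · change (e (x * a)).2.1 = c • (e x).2.1
    rw [he, he, map_mul, h, ← Algebra.commutes]; rfl
  · change (e x).2.2 = _
    rw [he, h, lift_truncAct]
    exact one_smul ℂ _

end Truncation

/-! ### Relations among products of one-forms. -/

section TwoForms

variable {G H : Type*} [Ring G] [HopfAlgebra ℂ G] [Ring H] [HopfAlgebra ℂ H] {π : G →ₐc[ℂ] H}
variable {Ω : Type*} [AddCommGroup Ω] [Module ℂ Ω]
  [Module (coinv π) Ω] [IsScalarTower ℂ (coinv π) Ω]
  [Module (coinv π)ᵐᵒᵖ Ω] [IsScalarTower ℂ (coinv π)ᵐᵒᵖ Ω]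
  [SMulCommClass (coinv π) (coinv π)ᵐᵒᵖ Ω]

namespace CovariantCalculus

variable (C : CovariantCalculus π Ω)

/-- The preimage of `dN` in `Ω ⊗ Ω`. -/
def relTwo : Submodule (coinv π) (Ω ⊗[ℂ] Ω) := C.dN.comap (balanced (coinv π) Ω Ω).mkQ

theorem balanced_le_relTwo : balanced (coinv π) Ω Ω ≤ C.relTwo := by
  intro t ht
  have : (balanced (coinv π) Ω Ω).mkQ t = 0 := (Submodule.Quotient.mk_eq_zero _).2 ht
  rw [relTwo, Submodule.mem_comap, this]
  exact zero_mem _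

theorem map_d_mem_relTwo {n : coinv π ⊗[ℂ] coinv π} (hn : n ∈ C.N) :
    TensorProduct.map C.d C.d n ∈ C.relTwo := ⟨n, hn, rfl⟩

theorem exists_sub_mem_balanced {t : Ω ⊗[ℂ] Ω} (ht : t ∈ C.relTwo) :
    ∃ n ∈ C.N, t - TensorProduct.map C.d C.d n ∈ balanced (coinv π) Ω Ω := by
  obtain ⟨n, hn, h⟩ := ht
  exact ⟨n, hn, (Submodule.Quotient.eq _).1 h.symm⟩

theorem wedgeForms_smul (m : coinv π) (t : Ω ⊗[ℂ] Ω) :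
    C.wedgeForms (m • t) = C.ofM m * C.wedgeForms t := by
  induction t with
  | zero => simp
  | add x y hx hy => rw [smul_add, map_add, hx, hy, map_add, mul_add]
  | tmul a b =>
    rw [TensorProduct.smul_tmul', wedgeForms_tmul, wedgeForms_tmul, ← ofM_mul_ofForms, mul_assoc]

theorem wedgeForms_relTwo {t : Ω ⊗[ℂ] Ω} (ht : t ∈ C.relTwo) : C.wedgeForms t = 0 := by
  have h : ∀ x ∈ balanced (coinv π) Ω Ω, C.wedgeForms x = 0 := by
    intro x hx
    induction hx using Submodule.span_induction with
    | mem x hx =>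
      obtain ⟨e, a, f, rfl⟩ := hx
      rw [map_sub, wedgeForms_tmul, wedgeForms_tmul, ← ofForms_mul_ofM, ← ofM_mul_ofForms,
        mul_assoc, sub_self]
    | zero => simp
    | add x y _ _ hx hy => rw [map_add, hx, hy, add_zero]
    | smul m x _ hx => rw [wedgeForms_smul, hx, mul_zero]
  obtain ⟨n, hn, hb⟩ := C.exists_sub_mem_balanced ht
  have := h _ hb
  rwa [map_sub, C.wedgeForms_d hn, sub_zero] at this

/-- `Ω ⊗ Ω` as a relative Hopf module. -/
def twoRelHopf : RelHopf π (Ω ⊗[ℂ] Ω) := C.toRelHopf.tensor C.toRelHopf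

theorem twoRelHopf_coact (t : Ω ⊗[ℂ] Ω) :
    C.twoRelHopf.coact t = diagCoact C.coact C.coact t := rfl

/-- The two kinds of relations are treated separately: for the balancing relations the generators
suffice, as the coaction is compatible with both actions of `M`; for `dN`, the subcomodule `N` is
transported by `d ⊗ d`. -/
theorem coact_mem_relTwo {t : Ω ⊗[ℂ] Ω} (ht : t ∈ C.relTwo) :
    diagCoact C.coact C.coact t ∈ gTensor G (C.relTwo.restrictScalars ℂ) := by
  obtain ⟨n, hn, hb⟩ := C.exists_sub_mem_balanced ht
  have h1 : diagCoact C.coact C.coact (t - TensorProduct.map C.d C.d n) ∈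
      gTensor G (C.relTwo.restrictScalars ℂ) := by
    refine C.twoRelHopf.coact_mem_span C.relTwo _ ?_ _ hb
    rintro _ ⟨e, a, f, rfl⟩
    rw [map_sub, twoRelHopf_coact, twoRelHopf_coact, diagCoact_tmul, diagCoact_tmul,
      coact_op_smul, coact_smul]
    have key : ∀ s : G ⊗[ℂ] coinv π, diagMul (tensorActR π Ω s (C.coact e) ⊗ₜ C.coact f) -
        diagMul (C.coact e ⊗ₜ tensorAct π Ω s (C.coact f)) ∈
          gTensor G (C.relTwo.restrictScalars ℂ) := by
      intro s
      induction s with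
      | zero => simp
      | add x y hx hy =>
        simp only [map_add, LinearMap.add_apply, TensorProduct.add_tmul, TensorProduct.tmul_add]
        rw [add_sub_add_comm]
        exact add_mem hx hy
      | tmul g m =>
        rw [gTensor_eq_ker, LinearMap.mem_ker, map_sub, sub_eq_zero]
        exact ext_diag (p := (C.relTwo.restrictScalars ℂ).mkQ.lTensor G ∘ₗ diagMul ∘ₗ
            (tensorActR π Ω (g ⊗ₜ m)).rTensor (G ⊗[ℂ] Ω))
          (q := (C.relTwo.restrictScalars ℂ).mkQ.lTensor G ∘ₗ diagMul ∘ₗ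
            (tensorAct π Ω (g ⊗ₜ m)).lTensor (G ⊗[ℂ] Ω)) (fun a e b f => by
            simp only [LinearMap.comp_apply, LinearMap.rTensor_tmul, LinearMap.lTensor_tmul,
              tensorActR_tmul, tensorAct_tmul, diagMul_tmul, mul_assoc]
            congr 1
            exact (Submodule.Quotient.eq _).2 (C.balanced_le_relTwo
              (Submodule.subset_span ⟨e, m, f, rfl⟩))) _ _
    exact key _
  have h2 : diagCoact C.coact C.coact (TensorProduct.map C.d C.d n) ∈
      gTensor G (C.relTwo.restrictScalars ℂ) := by
    rw [diagCoact_map C.d C.d C.coact_d C.coact_d]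
    have h3 : gTensor G C.N ≤ (gTensor G (C.relTwo.restrictScalars ℂ)).comap
        ((TensorProduct.map C.d C.d).lTensor G) :=
      gTensor_le fun g n hn => tmul_mem_gTensor g (C.map_d_mem_relTwo hn)
    exact h3 (C.diagCoact_mem_N hn)
  have := add_mem h1 h2
  rwa [← map_add, sub_add_cancel] at this

/-- The map `ω ⊗ ω' ↦ σ[ω] ⊗ σ[ω']`. -/
def sigmaSq : Ω ⊗[ℂ] Ω →ₗ[ℂ] C.V ⊗[ℂ] C.V := TensorProduct.map C.sigmaMk C.sigmaMk

theorem sigmaSq_tmul (ω ω' : Ω) : C.sigmaSq (ω ⊗ₜ ω') = C.sigmaMk ω ⊗ₜ C.sigmaMk ω' := rfl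

variable (h0 : IsInM0 π Ω)

theorem sigmaTwo_mk (t : Ω ⊗[ℂ] Ω) :
    C.sigmaTwo h0 (Phi.mk (counitM π) (BTensor.mk t)) = C.sigmaSq t := by
  induction t with
  | zero => simp
  | add x y hx hy => simp only [map_add, hx, hy]
  | tmul a b => rfl

theorem ITwo_eq : C.ITwo h0 = (C.relTwo.restrictScalars ℂ).map C.sigmaSq := by
  ext z
  constructor
  · rintro ⟨_, ⟨x, hx, rfl⟩, rfl⟩
    obtain ⟨t, rfl⟩ := Submodule.mkQ_surjective _ x
    exact ⟨t, hx, (C.sigmaTwo_mk h0 t).symm⟩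
  · rintro ⟨t, ht, rfl⟩
    exact ⟨_, ⟨BTensor.mk t, ht, rfl⟩, C.sigmaTwo_mk h0 t⟩

-- `σ²` is injective on `Φ(Ω ⊗_M Ω)`, and `M⁺(Ω ⊗_M Ω)` is the image of `M⁺(Ω ⊗ Ω)`. Passing from
-- `⊗_M` back to `⊗` costs only balancing relations, which belong to `relTwo`.
include h0 in
theorem mem_of_sigmaSq_eq_zero {t : Ω ⊗[ℂ] Ω} (ht : C.sigmaSq t = 0) :
    t ∈ C.relTwo.restrictScalars ℂ ⊔ augSub (counitM π) (Ω ⊗[ℂ] Ω) := by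
  rw [← C.sigmaTwo_mk h0, LinearEquiv.map_eq_zero_iff] at ht
  have h1 : BTensor.mk t ∈ augSub (counitM π) (Omega2T π Ω) :=
    (Submodule.Quotient.mk_eq_zero _).1 ht
  have h2 : ∀ x ∈ augSub (counitM π) (Omega2T π Ω), ∃ s ∈ augSub (counitM π) (Ω ⊗[ℂ] Ω),
      BTensor.mk s = x := by
    intro x hx
    induction hx using Submodule.span_induction with
    | mem x hx =>
      obtain ⟨a, e, ha, rfl⟩ := hx
      obtain ⟨s, rfl⟩ := Submodule.mkQ_surjective _ e
      exact ⟨a • s, Submodule.subset_span ⟨a, s, ha, rfl⟩, rfl⟩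
    | zero => exact ⟨0, zero_mem _, map_zero _⟩
    | add x y _ _ hx hy =>
      obtain ⟨s, hs, rfl⟩ := hx
      obtain ⟨s', hs', rfl⟩ := hy
      exact ⟨s + s', add_mem hs hs', map_add _ _ _⟩
    | smul c x _ hx =>
      obtain ⟨s, hs, rfl⟩ := hx
      exact ⟨c • s, Submodule.smul_mem _ _ hs, map_smul _ _ _⟩
  obtain ⟨s, hs, hst⟩ := h2 _ h1
  refine Submodule.mem_sup.2 ⟨t - s, ?_, s, hs, sub_add_cancel _ _⟩
  exact C.balanced_le_relTwo ((Submodule.Quotient.eq _).1 hst.symm)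

theorem mem_of_sigmaSq_mem {t : Ω ⊗[ℂ] Ω} (ht : C.sigmaSq t ∈ C.ITwo h0) :
    t ∈ C.relTwo.restrictScalars ℂ ⊔ augSub (counitM π) (Ω ⊗[ℂ] Ω) := by
  rw [ITwo_eq] at ht
  obtain ⟨s, hs, hst⟩ := ht
  have h1 := C.mem_of_sigmaSq_eq_zero h0 (t := t - s) (by rw [map_sub, hst, sub_self])
  have := add_mem h1 (Submodule.mem_sup_left hs)
  rwa [sub_add_cancel] at this

include h0 in
theorem sigmaMk_op_smul_eq (m : coinv π) (ω : Ω) :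
    C.sigmaMk (MulOpposite.op m • ω) = counitM π m • C.sigmaMk ω := by
  rw [sigmaMk_apply, h0.mk_op_smul, map_smul]; rfl

/-- A linear map `V → Q` into an algebra whose square vanishes on `I²` defines a representation of
the maximal prolongation on which `M` acts by the counit. -/
theorem exists_prolongation_rep {Q : Type*} [Ring Q] [Algebra ℂ Q] (L : C.V →ₗ[ℂ] Q)
    (hL : ∀ z ∈ C.ITwo h0, TensorProduct.lift ((LinearMap.mul ℂ Q).compl₁₂ L L) z = 0) :
    ∃ F : C.MaximalProlongation →ₐ[ℂ] Q,
      (∀ m, F (C.ofM m) = algebraMap ℂ Q (counitM π m)) ∧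
        (∀ ω, F (C.ofForms ω) = L (C.sigmaMk ω)) ∧
          ∀ t, F (C.wedgeForms t) =
            TensorProduct.lift ((LinearMap.mul ℂ Q).compl₁₂ L L) (C.sigmaSq t) := by
  suffices h : ∃ F : C.MaximalProlongation →ₐ[ℂ] Q,
      (∀ m, F (C.ofM m) = algebraMap ℂ Q (counitM π m)) ∧
        ∀ ω, F (C.ofForms ω) = L (C.sigmaMk ω) by
    obtain ⟨F, hM, hΩ⟩ := h
    refine ⟨F, hM, hΩ, fun t => ?_⟩
    induction t with
    | zero => simp
    | add x y hx hy => rw [map_add, map_add, map_add, map_add, hx, hy]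
    | tmul a b => rw [wedgeForms_tmul, map_mul, hΩ, hΩ]; rfl
  refine C.exists_prolongation_lift (Algebra.linearMap ℂ Q ∘ₗ (counitM π).toLinearMap)
    (L ∘ₗ C.sigmaMk) ?_ ?_ ?_ ?_ ?_
  · exact (congrArg (algebraMap ℂ Q) (map_one (counitM π))).trans (map_one _)
  · intro a b
    exact (congrArg (algebraMap ℂ Q) (map_mul (counitM π) a b)).trans (map_mul _ _ _)
  · intro m ω
    change algebraMap ℂ Q (counitM π m) * L (C.sigmaMk ω) = L (C.sigmaMk (m • ω))
    rw [sigmaMk_smul, map_smul, Algebra.smul_def]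
  · intro m ω
    change L (C.sigmaMk ω) * algebraMap ℂ Q (counitM π m) = L (C.sigmaMk (MulOpposite.op m • ω))
    rw [C.sigmaMk_op_smul_eq h0 m ω, map_smul, ← Algebra.commutes, ← Algebra.smul_def]
  · intro t ht
    have h1 : C.sigmaSq (TensorProduct.map C.d C.d t) ∈ C.ITwo h0 := by
      rw [ITwo_eq]; exact ⟨_, C.map_d_mem_relTwo ht, rfl⟩
    rw [← hL _ h1]
    generalize TensorProduct.map C.d C.d t = s
    induction s with
    | zero => simp
    | add x y hx hy => simp only [map_add, hx, hy]
    | tmul a b => rfl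

/-- The prolongation is given by generators and relations, so its low degrees are detected by a
representation: `V` raises degrees in `ℂ ⊕ V ⊕ V²_M` and `M` acts by the counit. The components of
the image of `(1, 0, 0)` are the two maps. -/
theorem exists_truncation : ∃ (k₁ : C.MaximalProlongation →ₗ[ℂ] C.V)
    (k₂ : C.MaximalProlongation →ₗ[ℂ] C.VTwo h0),
    (∀ ω, k₁ (C.ofForms ω) = C.sigmaMk ω) ∧
    (∀ m x, k₁ (C.ofM m * x) = counitM π m • k₁ x) ∧
    (∀ m x, k₁ (x * C.ofM m) = counitM π m • k₁ x) ∧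
    ∀ t, k₂ (C.wedgeForms t) = (C.ITwo h0).mkQ (C.sigmaSq t) := by
  obtain ⟨F, hM, hΩ, hw⟩ := C.exists_prolongation_rep h0 (truncAct (C.ITwo h0).mkQ) (fun z hz => by
    rw [lift_truncAct, (show (C.ITwo h0).mkQ z = 0 from (Submodule.Quotient.mk_eq_zero _).2 hz),
      truncAct_comp_zero])
  obtain ⟨k₁, k₂, h1, h2, h3, h4⟩ := exists_components (C.ITwo h0).mkQ F
  exact ⟨k₁, k₂, fun ω => h1 _ _ (hΩ ω), fun m x => h2 _ _ x (hM m),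
    fun m x => h3 _ _ x (hM m), fun t => h4 _ _ (hw t)⟩

theorem sigmaSq_mem_of_wedgeForms_eq_zero {t : Ω ⊗[ℂ] Ω} (ht : C.wedgeForms t = 0) :
    C.sigmaSq t ∈ C.ITwo h0 := by
  obtain ⟨k₁, k₂, -, -, -, h⟩ := C.exists_truncation h0
  have := h t
  rw [ht, map_zero] at this
  exact (Submodule.Quotient.mk_eq_zero _).1 this.symm

end CovariantCalculus

end TwoForms

/-! ### Completeness of the relations in degree two. -/

section Kernel

variable {G H : Type u} [Ring G] [HopfAlgebra ℂ G] [Ring H] [HopfAlgebra ℂ H] {π : G →ₐc[ℂ] H}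
variable {Ω : Type u} [AddCommGroup Ω] [Module ℂ Ω]
  [Module (coinv π) Ω] [IsScalarTower ℂ (coinv π) Ω]
  [Module (coinv π)ᵐᵒᵖ Ω] [IsScalarTower ℂ (coinv π)ᵐᵒᵖ Ω]
  [SMulCommClass (coinv π) (coinv π)ᵐᵒᵖ Ω]

/-- The relations among products of one-forms are those generated by `dN`. -/
theorem CovariantCalculus.mem_relTwo_iff (hff : IsFaithfullyFlatRight π)
    (C : CovariantCalculus π Ω) (h0 : IsInM0 π Ω) (t : Ω ⊗[ℂ] Ω) :
    t ∈ C.relTwo ↔ C.wedgeForms t = 0 := by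
  refine ⟨C.wedgeForms_relTwo, fun ht => ?_⟩
  -- Descent: the kernel of `wedgeForms` is a subcomodule by colinearity, and the truncated
  -- representation places it in `relTwo` up to `M⁺(Ω ⊗ Ω)`.
  refine C.twoRelHopf.le_of_le_sup_augSub hff C.relTwo (fun w hw => C.coact_mem_relTwo hw)
    (LinearMap.ker C.wedgeForms) (fun z hz => ?_) (fun z hz => ?_) ht
  · rw [gTensor_ker, LinearMap.mem_ker, twoRelHopf_coact, ← prolongationCoact_wedgeForms,
      LinearMap.mem_ker.1 hz, map_zero]
  · exact C.mem_of_sigmaSq_mem h0 (C.sigmaSq_mem_of_wedgeForms_eq_zero h0 hz)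

end Kernel

/-! ### Gradings as coactions of monoid algebras. -/

section Gradings

variable {A ι : Type*} [Ring A] [Algebra ℂ A] [AddCommMonoid ι] [DecidableEq ι]

/-- The homogeneous elements for the coaction `φ` of the monoid algebra of `ι`. -/
def gradedPart (φ : A →ₐ[ℂ] AddMonoidAlgebra A ι) (i : ι) : Submodule ℂ A :=
  LinearMap.ker (φ.toLinearMap - AddMonoidAlgebra.lsingle (R := ℂ) i)

variable {φ : A →ₐ[ℂ] AddMonoidAlgebra A ι}

theorem mem_gradedPart {i : ι} {x : A} : x ∈ gradedPart φ i ↔ φ x = AddMonoidAlgebra.single i x := by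
  rw [gradedPart, LinearMap.mem_ker, LinearMap.sub_apply, sub_eq_zero]
  rfl

theorem one_mem_gradedPart : 1 ∈ gradedPart φ 0 := by
  rw [mem_gradedPart, map_one]; rfl

theorem mul_mem_gradedPart {i j : ι} {x y : A} (hx : x ∈ gradedPart φ i)
    (hy : y ∈ gradedPart φ j) : x * y ∈ gradedPart φ (i + j) := by
  rw [mem_gradedPart] at *
  rw [map_mul, hx, hy, AddMonoidAlgebra.single_mul_single]

/-- The coefficient of `φ x` at `i`. -/
def gradedCoeff (φ : A →ₐ[ℂ] AddMonoidAlgebra A ι) (i : ι) : A →ₗ[ℂ] A :=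
  Finsupp.lapply i ∘ₗ (AddMonoidAlgebra.coeffLinearEquiv ℂ).toLinearMap ∘ₗ φ.toLinearMap

theorem gradedCoeff_of_mem {i : ι} (j : ι) {x : A} (hx : x ∈ gradedPart φ i) :
    gradedCoeff φ j x = if i = j then x else 0 := by
  have h : gradedCoeff φ j x = (φ x).coeff j := rfl
  rw [h, mem_gradedPart.1 hx, AddMonoidAlgebra.coeff_single, Finsupp.single_apply]

/-- Independence is seen by the coefficient maps: the coefficient at `i` is the identity on the part
of degree `i` and zero on all others. -/
theorem isInternal_gradedPart (h : ⨆ i, gradedPart φ i = ⊤) :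
    DirectSum.IsInternal (gradedPart φ) := by
  rw [DirectSum.isInternal_submodule_iff_iSupIndep_and_iSup_eq_top]
  refine ⟨fun i => Submodule.disjoint_def.2 fun x hx hx' => ?_, h⟩
  have h1 : ⨆ j, ⨆ (_ : j ≠ i), gradedPart φ j ≤ LinearMap.ker (gradedCoeff φ i) :=
    iSup₂_le fun j hj y hy => by
      rw [LinearMap.mem_ker, gradedCoeff_of_mem i hy, if_neg hj]
  have h2 := LinearMap.mem_ker.1 (h1 hx')
  rwa [gradedCoeff_of_mem i hx, if_pos rfl] at h2

/-- A linear map on a direct sum can be prescribed on the summands. -/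
theorem exists_of_summands {𝒜 : ι → Submodule ℂ A} (h : DirectSum.IsInternal 𝒜) {B : Type*}
    [AddCommGroup B] [Module ℂ B] (L : ι → A →ₗ[ℂ] B) :
    ∃ E : A →ₗ[ℂ] B, ∀ i, ∀ x ∈ 𝒜 i, E x = L i x := by
  let e : (DirectSum ι fun i => 𝒜 i) ≃ₗ[ℂ] A :=
    LinearEquiv.ofBijective (DirectSum.coeLinearMap 𝒜) h
  refine ⟨DirectSum.toModule ℂ ι B (fun i => L i ∘ₗ (𝒜 i).subtype) ∘ₗ e.symm.toLinearMap,
    fun i x hx => ?_⟩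
  have h1 : e.symm x = DirectSum.lof ℂ ι (fun i => 𝒜 i) i ⟨x, hx⟩ := by
    rw [LinearEquiv.symm_apply_eq]
    exact (DirectSum.coeLinearMap_lof 𝒜 i ⟨x, hx⟩).symm
  rw [LinearMap.comp_apply, LinearEquiv.coe_coe, h1, DirectSum.toModule_lof]
  rfl

/-- The projections on the summands of a direct sum decomposition. -/
theorem exists_gradedProj {𝒜 : ι → Submodule ℂ A} (h : DirectSum.IsInternal 𝒜) :
    ∃ p : ι → A →ₗ[ℂ] A, (∀ i x, p i x ∈ 𝒜 i) ∧
      ∀ i j, ∀ x ∈ 𝒜 i, p j x = if i = j then x else 0 := by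
  choose p hp using fun j => exists_of_summands h
    (fun i => if i = j then LinearMap.id else (0 : A →ₗ[ℂ] A))
  have hp' : ∀ i j, ∀ x ∈ 𝒜 i, p j x = if i = j then x else 0 := fun i j x hx => by
    rw [hp j i x hx]; split_ifs <;> rfl
  refine ⟨p, fun i x => ?_, hp'⟩
  have hx : ⊤ ≤ (𝒜 i).comap (p i) := by
    rw [← h.submodule_iSup_eq_top]
    refine iSup_le fun j x hx => ?_
    rw [Submodule.mem_comap, hp' j i x hx]
    split_ifs with hij
    · exact hij ▸ hx
    · exact zero_mem _
  exact hx trivial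

/-- Subspaces `D k ≤ ⨁_{f i = k} 𝒜 i` which span `⨁ 𝒜 i` are equal to these sums. -/
theorem eq_iSup_of_le {𝒜 : ι → Submodule ℂ A} (h : DirectSum.IsInternal 𝒜) {κ : Type*}
    (f : ι → κ) (D : κ → Submodule ℂ A) (hD : ∀ k, D k ≤ ⨆ i ∈ {i | f i = k}, 𝒜 i)
    (hD' : ⨆ k, D k = ⊤) (k : κ) : D k = ⨆ i ∈ {i | f i = k}, 𝒜 i := by
  classical
  -- `E` projects onto the summands lying over `k`. It is the identity on `D k` and zero on the
  -- other `D l`, so it maps everything into `D k`.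
  obtain ⟨E, hE⟩ := exists_of_summands h
    (fun i => if f i = k then LinearMap.id else (0 : A →ₗ[ℂ] A))
  have h1 : ∀ l, D l ≤ (D k).comap E := by
    intro l y hy
    have h2 : ⨆ j ∈ {j | f j = l}, 𝒜 j ≤
        LinearMap.ker (E - if l = k then LinearMap.id else 0) := iSup₂_le fun j hj z hz => by
      have hj : f j = l := hj
      rw [LinearMap.mem_ker, LinearMap.sub_apply, hE j z hz, hj, sub_self]
    have h3 := sub_eq_zero.1 (LinearMap.mem_ker.1 (h2 (hD l hy)))
    rw [Submodule.mem_comap, h3]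
    split_ifs with hl
    · exact hl ▸ hy
    · exact zero_mem _
  have h4 : ⊤ ≤ (D k).comap E := hD' ▸ iSup_le h1
  refine le_antisymm (hD k) (iSup₂_le fun i hi x hx => ?_)
  have hi : f i = k := hi
  have h5 := hE i x hx
  rw [if_pos hi] at h5
  have h6 : E x ∈ D k := h4 trivial
  rwa [h5] at h6

end Gradings

/-! ### Components of `E ⊗ E` for a decomposition of `E`. -/

section TensorMaps

variable {E F E' F' : Type*} [AddCommGroup E] [Module ℂ E] [AddCommGroup F] [Module ℂ F]
  [AddCommGroup E'] [Module ℂ E'] [AddCommGroup F'] [Module ℂ F']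

theorem map_eq_map_of_mem {f f' : E →ₗ[ℂ] E'} {g g' : F →ₗ[ℂ] F'} {U : Submodule ℂ E}
    {W : Submodule ℂ F} (hf : ∀ x ∈ U, f x = f' x) (hg : ∀ x ∈ W, g x = g' x) {t : E ⊗[ℂ] F}
    (ht : t ∈ Submodule.map₂ (TensorProduct.mk ℂ E F) U W) :
    TensorProduct.map f g t = TensorProduct.map f' g' t := by
  have : Submodule.map₂ (TensorProduct.mk ℂ E F) U W ≤
      LinearMap.ker (TensorProduct.map f g - TensorProduct.map f' g') := by
    refine Submodule.map₂_le.2 fun x hx y hy => ?_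
    rw [LinearMap.mem_ker, LinearMap.sub_apply, TensorProduct.mk_apply, TensorProduct.map_tmul,
      TensorProduct.map_tmul, hf x hx, hg y hy, sub_self]
  exact sub_eq_zero.1 (LinearMap.mem_ker.1 (this ht))

theorem map_mem_map₂ {f : E →ₗ[ℂ] E'} {g : F →ₗ[ℂ] F'} {U : Submodule ℂ E'} {W : Submodule ℂ F'}
    (hf : ∀ x, f x ∈ U) (hg : ∀ x, g x ∈ W) (t : E ⊗[ℂ] F) :
    TensorProduct.map f g t ∈ Submodule.map₂ (TensorProduct.mk ℂ E' F') U W := by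
  induction t with
  | zero => simp
  | add x y hx hy => rw [map_add]; exact add_mem hx hy
  | tmul x y => exact Submodule.apply_mem_map₂ _ (hf x) (hg y)

theorem map_map₂_mk (f : E →ₗ[ℂ] E') (g : F →ₗ[ℂ] F') (U : Submodule ℂ E) (W : Submodule ℂ F) :
    (Submodule.map₂ (TensorProduct.mk ℂ E F) U W).map (TensorProduct.map f g) =
      Submodule.map₂ (TensorProduct.mk ℂ E' F') (U.map f) (W.map g) := by
  rw [Submodule.map_map₂, Submodule.map₂_map_map]
  rfl

variable {U W : Submodule ℂ E} (h : IsCompl U W)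

theorem projection_eq_of_mem {x : E} (hx : x ∈ U) : U.projection W h x = (LinearMap.id : E →ₗ[ℂ] E) x :=
  Submodule.projection_apply_left h ⟨x, hx⟩

theorem projection_eq_zero_of_mem {x : E} (hx : x ∈ W) :
    U.projection W h x = (0 : E →ₗ[ℂ] E) x := Submodule.projection_apply_right h ⟨x, hx⟩

/-- The components of an element of `E ⊗ E` for the decomposition `E = U ⊕ W`. -/
theorem map_projection_add (t : E ⊗[ℂ] E) :
    TensorProduct.map (U.projection W h) (U.projection W h) t +
      (TensorProduct.map (U.projection W h) (W.projection U h.symm) t +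
        TensorProduct.map (W.projection U h.symm) (U.projection W h) t) +
      TensorProduct.map (W.projection U h.symm) (W.projection U h.symm) t = t := by
  induction t with
  | zero => simp
  | add x y hx hy =>
    conv_rhs => rw [← hx, ← hy]
    simp only [map_add]
    abel
  | tmul x y =>
    conv_rhs => rw [← Submodule.projection_add_projection_eq_self h x,
      ← Submodule.projection_add_projection_eq_self h y]
    simp only [TensorProduct.map_tmul, TensorProduct.add_tmul, TensorProduct.tmul_add]
    abel

/-- A subspace of `E ⊗ E` is homogeneous for `E = U ⊕ W` if and only if it is stable under the
projections on the components. -/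
theorem eq_sup_inf_iff (I : Submodule ℂ (E ⊗[ℂ] E)) :
    I = (I ⊓ Submodule.map₂ (TensorProduct.mk ℂ E E) U U) ⊔
        (I ⊓ (Submodule.map₂ (TensorProduct.mk ℂ E E) U W ⊔
          Submodule.map₂ (TensorProduct.mk ℂ E E) W U)) ⊔
        (I ⊓ Submodule.map₂ (TensorProduct.mk ℂ E E) W W) ↔
      ∀ t ∈ I, TensorProduct.map (U.projection W h) (U.projection W h) t ∈ I ∧
        TensorProduct.map (U.projection W h) (W.projection U h.symm) t +
          TensorProduct.map (W.projection U h.symm) (U.projection W h) t ∈ I ∧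
        TensorProduct.map (W.projection U h.symm) (W.projection U h.symm) t ∈ I := by
  have pU : ∀ x ∈ U, U.projection W h x = LinearMap.id x := fun x hx => projection_eq_of_mem h hx
  have pW : ∀ x ∈ W, U.projection W h x = (0 : E →ₗ[ℂ] E) x :=
    fun x hx => projection_eq_zero_of_mem h hx
  have qW : ∀ x ∈ W, W.projection U h.symm x = LinearMap.id x :=
    fun x hx => projection_eq_of_mem h.symm hx
  have qU : ∀ x ∈ U, W.projection U h.symm x = (0 : E →ₗ[ℂ] E) x :=
    fun x hx => projection_eq_zero_of_mem h.symm hx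
  constructor
  · intro hI t ht
    rw [hI] at ht
    obtain ⟨s, hs, c, hc, rfl⟩ := Submodule.mem_sup.1 ht
    obtain ⟨a, ha, b, hb, rfl⟩ := Submodule.mem_sup.1 hs
    obtain ⟨b₁, hb₁, b₂, hb₂, rfl⟩ := Submodule.mem_sup.1 hb.2
    have hb' : b₁ + b₂ ∈ I := hb.1
    simp only [map_add]
    -- Four tensor products of projections meet four pure components; in each of the sixteen cases
    -- every projection is the identity or zero.
    rw [map_eq_map_of_mem pU pU ha.2, map_eq_map_of_mem pU pW hb₁, map_eq_map_of_mem pW pU hb₂,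
      map_eq_map_of_mem pW pW hc.2, map_eq_map_of_mem pU qU ha.2, map_eq_map_of_mem pU qW hb₁,
      map_eq_map_of_mem pW qU hb₂, map_eq_map_of_mem pW qW hc.2, map_eq_map_of_mem qU pU ha.2,
      map_eq_map_of_mem qU pW hb₁, map_eq_map_of_mem qW pU hb₂, map_eq_map_of_mem qW pW hc.2,
      map_eq_map_of_mem qU qU ha.2, map_eq_map_of_mem qU qW hb₁, map_eq_map_of_mem qW qU hb₂,
      map_eq_map_of_mem qW qW hc.2]
    simp only [TensorProduct.map_zero_left, TensorProduct.map_zero_right, TensorProduct.map_id,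
      LinearMap.zero_apply, LinearMap.id_apply, add_zero, zero_add]
    exact ⟨ha.1, hb', hc.1⟩
  · intro hI
    refine le_antisymm (fun t ht => ?_) (sup_le (sup_le inf_le_left inf_le_left) inf_le_left)
    obtain ⟨h1, h2, h3⟩ := hI t ht
    have hp := Submodule.projection_apply_mem h
    have hq := Submodule.projection_apply_mem h.symm
    rw [← map_projection_add h t]
    refine add_mem (Submodule.mem_sup_left (add_mem (Submodule.mem_sup_left
      ⟨h1, map_mem_map₂ hp hp t⟩) (Submodule.mem_sup_right ⟨h2, ?_⟩)))
      (Submodule.mem_sup_right ⟨h3, map_mem_map₂ hq hq t⟩)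
    exact add_mem (Submodule.mem_sup_left (map_mem_map₂ hp hq t))
      (Submodule.mem_sup_right (map_mem_map₂ hq hp t))

end TensorMaps

/-! ### Degrees of forms and coactions of the monoid algebra of `ℕ × ℕ`. -/

section Prolongation

variable {G H : Type*} [Ring G] [HopfAlgebra ℂ G] [Ring H] [HopfAlgebra ℂ H] {π : G →ₐc[ℂ] H}
variable {Ω : Type*} [AddCommGroup Ω] [Module ℂ Ω]
  [Module (coinv π) Ω] [IsScalarTower ℂ (coinv π) Ω]
  [Module (coinv π)ᵐᵒᵖ Ω] [IsScalarTower ℂ (coinv π)ᵐᵒᵖ Ω]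
  [SMulCommClass (coinv π) (coinv π)ᵐᵒᵖ Ω]

namespace CovariantCalculus

variable (C : CovariantCalculus π Ω)

theorem map_sigmaTwo_image (h0 : IsInM0 π Ω) (S : Submodule ℂ (Ω ⊗[ℂ] Ω)) :
    (Phi.image (counitM π) (S.map BTensor.mk)).map (C.sigmaTwo h0).toLinearMap =
      S.map C.sigmaSq := by
  ext z
  constructor
  · rintro ⟨_, ⟨_, ⟨t, ht, rfl⟩, rfl⟩, rfl⟩
    exact ⟨t, ht, (C.sigmaTwo_mk h0 t).symm⟩
  · rintro ⟨t, ht, rfl⟩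
    exact ⟨_, ⟨_, ⟨t, ht, rfl⟩, rfl⟩, C.sigmaTwo_mk h0 t⟩

theorem map_sigmaTwo_subTensor (h0 : IsInM0 π Ω) (X Y : Submodule ℂ Ω) :
    (Phi.image (counitM π) (subTensor π X Y)).map (C.sigmaTwo h0).toLinearMap =
      Submodule.map₂ (TensorProduct.mk ℂ C.V C.V) (C.toV X) (C.toV Y) := by
  rw [subTensor, map_sigmaTwo_image, sigmaSq, map_map₂_mk, toV_eq_map, toV_eq_map]

theorem V11_eq (h0 : IsInM0 π Ω) (X Y : Submodule ℂ Ω) :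
    C.V11 h0 X Y = Submodule.map₂ (TensorProduct.mk ℂ C.V C.V) (C.toV X) (C.toV Y) ⊔
      Submodule.map₂ (TensorProduct.mk ℂ C.V C.V) (C.toV Y) (C.toV X) := by
  rw [V11, Phi.image, Submodule.map_sup, Submodule.map_sup]
  exact congrArg₂ _ (C.map_sigmaTwo_subTensor h0 X Y) (C.map_sigmaTwo_subTensor h0 Y X)

/-- The maximal prolongation is spanned by products from the left. -/
theorem eq_top_of_left_stable (T : Submodule ℂ C.MaximalProlongation) (h1 : 1 ∈ T)
    (hM : ∀ m, ∀ x ∈ T, C.ofM m * x ∈ T) (hΩ : ∀ ω, ∀ x ∈ T, C.ofForms ω * x ∈ T) : T = ⊤ := by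
  let S : Subalgebra ℂ C.MaximalProlongation :=
    { carrier := {x | ∀ y ∈ T, x * y ∈ T}
      mul_mem' := fun {a b} ha hb y hy => by rw [mul_assoc]; exact ha _ (hb _ hy)
      add_mem' := fun {a b} ha hb y hy => by rw [add_mul]; exact add_mem (ha _ hy) (hb _ hy)
      algebraMap_mem' := fun r y hy => by rw [← Algebra.smul_def]; exact T.smul_mem _ hy }
  refine eq_top_iff.2 fun x _ => ?_
  have := C.prolongation_mem_of_generators S hM hΩ x 1 h1
  rwa [mul_one] at this

theorem range_ofM_mul_degree (k : ℕ) : LinearMap.range C.ofM * C.degree k ≤ C.degree k := by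
  rw [degree, ← mul_assoc]
  refine mul_le_mul_left (Submodule.mul_le.2 ?_) _
  rintro _ ⟨a, rfl⟩ _ ⟨b, rfl⟩
  exact ⟨a * b, C.ofM_mul a b⟩

theorem one_mem_range_ofM : 1 ∈ LinearMap.range C.ofM := ⟨1, C.ofM_one⟩

theorem range_ofForms_mul_range_ofM :
    LinearMap.range C.ofForms * LinearMap.range C.ofM ≤ LinearMap.range C.ofForms := by
  refine Submodule.mul_le.2 ?_
  rintro _ ⟨a, rfl⟩ _ ⟨b, rfl⟩
  exact ⟨_, (C.ofForms_mul_ofM b a).symm⟩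

theorem range_ofM_mul_range_ofForms :
    LinearMap.range C.ofM * LinearMap.range C.ofForms ≤ LinearMap.range C.ofForms := by
  refine Submodule.mul_le.2 ?_
  rintro _ ⟨a, rfl⟩ _ ⟨b, rfl⟩
  exact ⟨_, (C.ofM_mul_ofForms a b).symm⟩

theorem range_ofForms_mul_degree (k : ℕ) :
    LinearMap.range C.ofForms * C.degree k ≤ C.degree (k + 1) := by
  rw [degree, ← mul_assoc, degree, pow_succ']
  refine (mul_le_mul_left C.range_ofForms_mul_range_ofM _).trans ?_
  exact (one_mul (LinearMap.range C.ofForms * LinearMap.range C.ofForms ^ k)).ge.trans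
    (mul_le_mul_left (Submodule.one_le.2 C.one_mem_range_ofM) _)

theorem iSup_degree : ⨆ k, C.degree k = ⊤ := by
  refine C.eq_top_of_left_stable _ ?_ (fun m x hx => ?_) (fun ω x hx => ?_)
  · refine Submodule.mem_iSup_of_mem 0 ?_
    rw [degree, pow_zero, mul_one]
    exact C.one_mem_range_ofM
  · induction hx using Submodule.iSup_induction' with
    | mem k x hx =>
      exact Submodule.mem_iSup_of_mem k (C.range_ofM_mul_degree k (Submodule.mul_mem_mul ⟨m, rfl⟩ hx))
    | zero => rw [mul_zero]; exact zero_mem _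
    | add x y _ _ hx hy => rw [mul_add]; exact add_mem hx hy
  · induction hx using Submodule.iSup_induction' with
    | mem k x hx =>
      exact Submodule.mem_iSup_of_mem (k + 1) (C.range_ofForms_mul_degree k (Submodule.mul_mem_mul ⟨ω, rfl⟩ hx))
    | zero => rw [mul_zero]; exact zero_mem _
    | add x y _ _ hx hy => rw [mul_add]; exact add_mem hx hy

theorem degree_one : C.degree 1 = LinearMap.range C.ofForms := by
  rw [degree, pow_one]
  refine le_antisymm C.range_ofM_mul_range_ofForms ?_
  exact (one_mul (LinearMap.range C.ofForms)).ge.trans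
    (mul_le_mul_left (Submodule.one_le.2 C.one_mem_range_ofM) _)

/-- Bimodule endomorphisms `P`, `Q` of `Ω` whose products preserve the relations define a
coaction of the monoid algebra of `ℕ × ℕ` on the maximal prolongation. -/
theorem exists_bigrading_coaction (P Q : Ω →ₗ[ℂ] Ω) (hP : ∀ (m : coinv π) ω, P (m • ω) = m • P ω)
    (hP' : ∀ (m : coinv π) ω, P (MulOpposite.op m • ω) = MulOpposite.op m • P ω)
    (hQ : ∀ (m : coinv π) ω, Q (m • ω) = m • Q ω)
    (hQ' : ∀ (m : coinv π) ω, Q (MulOpposite.op m • ω) = MulOpposite.op m • Q ω)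
    (hr : ∀ t ∈ C.relTwo, TensorProduct.map P P t ∈ C.relTwo ∧
      TensorProduct.map P Q t + TensorProduct.map Q P t ∈ C.relTwo ∧
      TensorProduct.map Q Q t ∈ C.relTwo) :
    ∃ φ : C.MaximalProlongation →ₐ[ℂ] AddMonoidAlgebra C.MaximalProlongation (ℕ × ℕ),
      (∀ m, φ (C.ofM m) = AddMonoidAlgebra.single 0 (C.ofM m)) ∧
      ∀ ω, φ (C.ofForms ω) = AddMonoidAlgebra.single (1, 0) (C.ofForms (P ω)) +
        AddMonoidAlgebra.single (0, 1) (C.ofForms (Q ω)) := by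
  let g : Ω →ₗ[ℂ] AddMonoidAlgebra C.MaximalProlongation (ℕ × ℕ) :=
    AddMonoidAlgebra.lsingle (1, 0) ∘ₗ C.ofForms ∘ₗ P +
      AddMonoidAlgebra.lsingle (0, 1) ∘ₗ C.ofForms ∘ₗ Q
  have hg : ∀ ω, g ω = AddMonoidAlgebra.single (1, 0) (C.ofForms (P ω)) +
        AddMonoidAlgebra.single (0, 1) (C.ofForms (Q ω)) := fun _ => rfl
  -- The product of two one-forms splits by bidegree into the three expressions which `hr` controls.
  have hgg : ∀ t, TensorProduct.lift ((LinearMap.mul ℂ _).compl₁₂ g g) t =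
      AddMonoidAlgebra.single (2, 0) (C.wedgeForms (TensorProduct.map P P t)) +
      AddMonoidAlgebra.single (1, 1) (C.wedgeForms
        (TensorProduct.map P Q t + TensorProduct.map Q P t)) +
      AddMonoidAlgebra.single (0, 2) (C.wedgeForms (TensorProduct.map Q Q t)) := by
    intro t
    induction t with
    | zero => simp
    | add x y hx hy =>
      rw [map_add, hx, hy]
      simp only [map_add, AddMonoidAlgebra.single_add]
      abel
    | tmul x y =>
      change g x * g y = _
      rw [hg, hg, map_add]
      simp only [TensorProduct.map_tmul, wedgeForms_tmul, add_mul, mul_add,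
        AddMonoidAlgebra.single_mul_single, AddMonoidAlgebra.single_add, Prod.mk_add_mk,
        Nat.reduceAdd, zero_add, add_zero]
      abel
  refine C.exists_prolongation_lift (AddMonoidAlgebra.lsingle 0 ∘ₗ C.ofM) g ?_ ?_ ?_ ?_ ?_
  · change AddMonoidAlgebra.single 0 (C.ofM 1) = 1
    rw [ofM_one]; rfl
  · intro a b
    change AddMonoidAlgebra.single 0 (C.ofM (a * b)) =
      AddMonoidAlgebra.single 0 (C.ofM a) * AddMonoidAlgebra.single 0 (C.ofM b)
    rw [AddMonoidAlgebra.single_mul_single, ofM_mul, add_zero]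
  · intro m ω
    change AddMonoidAlgebra.single 0 (C.ofM m) * g ω = _
    rw [hg, hg, mul_add, AddMonoidAlgebra.single_mul_single, AddMonoidAlgebra.single_mul_single,
      zero_add, zero_add, ofM_mul_ofForms, ofM_mul_ofForms, hP, hQ]
  · intro m ω
    change g ω * AddMonoidAlgebra.single 0 (C.ofM m) = _
    rw [hg, hg, add_mul, AddMonoidAlgebra.single_mul_single, AddMonoidAlgebra.single_mul_single,
      add_zero, add_zero, ofForms_mul_ofM, ofForms_mul_ofM, hP', hQ']
  · intro t ht
    obtain ⟨h1, h2, h3⟩ := hr _ (C.map_d_mem_relTwo ht)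
    rw [hgg, C.wedgeForms_relTwo h1, C.wedgeForms_relTwo h2, C.wedgeForms_relTwo h3]
    simp

end CovariantCalculus

end Prolongation

/-! ### Bigradings and homogeneity of `I²`. -/

section Bigrading

variable {G H : Type u} [Ring G] [HopfAlgebra ℂ G] [Ring H] [HopfAlgebra ℂ H] {π : G →ₐc[ℂ] H}
variable {Ω : Type u} [AddCommGroup Ω] [Module ℂ Ω]
  [Module (coinv π) Ω] [IsScalarTower ℂ (coinv π) Ω]
  [Module (coinv π)ᵐᵒᵖ Ω] [IsScalarTower ℂ (coinv π)ᵐᵒᵖ Ω]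
  [SMulCommClass (coinv π) (coinv π)ᵐᵒᵖ Ω]

namespace CovariantCalculus

variable {C : CovariantCalculus π Ω}

/-- A colinear endomorphism of `Ω ⊗ Ω` preserves the relations if it preserves them in the fibre. -/
theorem map_mem_relTwo (hff : IsFaithfullyFlatRight π) (h0 : IsInM0 π Ω)
    (E : Ω ⊗[ℂ] Ω →ₗ[ℂ] Ω ⊗[ℂ] Ω) (hE : ∀ t, diagCoact C.coact C.coact (E t) =
      E.lTensor G (diagCoact C.coact C.coact t))
    (hI : ∀ t ∈ C.relTwo, C.sigmaSq (E t) ∈ C.ITwo h0) {t : Ω ⊗[ℂ] Ω} (ht : t ∈ C.relTwo) :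
    E t ∈ C.relTwo := by
  refine C.twoRelHopf.le_of_le_sup_augSub hff C.relTwo (fun w hw => C.coact_mem_relTwo hw)
    ((C.relTwo.restrictScalars ℂ).map E) (fun z hz => ?_) (fun z hz => ?_) ⟨t, ht, rfl⟩
  · obtain ⟨s, hs, rfl⟩ := hz
    rw [twoRelHopf_coact, hE, gTensor_map]
    exact ⟨_, C.coact_mem_relTwo hs, rfl⟩
  · obtain ⟨s, hs, rfl⟩ := hz
    exact C.mem_of_sigmaSq_mem h0 (hI s hs)

variable {X Y : Submodule ℂ Ω} (hX : C.IsCovariantSubbimodule X)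
  (hY : C.IsCovariantSubbimodule Y) (h : IsCompl X Y)

include hX hY in
theorem sigmaMk_projection (ω : Ω) : C.sigmaMk (X.projection Y h ω) =
    (C.toV X).projection (C.toV Y) (isCompl_toV hX hY h) (C.sigmaMk ω) :=
  map_projection h (isCompl_toV hX hY h) C.sigmaMk
    (Submodule.map_le_iff_le_comap.1 (C.toV_eq_map X).ge)
    (Submodule.map_le_iff_le_comap.1 (C.toV_eq_map Y).ge) ω

include hX hY in
theorem isHomogeneousITwo_iff (h0 : IsInM0 π Ω) : C.IsHomogeneousITwo h0 X Y ↔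
    ∀ t ∈ C.ITwo h0,
      TensorProduct.map ((C.toV X).projection (C.toV Y) (isCompl_toV hX hY h))
        ((C.toV X).projection (C.toV Y) (isCompl_toV hX hY h)) t ∈ C.ITwo h0 ∧
      TensorProduct.map ((C.toV X).projection (C.toV Y) (isCompl_toV hX hY h))
          ((C.toV Y).projection (C.toV X) (isCompl_toV hX hY h).symm) t +
        TensorProduct.map ((C.toV Y).projection (C.toV X) (isCompl_toV hX hY h).symm)
          ((C.toV X).projection (C.toV Y) (isCompl_toV hX hY h)) t ∈ C.ITwo h0 ∧
      TensorProduct.map ((C.toV Y).projection (C.toV X) (isCompl_toV hX hY h).symm)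
        ((C.toV Y).projection (C.toV X) (isCompl_toV hX hY h).symm) t ∈ C.ITwo h0 := by
  rw [IsHomogeneousITwo, V11_eq, V20, V02, map_sigmaTwo_subTensor, map_sigmaTwo_subTensor]
  exact eq_sup_inf_iff _ _

/-- The projections on the components of `Ω ⊗ Ω` preserve the relations. -/
def RelationsHomogeneous (C : CovariantCalculus π Ω) (h : IsCompl X Y) : Prop :=
  ∀ t ∈ C.relTwo, TensorProduct.map (X.projection Y h) (X.projection Y h) t ∈ C.relTwo ∧
    TensorProduct.map (X.projection Y h) (Y.projection X h.symm) t +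
      TensorProduct.map (Y.projection X h.symm) (X.projection Y h) t ∈ C.relTwo ∧
    TensorProduct.map (Y.projection X h.symm) (Y.projection X h.symm) t ∈ C.relTwo

theorem sigmaSq_map {f g : Ω →ₗ[ℂ] Ω} {f' g' : C.V →ₗ[ℂ] C.V}
    (hf : ∀ ω, C.sigmaMk (f ω) = f' (C.sigmaMk ω)) (hg : ∀ ω, C.sigmaMk (g ω) = g' (C.sigmaMk ω))
    (t : Ω ⊗[ℂ] Ω) :
    C.sigmaSq (TensorProduct.map f g t) = TensorProduct.map f' g' (C.sigmaSq t) := by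
  have h1 : C.sigmaMk ∘ₗ f = f' ∘ₗ C.sigmaMk := LinearMap.ext hf
  have h2 : C.sigmaMk ∘ₗ g = g' ∘ₗ C.sigmaMk := LinearMap.ext hg
  rw [sigmaSq, ← LinearMap.comp_apply, ← LinearMap.comp_apply, ← TensorProduct.map_comp,
    ← TensorProduct.map_comp, h1, h2]

-- The projections of `Ω` are colinear and induce those of `V` on fibres. So stability of `relTwo`
-- follows from that of `I²` by descent (`map_mem_relTwo`), and the other direction holds because
-- `I²` is the image of `relTwo`.
include hX hY in
theorem relationsHomogeneous_iff (hff : IsFaithfullyFlatRight π) (h0 : IsInM0 π Ω) :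
    C.RelationsHomogeneous h ↔ C.IsHomogeneousITwo h0 X Y := by
  have hP := sigmaMk_projection hX hY h
  have hQ := sigmaMk_projection hY hX h.symm
  have cP := coact_projection hX hY h
  have cQ := coact_projection hY hX h.symm
  rw [isHomogeneousITwo_iff hX hY h h0]
  constructor
  · intro hr z hz
    rw [ITwo_eq] at hz
    obtain ⟨t, ht, rfl⟩ := hz
    obtain ⟨h1, h2, h3⟩ := hr t ht
    have hI : ∀ t ∈ C.relTwo, C.sigmaSq t ∈ C.ITwo h0 := fun t ht => by
      rw [ITwo_eq]; exact ⟨t, ht, rfl⟩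
    rw [← sigmaSq_map hP hP, ← sigmaSq_map hP hQ, ← sigmaSq_map hQ hP, ← sigmaSq_map hQ hQ,
      ← map_add]
    exact ⟨hI _ h1, hI _ h2, hI _ h3⟩
  · intro hI t ht
    have hI' : ∀ t ∈ C.relTwo, _ := fun t ht =>
      hI (C.sigmaSq t) (by rw [ITwo_eq]; exact ⟨t, ht, rfl⟩)
    refine ⟨map_mem_relTwo hff h0 _ (diagCoact_map _ _ cP cP) (fun t ht => ?_) ht,
      map_mem_relTwo hff h0 (TensorProduct.map (X.projection Y h) (Y.projection X h.symm) +
        TensorProduct.map (Y.projection X h.symm) (X.projection Y h)) (fun t => ?_)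
        (fun t ht => ?_) ht,
      map_mem_relTwo hff h0 _ (diagCoact_map _ _ cQ cQ) (fun t ht => ?_) ht⟩
    · rw [sigmaSq_map hP hP]
      exact (hI' t ht).1
    · rw [LinearMap.add_apply, map_add, diagCoact_map _ _ cP cQ, diagCoact_map _ _ cQ cP,
        LinearMap.lTensor_add, LinearMap.add_apply]
    · rw [LinearMap.add_apply, map_add, sigmaSq_map hP hQ, sigmaSq_map hQ hP]
      exact (hI' t ht).2.1
    · rw [sigmaSq_map hQ hQ]
      exact (hI' t ht).2.2

theorem ofForms_projection_add (ω : Ω) :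
    C.ofForms (X.projection Y h ω) + C.ofForms (Y.projection X h.symm ω) = C.ofForms ω := by
  rw [← map_add, Submodule.projection_add_projection_eq_self]

-- The two projections define a coaction of the monoid algebra. Its homogeneous parts exhaust the
-- prolongation, since `M`, `X` and `Y` are homogeneous and generate it.
include hX hY in
theorem exists_isBigrading (hr : C.RelationsHomogeneous h) : ∃ 𝒜, C.IsBigrading X Y 𝒜 := by
  obtain ⟨φ, hφ0, hφ1⟩ := C.exists_bigrading_coaction (X.projection Y h) (Y.projection X h.symm)
    (projection_smul hX hY h) (projection_op_smul hX hY h) (projection_smul hY hX h.symm)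
    (projection_op_smul hY hX h.symm) hr
  have m0 : ∀ m, C.ofM m ∈ gradedPart φ 0 := fun m => mem_gradedPart.2 (hφ0 m)
  have m10 : ∀ ω ∈ X, C.ofForms ω ∈ gradedPart φ (1, 0) := fun ω hω => by
    rw [mem_gradedPart, hφ1, projection_eq_of_mem h hω, projection_eq_zero_of_mem h.symm hω]
    simp
  have m01 : ∀ ω ∈ Y, C.ofForms ω ∈ gradedPart φ (0, 1) := fun ω hω => by
    rw [mem_gradedPart, hφ1, projection_eq_of_mem h.symm hω, projection_eq_zero_of_mem h hω]
    simp
  have htop : ⨆ i, gradedPart φ i = ⊤ := by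
    refine C.eq_top_of_left_stable _ (Submodule.mem_iSup_of_mem 0 one_mem_gradedPart)
      (fun m x hx => ?_) (fun ω x hx => ?_)
    · induction hx using Submodule.iSup_induction' with
      | mem k x hx => exact Submodule.mem_iSup_of_mem _ (mul_mem_gradedPart (m0 m) hx)
      | zero => rw [mul_zero]; exact zero_mem _
      | add x y _ _ hx hy => rw [mul_add]; exact add_mem hx hy
    · induction hx using Submodule.iSup_induction' with
      | mem k x hx =>
        rw [← ofForms_projection_add h, add_mul]
        exact add_mem
          (Submodule.mem_iSup_of_mem _
            (mul_mem_gradedPart (m10 _ (Submodule.projection_apply_mem h ω)) hx))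
          (Submodule.mem_iSup_of_mem _
            (mul_mem_gradedPart (m01 _ (Submodule.projection_apply_mem h.symm ω)) hx))
      | zero => rw [mul_zero]; exact zero_mem _
      | add x y _ _ hx hy => rw [mul_add]; exact add_mem hx hy
  have hint := isInternal_gradedPart htop
  let 𝒟 : ℕ → Submodule ℂ C.MaximalProlongation :=
    fun k => ⨆ i ∈ {i : ℕ × ℕ | i.1 + i.2 = k}, gradedPart φ i
  have h𝒟 : ∀ i : ℕ × ℕ, gradedPart φ i ≤ 𝒟 (i.1 + i.2) := fun i =>
    le_iSup₂_of_le (f := fun (j : ℕ × ℕ) (_ : j ∈ {j : ℕ × ℕ | j.1 + j.2 = i.1 + i.2}) =>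
      gradedPart φ j) i rfl le_rfl
  have hmul : ∀ j k, 𝒟 j * 𝒟 k ≤ 𝒟 (j + k) := by
    intro j k
    refine Submodule.mul_le.2 fun x hx y hy => ?_
    have h1 : 𝒟 j ≤ (𝒟 (j + k)).comap (LinearMap.mulRight ℂ y) := iSup₂_le fun i hi x hx => by
      have h2 : 𝒟 k ≤ (𝒟 (j + k)).comap (LinearMap.mulLeft ℂ x) := iSup₂_le fun l hl y hy => by
        have h3 := h𝒟 _ (mul_mem_gradedPart hx hy)
        have hi : i.1 + i.2 = j := hi
        have hl : l.1 + l.2 = k := hl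
        have h4 : (i + l).1 + (i + l).2 = j + k := by
          rw [Prod.fst_add, Prod.snd_add]; omega
        rwa [h4] at h3
      exact h2 hy
    exact h1 hx
  have hM : LinearMap.range C.ofM ≤ 𝒟 0 := by
    rintro _ ⟨m, rfl⟩
    exact h𝒟 0 (m0 m)
  have hΩ : LinearMap.range C.ofForms ≤ 𝒟 1 := by
    rintro _ ⟨ω, rfl⟩
    rw [← ofForms_projection_add h]
    exact add_mem (h𝒟 (1, 0) (m10 _ (Submodule.projection_apply_mem h ω)))
      (h𝒟 (0, 1) (m01 _ (Submodule.projection_apply_mem h.symm ω)))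
  have hpow : ∀ k, LinearMap.range C.ofForms ^ k ≤ 𝒟 k := by
    intro k
    induction k with
    | zero => rw [pow_zero]; exact Submodule.one_le.2 (h𝒟 0 one_mem_gradedPart)
    | succ k ih => rw [pow_succ]; exact (mul_le_mul' ih hΩ).trans (hmul _ _)
  have hdeg : ∀ k, C.degree k ≤ 𝒟 k := fun k =>
    (mul_le_mul' hM (hpow k)).trans ((hmul 0 k).trans (by rw [zero_add]))
  -- Only the inclusions have been shown; equality is automatic because the spaces of `k`-forms span
  -- everything.
  have hdeg' := eq_iSup_of_le hint (fun i : ℕ × ℕ => i.1 + i.2) C.degree hdeg C.iSup_degree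
  have key : ∀ i, i.1 + i.2 = 1 → ∀ x ∈ gradedPart φ i, ∃ ω, x = C.ofForms ω := by
    intro i hi x hx
    have h1 := h𝒟 i hx
    rw [hi] at h1
    have h2 : x ∈ C.degree 1 := by rw [hdeg']; exact h1
    rw [degree_one] at h2
    obtain ⟨ω, rfl⟩ := h2
    exact ⟨ω, rfl⟩
  refine ⟨gradedPart φ, one_mem_gradedPart, fun i j x hx y hy => mul_mem_gradedPart hx hy, hint,
    hdeg', le_antisymm (fun x hx => ?_) ?_, le_antisymm (fun x hx => ?_) ?_⟩
  · obtain ⟨ω, rfl⟩ := key (1, 0) rfl x hx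
    -- A homogeneous element equals its own coefficient, which here is the image of the
    -- `X`-component of `ω`.
    have h1 := gradedCoeff_of_mem (1, 0) hx
    rw [← ofForms_projection_add h, map_add,
      gradedCoeff_of_mem (1, 0) (m10 _ (Submodule.projection_apply_mem h ω)),
      gradedCoeff_of_mem (1, 0) (m01 _ (Submodule.projection_apply_mem h.symm ω)),
      ofForms_projection_add h] at h1
    exact ⟨_, Submodule.projection_apply_mem h ω, by simpa using h1⟩
  · rintro _ ⟨ω, hω, rfl⟩
    exact m10 ω hω
  · obtain ⟨ω, rfl⟩ := key (0, 1) rfl x hx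
    have h1 := gradedCoeff_of_mem (0, 1) hx
    rw [← ofForms_projection_add h, map_add,
      gradedCoeff_of_mem (0, 1) (m10 _ (Submodule.projection_apply_mem h ω)),
      gradedCoeff_of_mem (0, 1) (m01 _ (Submodule.projection_apply_mem h.symm ω)),
      ofForms_projection_add h] at h1
    exact ⟨_, Submodule.projection_apply_mem h.symm ω, by simpa using h1⟩
  · rintro _ ⟨ω, hω, rfl⟩
    exact m01 ω hω

theorem IsBigrading.wedgeForms_mem {𝒜 : ℕ × ℕ → Submodule ℂ C.MaximalProlongation} {X' Y' : Submodule ℂ Ω} {i j : ℕ × ℕ}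
    (hA : C.IsBigrading X Y 𝒜) (hi : X'.map C.ofForms ≤ 𝒜 i) (hj : Y'.map C.ofForms ≤ 𝒜 j)
    {t : Ω ⊗[ℂ] Ω} (ht : t ∈ Submodule.map₂ (TensorProduct.mk ℂ Ω Ω) X' Y') :
    C.wedgeForms t ∈ 𝒜 (i + j) := by
  have h1 : Submodule.map₂ (TensorProduct.mk ℂ Ω Ω) X' Y' ≤ (𝒜 (i + j)).comap C.wedgeForms :=
    Submodule.map₂_le.2 fun x hx y hy => by
      rw [Submodule.mem_comap, TensorProduct.mk_apply, wedgeForms_tmul]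
      exact hA.mul_mem i j _ (hi ⟨x, hx, rfl⟩) _ (hj ⟨y, hy, rfl⟩)
  exact h1 ht

/-- The components of a relation have wedge products in three different summands, with sum zero; so
each product is zero, and by `mem_relTwo_iff` each component is itself a relation. -/
theorem IsBigrading.relationsHomogeneous {𝒜 : ℕ × ℕ → Submodule ℂ C.MaximalProlongation}
    (hA : C.IsBigrading X Y 𝒜) (hff : IsFaithfullyFlatRight π) (h0 : IsInM0 π Ω) :
    C.RelationsHomogeneous h := by
  intro t ht
  have hp := Submodule.projection_apply_mem h
  have hq := Submodule.projection_apply_mem h.symm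
  have a20 := hA.wedgeForms_mem hA.extends10.ge hA.extends10.ge (map_mem_map₂ hp hp t)
  have a11 := add_mem (hA.wedgeForms_mem hA.extends10.ge hA.extends01.ge (map_mem_map₂ hp hq t))
    (hA.wedgeForms_mem hA.extends01.ge hA.extends10.ge (map_mem_map₂ hq hp t))
  have a02 := hA.wedgeForms_mem hA.extends01.ge hA.extends01.ge (map_mem_map₂ hq hq t)
  have hsum := congrArg C.wedgeForms (map_projection_add h t)
  rw [C.wedgeForms_relTwo ht] at hsum
  simp only [map_add] at hsum
  obtain ⟨p, -, hp'⟩ := exists_gradedProj hA.isInternal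
  have key : ∀ i, _ := fun i => congrArg (p i) hsum
  simp only [mem_relTwo_iff hff C h0, map_add]
  refine ⟨?_, ?_, ?_⟩
  · have := key (2, 0)
    rw [map_add, map_add, hp' _ _ _ a20, hp' _ _ _ a11, hp' _ _ _ a02] at this
    simpa using this
  · have := key (1, 1)
    rw [map_add, map_add, hp' _ _ _ a20, hp' _ _ _ a11, hp' _ _ _ a02] at this
    simpa using this
  · have := key (0, 2)
    rw [map_add, map_add, hp' _ _ _ a20, hp' _ _ _ a11, hp' _ _ _ a02] at this
    simpa using this

/-- The decomposition extends to a bigrading if and only if `I²` is homogeneous. -/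
theorem exists_isBigrading_iff (hff : IsFaithfullyFlatRight π) (h0 : IsInM0 π Ω)
    (hXY : (X, Y) ∈ C.formDecompositions) :
    (∃ 𝒜, C.IsBigrading X Y 𝒜) ↔ C.IsHomogeneousITwo h0 X Y := by
  obtain ⟨hX, hY, h⟩ := hXY
  rw [← relationsHomogeneous_iff hX hY h hff h0]
  exact ⟨fun ⟨𝒜, hA⟩ => hA.relationsHomogeneous h hff h0, exists_isBigrading hX hY h⟩

end CovariantCalculus

end Bigrading

/-! ### Maps onto quotients of tensor products. -/

section Quotients

variable {E F : Type*} [AddCommGroup E] [Module ℂ E] [AddCommGroup F] [Module ℂ F]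

theorem range_map_subtype (U : Submodule ℂ E) (W : Submodule ℂ F) :
    LinearMap.range (TensorProduct.map U.subtype W.subtype) =
      Submodule.map₂ (TensorProduct.mk ℂ E F) U W := by
  rw [TensorProduct.range_map, Submodule.range_subtype, Submodule.range_subtype]

theorem map_subtype_injective (U : Submodule ℂ E) (W : Submodule ℂ F) :
    Function.Injective (TensorProduct.map U.subtype W.subtype) :=
  TensorProduct.map_injective_of_flat_flat _ _ U.subtype_injective W.subtype_injective

/-- `U ⊗ W` embeds in `E ⊗ E`, so injectivity means that its image avoids the kernel `I`; for the
range, only the summand `W ⊗ U` imposes a condition. -/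
theorem isIsoOnto_mkQ_iff (I : Submodule ℂ (E ⊗[ℂ] E)) (U W : Submodule ℂ E) :
    IsIsoOnto (I.mkQ ∘ₗ TensorProduct.map U.subtype W.subtype)
      ((Submodule.map₂ (TensorProduct.mk ℂ E E) U W ⊔
        Submodule.map₂ (TensorProduct.mk ℂ E E) W U).map I.mkQ) ↔
      Disjoint (Submodule.map₂ (TensorProduct.mk ℂ E E) U W) I ∧
        Submodule.map₂ (TensorProduct.mk ℂ E E) W U ≤
          Submodule.map₂ (TensorProduct.mk ℂ E E) U W ⊔ I := by
  refine and_congr ?_ ?_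
  · rw [← LinearMap.ker_eq_bot, Submodule.disjoint_def, ← range_map_subtype]
    constructor
    · rintro h _ ⟨t, rfl⟩ ht
      have : t ∈ LinearMap.ker (I.mkQ ∘ₗ TensorProduct.map U.subtype W.subtype) :=
        (Submodule.Quotient.mk_eq_zero _).2 ht
      rw [h, Submodule.mem_bot] at this
      rw [this, map_zero]
    · intro h
      refine (Submodule.eq_bot_iff _).2 fun t ht => ?_
      have := h _ ⟨t, rfl⟩ ((Submodule.Quotient.mk_eq_zero _).1 ht)
      exact map_subtype_injective U W (this.trans (map_zero _).symm)
  · rw [LinearMap.range_comp, range_map_subtype, Submodule.map_sup]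
    constructor
    · intro h x hx
      have h1 : I.mkQ x ∈ (Submodule.map₂ (TensorProduct.mk ℂ E E) U W).map I.mkQ := by
        rw [h]; exact Submodule.mem_sup_right ⟨x, hx, rfl⟩
      obtain ⟨y, hy, hyx⟩ := h1
      have h2 := (Submodule.Quotient.eq I).1 hyx.symm
      rw [← add_sub_cancel y x]
      exact Submodule.add_mem_sup hy h2
    · intro h
      refine (sup_eq_left.2 ?_).symm
      rintro _ ⟨x, hx, rfl⟩
      obtain ⟨y, hy, z, hz, rfl⟩ := Submodule.mem_sup.1 (h hx)
      refine ⟨y, hy, ?_⟩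
      rw [map_add, (show I.mkQ z = 0 from (Submodule.Quotient.mk_eq_zero _).2 hz), add_zero]

theorem TensorQuot.lift_mk {W : Type*} [AddCommGroup W] [Module ℂ W] (S : Set (E ⊗[ℂ] F))
    (f : E →ₗ[ℂ] F →ₗ[ℂ] W) (hf : ∀ t ∈ S, TensorProduct.lift f t = 0) (t : E ⊗[ℂ] F) :
    TensorQuot.lift S f hf (Submodule.Quotient.mk t) = TensorProduct.lift f t := rfl

theorem TensorQuot.range_lift {W : Type*} [AddCommGroup W] [Module ℂ W] (S : Set (E ⊗[ℂ] F))
    (f : E →ₗ[ℂ] F →ₗ[ℂ] W) (hf : ∀ t ∈ S, TensorProduct.lift f t = 0) :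
    LinearMap.range (TensorQuot.lift S f hf) = LinearMap.range (TensorProduct.lift f) :=
  Submodule.range_liftQ _ _ _

theorem lift_mul_subtype {A : Type*} [Ring A] [Algebra ℂ A] (P Q : Submodule ℂ A) :
    TensorProduct.lift ((LinearMap.mul ℂ A).compl₁₂ P.subtype Q.subtype) =
      LinearMap.mul' ℂ A ∘ₗ TensorProduct.map P.subtype Q.subtype :=
  TensorProduct.ext' fun _ _ => rfl

theorem range_lift_mul_subtype {A : Type*} [Ring A] [Algebra ℂ A] (P Q : Submodule ℂ A) :
    LinearMap.range (TensorProduct.lift ((LinearMap.mul ℂ A).compl₁₂ P.subtype Q.subtype)) =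
      P * Q := by
  rw [lift_mul_subtype, LinearMap.range_comp, range_map_subtype, Submodule.map_map₂,
    Submodule.mul_eq_map₂]
  rfl

end Quotients

/-! ### The wedge map in degree two and its fibre. -/

section Wedge

variable {G H : Type*} [Ring G] [HopfAlgebra ℂ G] [Ring H] [HopfAlgebra ℂ H] {π : G →ₐc[ℂ] H}
variable {Ω : Type*} [AddCommGroup Ω] [Module ℂ Ω]
  [Module (coinv π) Ω] [IsScalarTower ℂ (coinv π) Ω]
  [Module (coinv π)ᵐᵒᵖ Ω] [IsScalarTower ℂ (coinv π)ᵐᵒᵖ Ω]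
  [SMulCommClass (coinv π) (coinv π)ᵐᵒᵖ Ω]

namespace CovariantCalculus

variable (C : CovariantCalculus π Ω)

theorem wedgeSigma_eq (h0 : IsInM0 π Ω) : C.wedgeSigma h0 = (C.ITwo h0).mkQ := by
  refine LinearMap.ext fun z => ?_
  obtain ⟨x, rfl⟩ := (C.sigmaTwo h0).surjective z
  obtain ⟨x, rfl⟩ := Phi.mk_surjective _ x
  rw [wedgeSigma, LinearMap.comp_apply, LinearMap.comp_apply, LinearEquiv.coe_coe,
    LinearEquiv.symm_apply_apply]
  rfl

theorem VTwo11_eq (h0 : IsInM0 π Ω) (X Y : Submodule ℂ Ω) :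
    C.VTwo11 h0 X Y = (Submodule.map₂ (TensorProduct.mk ℂ C.V C.V) (C.toV X) (C.toV Y) ⊔
      Submodule.map₂ (TensorProduct.mk ℂ C.V C.V) (C.toV Y) (C.toV X)).map (C.ITwo h0).mkQ := by
  rw [← C.V11_eq h0, VTwo11, V11]
  ext z
  constructor
  · rintro ⟨_, ⟨_, ⟨x, hx, rfl⟩, rfl⟩, rfl⟩
    exact ⟨_, ⟨_, ⟨x, hx, rfl⟩, rfl⟩, rfl⟩
  · rintro ⟨_, ⟨_, ⟨x, hx, rfl⟩, rfl⟩, rfl⟩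
    exact ⟨_, ⟨_, ⟨x, hx, rfl⟩, rfl⟩, rfl⟩

theorem isIsoOnto_wedgeSigmaRes_iff (h0 : IsInM0 π Ω) (X Y : Submodule ℂ Ω) :
    IsIsoOnto (C.wedgeSigmaRes h0 (C.toV X) (C.toV Y)) (C.VTwo11 h0 X Y) ↔
      Disjoint (Submodule.map₂ (TensorProduct.mk ℂ C.V C.V) (C.toV X) (C.toV Y)) (C.ITwo h0) ∧
        Submodule.map₂ (TensorProduct.mk ℂ C.V C.V) (C.toV Y) (C.toV X) ≤
          Submodule.map₂ (TensorProduct.mk ℂ C.V C.V) (C.toV X) (C.toV Y) ⊔ C.ITwo h0 := by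
  rw [VTwo11_eq, wedgeSigmaRes, wedgeSigma_eq]
  exact isIsoOnto_mkQ_iff _ _ _

theorem VTwo11_comm (h0 : IsInM0 π Ω) (X Y : Submodule ℂ Ω) :
    C.VTwo11 h0 X Y = C.VTwo11 h0 Y X := by
  rw [VTwo11_eq, VTwo11_eq, sup_comm]

theorem wedge_mk (A B : Submodule ℂ C.MaximalProlongation) (t : A ⊗[ℂ] B) :
    C.wedge A B (Submodule.Quotient.mk t) =
      TensorProduct.lift ((LinearMap.mul ℂ C.MaximalProlongation).compl₁₂ A.subtype B.subtype) t :=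
  TensorQuot.lift_mk _ _ _ t

theorem range_wedge (A B : Submodule ℂ C.MaximalProlongation) :
    LinearMap.range (C.wedge A B) = A * B := by
  rw [wedge, TensorQuot.range_lift, range_lift_mul_subtype]

theorem map_wedgeForms_map₂ (X Y : Submodule ℂ Ω) :
    (Submodule.map₂ (TensorProduct.mk ℂ Ω Ω) X Y).map C.wedgeForms =
      X.map C.ofForms * Y.map C.ofForms := by
  rw [Submodule.map_map₂, Submodule.mul_eq_map₂, Submodule.map₂_map_map]
  rfl

variable {C}

/-- By this symmetry, statements on products of `(p, 0)` with `(0, q)` also cover the opposite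
order. -/
theorem IsBigrading.swap {X Y : Submodule ℂ Ω} {𝒜 : ℕ × ℕ → Submodule ℂ C.MaximalProlongation}
    (hA : C.IsBigrading X Y 𝒜) : C.IsBigrading Y X (fun i => 𝒜 i.swap) where
  one_mem := hA.one_mem
  mul_mem i j x hx y hy := hA.mul_mem i.swap j.swap x hx y hy
  isInternal := by
    have h := hA.isInternal
    rw [DirectSum.isInternal_submodule_iff_iSupIndep_and_iSup_eq_top] at h ⊢
    exact ⟨h.1.comp Prod.swap_injective, ((Equiv.prodComm ℕ ℕ).iSup_comp (g := 𝒜)).trans h.2⟩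
  degree_eq k := by
    rw [hA.degree_eq]
    refine le_antisymm (iSup₂_le fun i hi => ?_) (iSup₂_le fun i hi => ?_)
    · exact le_iSup₂_of_le (f := fun (j : ℕ × ℕ) (_ : j ∈ {j : ℕ × ℕ | j.1 + j.2 = k}) =>
        𝒜 j.swap) i.swap ((add_comm _ _).trans hi) le_rfl
    · exact le_iSup₂_of_le (f := fun (j : ℕ × ℕ) (_ : j ∈ {j : ℕ × ℕ | j.1 + j.2 = k}) =>
        𝒜 j) i.swap ((add_comm _ _).trans hi) le_rfl
  extends10 := hA.extends01
  extends01 := hA.extends10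

/-- On products of one-forms, an injective wedge map determines the class in `V ⊗ V`. -/
theorem sigmaSq_eq_zero_of_wedge (h0 : IsInM0 π Ω) {X Y : Submodule ℂ Ω}
    (hinj : Function.Injective (C.wedge (X.map C.ofForms) (Y.map C.ofForms))) {t : Ω ⊗[ℂ] Ω}
    (ht : t ∈ Submodule.map₂ (TensorProduct.mk ℂ Ω Ω) X Y) (h : C.wedgeForms t = 0) :
    C.sigmaSq t = 0 := by
  obtain ⟨k, -, hk, hkl, hkr, -⟩ := C.exists_truncation h0
  have h1 : ∃ s : X.map C.ofForms ⊗[ℂ] Y.map C.ofForms,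
      TensorProduct.map (Submodule.subtype _) (Submodule.subtype _) s =
        TensorProduct.map C.ofForms C.ofForms t := by
    change _ ∈ LinearMap.range _
    rw [range_map_subtype, ← map_map₂_mk]
    exact ⟨t, ht, rfl⟩
  obtain ⟨s, hs⟩ := h1
  have h2 : ∀ t, LinearMap.mul' ℂ _ (TensorProduct.map C.ofForms C.ofForms t) =
      C.wedgeForms t := fun t => by
    induction t with
    | zero => simp
    | add x y hx hy => simp only [map_add, hx, hy]
    | tmul x y => rfl
  have h3 : s ∈ Submodule.span ℂ (C.balancedSet (X.map C.ofForms) (Y.map C.ofForms)) := by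
    refine (Submodule.Quotient.mk_eq_zero _).1 (hinj ((C.wedge_mk _ _ s).trans ?_))
    rw [lift_mul_subtype, LinearMap.comp_apply, hs, h2, h, map_zero]
  -- `k ⊗ k` kills the balancing relations because `k` turns both actions of `M` into the counit.
  have h4 : ∀ s, s ∈ Submodule.span ℂ (C.balancedSet (X.map C.ofForms) (Y.map C.ofForms)) →
      TensorProduct.map k k (TensorProduct.map (Submodule.subtype _) (Submodule.subtype _) s) =
        0 := by
    intro s hs
    induction hs using Submodule.span_induction with
    | mem s hs =>
      obtain ⟨x, x', y, y', m, hx, hy, rfl⟩ := hs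
      simp only [map_sub, TensorProduct.map_tmul, Submodule.subtype_apply]
      rw [hx, hy, hkl, hkr, TensorProduct.smul_tmul, sub_self]
    | zero => simp
    | add x y _ _ hx hy => rw [map_add, map_add, hx, hy, add_zero]
    | smul c x _ hx => rw [map_smul, map_smul, hx, smul_zero]
  have h5 := h4 s h3
  rw [hs] at h5
  rw [← h5]
  clear hs h3 h5 h ht
  induction t with
  | zero => simp
  | add x y hx hy => simp only [map_add, hx, hy]
  | tmul x y => rw [sigmaSq_tmul, TensorProduct.map_tmul, TensorProduct.map_tmul, hk, hk]

theorem sigmaSq_smul (m : coinv π) (t : Ω ⊗[ℂ] Ω) :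
    C.sigmaSq (m • t) = counitM π m • C.sigmaSq t := by
  induction t with
  | zero => simp
  | add x y hx hy => rw [smul_add, map_add, hx, hy, map_add, smul_add]
  | tmul a b =>
    rw [TensorProduct.smul_tmul', sigmaSq_tmul, sigmaSq_tmul, sigmaMk_smul,
      TensorProduct.smul_tmul']

theorem smul_mem_map₂ {X Y : Submodule ℂ Ω} (hX : C.IsCovariantSubbimodule X) (m : coinv π)
    {t : Ω ⊗[ℂ] Ω} (ht : t ∈ Submodule.map₂ (TensorProduct.mk ℂ Ω Ω) X Y) :
    m • t ∈ Submodule.map₂ (TensorProduct.mk ℂ Ω Ω) X Y := by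
  have h1 : Submodule.map₂ (TensorProduct.mk ℂ Ω Ω) X Y ≤
      (Submodule.map₂ (TensorProduct.mk ℂ Ω Ω) X Y).comap (Algebra.lsmul ℂ ℂ (Ω ⊗[ℂ] Ω) m) :=
    Submodule.map₂_le.2 fun x hx y hy =>
      Submodule.apply_mem_map₂ (TensorProduct.mk ℂ Ω Ω) (hX.smul_mem m x hx) hy
  exact h1 ht

end CovariantCalculus

end Wedge

/-! ### From forms to fibres in bidegree `(1, 1)`. -/

section Condition

variable {G H : Type u} [Ring G] [HopfAlgebra ℂ G] [Ring H] [HopfAlgebra ℂ H] {π : G →ₐc[ℂ] H}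
variable {Ω : Type u} [AddCommGroup Ω] [Module ℂ Ω]
  [Module (coinv π) Ω] [IsScalarTower ℂ (coinv π) Ω]
  [Module (coinv π)ᵐᵒᵖ Ω] [IsScalarTower ℂ (coinv π)ᵐᵒᵖ Ω]
  [SMulCommClass (coinv π) (coinv π)ᵐᵒᵖ Ω]

namespace CovariantCalculus

variable {C : CovariantCalculus π Ω} {X Y : Submodule ℂ Ω}
  {𝒜 : ℕ × ℕ → Submodule ℂ C.MaximalProlongation}

/-- Injectivity on fibres is traced by hand. An element of `X ⊗ Y` whose class lies in `I²` is a
relation plus an element of `M⁺(Ω ⊗ Ω)`; the latter is replaced by an element of `X ⊗ Y` that is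
trivial in the fibre, using surjectivity of the wedge map, and then its injectivity applies. -/
theorem isIsoOnto_wedgeSigmaRes (hff : IsFaithfullyFlatRight π) (h0 : IsInM0 π Ω)
    (hXY : (X, Y) ∈ C.formDecompositions) (hA : C.IsBigrading X Y 𝒜)
    (hW : IsIsoOnto (C.wedge (𝒜 (1, 0)) (𝒜 (0, 1))) (𝒜 (1, 1))) :
    IsIsoOnto (C.wedgeSigmaRes h0 (C.toV X) (C.toV Y)) (C.VTwo11 h0 X Y) := by
  obtain ⟨hX, hY, h⟩ := hXY
  have h11 : (Submodule.map₂ (TensorProduct.mk ℂ Ω Ω) X Y).map C.wedgeForms = 𝒜 (1, 1) := by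
    rw [map_wedgeForms_map₂, ← hA.extends10, ← hA.extends01, ← range_wedge, hW.2]
  have hinj := hW.1
  rw [hA.extends10, hA.extends01] at hinj
  have hr := hA.relationsHomogeneous h hff h0
  have hV : ∀ X Y : Submodule ℂ Ω, Submodule.map₂ (TensorProduct.mk ℂ C.V C.V) (C.toV X) (C.toV Y) =
      (Submodule.map₂ (TensorProduct.mk ℂ Ω Ω) X Y).map C.sigmaSq := fun X Y => by
    rw [sigmaSq, map_map₂_mk, toV_eq_map, toV_eq_map]
  have hp := Submodule.projection_apply_mem h
  have hq := Submodule.projection_apply_mem h.symm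
  set E : Ω ⊗[ℂ] Ω →ₗ[ℂ] Ω ⊗[ℂ] Ω := TensorProduct.map (X.projection Y h) (Y.projection X h.symm) +
    TensorProduct.map (Y.projection X h.symm) (X.projection Y h) with hE
  have hEsmul : ∀ (m : coinv π) t, E (m • t) = m • E t := by
    intro m t
    induction t with
    | zero => simp
    | add x y hx hy => rw [smul_add, map_add, hx, hy, map_add, smul_add]
    | tmul a b =>
      rw [TensorProduct.smul_tmul', hE, LinearMap.add_apply, LinearMap.add_apply, smul_add]
      simp only [TensorProduct.map_tmul, TensorProduct.smul_tmul', projection_smul hX hY h,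
        projection_smul hY hX h.symm]
  have hE11 : ∀ t, C.wedgeForms (E t) ∈ 𝒜 (1, 1) := fun t => by
    rw [hE, LinearMap.add_apply, map_add]
    exact add_mem (hA.wedgeForms_mem hA.extends10.ge hA.extends01.ge (map_mem_map₂ hp hq t))
      (hA.wedgeForms_mem hA.extends01.ge hA.extends10.ge (map_mem_map₂ hq hp t))
  rw [isIsoOnto_wedgeSigmaRes_iff]
  refine ⟨Submodule.disjoint_def.2 fun z hz hzI => ?_, fun z hz => ?_⟩
  · rw [hV] at hz
    obtain ⟨y, hy, rfl⟩ := hz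
    obtain ⟨r, hrr, f, hf, hrf⟩ := Submodule.mem_sup.1 (C.mem_of_sigmaSq_mem h0 hzI)
    have hEy : E y = y := by
      rw [hE, LinearMap.add_apply,
        map_eq_map_of_mem (fun x hx => projection_eq_of_mem h hx)
          (fun x hx => projection_eq_of_mem h.symm hx) hy,
        map_eq_map_of_mem (fun x hx => projection_eq_zero_of_mem h.symm hx)
          (fun x hx => projection_eq_zero_of_mem h hx) hy]
      simp
    -- For `f = a e` with `ε(a) = 0`, the wedge product of `E e` is that of some `t ∈ X ⊗ Y`, as
    -- such products fill `𝒜 (1, 1)`; then `a t` has the required product and vanishes in the fibre.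
    have key : ∀ f ∈ augSub (counitM π) (Ω ⊗[ℂ] Ω),
        ∃ y' ∈ Submodule.map₂ (TensorProduct.mk ℂ Ω Ω) X Y, C.sigmaSq y' = 0 ∧
          C.wedgeForms y' = C.wedgeForms (E f) := by
      intro f hf
      induction hf using Submodule.span_induction with
      | mem x hx =>
        obtain ⟨a, e, ha, rfl⟩ := hx
        have h1 := hE11 e
        rw [← h11] at h1
        obtain ⟨t, ht, hte⟩ := h1
        exact ⟨a • t, smul_mem_map₂ hX a ht, by rw [sigmaSq_smul, ha, zero_smul],
          by rw [wedgeForms_smul, hte, hEsmul, wedgeForms_smul]⟩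
      | zero => exact ⟨0, zero_mem _, map_zero _, by simp⟩
      | add x y _ _ hx hy =>
        obtain ⟨x', hx1, hx2, hx3⟩ := hx
        obtain ⟨y', hy1, hy2, hy3⟩ := hy
        exact ⟨x' + y', add_mem hx1 hy1, by rw [map_add, hx2, hy2, add_zero],
          by rw [map_add, hx3, hy3, map_add, map_add]⟩
      | smul c x _ hx =>
        obtain ⟨x', hx1, hx2, hx3⟩ := hx
        exact ⟨c • x', Submodule.smul_mem _ _ hx1, by rw [map_smul, hx2, smul_zero],
          by rw [map_smul, hx3, map_smul, map_smul]⟩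
    obtain ⟨y', hy', hs, hw⟩ := key f hf
    -- `E` fixes `y` and sends the relation `r` to a relation, so only `E f` contributes to the
    -- wedge product of `y`.
    have h1 : C.wedgeForms (y - y') = 0 := by
      have h2 : C.wedgeForms (E r) = 0 := C.wedgeForms_relTwo (hr r hrr).2.1
      rw [map_sub, hw, ← hEy, ← hrf, map_add, map_add, h2, zero_add, sub_self]
    have := sigmaSq_eq_zero_of_wedge h0 hinj (sub_mem hy hy') h1
    rwa [map_sub, hs, sub_zero] at this
  · rw [hV] at hz
    obtain ⟨g, hg, rfl⟩ := hz
    have h1 : C.wedgeForms g ∈ 𝒜 (1, 1) :=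
      hA.wedgeForms_mem hA.extends01.ge hA.extends10.ge hg
    rw [← h11] at h1
    obtain ⟨g', hg', he⟩ := h1
    have h2 : g - g' ∈ C.relTwo := by
      rw [mem_relTwo_iff hff C h0, map_sub, he, sub_self]
    rw [← add_sub_cancel g' g, map_add, hV, ITwo_eq]
    exact Submodule.add_mem_sup ⟨g', hg', rfl⟩ ⟨_, h2, rfl⟩

/-- The wedge condition implies that the restrictions of `∧_σ` are isomorphisms. -/
theorem WedgeCondition.wedgeSigmaCondition (hff : IsFaithfullyFlatRight π) (h0 : IsInM0 π Ω)
    (hXY : (X, Y) ∈ C.formDecompositions) (hA : C.IsBigrading X Y 𝒜) (hW : C.WedgeCondition 𝒜) :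
    C.WedgeSigmaCondition h0 X Y := by
  refine ⟨isIsoOnto_wedgeSigmaRes hff h0 hXY hA (hW 1 1).1, ?_⟩
  rw [VTwo11_comm]
  exact isIsoOnto_wedgeSigmaRes hff h0 ⟨hXY.2.1, hXY.1, hXY.2.2.symm⟩ hA.swap (hW 1 1).2

end CovariantCalculus

end Condition

/-! ### Products of two maps into an algebra. -/

section MulTwo

variable {E F Q : Type*} [AddCommGroup E] [Module ℂ E] [AddCommGroup F] [Module ℂ F] [Ring Q]
  [Algebra ℂ Q]

/-- The map `x ⊗ y ↦ f x * g y` into an algebra. -/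
def mulTwo (f : E →ₗ[ℂ] Q) (g : F →ₗ[ℂ] Q) : E ⊗[ℂ] F →ₗ[ℂ] Q :=
  TensorProduct.lift ((LinearMap.mul ℂ Q).compl₁₂ f g)

theorem mulTwo_tmul (f : E →ₗ[ℂ] Q) (g : F →ₗ[ℂ] Q) (x : E) (y : F) :
    mulTwo f g (x ⊗ₜ y) = f x * g y := rfl

theorem mulTwo_comp {E' F' : Type*} [AddCommGroup E'] [Module ℂ E'] [AddCommGroup F'] [Module ℂ F']
    (f : E →ₗ[ℂ] Q) (g : F →ₗ[ℂ] Q) (f' : E' →ₗ[ℂ] E) (g' : F' →ₗ[ℂ] F) (t : E' ⊗[ℂ] F') :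
    mulTwo (f ∘ₗ f') (g ∘ₗ g') t = mulTwo f g (TensorProduct.map f' g' t) := by
  induction t with
  | zero => simp
  | add x y hx hy => rw [map_add, map_add, map_add, hx, hy]
  | tmul x y => rfl

theorem map_mulTwo {Q' : Type*} [Ring Q'] [Algebra ℂ Q'] (φ : Q →ₐ[ℂ] Q') (f : E →ₗ[ℂ] Q)
    (g : F →ₗ[ℂ] Q) (t : E ⊗[ℂ] F) :
    φ (mulTwo f g t) = mulTwo (φ.toLinearMap ∘ₗ f) (φ.toLinearMap ∘ₗ g) t := by
  induction t with
  | zero => simp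
  | add x y hx hy => rw [map_add, map_add, map_add, hx, hy]
  | tmul x y => exact map_mul φ _ _

end MulTwo

/-! ### Quadratic algebras. -/

section QuadraticAlgebra

variable {U : Type*} [AddCommGroup U] [Module ℂ U] (R : Submodule ℂ (U ⊗[ℂ] U))

/-- The relations `R = 0` on the tensor algebra of `U`. -/
def quadRel (x y : TensorAlgebra ℂ U) : Prop :=
  x ∈ R.map (mulTwo (TensorAlgebra.ι ℂ) (TensorAlgebra.ι ℂ)) ∧ y = 0

/-- The quadratic algebra `T(U) / (R)`. -/
def QuadAlg : Type _ := RingQuot (quadRel R)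

namespace QuadAlg

instance : Ring (QuadAlg R) := inferInstanceAs (Ring (RingQuot (quadRel R)))

instance : Algebra ℂ (QuadAlg R) := inferInstanceAs (Algebra ℂ (RingQuot (quadRel R)))

/-- The projection from the tensor algebra. -/
def mk : TensorAlgebra ℂ U →ₐ[ℂ] QuadAlg R := RingQuot.mkAlgHom ℂ (quadRel R)

/-- The inclusion of the generators. -/
def ι : U →ₗ[ℂ] QuadAlg R := (mk R).toLinearMap ∘ₗ TensorAlgebra.ι ℂ

theorem mulTwo_ι {r : U ⊗[ℂ] U} (hr : r ∈ R) : mulTwo (ι R) (ι R) r = 0 := by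
  have h : quadRel R (mulTwo (TensorAlgebra.ι ℂ) (TensorAlgebra.ι ℂ) r) 0 := ⟨⟨r, hr, rfl⟩, rfl⟩
  refine (map_mulTwo (mk R) _ _ r).symm.trans ?_
  exact (RingQuot.mkAlgHom_rel ℂ h).trans (map_zero (mk R))

variable {R} in
theorem exists_lift {Q : Type*} [Ring Q] [Algebra ℂ Q] (f : U →ₗ[ℂ] Q)
    (hf : ∀ r ∈ R, mulTwo f f r = 0) : ∃ F : QuadAlg R →ₐ[ℂ] Q, ∀ u, F (ι R u) = f u := by
  refine ⟨RingQuot.liftAlgHom ℂ ⟨TensorAlgebra.lift ℂ f, ?_⟩, fun u => ?_⟩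
  · rintro _ y ⟨⟨r, hr, rfl⟩, rfl⟩
    rw [map_zero, map_mulTwo]
    refine Eq.trans (congrArg₂ (fun a b => mulTwo a b r) ?_ ?_) (hf r hr) <;>
    · ext u; exact TensorAlgebra.lift_ι_apply f u
  · exact (RingQuot.liftAlgHom_mkAlgHom_apply ℂ _ _ _).trans (TensorAlgebra.lift_ι_apply f u)

/-- A quadratic algebra is spanned by products from the left. -/
theorem eq_top_of_left_stable (T : Submodule ℂ (QuadAlg R)) (h1 : 1 ∈ T)
    (hU : ∀ u, ∀ x ∈ T, ι R u * x ∈ T) : T = ⊤ := by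
  have key : ∀ z : TensorAlgebra ℂ U, ∀ x ∈ T, mk R z * x ∈ T := by
    intro z
    induction z using TensorAlgebra.induction with
    | algebraMap r =>
      intro x hx
      rw [AlgHom.commutes, ← Algebra.smul_def]
      exact T.smul_mem r hx
    | ι u => exact hU u
    | mul a b ha hb =>
      intro x hx
      rw [map_mul, mul_assoc]
      exact ha _ (hb _ hx)
    | add a b ha hb =>
      intro x hx
      rw [map_add, add_mul]
      exact add_mem (ha _ hx) (hb _ hx)
  refine eq_top_iff.2 fun x _ => ?_
  obtain ⟨z, rfl⟩ := RingQuot.mkAlgHom_surjective ℂ (quadRel R) x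
  have := key z 1 h1
  rwa [mul_one] at this

end QuadAlg

end QuadraticAlgebra

/-! ### Twisted tensor products of quadratic algebras. -/

section Twist

variable {U W : Type*} [AddCommGroup U] [Module ℂ U] [AddCommGroup W] [Module ℂ W]
  (τ : W ⊗[ℂ] U →ₗ[ℂ] U ⊗[ℂ] W)

/-- Moving `W` past `U ⊗ U` by means of `τ`. -/
def swapLeft : W ⊗[ℂ] (U ⊗[ℂ] U) →ₗ[ℂ] (U ⊗[ℂ] U) ⊗[ℂ] W :=
  (TensorProduct.assoc ℂ U U W).symm.toLinearMap ∘ₗ τ.lTensor U ∘ₗ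
    (TensorProduct.assoc ℂ U W U).toLinearMap ∘ₗ τ.rTensor U ∘ₗ
      (TensorProduct.assoc ℂ W U U).symm.toLinearMap

/-- Moving `U` past `W ⊗ W` by means of `τ`. -/
def swapRight : (W ⊗[ℂ] W) ⊗[ℂ] U →ₗ[ℂ] U ⊗[ℂ] (W ⊗[ℂ] W) :=
  (TensorProduct.assoc ℂ U W W).toLinearMap ∘ₗ τ.rTensor W ∘ₗ
    (TensorProduct.assoc ℂ W U W).symm.toLinearMap ∘ₗ τ.lTensor W ∘ₗ
      (TensorProduct.assoc ℂ W W U).toLinearMap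

variable {N : Type*} [AddCommGroup N] [Module ℂ N] (l : U →ₗ[ℂ] Module.End ℂ N)

/-- The action of `U` on `Hom(W, N)` which moves the argument past `U`. -/
def twistHom : U →ₗ[ℂ] Module.End ℂ (W →ₗ[ℂ] N) :=
  LinearMap.mk₂ ℂ (fun u g => TensorProduct.lift (l.compl₂ g) ∘ₗ τ ∘ₗ (TensorProduct.mk ℂ W U).flip u)
    (fun u v g => by ext w; simp)
    (fun c u g => by ext w; simp)
    (fun u g g' => by
      ext w
      simp only [LinearMap.comp_apply, LinearMap.add_apply]
      generalize τ ((TensorProduct.mk ℂ W U).flip u w) = s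
      induction s with
      | zero => simp
      | add x y hx hy => rw [map_add, map_add, map_add, hx, hy, add_add_add_comm]
      | tmul u' w' => simp)
    (fun c u g => by
      ext w
      simp only [LinearMap.comp_apply, LinearMap.smul_apply]
      generalize τ ((TensorProduct.mk ℂ W U).flip u w) = s
      induction s with
      | zero => simp
      | add x y hx hy => rw [map_add, map_add, smul_add, hx, hy]
      | tmul u' w' => simp)

theorem twistHom_apply (u : U) (g : W →ₗ[ℂ] N) (w : W) :
    twistHom τ l u g w = TensorProduct.lift (l.compl₂ g) (τ (w ⊗ₜ u)) := rfl

theorem mulTwo_twistHom (t : U ⊗[ℂ] U) (g : W →ₗ[ℂ] N) (w : W) :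
    mulTwo (twistHom τ l) (twistHom τ l) t g w =
      TensorProduct.lift ((mulTwo l l).compl₂ g) (swapLeft τ (w ⊗ₜ t)) := by
  induction t with
  | zero => simp
  | add x y hx hy => rw [TensorProduct.tmul_add, map_add, map_add, map_add, LinearMap.add_apply,
      LinearMap.add_apply, hx, hy]
  | tmul u v =>
    rw [mulTwo_tmul, Module.End.mul_apply, twistHom_apply, swapLeft]
    simp only [LinearMap.comp_apply, LinearEquiv.coe_coe, TensorProduct.assoc_symm_tmul,
      LinearMap.rTensor_tmul]
    generalize τ (w ⊗ₜ u) = s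
    induction s with
    | zero => simp
    | add x y hx hy => simp only [map_add, TensorProduct.add_tmul, hx, hy]
    | tmul u' w' =>
      simp only [TensorProduct.assoc_tmul, LinearMap.lTensor_tmul, TensorProduct.lift.tmul,
        LinearMap.compl₂_apply, twistHom_apply]
      generalize τ (w' ⊗ₜ v) = s
      induction s with
      | zero => simp
      | add x y hx hy => simp only [map_add, TensorProduct.tmul_add, hx, hy]
      | tmul u'' w'' =>
        simp only [TensorProduct.assoc_symm_tmul, TensorProduct.lift.tmul, LinearMap.compl₂_apply,
          mulTwo_tmul, Module.End.mul_apply]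

/-- A product of two twisted actions is the untwisted product after `swapLeft`, which keeps `w ⊗ r`
inside `RU ⊗ W`; there `l` vanishes. -/
theorem mulTwo_twistHom_eq_zero (RU : Submodule ℂ (U ⊗[ℂ] U))
    (h1 : ∀ w, ∀ r ∈ RU, swapLeft τ (w ⊗ₜ r) ∈ LinearMap.range (RU.subtype.rTensor W))
    (hl : ∀ r ∈ RU, mulTwo l l r = 0) {r : U ⊗[ℂ] U} (hr : r ∈ RU) :
    mulTwo (twistHom τ l) (twistHom τ l) r = 0 := by
  ext g w
  rw [mulTwo_twistHom]
  obtain ⟨t, ht⟩ := h1 w r hr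
  have key : ∀ t, TensorProduct.lift ((mulTwo l l).compl₂ g) (RU.subtype.rTensor W t) = 0 := by
    intro t
    induction t with
    | zero => simp
    | add x y hx hy => rw [map_add, map_add, hx, hy, add_zero]
    | tmul r' w' => simp [hl r' r'.2]
  rw [← ht, key]
  rfl

variable {τ} in
theorem mulTwo_swapRight {Q : Type*} [Ring Q] [Algebra ℂ Q] {LU : U →ₗ[ℂ] Q} {LW : W →ₗ[ℂ] Q}
    (h : ∀ t, mulTwo LW LU t = mulTwo LU LW (τ t)) (x : (W ⊗[ℂ] W) ⊗[ℂ] U) :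
    mulTwo (mulTwo LW LW) LU x = mulTwo LU (mulTwo LW LW) (swapRight τ x) := by
  induction x with
  | zero => simp
  | add x y hx hy => rw [map_add, map_add, map_add, hx, hy]
  | tmul t u =>
    induction t with
    | zero => simp
    | add x y hx hy => rw [TensorProduct.add_tmul, map_add, map_add, map_add, hx, hy]
    | tmul w w' =>
      rw [mulTwo_tmul, mulTwo_tmul, mul_assoc, ← mulTwo_tmul LW LU, h, swapRight]
      simp only [LinearMap.comp_apply, LinearEquiv.coe_coe, TensorProduct.assoc_tmul,
        LinearMap.lTensor_tmul]
      generalize τ (w' ⊗ₜ u) = s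
      induction s with
      | zero => simp
      | add x y hx hy =>
        simp only [map_add, TensorProduct.tmul_add, mul_add, hx, hy]
      | tmul u' w'' =>
        rw [mulTwo_tmul, ← mul_assoc, ← mulTwo_tmul LW LU, h, TensorProduct.assoc_symm_tmul,
          LinearMap.rTensor_tmul]
        generalize τ (w ⊗ₜ u') = s
        induction s with
        | zero => simp
        | add x y hx hy =>
          simp only [map_add, TensorProduct.add_tmul, add_mul, hx, hy]
        | tmul u'' w''' =>
          rw [TensorProduct.assoc_tmul, mulTwo_tmul, mulTwo_tmul, mulTwo_tmul, mul_assoc]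

variable {τ}

theorem exists_evaluation {A E : Type*} [Ring A] [Algebra ℂ A] [AddCommGroup E] [Module ℂ E]
    (F : A →ₐ[ℂ] Module.End ℂ E) (g : E) : ∃ c : A →ₗ[ℂ] E, ∀ a, c a = F a g :=
  ⟨LinearMap.applyₗ g ∘ₗ F.toLinearMap, fun _ => rfl⟩

/-- A rule for moving `w` past `u a` determines `c` recursively from `c 1`. Read as an action of `U`
on `Hom(W, N)`, the recursion becomes an algebra map out of `T(U)/(RU)`, and compatibility of `τ`
with `RU` is what makes it well defined. -/
theorem exists_twist_extension (RU : Submodule ℂ (U ⊗[ℂ] U)) (l : U →ₗ[ℂ] Module.End ℂ N)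
    (hl : ∀ r ∈ RU, mulTwo l l r = 0) (g : W →ₗ[ℂ] N)
    (h1 : ∀ w, ∀ r ∈ RU, swapLeft τ (w ⊗ₜ r) ∈ LinearMap.range (RU.subtype.rTensor W)) :
    ∃ c : QuadAlg RU →ₗ[ℂ] W →ₗ[ℂ] N, c 1 = g ∧ ∀ u a w,
      c (QuadAlg.ι RU u * a) w = TensorProduct.lift (l.compl₂ (c a)) (τ (w ⊗ₜ u)) := by
  obtain ⟨F, hF⟩ := QuadAlg.exists_lift (twistHom τ l)
    (fun r hr => mulTwo_twistHom_eq_zero τ l RU h1 hl hr)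
  obtain ⟨c, hc⟩ := exists_evaluation F g
  refine ⟨c, ?_, fun u a w => ?_⟩
  · rw [hc, map_one, Module.End.one_apply]
  · rw [hc, hc, map_mul, hF, Module.End.mul_apply, twistHom_apply]

/-- The action on `Hom(B, K)` by composition. -/
theorem exists_comp_action {B K : Type*} [AddCommGroup B] [Module ℂ B] [AddCommGroup K]
    [Module ℂ K] (RU : Submodule ℂ (U ⊗[ℂ] U)) (LU : U →ₗ[ℂ] Module.End ℂ K)
    (hLU : ∀ r ∈ RU, mulTwo LU LU r = 0) : ∃ l : U →ₗ[ℂ] Module.End ℂ (B →ₗ[ℂ] K),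
      (∀ u g b, l u g b = LU u (g b)) ∧ ∀ r ∈ RU, mulTwo l l r = 0 := by
  obtain ⟨l, hl⟩ : ∃ l : U →ₗ[ℂ] Module.End ℂ (B →ₗ[ℂ] K), ∀ u g b, l u g b = LU u (g b) :=
    ⟨LinearMap.llcomp ℂ B K K ∘ₗ LU, fun _ _ _ => rfl⟩
  refine ⟨l, hl, fun r hr => LinearMap.ext fun g => LinearMap.ext fun b => ?_⟩
  have hll : ∀ t : U ⊗[ℂ] U, (mulTwo (Q := Module.End ℂ (B →ₗ[ℂ] K)) l l t) g b =
      (mulTwo (Q := Module.End ℂ K) LU LU t) (g b) := by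
    intro t
    induction t with
    | zero => rw [map_zero, map_zero]; rfl
    | add x y hx hy =>
      rw [map_add, map_add, LinearMap.add_apply, LinearMap.add_apply, LinearMap.add_apply, hx, hy]
    | tmul u v =>
      rw [mulTwo_tmul, mulTwo_tmul, Module.End.mul_apply, Module.End.mul_apply, hl, hl]
  rw [hll, hLU r hr]
  rfl

/-- Induction on the length of the left factor. On `1 ⊗ b` a relation acts through `κ`; on `u a ⊗ b`
it is moved past `u` by `swapRight`, which leaves elements of `RW` acting on `a ⊗ b`. -/
theorem mulTwo_eq_zero_of_twist {B : Type*} [Ring B] [Algebra ℂ B] (RU : Submodule ℂ (U ⊗[ℂ] U))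
    (RW : Submodule ℂ (W ⊗[ℂ] W)) (κ : W →ₗ[ℂ] B) (hκ : ∀ r ∈ RW, mulTwo κ κ r = 0)
    (h2 : ∀ u, ∀ r ∈ RW, swapRight τ (r ⊗ₜ u) ∈ LinearMap.range (RW.subtype.lTensor U))
    (LU : U →ₗ[ℂ] Module.End ℂ (QuadAlg RU ⊗[ℂ] B)) (LW : W →ₗ[ℂ] Module.End ℂ (QuadAlg RU ⊗[ℂ] B))
    (hLU : ∀ u a b, LU u (a ⊗ₜ b) = (QuadAlg.ι RU u * a) ⊗ₜ b)
    (hLW : ∀ w b, LW w (1 ⊗ₜ b) = 1 ⊗ₜ (κ w * b))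
    (hτ : ∀ t, mulTwo LW LU t = mulTwo LU LW (τ t)) {r : W ⊗[ℂ] W} (hr : r ∈ RW) :
    mulTwo LW LW r = 0 := by
  -- All relations are treated at once, because moving `r` past `u` replaces it by other relations.
  have hT : (⊤ : Submodule ℂ (QuadAlg RU)) ≤ ⨅ (r : RW) (b : B), LinearMap.ker
      (mulTwo LW LW r ∘ₗ (TensorProduct.mk ℂ (QuadAlg RU) B).flip b) := by
    refine (QuadAlg.eq_top_of_left_stable RU _ ?_ fun u a ha => ?_).ge
    · simp only [Submodule.mem_iInf, LinearMap.mem_ker]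
      intro r b
      have h3 : ∀ t, mulTwo LW LW t (1 ⊗ₜ b) = 1 ⊗ₜ (mulTwo κ κ t * b) := by
        intro t
        induction t with
        | zero => simp
        | add x y hx hy =>
          rw [map_add, map_add, LinearMap.add_apply, hx, hy, add_mul, TensorProduct.tmul_add]
        | tmul w w' =>
          rw [mulTwo_tmul, mulTwo_tmul, Module.End.mul_apply, hLW, hLW, mul_assoc]
      refine (h3 r).trans ?_
      rw [hκ r r.2, zero_mul, TensorProduct.tmul_zero]
    · simp only [Submodule.mem_iInf, LinearMap.mem_ker] at ha ⊢
      intro r b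
      have h4 : (mulTwo LW LW r * LU u) (a ⊗ₜ b) = 0 := by
        rw [← mulTwo_tmul (mulTwo LW LW) LU, mulTwo_swapRight hτ]
        obtain ⟨y, hy⟩ := h2 u r r.2
        rw [← hy]
        clear hy
        induction y with
        | zero => simp
        | add x y hx hy => rw [map_add, map_add, LinearMap.add_apply, hx, hy, add_zero]
        | tmul u' r' =>
          rw [LinearMap.lTensor_tmul, mulTwo_tmul, Module.End.mul_apply]
          exact (congrArg (LU u') (ha r' b)).trans (map_zero _)
      rw [Module.End.mul_apply, hLU] at h4
      exact h4
  refine TensorProduct.ext' fun a b => ?_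
  have := hT (show a ∈ ⊤ from trivial)
  simp only [Submodule.mem_iInf, LinearMap.mem_ker] at this
  exact this ⟨r, hr⟩ b

/-- The twisted tensor product: if `τ` is compatible with the relations `RU` and `RW`, then `U` and
`W` act on `T(U)/(RU) ⊗ B`, for an algebra `B` generated by `W` with relations `RW`, so that `W` is
moved past `U` by means of `τ`. -/
theorem exists_twisted_rep {B : Type*} [Ring B] [Algebra ℂ B] (RU : Submodule ℂ (U ⊗[ℂ] U))
    (RW : Submodule ℂ (W ⊗[ℂ] W)) (κ : W →ₗ[ℂ] B) (hκ : ∀ r ∈ RW, mulTwo κ κ r = 0)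
    (h1 : ∀ w, ∀ r ∈ RU, swapLeft τ (w ⊗ₜ r) ∈ LinearMap.range (RU.subtype.rTensor W))
    (h2 : ∀ u, ∀ r ∈ RW, swapRight τ (r ⊗ₜ u) ∈ LinearMap.range (RW.subtype.lTensor U)) :
    ∃ (LU : U →ₗ[ℂ] Module.End ℂ (QuadAlg RU ⊗[ℂ] B)) (LW : W →ₗ[ℂ] Module.End ℂ (QuadAlg RU ⊗[ℂ] B)),
      (∀ u a b, LU u (a ⊗ₜ b) = (QuadAlg.ι RU u * a) ⊗ₜ b) ∧
      (∀ w b, LW w (1 ⊗ₜ b) = 1 ⊗ₜ (κ w * b)) ∧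
      (∀ r ∈ RU, mulTwo LU LU r = 0) ∧ (∀ r ∈ RW, mulTwo LW LW r = 0) ∧
      ∀ t, mulTwo LW LU t = mulTwo LU LW (τ t) := by
  let Λ : QuadAlg RU →ₐ[ℂ] Module.End ℂ (QuadAlg RU ⊗[ℂ] B) :=
    Algebra.lsmul ℂ ℂ (QuadAlg RU ⊗[ℂ] B)
  obtain ⟨LU, hLU⟩ : ∃ LU : U →ₗ[ℂ] Module.End ℂ (QuadAlg RU ⊗[ℂ] B),
      LU = Λ.toLinearMap ∘ₗ QuadAlg.ι RU := ⟨_, rfl⟩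
  have hLU1 : ∀ u a b, LU u (a ⊗ₜ b) = (QuadAlg.ι RU u * a) ⊗ₜ b := fun u a b => by
    rw [hLU]; rfl
  have hLUR : ∀ r ∈ RU, mulTwo LU LU r = 0 := fun r hr => by
    rw [hLU, ← map_mulTwo, QuadAlg.mulTwo_ι RU hr, map_zero]
  -- With `N = Hom(B, T(U)/(RU) ⊗ B)`, the value `c a w b` of the extension can serve as the action
  -- of `w` on `a ⊗ b`.
  obtain ⟨l, hl, hlR⟩ := exists_comp_action (B := B) RU LU hLUR
  obtain ⟨c, hc1, hc⟩ := exists_twist_extension RU l hlR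
    (((LinearMap.mul ℂ B) ∘ₗ κ).compr₂ (TensorProduct.mk ℂ (QuadAlg RU) B 1)) h1
  obtain ⟨LW, hLW⟩ : ∃ LW : W →ₗ[ℂ] Module.End ℂ (QuadAlg RU ⊗[ℂ] B),
      ∀ w a b, LW w (a ⊗ₜ b) = c a w b :=
    ⟨(TensorProduct.lift.equiv (RingHom.id ℂ) (QuadAlg RU) B (QuadAlg RU ⊗[ℂ] B)).toLinearMap ∘ₗ
      c.flip, fun _ _ _ => rfl⟩
  have hLW1 : ∀ w b, LW w (1 ⊗ₜ b) = 1 ⊗ₜ (κ w * b) := fun w b => by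
    rw [hLW, hc1]; rfl
  have hτ : ∀ t, mulTwo LW LU t = mulTwo LU LW (τ t) := by
    intro t
    induction t with
    | zero => simp
    | add x y hx hy => rw [map_add, map_add, map_add, hx, hy]
    | tmul w u =>
      refine TensorProduct.ext' fun a b => ?_
      rw [mulTwo_tmul, Module.End.mul_apply, hLU1, hLW, hc]
      generalize τ (w ⊗ₜ u) = s
      induction s with
      | zero => simp
      | add x y hx hy => rw [map_add, map_add, LinearMap.add_apply, LinearMap.add_apply, hx, hy]
      | tmul u' w' =>
        rw [mulTwo_tmul, Module.End.mul_apply, hLW, TensorProduct.lift.tmul, LinearMap.compl₂_apply,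
          hl]
  exact ⟨LU, LW, hLU1, hLW1, hLUR,
    fun r hr => mulTwo_eq_zero_of_twist RU RW κ hκ h2 LU LW hLU1 hLW1 hτ hr, hτ⟩

end Twist

/-! ### Quadratic relations for a decomposition `V = U ⊕ W`. -/

section Split

variable {V : Type*} [AddCommGroup V] [Module ℂ V] {U W : Submodule ℂ V} (h : IsCompl U W)
  (I : Submodule ℂ (V ⊗[ℂ] V))

/-- The relations induced on a subspace. -/
def subRel (U : Submodule ℂ V) : Submodule ℂ (U ⊗[ℂ] U) :=
  I.comap (TensorProduct.map U.subtype U.subtype)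

/-- The projections on the components of `V ⊗ V` preserve `I`. -/
def IsSplitHomogeneous : Prop :=
  ∀ t ∈ I, TensorProduct.map (U.projection W h) (U.projection W h) t ∈ I ∧
    TensorProduct.map (U.projection W h) (W.projection U h.symm) t +
      TensorProduct.map (W.projection U h.symm) (U.projection W h) t ∈ I ∧
    TensorProduct.map (W.projection U h.symm) (W.projection U h.symm) t ∈ I

variable {I h}

theorem IsSplitHomogeneous.symm (hI : IsSplitHomogeneous h I) : IsSplitHomogeneous h.symm I :=
  fun t ht => ⟨(hI t ht).2.2, by rw [add_comm]; exact (hI t ht).2.1, (hI t ht).1⟩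

theorem map_subtype_map_projectionOnto {U' W' : Submodule ℂ V} (h' : IsCompl U' W')
    (t : V ⊗[ℂ] V) : TensorProduct.map U.subtype U'.subtype
      (TensorProduct.map (U.projectionOnto W h) (U'.projectionOnto W' h') t) =
        TensorProduct.map (U.projection W h) (U'.projection W' h') t := by
  rw [← LinearMap.comp_apply, ← TensorProduct.map_comp]
  rfl

theorem IsSplitHomogeneous.map_mem_subRel (hI : IsSplitHomogeneous h I) {t : V ⊗[ℂ] V}
    (ht : t ∈ I) :
    TensorProduct.map (U.projectionOnto W h) (U.projectionOnto W h) t ∈ subRel I U := by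
  rw [subRel, Submodule.mem_comap, map_subtype_map_projectionOnto]
  exact (hI t ht).1

theorem IsSplitHomogeneous.mulTwo_eq_zero (hI : IsSplitHomogeneous h I) {Q : Type*} [Ring Q]
    [Algebra ℂ Q] (f : U →ₗ[ℂ] Q) (hf : ∀ r ∈ subRel I U, mulTwo f f r = 0) {t : V ⊗[ℂ] V}
    (ht : t ∈ I) : mulTwo (f ∘ₗ U.projectionOnto W h) (f ∘ₗ U.projectionOnto W h) t = 0 := by
  rw [mulTwo_comp]
  exact hf _ (hI.map_mem_subRel ht)

theorem mulTwo_add_add {E Q : Type*} [AddCommGroup E] [Module ℂ E] [Ring Q] [Algebra ℂ Q]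
    (f g : E →ₗ[ℂ] Q) (t : E ⊗[ℂ] E) : mulTwo (f + g) (f + g) t =
      mulTwo f f t + (mulTwo f g t + mulTwo g f t) + mulTwo g g t := by
  induction t with
  | zero => simp
  | add x y hx hy => simp only [map_add, hx, hy]; abel
  | tmul x y =>
    simp only [mulTwo_tmul, LinearMap.add_apply, add_mul, mul_add]
    abel

/-- The pure components of a relation vanish by `hf` and `hg`. In the mixed part, replacing `y ∈ W ⊗
U` by `τ y` gives `x + τ y`, which lies in `I ∩ (U ⊗ W) = 0`. -/
theorem IsSplitHomogeneous.mulTwo_sum_eq_zero (hI : IsSplitHomogeneous h I)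
    (hd : Disjoint (Submodule.map₂ (TensorProduct.mk ℂ V V) U W) I)
    {τ : W ⊗[ℂ] U →ₗ[ℂ] U ⊗[ℂ] W} (hτ : ∀ t, TensorProduct.map W.subtype U.subtype t -
      TensorProduct.map U.subtype W.subtype (τ t) ∈ I) {Q : Type*} [Ring Q] [Algebra ℂ Q]
    (f : U →ₗ[ℂ] Q) (g : W →ₗ[ℂ] Q) (hf : ∀ r ∈ subRel I U, mulTwo f f r = 0)
    (hg : ∀ r ∈ subRel I W, mulTwo g g r = 0) (hfg : ∀ t, mulTwo g f t = mulTwo f g (τ t))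
    {t : V ⊗[ℂ] V} (ht : t ∈ I) :
    mulTwo (f ∘ₗ U.projectionOnto W h + g ∘ₗ W.projectionOnto U h.symm)
      (f ∘ₗ U.projectionOnto W h + g ∘ₗ W.projectionOnto U h.symm) t = 0 := by
  rw [mulTwo_add_add, hI.mulTwo_eq_zero f hf ht, hI.symm.mulTwo_eq_zero g hg ht, zero_add, add_zero,
    mulTwo_comp, mulTwo_comp, hfg, ← map_add]
  set x := TensorProduct.map (U.projectionOnto W h) (W.projectionOnto U h.symm) t with hx
  set y := TensorProduct.map (W.projectionOnto U h.symm) (U.projectionOnto W h) t with hy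
  have h1 : TensorProduct.map U.subtype W.subtype (x + τ y) ∈ I := by
    have h2 := sub_mem (hI t ht).2.1 (hτ y)
    rw [hy, map_subtype_map_projectionOnto, ← hy, ← map_subtype_map_projectionOnto, ← hx] at h2
    rw [map_add]
    convert h2 using 1
    abel
  have h2 := Submodule.disjoint_def.1 hd _ (by rw [← range_map_subtype]; exact ⟨_, rfl⟩) h1
  have h3 : x + τ y = 0 := map_subtype_injective U W (h2.trans (map_zero _).symm)
  rw [h3, map_zero]

/-- The actions of `V = U ⊕ W` on `T(U)/(I)`, `T(W)/(I)` and on their twisted tensor product. -/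
theorem IsSplitHomogeneous.exists_actions (hI : IsSplitHomogeneous h I)
    (hd : Disjoint (Submodule.map₂ (TensorProduct.mk ℂ V V) U W) I)
    {τ : W ⊗[ℂ] U →ₗ[ℂ] U ⊗[ℂ] W} (hτ : ∀ t, TensorProduct.map W.subtype U.subtype t -
      TensorProduct.map U.subtype W.subtype (τ t) ∈ I)
    (h1 : ∀ w, ∀ r ∈ subRel I U,
      swapLeft τ (w ⊗ₜ r) ∈ LinearMap.range ((subRel I U).subtype.rTensor W))
    (h2 : ∀ u, ∀ r ∈ subRel I W,
      swapRight τ (r ⊗ₜ u) ∈ LinearMap.range ((subRel I W).subtype.lTensor U)) :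
    ∃ (LA : V →ₗ[ℂ] QuadAlg (subRel I U)) (LB : V →ₗ[ℂ] QuadAlg (subRel I W))
      (L : V →ₗ[ℂ] Module.End ℂ (QuadAlg (subRel I U) ⊗[ℂ] QuadAlg (subRel I W))),
      (∀ t ∈ I, mulTwo LA LA t = 0 ∧ mulTwo LB LB t = 0 ∧ mulTwo L L t = 0) ∧
      (∀ u : U, LA u = QuadAlg.ι _ u) ∧ (∀ w : W, LB w = QuadAlg.ι _ w) ∧
      (∀ (u : U) a b, L u (a ⊗ₜ b) = (LA u * a) ⊗ₜ b) ∧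
      ∀ (w : W) b, L w (1 ⊗ₜ b) = 1 ⊗ₜ (LB w * b) := by
  have hA := fun r hr => QuadAlg.mulTwo_ι (subRel I U) (r := r) hr
  have hB := fun r hr => QuadAlg.mulTwo_ι (subRel I W) (r := r) hr
  obtain ⟨LU, LW, hLU, hLW, hLUR, hLWR, hτ'⟩ :=
    exists_twisted_rep (subRel I U) (subRel I W) (QuadAlg.ι (subRel I W)) hB h1 h2
  refine ⟨QuadAlg.ι _ ∘ₗ U.projectionOnto W h, QuadAlg.ι _ ∘ₗ W.projectionOnto U h.symm,
    LU ∘ₗ U.projectionOnto W h + LW ∘ₗ W.projectionOnto U h.symm,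
    fun t ht => ⟨hI.mulTwo_eq_zero _ hA ht, hI.symm.mulTwo_eq_zero _ hB ht,
      hI.mulTwo_sum_eq_zero hd hτ LU LW hLUR hLWR hτ' ht⟩, fun u => ?_, fun w => ?_,
    fun u a b => ?_, fun w b => ?_⟩
  · rw [LinearMap.comp_apply, Submodule.projectionOnto_apply_left]
  · rw [LinearMap.comp_apply, Submodule.projectionOnto_apply_left]
  · rw [LinearMap.add_apply, LinearMap.comp_apply, LinearMap.comp_apply, LinearMap.comp_apply,
      Submodule.projectionOnto_apply_left, Submodule.projectionOnto_apply_right, map_zero,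
      add_zero, hLU]
  · rw [LinearMap.add_apply, LinearMap.comp_apply, LinearMap.comp_apply, LinearMap.comp_apply,
      Submodule.projectionOnto_apply_left, Submodule.projectionOnto_apply_right, map_zero,
      zero_add, hLW]

/-- The elements whose image under a homomorphism into `End K` restricts to a given action. -/
theorem exists_subalgebra_intertwine {A K E : Type*} [Ring A] [Algebra ℂ A]
    [AddCommGroup K] [Module ℂ K] [AddCommGroup E] [Module ℂ E] (j : A →ₐ[ℂ] Module.End ℂ K)
    (k : A →ₐ[ℂ] Module.End ℂ E) (f : E →ₗ[ℂ] K) :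
    ∃ S : Subalgebra ℂ A, ∀ x, x ∈ S ↔ ∀ e, j x (f e) = f (k x e) :=
  ⟨{ carrier := {x | ∀ e, j x (f e) = f (k x e)}
     mul_mem' := fun {a b} ha hb e => by
      rw [map_mul, map_mul, Module.End.mul_apply, Module.End.mul_apply, hb, ha]
     add_mem' := fun {a b} ha hb e => by
      rw [map_add, map_add, LinearMap.add_apply, LinearMap.add_apply, hb, ha, map_add]
     algebraMap_mem' := fun r e => by
      rw [AlgHom.commutes, AlgHom.commutes, Module.algebraMap_end_apply,
        Module.algebraMap_end_apply, map_smul] }, fun _ => Iff.rfl⟩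

end Split

/-! ### Multiplication on the fibre of `Ω•`. -/

section Fibre

variable {G H : Type*} [Ring G] [HopfAlgebra ℂ G] [Ring H] [HopfAlgebra ℂ H] {π : G →ₐc[ℂ] H}
variable {Ω : Type*} [AddCommGroup Ω] [Module ℂ Ω]
  [Module (coinv π) Ω] [IsScalarTower ℂ (coinv π) Ω]
  [Module (coinv π)ᵐᵒᵖ Ω] [IsScalarTower ℂ (coinv π)ᵐᵒᵖ Ω]
  [SMulCommClass (coinv π) (coinv π)ᵐᵒᵖ Ω]

namespace CovariantCalculus

variable (C : CovariantCalculus π Ω)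

theorem ofM_mul_mem_augSub (m : coinv π) {x : C.MaximalProlongation}
    (hx : x ∈ augSub (counitM π) C.MaximalProlongation) :
    C.ofM m * x ∈ augSub (counitM π) C.MaximalProlongation := by
  induction hx using Submodule.span_induction with
  | mem x hx =>
    obtain ⟨a, e, ha, rfl⟩ := hx
    refine Submodule.subset_span ⟨m * a, e, by rw [map_mul, ha, mul_zero], ?_⟩
    rw [mul_smul]; rfl
  | zero => rw [mul_zero]; exact zero_mem _
  | add x y _ _ hx hy => rw [mul_add]; exact add_mem hx hy
  | smul c x _ hx => rw [mul_smul_comm]; exact Submodule.smul_mem _ c hx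

theorem ofForms_mul_mem_augSub_of_mem {ω : Ω} (hω : ω ∈ augSub (counitM π) Ω)
    (x : C.MaximalProlongation) :
    C.ofForms ω * x ∈ augSub (counitM π) C.MaximalProlongation := by
  induction hω using Submodule.span_induction with
  | mem ω hω =>
    obtain ⟨a, e, ha, rfl⟩ := hω
    refine Submodule.subset_span ⟨a, C.ofForms e * x, ha, ?_⟩
    rw [← ofM_mul_ofForms, mul_assoc]; rfl
  | zero => rw [map_zero, zero_mul]; exact zero_mem _
  | add ω η _ _ hx hy => rw [map_add, add_mul]; exact add_mem hx hy
  | smul c ω _ hx => rw [map_smul, smul_mul_assoc]; exact Submodule.smul_mem _ c hx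

-- The hypothesis `Ω M⁺ ⊆ M⁺ Ω` enters here: `ω ∧ (a e) = (ω a) ∧ e`, and `ω a ∈ M⁺Ω` when `ε(a) =
-- 0`. So multiplication by forms descends to the fibre.
variable {C} in
theorem ofForms_mul_mem_augSub (h0 : IsInM0 π Ω) (ω : Ω) {x : C.MaximalProlongation}
    (hx : x ∈ augSub (counitM π) C.MaximalProlongation) :
    C.ofForms ω * x ∈ augSub (counitM π) C.MaximalProlongation := by
  induction hx using Submodule.span_induction with
  | mem x hx =>
    obtain ⟨a, e, ha, rfl⟩ := hx
    rw [coinv_smul_def, ← mul_assoc, ofForms_mul_ofM]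
    exact C.ofForms_mul_mem_augSub_of_mem (h0 a ω ha) e
  | zero => rw [mul_zero]; exact zero_mem _
  | add x y _ _ hx hy => rw [mul_add]; exact add_mem hx hy
  | smul c x _ hx => rw [mul_smul_comm]; exact Submodule.smul_mem _ c hx

/-- The maximal prolongation satisfies `Ω• M⁺ ⊆ M⁺ Ω•`. -/
theorem mul_ofM_mem_augSub (h0 : IsInM0 π Ω) {m : coinv π} (hm : counitM π m = 0)
    (x : C.MaximalProlongation) : x * C.ofM m ∈ augSub (counitM π) C.MaximalProlongation := by
  have h1 := C.eq_top_of_left_stable ((augSub (counitM π) C.MaximalProlongation).comap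
    (LinearMap.mulRight ℂ (C.ofM m))) ?_ (fun a x hx => ?_) (fun ω x hx => ?_)
  · have : x ∈ (⊤ : Submodule ℂ C.MaximalProlongation) := trivial
    rw [← h1] at this
    exact this
  · exact Submodule.subset_span ⟨m, 1, hm, by rw [coinv_smul_def]; simp⟩
  · change C.ofM a * x * C.ofM m ∈ augSub (counitM π) C.MaximalProlongation
    rw [mul_assoc]
    exact C.ofM_mul_mem_augSub a hx
  · change C.ofForms ω * x * C.ofM m ∈ augSub (counitM π) C.MaximalProlongation
    rw [mul_assoc]
    exact ofForms_mul_mem_augSub h0 ω hx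

/-- The left multiplication by forms defines an action of `V` on `Φ(Ω•)`. -/
theorem exists_fibre_action (h0 : IsInM0 π Ω) :
    ∃ L : C.V →ₗ[ℂ] Module.End ℂ (Phi (counitM π) C.MaximalProlongation),
      (∀ ω x, L (C.sigmaMk ω) (Phi.mk (counitM π) x) = Phi.mk (counitM π) (C.ofForms ω * x)) ∧
        ∀ z ∈ C.ITwo h0, mulTwo L L z = 0 := by
  obtain ⟨f, hf⟩ := Phi.exists_lift (counitM π) (E := C.MaximalProlongation)
    (P := Ω →ₗ[ℂ] Phi (counitM π) C.MaximalProlongation)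
    ((LinearMap.mul ℂ C.MaximalProlongation ∘ₗ C.ofForms).compr₂ (Phi.mk (counitM π))).flip
    (fun a e ha => LinearMap.ext fun ω => (Submodule.Quotient.mk_eq_zero _).2
      (ofForms_mul_mem_augSub h0 ω (Submodule.subset_span ⟨a, e, ha, rfl⟩)))
  have hf' : ∀ ω x, f (Phi.mk (counitM π) x) ω = Phi.mk (counitM π) (C.ofForms ω * x) :=
    fun ω x => congrArg (fun g => g ω) (hf x)
  obtain ⟨L, hL⟩ := C.exists_lift_sigmaMk
    (P := Module.End ℂ (Phi (counitM π) C.MaximalProlongation)) f.flip (fun m ω => by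
      refine LinearMap.ext fun y => ?_
      obtain ⟨x, rfl⟩ := Phi.mk_surjective _ y
      refine (hf' _ _).trans ?_
      rw [← ofM_mul_ofForms, mul_assoc]
      refine (Phi.mk_smul (counitM π) m (C.ofForms ω * x)).trans ?_
      rw [← hf']; rfl)
  have hL' : ∀ ω x, L (C.sigmaMk ω) (Phi.mk (counitM π) x) =
      Phi.mk (counitM π) (C.ofForms ω * x) := fun ω x => by
    rw [hL]; exact hf' ω x
  refine ⟨L, hL', fun z hz => LinearMap.ext fun y => ?_⟩
  obtain ⟨x, rfl⟩ := Phi.mk_surjective _ y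
  rw [ITwo_eq] at hz
  obtain ⟨t, ht, rfl⟩ := hz
  have h1 : ∀ t, mulTwo L L (C.sigmaSq t) (Phi.mk (counitM π) x) =
      Phi.mk (counitM π) (C.wedgeForms t * x) := by
    intro t
    induction t with
    | zero => simp
    | add a b ha hb =>
      rw [map_add, map_add, LinearMap.add_apply, ha, hb, map_add, add_mul, map_add]
    | tmul a b =>
      rw [sigmaSq_tmul, mulTwo_tmul, Module.End.mul_apply, hL', hL', wedgeForms_tmul, mul_assoc]
  rw [h1, C.wedgeForms_relTwo ht, zero_mul, map_zero]
  rfl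

/-- The subalgebra of forms generated by `M` and a space `X` of one-forms. -/
def formSubalgebra (X : Submodule ℂ Ω) : Subalgebra ℂ C.MaximalProlongation :=
  Algebra.adjoin ℂ (Set.range C.ofM ∪ C.ofForms '' X)

variable {C} in
theorem formSubalgebra_induction {X : Submodule ℂ Ω} (S : Subalgebra ℂ C.MaximalProlongation)
    (hM : ∀ m, C.ofM m ∈ S) (hX : ∀ ω ∈ X, C.ofForms ω ∈ S) : C.formSubalgebra X ≤ S := by
  refine Algebra.adjoin_le ?_
  rintro _ (⟨m, rfl⟩ | ⟨ω, hω, rfl⟩)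
  · exact hM m
  · exact hX ω hω

end CovariantCalculus

end Fibre

/-! ### Injectivity of products in the fibre. -/

section Injectivity

variable {G H : Type*} [Ring G] [HopfAlgebra ℂ G] [Ring H] [HopfAlgebra ℂ H] {π : G →ₐc[ℂ] H}
variable {Ω : Type*} [AddCommGroup Ω] [Module ℂ Ω]
  [Module (coinv π) Ω] [IsScalarTower ℂ (coinv π) Ω]
  [Module (coinv π)ᵐᵒᵖ Ω] [IsScalarTower ℂ (coinv π)ᵐᵒᵖ Ω]
  [SMulCommClass (coinv π) (coinv π)ᵐᵒᵖ Ω]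

namespace CovariantCalculus

variable (C : CovariantCalculus π Ω) (h0 : IsInM0 π Ω)

theorem sigmaMk_mem_toV {X : Submodule ℂ Ω} {ω : Ω} (hω : ω ∈ X) : C.sigmaMk ω ∈ C.toV X := by
  rw [toV_eq_map]; exact ⟨ω, hω, rfl⟩

/-- A form generated by `M` and `X` whose image in the quadratic algebra of `X` is known has known
class in `Φ(Ω•)`. -/
theorem exists_fibre_class (X : Submodule ℂ Ω) (LA : C.V →ₗ[ℂ] QuadAlg (subRel (C.ITwo h0) (C.toV X)))
    (hLA : ∀ u : C.toV X, LA u = QuadAlg.ι _ u)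
    (jA : C.MaximalProlongation →ₐ[ℂ] QuadAlg (subRel (C.ITwo h0) (C.toV X)))
    (hM : ∀ m, jA (C.ofM m) = algebraMap ℂ _ (counitM π m))
    (hΩ : ∀ ω, jA (C.ofForms ω) = LA (C.sigmaMk ω)) :
    ∃ s : QuadAlg (subRel (C.ITwo h0) (C.toV X)) →ₗ[ℂ] Phi (counitM π) C.MaximalProlongation,
      ∀ x ∈ C.formSubalgebra X, s (jA x) = Phi.mk (counitM π) x := by
  obtain ⟨L, hL, hLI⟩ := C.exists_fibre_action h0
  obtain ⟨F, hF⟩ := QuadAlg.exists_lift (R := subRel (C.ITwo h0) (C.toV X))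
    (L ∘ₗ (C.toV X).subtype) (fun r hr => by rw [mulTwo_comp]; exact hLI _ hr)
  -- For `x` generated by `M` and `X`, the action of `jA x` on `Φ(Ω•)` is left multiplication by
  -- `x`; evaluation at `[1]` yields the class of `x`.
  obtain ⟨S, hS⟩ := exists_subalgebra_intertwine
    (K := Phi (counitM π) C.MaximalProlongation) (E := C.MaximalProlongation) (F.comp jA) (Algebra.lmul ℂ C.MaximalProlongation)
    (Phi.mk (counitM π) : C.MaximalProlongation →ₗ[ℂ] _)
  have h1 : C.formSubalgebra X ≤ S := by
    refine formSubalgebra_induction S (fun m => (hS _).2 fun e => ?_)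
      (fun ω hω => (hS _).2 fun e => ?_)
    · rw [AlgHom.comp_apply, hM, AlgHom.commutes, Module.algebraMap_end_apply]
      exact (Phi.mk_smul (counitM π) m e).symm
    · have h2 : LA (C.sigmaMk ω) = QuadAlg.ι _ ⟨C.sigmaMk ω, C.sigmaMk_mem_toV hω⟩ :=
        hLA ⟨_, C.sigmaMk_mem_toV hω⟩
      rw [AlgHom.comp_apply, hΩ, h2, hF]
      exact hL ω e
  obtain ⟨s, hs⟩ := exists_evaluation F (Phi.mk (counitM π) (1 : C.MaximalProlongation))
  refine ⟨s, fun x hx => ?_⟩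
  rw [hs]
  refine ((hS x).1 (h1 hx) 1).trans ?_
  exact congrArg _ (mul_one x)

/-- Left multiplications by forms generated by `X` and `Y` in the twisted tensor product. -/
theorem product_rep_apply {X Y : Submodule ℂ Ω} {A B : Type*} [Ring A] [Algebra ℂ A] [Ring B]
    [Algebra ℂ B] (LA : C.V →ₗ[ℂ] A) (LB : C.V →ₗ[ℂ] B) (L : C.V →ₗ[ℂ] Module.End ℂ (A ⊗[ℂ] B))
    (hLA : ∀ (u : C.toV X) a b, L u (a ⊗ₜ b) = (LA u * a) ⊗ₜ b)
    (hLB : ∀ (w : C.toV Y) b, L w (1 ⊗ₜ b) = 1 ⊗ₜ (LB w * b))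
    (jA : C.MaximalProlongation →ₐ[ℂ] A) (hA : ∀ m, jA (C.ofM m) = algebraMap ℂ _ (counitM π m))
    (hA' : ∀ ω, jA (C.ofForms ω) = LA (C.sigmaMk ω))
    (jB : C.MaximalProlongation →ₐ[ℂ] B) (hB : ∀ m, jB (C.ofM m) = algebraMap ℂ _ (counitM π m))
    (hB' : ∀ ω, jB (C.ofForms ω) = LB (C.sigmaMk ω))
    (j : C.MaximalProlongation →ₐ[ℂ] Module.End ℂ (A ⊗[ℂ] B))
    (hj : ∀ m, j (C.ofM m) = algebraMap ℂ _ (counitM π m))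
    (hj' : ∀ ω, j (C.ofForms ω) = L (C.sigmaMk ω)) {x y : C.MaximalProlongation}
    (hx : x ∈ C.formSubalgebra X) (hy : y ∈ C.formSubalgebra Y) :
    j (x * y) (1 ⊗ₜ 1) = jA x ⊗ₜ jB y := by
  -- Forms generated by `X` act on the left factor everywhere, but those generated by `Y` act on the
  -- right factor only on `1 ⊗ B`. This is enough, as `y` is applied first, to `1 ⊗ 1`.
  obtain ⟨S, hS⟩ := exists_subalgebra_intertwine (K := A ⊗[ℂ] B) (E := B) j ((Algebra.lmul ℂ B).comp jB)
    (TensorProduct.mk ℂ A B 1)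
  obtain ⟨T, hT⟩ := exists_subalgebra_intertwine (K := A ⊗[ℂ] B) (E := A ⊗[ℂ] B) j
    ((Algebra.lsmul ℂ ℂ (A ⊗[ℂ] B) : A →ₐ[ℂ] Module.End ℂ (A ⊗[ℂ] B)).comp jA) LinearMap.id
  have h1 : C.formSubalgebra Y ≤ S := by
    refine formSubalgebra_induction S (fun m => (hS _).2 fun e => ?_)
      (fun ω hω => (hS _).2 fun e => ?_)
    · rw [hj, Module.algebraMap_end_apply, AlgHom.comp_apply, hB, AlgHom.commutes,
        Module.algebraMap_end_apply, map_smul]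
    · rw [hj', AlgHom.comp_apply, hB']
      exact hLB ⟨_, C.sigmaMk_mem_toV hω⟩ e
  have h2 : C.formSubalgebra X ≤ T := by
    refine formSubalgebra_induction T (fun m => (hT _).2 fun e => ?_)
      (fun ω hω => (hT _).2 fun e => ?_)
    · rw [hj, Module.algebraMap_end_apply, AlgHom.comp_apply, hA, AlgHom.commutes,
        Module.algebraMap_end_apply, map_smul]
    · rw [hj', AlgHom.comp_apply, hA']
      induction e with
      | zero => simp
      | add a b ha hb => rw [map_add, map_add, ha, hb, map_add, map_add]
      | tmul a b => exact hLA ⟨_, C.sigmaMk_mem_toV hω⟩ a b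
  rw [map_mul, Module.End.mul_apply]
  refine (congrArg (j x) ((hS y).1 (h1 hy) 1)).trans (((hT x).1 (h2 hx) _).trans ?_)
  change jA x • ((1 : A) ⊗ₜ[ℂ] (jB y * 1)) = _
  rw [TensorProduct.smul_tmul', smul_eq_mul, mul_one, mul_one]

/-- In the twisted tensor product of the quadratic algebras, `x y` sends `1 ⊗ 1` to `jA x ⊗ jB y`.
So a vanishing sum of products gives a vanishing tensor, and `jA x`, `jB y` determine the classes of
`x` and `y`. -/
theorem map_mk_eq_zero {X Y : Submodule ℂ Ω} {h : IsCompl (C.toV X) (C.toV Y)}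
    (hI : IsSplitHomogeneous h (C.ITwo h0))
    (hd : Disjoint (Submodule.map₂ (TensorProduct.mk ℂ C.V C.V) (C.toV X) (C.toV Y)) (C.ITwo h0))
    {τ : C.toV Y ⊗[ℂ] C.toV X →ₗ[ℂ] C.toV X ⊗[ℂ] C.toV Y}
    (hτ : ∀ t, TensorProduct.map (C.toV Y).subtype (C.toV X).subtype t -
      TensorProduct.map (C.toV X).subtype (C.toV Y).subtype (τ t) ∈ C.ITwo h0)
    (h1 : ∀ w, ∀ r ∈ subRel (C.ITwo h0) (C.toV X),
      swapLeft τ (w ⊗ₜ r) ∈ LinearMap.range ((subRel (C.ITwo h0) (C.toV X)).subtype.rTensor _))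
    (h2 : ∀ u, ∀ r ∈ subRel (C.ITwo h0) (C.toV Y),
      swapRight τ (r ⊗ₜ u) ∈ LinearMap.range ((subRel (C.ITwo h0) (C.toV Y)).subtype.lTensor _))
    {t : C.MaximalProlongation ⊗[ℂ] C.MaximalProlongation}
    (ht : t ∈ Submodule.map₂ (TensorProduct.mk ℂ _ _) (C.formSubalgebra X).toSubmodule
      (C.formSubalgebra Y).toSubmodule) (ht0 : LinearMap.mul' ℂ _ t = 0) :
    TensorProduct.map (Phi.mk (counitM π)) (Phi.mk (counitM π)) t = 0 := by
  obtain ⟨LA, LB, L, hI', hLA, hLB, hL, hL'⟩ := hI.exists_actions hd hτ h1 h2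
  obtain ⟨jA, hA, hA', -⟩ := C.exists_prolongation_rep h0 LA fun z hz => (hI' z hz).1
  obtain ⟨jB, hB, hB', -⟩ := C.exists_prolongation_rep h0 LB fun z hz => (hI' z hz).2.1
  obtain ⟨j, hj, hj', -⟩ := C.exists_prolongation_rep h0 L fun z hz => (hI' z hz).2.2
  obtain ⟨sA, hsA⟩ := C.exists_fibre_class h0 X LA hLA jA hA hA'
  obtain ⟨sB, hsB⟩ := C.exists_fibre_class h0 Y LB hLB jB hB hB'
  have h3 : TensorProduct.map jA.toLinearMap jB.toLinearMap t = 0 := by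
    have h4 : Submodule.map₂ (TensorProduct.mk ℂ _ _) (C.formSubalgebra X).toSubmodule
        (C.formSubalgebra Y).toSubmodule ≤ LinearMap.ker
          (TensorProduct.map jA.toLinearMap jB.toLinearMap -
            LinearMap.applyₗ (1 ⊗ₜ 1) ∘ₗ j.toLinearMap ∘ₗ LinearMap.mul' ℂ _) := by
      refine Submodule.map₂_le.2 fun x hx y hy => ?_
      rw [LinearMap.mem_ker, LinearMap.sub_apply, sub_eq_zero]
      exact (C.product_rep_apply LA LB L hL hL' jA hA hA' jB hB hB' j hj hj' hx hy).symm
    have h5 := sub_eq_zero.1 (LinearMap.mem_ker.1 (h4 ht))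
    refine h5.trans ?_
    change j (LinearMap.mul' ℂ _ t) (1 ⊗ₜ 1) = 0
    rw [ht0, map_zero]
    rfl
  have h6 := map_eq_map_of_mem (f := sA ∘ₗ jA.toLinearMap) (f' := Phi.mk (counitM π))
    (g := sB ∘ₗ jB.toLinearMap) (g' := Phi.mk (counitM π)) hsA hsB ht
  rw [← h6, TensorProduct.map_comp, LinearMap.comp_apply, h3, map_zero]

end CovariantCalculus

end Injectivity

/-! ### Products of the subspaces `G ⊗ W`. -/

section GTensor

variable {G : Type*} [Ring G] [HopfAlgebra ℂ G]

theorem diagMul_mem_gTensor {E F : Type*} [AddCommGroup E] [Module ℂ E] [AddCommGroup F]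
    [Module ℂ F] {A : Submodule ℂ E} {B : Submodule ℂ F} {S : Submodule ℂ (E ⊗[ℂ] F)}
    (h : ∀ a ∈ A, ∀ b ∈ B, a ⊗ₜ b ∈ S) {z : G ⊗[ℂ] E} (hz : z ∈ gTensor G A) {w : G ⊗[ℂ] F}
    (hw : w ∈ gTensor G B) : diagMul (z ⊗ₜ w) ∈ gTensor G S := by
  have h1 : gTensor G A ≤ (gTensor G S).comap (diagMul ∘ₗ (TensorProduct.mk ℂ _ _).flip w) :=
    gTensor_le fun g a ha => by
      have h2 : gTensor G B ≤ (gTensor G S).comap (diagMul ∘ₗ TensorProduct.mk ℂ _ _ (g ⊗ₜ a)) :=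
        gTensor_le fun g' b hb => tmul_mem_gTensor (g * g') (h a ha b hb)
      exact h2 hw
  exact h1 hz

theorem mul_eq_lTensor_diagMul {A : Type*} [Ring A] [Algebra ℂ A] (z w : G ⊗[ℂ] A) :
    z * w = (LinearMap.mul' ℂ A).lTensor G (diagMul (z ⊗ₜ w)) := by
  refine Eq.trans ?_ (ext_diag (p := LinearMap.mul' ℂ (G ⊗[ℂ] A))
    (q := (LinearMap.mul' ℂ A).lTensor G ∘ₗ diagMul) (fun g e g' f => ?_) z w)
  · rfl
  · rw [LinearMap.mul'_apply, Algebra.TensorProduct.tmul_mul_tmul, LinearMap.comp_apply,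
      diagMul_tmul, LinearMap.lTensor_tmul, LinearMap.mul'_apply]

theorem mul_mem_gTensor {A : Type*} [Ring A] [Algebra ℂ A] {P Q S : Submodule ℂ A}
    (h : ∀ a ∈ P, ∀ b ∈ Q, a * b ∈ S) {z w : G ⊗[ℂ] A} (hz : z ∈ gTensor G P)
    (hw : w ∈ gTensor G Q) : z * w ∈ gTensor G S := by
  rw [mul_eq_lTensor_diagMul]
  have h1 := diagMul_mem_gTensor (S := S.comap (LinearMap.mul' ℂ A)) (fun a ha b hb => h a ha b hb)
    hz hw
  have h2 : gTensor G (S.comap (LinearMap.mul' ℂ A)) ≤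
      (gTensor G S).comap ((LinearMap.mul' ℂ A).lTensor G) :=
    gTensor_le fun g t ht => tmul_mem_gTensor g ht
  exact h2 h1

end GTensor

/-! ### Transporters between subspaces of an algebra. -/

section Transporter

variable {A : Type*} [Ring A] [Algebra ℂ A]

/-- The elements `x` with `P x ⊆ Q`. -/
def leftTransporter (P Q : Submodule ℂ A) : Submodule ℂ A :=
  ⨅ y : P, Q.comap (LinearMap.mulLeft ℂ (y : A))

theorem mem_leftTransporter {P Q : Submodule ℂ A} {x : A} :
    x ∈ leftTransporter P Q ↔ ∀ y ∈ P, y * x ∈ Q := by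
  simp [leftTransporter]

end Transporter

/-! ### Generation of a bigrading by `M`, `X` and `Y`. -/

section Graded

variable {G H : Type*} [Ring G] [HopfAlgebra ℂ G] [Ring H] [HopfAlgebra ℂ H] {π : G →ₐc[ℂ] H}
variable {Ω : Type*} [AddCommGroup Ω] [Module ℂ Ω]
  [Module (coinv π) Ω] [IsScalarTower ℂ (coinv π) Ω]
  [Module (coinv π)ᵐᵒᵖ Ω] [IsScalarTower ℂ (coinv π)ᵐᵒᵖ Ω]
  [SMulCommClass (coinv π) (coinv π)ᵐᵒᵖ Ω]

namespace CovariantCalculus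

variable {C : CovariantCalculus π Ω} {X Y : Submodule ℂ Ω}
  {𝒜 : ℕ × ℕ → Submodule ℂ C.MaximalProlongation}

namespace IsBigrading

variable (hA : C.IsBigrading X Y 𝒜)

include hA

theorem ofM_mem (m : coinv π) : C.ofM m ∈ 𝒜 0 := by
  have h1 : C.ofM m ∈ C.degree 0 := by
    rw [degree, pow_zero, mul_one]; exact ⟨m, rfl⟩
  rw [hA.degree_eq] at h1
  refine (iSup₂_le fun i hi => ?_ : ⨆ i ∈ {i : ℕ × ℕ | i.1 + i.2 = 0}, 𝒜 i ≤ 𝒜 0) h1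
  have hi' : i.1 + i.2 = 0 := hi
  have : i = 0 := Prod.ext (by simp; omega) (by simp; omega)
  rw [this]

theorem ofM_mul_mem (m : coinv π) {i : ℕ × ℕ} {x : C.MaximalProlongation} (hx : x ∈ 𝒜 i) :
    C.ofM m * x ∈ 𝒜 i := by
  have := hA.mul_mem 0 i _ (hA.ofM_mem m) x hx
  rwa [zero_add] at this

theorem mul_ofM_mem (m : coinv π) {i : ℕ × ℕ} {x : C.MaximalProlongation} (hx : x ∈ 𝒜 i) :
    x * C.ofM m ∈ 𝒜 i := by
  have := hA.mul_mem i 0 x hx _ (hA.ofM_mem m)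
  rwa [add_zero] at this

theorem ofForms_mem_left {ω : Ω} (hω : ω ∈ X) : C.ofForms ω ∈ 𝒜 (1, 0) := by
  rw [hA.extends10]; exact ⟨ω, hω, rfl⟩

theorem ofForms_mem_right {ω : Ω} (hω : ω ∈ Y) : C.ofForms ω ∈ 𝒜 (0, 1) := by
  rw [hA.extends01]; exact ⟨ω, hω, rfl⟩

/-- The bigrading is generated from the left by `M`, `X` and `Y`. -/
theorem eq_of_left_stable (h : IsCompl X Y) (𝒞 : ℕ × ℕ → Submodule ℂ C.MaximalProlongation)
    (hle : ∀ i, 𝒞 i ≤ 𝒜 i) (h1 : 1 ∈ 𝒞 0) (hM : ∀ m i, ∀ x ∈ 𝒞 i, C.ofM m * x ∈ 𝒞 i)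
    (hX : ∀ ω ∈ X, ∀ i, ∀ x ∈ 𝒞 i, C.ofForms ω * x ∈ 𝒞 ((1, 0) + i))
    (hY : ∀ ω ∈ Y, ∀ i, ∀ x ∈ 𝒞 i, C.ofForms ω * x ∈ 𝒞 ((0, 1) + i)) (i : ℕ × ℕ) : 𝒞 i = 𝒜 i := by
  have htop : ⨆ i, 𝒞 i = ⊤ := by
    refine C.eq_top_of_left_stable _ (Submodule.mem_iSup_of_mem 0 h1)
      (fun m x hx => ?_) (fun ω x hx => ?_)
    · induction hx using Submodule.iSup_induction' with
      | mem k x hx => exact Submodule.mem_iSup_of_mem k (hM m k x hx)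
      | zero => rw [mul_zero]; exact zero_mem _
      | add x y _ _ hx hy => rw [mul_add]; exact add_mem hx hy
    · induction hx using Submodule.iSup_induction' with
      | mem k x hx =>
        rw [← Submodule.projection_add_projection_eq_self h ω, map_add, add_mul]
        exact add_mem (Submodule.mem_iSup_of_mem _
            (hX _ (Submodule.projection_apply_mem h ω) k x hx))
          (Submodule.mem_iSup_of_mem _ (hY _ (Submodule.projection_apply_mem h.symm ω) k x hx))
      | zero => rw [mul_zero]; exact zero_mem _
      | add x y _ _ hx hy => rw [mul_add]; exact add_mem hx hy
  have h2 : ∀ k, ⨆ i ∈ {i : ℕ × ℕ | id i = k}, 𝒜 i = 𝒜 k := fun k =>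
    le_antisymm (iSup₂_le fun i hi => (congrArg 𝒜 (show i = k from hi)).le)
      (le_iSup₂_of_le (f := fun (j : ℕ × ℕ) (_ : j ∈ {j : ℕ × ℕ | id j = k}) => 𝒜 j) k rfl le_rfl)
  rw [eq_iSup_of_le hA.isInternal id 𝒞 (fun k => by rw [h2]; exact hle k) htop, h2]

/-- The coaction is an algebra map and is homogeneous on generators, so the elements with the
required coaction form a left-stable family, which by `eq_of_left_stable` is everything. -/
theorem coact_mem (hX : C.IsCovariantSubbimodule X) (hY : C.IsCovariantSubbimodule Y)
    (h : IsCompl X Y) {i : ℕ × ℕ} {x : C.MaximalProlongation} (hx : x ∈ 𝒜 i) :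
    C.prolongationCoact x ∈ gTensor G (𝒜 i) := by
  have hM : ∀ m, C.prolongationCoact (C.ofM m) ∈ gTensor G (𝒜 0) := fun m => by
    rw [prolongationCoact_ofM]
    generalize coactM π m = s
    induction s with
    | zero => simp
    | add a b ha hb => rw [map_add]; exact add_mem ha hb
    | tmul g m => exact tmul_mem_gTensor g (hA.ofM_mem m)
  have hZ : ∀ (Z : Submodule ℂ Ω), C.IsCovariantSubbimodule Z → ∀ ω ∈ Z,
      C.prolongationCoact (C.ofForms ω) ∈ gTensor G (Z.map C.ofForms) := fun Z hZ ω hω => by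
    rw [prolongationCoact_ofForms, gTensor_map]
    exact ⟨_, hZ.coact_mem ω hω, rfl⟩
  have key := hA.eq_of_left_stable h
    (fun i => 𝒜 i ⊓ (gTensor G (𝒜 i)).comap C.prolongationCoact.toLinearMap)
    (fun i => inf_le_left) ⟨hA.one_mem, ?_⟩ (fun m i x hx => ⟨hA.ofM_mul_mem m hx.1, ?_⟩)
    (fun ω hω i x hx => ⟨hA.mul_mem _ _ _ (hA.ofForms_mem_left hω) x hx.1, ?_⟩)
    (fun ω hω i x hx => ⟨hA.mul_mem _ _ _ (hA.ofForms_mem_right hω) x hx.1, ?_⟩) i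
  · rw [← key] at hx
    exact hx.2
  · rw [← ofM_one]
    exact hM 1
  · change C.prolongationCoact (C.ofM m * x) ∈ gTensor G (𝒜 i)
    rw [map_mul]
    exact mul_mem_gTensor (fun a ha b hb => by simpa using hA.mul_mem 0 i a ha b hb) (hM m) hx.2
  · change C.prolongationCoact (C.ofForms ω * x) ∈ gTensor G (𝒜 ((1, 0) + i))
    rw [map_mul]
    refine mul_mem_gTensor (fun a ha b hb => hA.mul_mem (1, 0) i a ha b hb) ?_ hx.2
    rw [hA.extends10]
    exact hZ X hX ω hω
  · change C.prolongationCoact (C.ofForms ω * x) ∈ gTensor G (𝒜 ((0, 1) + i))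
    rw [map_mul]
    refine mul_mem_gTensor (fun a ha b hb => hA.mul_mem (0, 1) i a ha b hb) ?_ hx.2
    rw [hA.extends01]
    exact hZ Y hY ω hω

theorem le_formSubalgebra (h : IsCompl X Y) (p : ℕ) :
    𝒜 (p, 0) ≤ (C.formSubalgebra X).toSubmodule := by
  have hM : ∀ m, C.ofM m ∈ C.formSubalgebra X := fun m => Algebra.subset_adjoin (Or.inl ⟨m, rfl⟩)
  have hX : ∀ ω ∈ X, C.ofForms ω ∈ C.formSubalgebra X := fun ω hω =>
    Algebra.subset_adjoin (Or.inr ⟨ω, hω, rfl⟩)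
  -- The condition is imposed only in bidegrees `(p, 0)`. Multiplication by `Y` leaves these
  -- bidegrees, so there only membership in `𝒜` has to be checked.
  have key := hA.eq_of_left_stable h
    (fun i => if i.2 = 0 then 𝒜 i ⊓ (C.formSubalgebra X).toSubmodule else 𝒜 i)
    (fun i => by split_ifs <;> simp) ?_ (fun m i x hx => ?_) (fun ω hω i x hx => ?_)
    (fun ω hω i x hx => ?_) (p, 0)
  · rw [if_pos rfl] at key
    exact inf_eq_left.1 key
  · exact ⟨hA.one_mem, Subalgebra.one_mem _⟩
  · split_ifs at hx ⊢
    · exact ⟨hA.ofM_mul_mem m hx.1, Subalgebra.mul_mem _ (hM m) hx.2⟩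
    · exact hA.ofM_mul_mem m hx
  · have h1 : ((1, 0) + i : ℕ × ℕ).2 = i.2 := zero_add _
    rw [h1]
    split_ifs at hx ⊢
    · exact ⟨hA.mul_mem _ _ _ (hA.ofForms_mem_left hω) x hx.1, Subalgebra.mul_mem _ (hX ω hω) hx.2⟩
    · exact hA.mul_mem _ _ _ (hA.ofForms_mem_left hω) x hx
  · have h1 : ((0, 1) + i : ℕ × ℕ).2 ≠ 0 := by
      change 1 + i.2 ≠ 0
      omega
    rw [if_neg h1]
    split_ifs at hx
    · exact hA.mul_mem _ _ _ (hA.ofForms_mem_right hω) x hx.1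
    · exact hA.mul_mem _ _ _ (hA.ofForms_mem_right hω) x hx

theorem mul_le (i j : ℕ × ℕ) : 𝒜 i * 𝒜 j ≤ 𝒜 (i + j) :=
  Submodule.mul_le.2 (hA.mul_mem i j)

/-- If `Y X ⊆ X Y`, then `Y` also commutes past all forms of bidegrees `(p, 0)`. -/
theorem map_mul_le (h : IsCompl X Y) (hYc : C.IsCovariantSubbimodule Y)
    (hYX : Y.map C.ofForms * X.map C.ofForms ≤ X.map C.ofForms * Y.map C.ofForms) (p : ℕ) :
    Y.map C.ofForms * 𝒜 (p, 0) ≤ 𝒜 (p, 0) * Y.map C.ofForms := by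
  obtain ⟨T, hT⟩ : ∃ T : ℕ × ℕ → Submodule ℂ C.MaximalProlongation, ∀ i x,
      x ∈ T i ↔ ∀ y ∈ Y.map C.ofForms, y * x ∈ 𝒜 i * Y.map C.ofForms :=
    ⟨fun i => leftTransporter (Y.map C.ofForms) (𝒜 i * Y.map C.ofForms),
      fun i x => mem_leftTransporter⟩
  -- The condition `T` passes from `x` to `ω x`, for `ω ∈ X`, by exchanging `Y ω ⊆ X Y` first and
  -- then using the condition on `x`.
  have key := hA.eq_of_left_stable h (fun i => if i.2 = 0 then 𝒜 i ⊓ T i else 𝒜 i)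
    (fun i => by split_ifs <;> simp) ?_ (fun m i x hx => ?_) (fun ω hω i x hx => ?_)
    (fun ω hω i x hx => ?_) (p, 0)
  · rw [if_pos rfl, inf_eq_left] at key
    exact Submodule.mul_le.2 fun y hy x hx => (hT _ _).1 (key hx) y hy
  · refine ⟨hA.one_mem, (hT _ _).2 fun y hy => ?_⟩
    rw [mul_one, ← one_mul y]
    exact Submodule.mul_mem_mul hA.one_mem hy
  · split_ifs at hx ⊢
    · refine ⟨hA.ofM_mul_mem m hx.1, (hT _ _).2 ?_⟩
      rintro _ ⟨η, hη, rfl⟩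
      rw [← mul_assoc, ofForms_mul_ofM]
      exact (hT _ _).1 hx.2 _ ⟨_, hYc.op_smul_mem m η hη, rfl⟩
    · exact hA.ofM_mul_mem m hx
  · have h1 : ((1, 0) + i : ℕ × ℕ).2 = i.2 := zero_add _
    rw [h1]
    split_ifs at hx ⊢
    · refine ⟨hA.mul_mem _ _ _ (hA.ofForms_mem_left hω) x hx.1, (hT _ _).2 fun y hy => ?_⟩
      rw [← mul_assoc]
      have h2 := hYX (Submodule.mul_mem_mul hy ⟨ω, hω, rfl⟩)
      generalize y * C.ofForms ω = z at h2
      induction h2 using Submodule.mul_induction_on' with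
      | mem_mul_mem ξ hξ η hη =>
        have h3 := Submodule.mul_mem_mul hξ ((hT _ _).1 hx.2 η hη)
        rw [← mul_assoc, ← mul_assoc, ← hA.extends10] at h3
        exact mul_le_mul_left (hA.mul_le _ _) _ h3
      | add a _ b _ ha hb => rw [add_mul]; exact add_mem ha hb
    · exact hA.mul_mem _ _ _ (hA.ofForms_mem_left hω) x hx
  · have h1 : ((0, 1) + i : ℕ × ℕ).2 ≠ 0 := by
      change 1 + i.2 ≠ 0
      omega
    rw [if_neg h1]
    split_ifs at hx
    · exact hA.mul_mem _ _ _ (hA.ofForms_mem_right hω) x hx.1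
    · exact hA.mul_mem _ _ _ (hA.ofForms_mem_right hω) x hx

/-- If `Y X ⊆ X Y`, then the forms of bidegree `(p, q)` are products of forms of bidegrees `(p, 0)`
and `(0, q)`. -/
theorem mul_eq (h : IsCompl X Y) (hYc : C.IsCovariantSubbimodule Y)
    (hYX : Y.map C.ofForms * X.map C.ofForms ≤ X.map C.ofForms * Y.map C.ofForms) (p q : ℕ) :
    𝒜 (p, 0) * 𝒜 (0, q) = 𝒜 (p, q) := by
  -- The sorted products form a left-stable family; only multiplication by `Y` requires commuting,
  -- past `𝒜 (p, 0)`.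
  refine hA.eq_of_left_stable h (fun i => 𝒜 (i.1, 0) * 𝒜 (0, i.2)) (fun i => ?_) ?_
    (fun m i x hx => ?_) (fun ω hω i x hx => ?_) (fun ω hω i x hx => ?_) (p, q)
  · refine (hA.mul_le _ _).trans_eq ?_
    rw [Prod.mk_add_mk, add_zero, zero_add]
  · have := Submodule.mul_mem_mul hA.one_mem hA.one_mem
    rwa [one_mul] at this
  · have h1 : C.ofM m * x ∈ 𝒜 0 * (𝒜 (i.1, 0) * 𝒜 (0, i.2)) :=
      Submodule.mul_mem_mul (hA.ofM_mem m) hx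
    rw [← mul_assoc] at h1
    have h2 := mul_le_mul_left (hA.mul_le _ _) _ h1
    rwa [zero_add] at h2
  · have h1 : C.ofForms ω * x ∈ 𝒜 (1, 0) * (𝒜 (i.1, 0) * 𝒜 (0, i.2)) :=
      Submodule.mul_mem_mul (hA.ofForms_mem_left hω) hx
    rw [← mul_assoc] at h1
    have h2 := mul_le_mul_left (hA.mul_le _ _) _ h1
    rw [Prod.fst_add, Prod.snd_add, zero_add]
    rwa [Prod.mk_add_mk, add_zero] at h2
  · have h1 : C.ofForms ω * x ∈ Y.map C.ofForms * (𝒜 (i.1, 0) * 𝒜 (0, i.2)) :=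
      Submodule.mul_mem_mul ⟨ω, hω, rfl⟩ hx
    rw [← mul_assoc] at h1
    have h2 := mul_le_mul_left (hA.map_mul_le h hYc hYX _) _ h1
    rw [mul_assoc, ← hA.extends01] at h2
    have h3 := mul_le_mul_right (hA.mul_le _ _) _ h2
    rw [Prod.fst_add, Prod.snd_add, zero_add]
    rwa [Prod.mk_add_mk, add_zero] at h3

end IsBigrading

end CovariantCalculus

end Graded

/-! ### Tensor products over `M` inside `Ω• ⊗ Ω•`. -/

section Balanced

variable {G H : Type*} [Ring G] [HopfAlgebra ℂ G] [Ring H] [HopfAlgebra ℂ H] {π : G →ₐc[ℂ] H}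
variable {Ω : Type*} [AddCommGroup Ω] [Module ℂ Ω]
  [Module (coinv π) Ω] [IsScalarTower ℂ (coinv π) Ω]
  [Module (coinv π)ᵐᵒᵖ Ω] [IsScalarTower ℂ (coinv π)ᵐᵒᵖ Ω]
  [SMulCommClass (coinv π) (coinv π)ᵐᵒᵖ Ω]

namespace CovariantCalculus

variable (C : CovariantCalculus π Ω)

/-- The `M`-submodule of `Ω• ⊗ Ω•` generated by the elements `x m ⊗ y - x ⊗ m y`, for `x ∈ A` and
`y ∈ B`. -/
def formBalanced (A B : Submodule ℂ C.MaximalProlongation) :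
    Submodule (coinv π) (C.MaximalProlongation ⊗[ℂ] C.MaximalProlongation) :=
  Submodule.span (coinv π) {t | ∃ x ∈ A, ∃ y ∈ B, ∃ m : coinv π,
    t = (x * C.ofM m) ⊗ₜ[ℂ] y - x ⊗ₜ[ℂ] (C.ofM m * y)}

theorem coact_mem_formBalanced {A B : Submodule ℂ C.MaximalProlongation}
    (hA : ∀ x ∈ A, C.prolongationCoact x ∈ gTensor G A)
    (hB : ∀ x ∈ B, C.prolongationCoact x ∈ gTensor G B)
    {t : C.MaximalProlongation ⊗[ℂ] C.MaximalProlongation} (ht : t ∈ C.formBalanced A B) :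
    (C.prolongationRelHopf.tensor C.prolongationRelHopf).coact t ∈
      gTensor G ((C.formBalanced A B).restrictScalars ℂ) := by
  refine RelHopf.coact_mem_span _ _ _ ?_ t ht
  rintro _ ⟨x, hx, y, hy, m, rfl⟩
  have h1 : ∀ x y, (C.prolongationRelHopf.tensor C.prolongationRelHopf).coact (x ⊗ₜ y) =
      diagMul (C.prolongationCoact x ⊗ₜ C.prolongationCoact y) := fun _ _ => rfl
  rw [map_sub, h1, h1, map_mul, map_mul, prolongationCoact_ofM]
  obtain ⟨z, hz⟩ := hA x hx
  obtain ⟨w, hw⟩ := hB y hy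
  rw [← hz, ← hw]
  generalize coactM π m = s
  clear hz hw hx hy
  induction s with
  | zero => simp
  | add a b ha hb =>
    simp only [map_add, mul_add, add_mul, TensorProduct.add_tmul, TensorProduct.tmul_add]
    rw [add_sub_add_comm]
    exact add_mem ha hb
  | tmul g m =>
    induction z with
    | zero => simp
    | add a b ha hb =>
      simp only [map_add, add_mul, TensorProduct.add_tmul]
      rw [add_sub_add_comm]
      exact add_mem ha hb
    | tmul g' x =>
      induction w with
      | zero => simp
      | add a b ha hb =>
        simp only [map_add, mul_add, TensorProduct.tmul_add]
        rw [add_sub_add_comm]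
        exact add_mem ha hb
      | tmul g'' y =>
        simp only [LinearMap.lTensor_tmul, Algebra.TensorProduct.tmul_mul_tmul, diagMul_tmul]
        rw [mul_assoc, ← TensorProduct.tmul_sub]
        exact tmul_mem_gTensor _ (Submodule.subset_span ⟨x, x.2, y, y.2, m, rfl⟩)

/-- Elements of `A ⊗ B` which are trivial in the fibres are balanced up to `M⁺(Ω• ⊗ Ω•)`. -/
theorem mem_formBalanced_sup {A B : Submodule ℂ C.MaximalProlongation} (h0 : IsInM0 π Ω)
    {p q : C.MaximalProlongation →ₗ[ℂ] C.MaximalProlongation}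
    (hp : ∀ x, p x ∈ A) (hq : ∀ x, q x ∈ B) (hpA : ∀ x ∈ A, p x = x) (hqB : ∀ x ∈ B, q x = x)
    (hpM : ∀ m x, p (C.ofM m * x) = C.ofM m * p x) (hqM : ∀ m x, q (C.ofM m * x) = C.ofM m * q x)
    {t : C.MaximalProlongation ⊗[ℂ] C.MaximalProlongation}
    (ht : t ∈ Submodule.map₂ (TensorProduct.mk ℂ _ _) A B)
    (ht0 : TensorProduct.map (Phi.mk (counitM π)) (Phi.mk (counitM π)) t = 0) :
    t ∈ (C.formBalanced A B).restrictScalars ℂ ⊔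
      augSub (counitM π) (C.MaximalProlongation ⊗[ℂ] C.MaximalProlongation) := by
  have hpq : TensorProduct.map p q t = t := by
    rw [map_eq_map_of_mem (f' := LinearMap.id) (g' := LinearMap.id) hpA hqB ht]
    simp
  have hex : Function.Exact (augSub (counitM π) C.MaximalProlongation).subtype
      (Phi.mk (counitM π) : C.MaximalProlongation →ₗ[ℂ] _) := by
    rw [LinearMap.exact_iff]; simp [Phi.mk]
  have h1 := TensorProduct.map_ker hex (Phi.mk_surjective _) hex (Phi.mk_surjective _)
  have h2 : t ∈ LinearMap.ker (TensorProduct.map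
    (Phi.mk (counitM π) : C.MaximalProlongation →ₗ[ℂ] _)
    (Phi.mk (counitM π) : C.MaximalProlongation →ₗ[ℂ] _)) := ht0
  have haug : ∀ x ∈ augSub (counitM π) C.MaximalProlongation, ∀ y : C.MaximalProlongation,
      x ⊗ₜ[ℂ] y ∈ augSub (counitM π) (C.MaximalProlongation ⊗[ℂ] C.MaximalProlongation) := by
    intro x hx y
    induction hx using Submodule.span_induction with
    | mem x hx =>
      obtain ⟨a, e, ha, rfl⟩ := hx
      exact Submodule.subset_span ⟨a, e ⊗ₜ y, ha, rfl⟩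
    | zero => rw [TensorProduct.zero_tmul]; exact zero_mem _
    | add x x' _ _ hx hx' => rw [TensorProduct.add_tmul]; exact add_mem hx hx'
    | smul c x _ hx => rw [← TensorProduct.smul_tmul']; exact Submodule.smul_mem _ c hx
  have hpaug : ∀ x ∈ augSub (counitM π) C.MaximalProlongation,
      p x ∈ augSub (counitM π) C.MaximalProlongation := by
    intro x hx
    induction hx using Submodule.span_induction with
    | mem x hx =>
      obtain ⟨a, e, ha, rfl⟩ := hx
      exact Submodule.subset_span ⟨a, p e, ha, hpM a e⟩
    | zero => rw [map_zero]; exact zero_mem _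
    | add x x' _ _ hx hx' => rw [map_add]; exact add_mem hx hx'
    | smul c x _ hx => rw [map_smul]; exact Submodule.smul_mem _ c hx
  -- The kernel of the map to the fibres is `Ω• ⊗ M⁺Ω• + M⁺Ω• ⊗ Ω•`. The projections `p` and `q`,
  -- being left `M`-linear, carry both summands into the same form inside `A ⊗ B`.
  rw [h1] at h2
  rw [← hpq]
  obtain ⟨_, ⟨a, rfl⟩, _, ⟨b, rfl⟩, rfl⟩ := Submodule.mem_sup.1 h2
  rw [map_add]
  clear h1 h2 hpq ht ht0
  refine add_mem ?_ ?_
  · induction a with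
    | zero => simp
    | add a a' ha ha' => rw [map_add, map_add]; exact add_mem ha ha'
    | tmul x y =>
      rw [LinearMap.lTensor_tmul, TensorProduct.map_tmul]
      obtain ⟨y, hy⟩ := y
      rw [Submodule.subtype_apply]
      change p x ⊗ₜ q y ∈ _
      induction hy using Submodule.span_induction with
      | mem y hy =>
        obtain ⟨a, e, ha, rfl⟩ := hy
        -- Up to a balancing relation `a` moves to the left leg, where `(p x) a ∈ M⁺Ω•` since `ε(a)
        -- = 0`.
        rw [coinv_smul_def, hqM, ← sub_sub_cancel ((p x * C.ofM a) ⊗ₜ[ℂ] q e)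
          (p x ⊗ₜ[ℂ] (C.ofM a * q e))]
        exact sub_mem (Submodule.mem_sup_right (haug _ (C.mul_ofM_mem_augSub h0 ha _) _))
          (Submodule.mem_sup_left (Submodule.subset_span ⟨p x, hp x, q e, hq e, a, rfl⟩))
      | zero => rw [map_zero, TensorProduct.tmul_zero]; exact zero_mem _
      | add y y' _ _ hy hy' => rw [map_add, TensorProduct.tmul_add]; exact add_mem hy hy'
      | smul c y _ hy => rw [map_smul, TensorProduct.tmul_smul]; exact Submodule.smul_mem _ c hy
  · induction b with
    | zero => simp
    | add a a' ha ha' => rw [map_add, map_add]; exact add_mem ha ha'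
    | tmul x y => exact Submodule.mem_sup_right (haug _ (hpaug _ x.2) _)

variable {C}

/-- On `A ⊗ B`, the elements of `formBalanced` are the relations defining the tensor product over
`M`. -/
theorem mem_span_balancedSet {A B : Submodule ℂ C.MaximalProlongation}
    (hA : ∀ m, ∀ x ∈ A, C.ofM m * x ∈ A) (hA' : ∀ m, ∀ x ∈ A, x * C.ofM m ∈ A)
    (hB : ∀ m, ∀ x ∈ B, C.ofM m * x ∈ B) {t : A ⊗[ℂ] B}
    (ht : TensorProduct.map A.subtype B.subtype t ∈ C.formBalanced A B) :
    t ∈ Submodule.span ℂ (C.balancedSet A B) := by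
  obtain ⟨L, hL⟩ : ∃ L : coinv π → A →ₗ[ℂ] A, ∀ m x, (L m x : C.MaximalProlongation) =
      C.ofM m * x :=
    ⟨fun m => (LinearMap.mulLeft ℂ (C.ofM m)).restrict (hA m), fun m x => rfl⟩
  have hLS : ∀ m, ∀ s ∈ Submodule.span ℂ (C.balancedSet A B),
      (L m).rTensor B s ∈ Submodule.span ℂ (C.balancedSet A B) := by
    intro m s hs
    induction hs using Submodule.span_induction with
    | mem s hs =>
      obtain ⟨x, x', y, y', a, hx, hy, rfl⟩ := hs
      refine Submodule.subset_span ⟨L m x, L m x', y, y', a, ?_, hy, by simp⟩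
      rw [hL, hL, hx, mul_assoc]
    | zero => simp
    | add x x' _ _ hx hx' => rw [map_add]; exact add_mem hx hx'
    | smul c x _ hx => rw [map_smul]; exact Submodule.smul_mem _ c hx
  have hLmap : ∀ m s, TensorProduct.map A.subtype B.subtype ((L m).rTensor B s) =
      m • TensorProduct.map A.subtype B.subtype s := by
    intro m s
    induction s with
    | zero => simp
    | add x y hx hy => simp only [map_add, smul_add, hx, hy]
    | tmul x y =>
      rw [LinearMap.rTensor_tmul, TensorProduct.map_tmul, TensorProduct.map_tmul,
        TensorProduct.smul_tmul', Submodule.subtype_apply, hL]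
      rfl
  have key : ∀ s ∈ C.formBalanced A B, ∃ s' ∈ Submodule.span ℂ (C.balancedSet A B),
      TensorProduct.map A.subtype B.subtype s' = s := by
    intro s hs
    induction hs using Submodule.span_induction with
    | mem s hs =>
      obtain ⟨x, hx, y, hy, m, rfl⟩ := hs
      exact ⟨_, Submodule.subset_span ⟨⟨x, hx⟩, ⟨_, hA' m x hx⟩, ⟨y, hy⟩, ⟨_, hB m y hy⟩, m, rfl, rfl,
        rfl⟩, by simp⟩
    | zero => exact ⟨0, zero_mem _, map_zero _⟩
    | add x x' _ _ hx hx' =>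
      obtain ⟨s, hs, rfl⟩ := hx
      obtain ⟨s', hs', rfl⟩ := hx'
      exact ⟨s + s', add_mem hs hs', map_add _ _ _⟩
    | smul c x _ hx =>
      obtain ⟨s, hs, rfl⟩ := hx
      exact ⟨_, hLS c s hs, hLmap c s⟩
  obtain ⟨s, hs, hst⟩ := key _ ht
  rwa [← map_subtype_injective A B hst]

end CovariantCalculus

end Balanced

/-! ### The wedge map in all bidegrees. -/

section Wedge

variable {G H : Type u} [Ring G] [HopfAlgebra ℂ G] [Ring H] [HopfAlgebra ℂ H] {π : G →ₐc[ℂ] H}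
variable {Ω : Type u} [AddCommGroup Ω] [Module ℂ Ω]
  [Module (coinv π) Ω] [IsScalarTower ℂ (coinv π) Ω]
  [Module (coinv π)ᵐᵒᵖ Ω] [IsScalarTower ℂ (coinv π)ᵐᵒᵖ Ω]
  [SMulCommClass (coinv π) (coinv π)ᵐᵒᵖ Ω]

namespace CovariantCalculus

variable {C : CovariantCalculus π Ω} {X Y : Submodule ℂ Ω}
  {𝒜 : ℕ × ℕ → Submodule ℂ C.MaximalProlongation}

/-- The wedge map on `A ⊗_M B` is injective if it is so on fibres. -/
theorem wedge_injective (hff : IsFaithfullyFlatRight π) (h0 : IsInM0 π Ω)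
    {A B : Submodule ℂ C.MaximalProlongation}
    (hA : ∀ m, ∀ x ∈ A, C.ofM m * x ∈ A) (hA' : ∀ m, ∀ x ∈ A, x * C.ofM m ∈ A)
    (hB : ∀ m, ∀ x ∈ B, C.ofM m * x ∈ B)
    (hAc : ∀ x ∈ A, C.prolongationCoact x ∈ gTensor G A)
    (hBc : ∀ x ∈ B, C.prolongationCoact x ∈ gTensor G B)
    {p q : C.MaximalProlongation →ₗ[ℂ] C.MaximalProlongation}
    (hp : ∀ x, p x ∈ A) (hq : ∀ x, q x ∈ B) (hpA : ∀ x ∈ A, p x = x) (hqB : ∀ x ∈ B, q x = x)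
    (hpM : ∀ m x, p (C.ofM m * x) = C.ofM m * p x) (hqM : ∀ m x, q (C.ofM m * x) = C.ofM m * q x)
    (hfib : ∀ t ∈ Submodule.map₂ (TensorProduct.mk ℂ _ _) A B,
      LinearMap.mul' ℂ C.MaximalProlongation t = 0 →
        TensorProduct.map (Phi.mk (counitM π)) (Phi.mk (counitM π)) t = 0) :
    Function.Injective (C.wedge A B) := by
  rw [← LinearMap.ker_eq_bot, LinearMap.ker_eq_bot']
  intro z hz
  obtain ⟨t, rfl⟩ := Submodule.Quotient.mk_surjective _ z
  rw [wedge_mk, lift_mul_subtype, LinearMap.comp_apply] at hz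
  refine (Submodule.Quotient.mk_eq_zero _).2 (mem_span_balancedSet hA hA' hB ?_)
  obtain ⟨R, hR⟩ : ∃ R : RelHopf π (C.MaximalProlongation ⊗[ℂ] C.MaximalProlongation),
    R = C.prolongationRelHopf.tensor C.prolongationRelHopf := ⟨_, rfl⟩
  have hRt : ∀ x y, R.coact (x ⊗ₜ y) =
      diagMul (C.prolongationCoact x ⊗ₜ C.prolongationCoact y) := by rw [hR]; exact fun _ _ => rfl
  have hRmul : ∀ s, (LinearMap.mul' ℂ C.MaximalProlongation).lTensor G (R.coact s) =
      C.prolongationCoact (LinearMap.mul' ℂ C.MaximalProlongation s) := by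
    intro s
    induction s with
    | zero => simp
    | add x y hx hy => simp only [map_add, hx, hy]
    | tmul x y => rw [hRt, ← mul_eq_lTensor_diagMul, LinearMap.mul'_apply, map_mul]
  have hRmap : Submodule.map₂ (TensorProduct.mk ℂ _ _) A B ≤
      (gTensor G (Submodule.map₂ (TensorProduct.mk ℂ _ _) A B)).comap R.coact :=
    Submodule.map₂_le.2 fun x hx y hy => by
      change R.coact (x ⊗ₜ y) ∈ gTensor G (Submodule.map₂ (TensorProduct.mk ℂ _ _) A B)
      rw [hRt]
      exact diagMul_mem_gTensor
        (fun a ha b hb => Submodule.apply_mem_map₂ (TensorProduct.mk ℂ _ _) ha hb)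
        (hAc x hx) (hBc y hy)
  -- Descent in `Ω• ⊗ Ω•`, from the kernel of the product on `A ⊗ B` to the balancing relations.
  -- Writing `A ⊗ B` as a kernel too makes the former an intersection of kernels, to which
  -- `gTensor_ker_inf` applies.
  have key := R.le_of_le_sup_augSub hff (C.formBalanced A B)
    (by rw [hR]; exact fun w hw => C.coact_mem_formBalanced hAc hBc hw)
    (LinearMap.ker (LinearMap.mul' ℂ C.MaximalProlongation) ⊓
      LinearMap.ker (Submodule.map₂ (TensorProduct.mk ℂ _ _) A B).mkQ) (fun s hs => ?_)
    (fun s hs => ?_)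
  · refine key ⟨hz, ?_⟩
    rw [Submodule.ker_mkQ, ← range_map_subtype]
    exact ⟨t, rfl⟩
  · obtain ⟨h1, h2⟩ := hs
    rw [Submodule.ker_mkQ] at h2
    refine gTensor_ker_inf _ _ ?_ ?_
    · rw [hRmul, LinearMap.mem_ker.1 h1, map_zero]
    · have := hRmap h2
      rw [gTensor_eq_ker] at this
      exact this
  · obtain ⟨h1, h2⟩ := hs
    rw [Submodule.ker_mkQ] at h2
    exact C.mem_formBalanced_sup h0 hp hq hpA hqB hpM hqM h2 (hfib s h2 h1)

theorem coact_mem_map₂ (hX : C.IsCovariantSubbimodule X) (hY : C.IsCovariantSubbimodule Y)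
    {t : Ω ⊗[ℂ] Ω} (ht : t ∈ Submodule.map₂ (TensorProduct.mk ℂ Ω Ω) X Y) :
    diagCoact C.coact C.coact t ∈ gTensor G (Submodule.map₂ (TensorProduct.mk ℂ Ω Ω) X Y) := by
  have h1 : Submodule.map₂ (TensorProduct.mk ℂ Ω Ω) X Y ≤
      (gTensor G (Submodule.map₂ (TensorProduct.mk ℂ Ω Ω) X Y)).comap
        (diagCoact C.coact C.coact) :=
    Submodule.map₂_le.2 fun x hx y hy =>
      diagMul_mem_gTensor
        (fun a ha b hb => Submodule.apply_mem_map₂ (TensorProduct.mk ℂ Ω Ω) ha hb)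
        (hX.coact_mem x hx) (hY.coact_mem y hy)
  exact h1 ht

theorem map₂_toV (X Y : Submodule ℂ Ω) :
    Submodule.map₂ (TensorProduct.mk ℂ C.V C.V) (C.toV X) (C.toV Y) =
      (Submodule.map₂ (TensorProduct.mk ℂ Ω Ω) X Y).map C.sigmaSq := by
  rw [sigmaSq, map_map₂_mk, toV_eq_map, toV_eq_map]

/-- If `Y X ⊆ X Y` in the fibre of the two-forms, then this holds for the two-forms. -/
theorem map_ofForms_mul_le (hff : IsFaithfullyFlatRight π) (h0 : IsInM0 π Ω)
    (hX : C.IsCovariantSubbimodule X) (hY : C.IsCovariantSubbimodule Y)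
    (hle : Submodule.map₂ (TensorProduct.mk ℂ C.V C.V) (C.toV Y) (C.toV X) ≤
      Submodule.map₂ (TensorProduct.mk ℂ C.V C.V) (C.toV X) (C.toV Y) ⊔ C.ITwo h0) :
    Y.map C.ofForms * X.map C.ofForms ≤ X.map C.ofForms * Y.map C.ofForms := by
  obtain ⟨P, hP⟩ : ∃ P : Submodule (coinv π) (Ω ⊗[ℂ] Ω), P.restrictScalars ℂ =
      Submodule.map₂ (TensorProduct.mk ℂ Ω Ω) X Y :=
    ⟨{ __ := Submodule.map₂ (TensorProduct.mk ℂ Ω Ω) X Y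
       smul_mem' := fun m t ht => smul_mem_map₂ hX m ht }, rfl⟩
  have hsup : ∀ t, t ∈ P ⊔ C.relTwo ↔
      t ∈ Submodule.map₂ (TensorProduct.mk ℂ Ω Ω) X Y ⊔ C.relTwo.restrictScalars ℂ := fun t => by
    rw [← hP, Submodule.mem_sup, Submodule.mem_sup]
    rfl
  have hsup' : (P ⊔ C.relTwo).restrictScalars ℂ =
      Submodule.map₂ (TensorProduct.mk ℂ Ω Ω) X Y ⊔ C.relTwo.restrictScalars ℂ :=
    Submodule.ext hsup
  -- Descent from `Y ⊗ X` to `X ⊗ Y + relTwo`; the relations then disappear in the prolongation.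
  have key := C.twoRelHopf.le_of_le_sup_augSub hff (P ⊔ C.relTwo) (fun w hw => ?_)
    (Submodule.map₂ (TensorProduct.mk ℂ Ω Ω) Y X) (fun z hz => coact_mem_map₂ hY hX hz)
    (fun t ht => ?_)
  · rw [← map_wedgeForms_map₂, ← map_wedgeForms_map₂]
    rintro _ ⟨t, ht, rfl⟩
    have h1 := key ht
    rw [hsup'] at h1
    obtain ⟨a, ha, b, hb, rfl⟩ := Submodule.mem_sup.1 h1
    rw [map_add, C.wedgeForms_relTwo hb, add_zero]
    exact ⟨a, ha, rfl⟩
  · rw [hsup] at hw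
    rw [hsup']
    obtain ⟨a, ha, b, hb, rfl⟩ := Submodule.mem_sup.1 hw
    rw [map_add]
    exact add_mem (gTensor_mono le_sup_left (coact_mem_map₂ hX hY ha))
      (gTensor_mono le_sup_right (C.coact_mem_relTwo hb))
  · rw [hsup']
    have h1 := hle (by rw [map₂_toV]; exact ⟨t, ht, rfl⟩)
    rw [map₂_toV, ITwo_eq] at h1
    obtain ⟨_, ⟨a, ha, rfl⟩, _, ⟨b, hb, rfl⟩, hab⟩ := Submodule.mem_sup.1 h1
    have h2 := C.mem_of_sigmaSq_eq_zero h0 (t := t - (a + b)) (by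
      rw [map_sub, map_add, hab, sub_self])
    rw [← sub_add_cancel t (a + b)]
    refine add_mem ((sup_le_sup_right le_sup_right _ :
      C.relTwo.restrictScalars ℂ ⊔ augSub (counitM π) (Ω ⊗[ℂ] Ω) ≤ _) h2) (Submodule.mem_sup_left ?_)
    exact Submodule.add_mem_sup ha hb

/-- The wedge map `𝒜(p,0) ⊗_M 𝒜(0,q) → 𝒜(p,q)` is an isomorphism under conditions on the fibres. -/
theorem IsBigrading.isIsoOnto_wedge (hff : IsFaithfullyFlatRight π) (h0 : IsInM0 π Ω)
    (hXY : (X, Y) ∈ C.formDecompositions) (hA : C.IsBigrading X Y 𝒜)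
    (hle : Submodule.map₂ (TensorProduct.mk ℂ C.V C.V) (C.toV Y) (C.toV X) ≤
      Submodule.map₂ (TensorProduct.mk ℂ C.V C.V) (C.toV X) (C.toV Y) ⊔ C.ITwo h0)
    (hfib : ∀ t ∈ Submodule.map₂ (TensorProduct.mk ℂ _ _) (C.formSubalgebra X).toSubmodule
      (C.formSubalgebra Y).toSubmodule, LinearMap.mul' ℂ C.MaximalProlongation t = 0 →
        TensorProduct.map (Phi.mk (counitM π)) (Phi.mk (counitM π)) t = 0) (p q : ℕ) :
    IsIsoOnto (C.wedge (𝒜 (p, 0)) (𝒜 (0, q))) (𝒜 (p, q)) := by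
  obtain ⟨hX, hY, h⟩ := hXY
  refine ⟨?_, ?_⟩
  · obtain ⟨pr, hpr, hpr'⟩ := exists_gradedProj hA.isInternal
    have hself : ∀ i, ∀ x ∈ 𝒜 i, pr i x = x := fun i x hx => by rw [hpr' i i x hx, if_pos rfl]
    have hM : ∀ i m x, pr i (C.ofM m * x) = C.ofM m * pr i x := fun i m x => by
      have hx : x ∈ ⨆ i, 𝒜 i := by rw [hA.isInternal.submodule_iSup_eq_top]; trivial
      induction hx using Submodule.iSup_induction' with
      | mem k x hx =>
        rw [hpr' k i x hx, hpr' k i _ (hA.ofM_mul_mem m hx)]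
        split_ifs
        · rfl
        · rw [mul_zero]
      | zero => simp
      | add x y _ _ hx hy => rw [mul_add, map_add, hx, hy, map_add, mul_add]
    exact wedge_injective hff h0 (fun m x hx => hA.ofM_mul_mem m hx)
      (fun m x hx => hA.mul_ofM_mem m hx) (fun m x hx => hA.ofM_mul_mem m hx)
      (fun x hx => hA.coact_mem hX hY h hx) (fun x hx => hA.coact_mem hX hY h hx)
      (hpr _) (hpr _) (hself _) (hself _) (hM _) (hM _) (fun t ht => hfib t
        (Submodule.map₂_le_map₂ (hA.le_formSubalgebra h p) (hA.swap.le_formSubalgebra h.symm q) ht))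
  · rw [range_wedge]
    exact hA.mul_eq h hY (map_ofForms_mul_le hff h0 hX hY hle) p q

end CovariantCalculus

end Wedge

/-! ### The exchange map `W ⊗ U → U ⊗ W` modulo relations. -/

section Swap

variable {V : Type*} [AddCommGroup V] [Module ℂ V] {U W : Submodule ℂ V} {I : Submodule ℂ (V ⊗[ℂ] V)}

/-- If `W ⊗ U ⊆ U ⊗ W + I` and `(U ⊗ W) ∩ I = 0`, then there is a map `W ⊗ U → U ⊗ W` which is the
identity modulo `I`. -/
theorem exists_swap (hd : Disjoint (Submodule.map₂ (TensorProduct.mk ℂ V V) U W) I)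
    (hle : Submodule.map₂ (TensorProduct.mk ℂ V V) W U ≤
      Submodule.map₂ (TensorProduct.mk ℂ V V) U W ⊔ I) :
    ∃ τ : W ⊗[ℂ] U →ₗ[ℂ] U ⊗[ℂ] W, ∀ t, TensorProduct.map W.subtype U.subtype t -
      TensorProduct.map U.subtype W.subtype (τ t) ∈ I := by
  obtain ⟨f, hf⟩ : ∃ f : U ⊗[ℂ] W →ₗ[ℂ] (V ⊗[ℂ] V) ⧸ I,
    f = I.mkQ ∘ₗ TensorProduct.map U.subtype W.subtype := ⟨_, rfl⟩
  have hinj : Function.Injective f := by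
    rw [← LinearMap.ker_eq_bot, LinearMap.ker_eq_bot']
    intro t ht
    rw [hf, LinearMap.comp_apply, Submodule.mkQ_apply, Submodule.Quotient.mk_eq_zero] at ht
    have h1 := Submodule.disjoint_def.1 hd _ (by rw [← range_map_subtype]; exact ⟨t, rfl⟩) ht
    exact map_subtype_injective U W (h1.trans (map_zero _).symm)
  have hr : ∀ t, (I.mkQ ∘ₗ TensorProduct.map W.subtype U.subtype) t ∈ LinearMap.range f := by
    intro t
    have h1 : TensorProduct.map W.subtype U.subtype t ∈
        Submodule.map₂ (TensorProduct.mk ℂ V V) W U := by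
      rw [← range_map_subtype]; exact ⟨t, rfl⟩
    have h2 := hle h1
    rw [← range_map_subtype] at h2
    obtain ⟨_, ⟨s, rfl⟩, i, hi, hsi⟩ := Submodule.mem_sup.1 h2
    refine ⟨s, ?_⟩
    rw [LinearMap.comp_apply, ← hsi, map_add, hf, LinearMap.comp_apply]
    exact (left_eq_add.2 ((Submodule.Quotient.mk_eq_zero _).2 hi))
  refine ⟨(LinearEquiv.ofInjective f hinj).symm.toLinearMap ∘ₗ LinearMap.codRestrict _ _ hr,
    fun t => ?_⟩
  have h3 : f ((LinearEquiv.ofInjective f hinj).symm (LinearMap.codRestrict _ _ hr t)) =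
      (I.mkQ ∘ₗ TensorProduct.map W.subtype U.subtype) t :=
    LinearEquiv.ofInjective_symm_apply (f := f) (h := hinj) (LinearMap.codRestrict _ _ hr t)
  have h4 : ∀ s, f s = I.mkQ (TensorProduct.map U.subtype W.subtype s) := fun s => by rw [hf]; rfl
  rw [h4] at h3
  exact (Submodule.Quotient.eq _).1 h3.symm

/-- `s` and `τ t` are both congruent to `t`, so their difference lies in `I ∩ (U ⊗ W) = 0`. Formulas
for exchange maps are verified in this way. -/
theorem swap_eq (hd : Disjoint (Submodule.map₂ (TensorProduct.mk ℂ V V) U W) I)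
    {τ : W ⊗[ℂ] U →ₗ[ℂ] U ⊗[ℂ] W} (hτ : ∀ t, TensorProduct.map W.subtype U.subtype t -
      TensorProduct.map U.subtype W.subtype (τ t) ∈ I) {t : W ⊗[ℂ] U} {s : U ⊗[ℂ] W}
    (h : TensorProduct.map W.subtype U.subtype t - TensorProduct.map U.subtype W.subtype s ∈ I) :
    τ t = s := by
  have h1 := sub_mem h (hτ t)
  rw [sub_sub_sub_cancel_left, ← map_sub] at h1
  have h2 := Submodule.disjoint_def.1 hd _ (by rw [← range_map_subtype]; exact ⟨_, rfl⟩) h1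
  exact sub_eq_zero.1 (map_subtype_injective U W (h2.trans (map_zero _).symm))

theorem swap_add_eq_zero (hd : Disjoint (Submodule.map₂ (TensorProduct.mk ℂ V V) U W) I)
    {τ : W ⊗[ℂ] U →ₗ[ℂ] U ⊗[ℂ] W} (hτ : ∀ t, TensorProduct.map W.subtype U.subtype t -
      TensorProduct.map U.subtype W.subtype (τ t) ∈ I) {t : W ⊗[ℂ] U} {s : U ⊗[ℂ] W}
    (h : TensorProduct.map W.subtype U.subtype t + TensorProduct.map U.subtype W.subtype s ∈ I) :
    τ t + s = 0 := by
  rw [swap_eq hd hτ (s := (-1 : ℂ) • s) (by rwa [map_smul, neg_one_smul, sub_neg_eq_add]),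
    ← one_smul ℂ s, smul_smul, ← add_smul]
  norm_num

end Swap

/-! ### Exchange maps and quadratic relations. -/

section Twist

variable {U W : Type*} [AddCommGroup U] [Module ℂ U] [AddCommGroup W] [Module ℂ W]

theorem swapLeft_swapRight {τ : W ⊗[ℂ] U →ₗ[ℂ] U ⊗[ℂ] W} {θ : U ⊗[ℂ] W →ₗ[ℂ] W ⊗[ℂ] U}
    (h : ∀ t, τ (θ t) = t) (x : (U ⊗[ℂ] U) ⊗[ℂ] W) : swapLeft τ (swapRight θ x) = x := by
  have h' : τ ∘ₗ θ = LinearMap.id := LinearMap.ext h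
  have hl : ∀ y, τ.lTensor U (θ.lTensor U y) = y := fun y => by
    rw [← LinearMap.comp_apply, ← LinearMap.lTensor_comp, h', LinearMap.lTensor_id]; rfl
  have hr : ∀ y, τ.rTensor U (θ.rTensor U y) = y := fun y => by
    rw [← LinearMap.comp_apply, ← LinearMap.rTensor_comp, h', LinearMap.rTensor_id]; rfl
  simp only [swapLeft, swapRight, LinearMap.comp_apply, LinearEquiv.coe_coe,
    LinearEquiv.symm_apply_apply, LinearEquiv.apply_symm_apply, hl, hr]

/-- In finite dimensions, the inverse of a map `(U ⊗ U) ⊗ W → W ⊗ (U ⊗ U)` which preserves relations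
preserves them as well. -/
theorem swapLeft_mem_of_finite [FiniteDimensional ℂ U] [FiniteDimensional ℂ W]
    {τ : W ⊗[ℂ] U →ₗ[ℂ] U ⊗[ℂ] W} {θ : U ⊗[ℂ] W →ₗ[ℂ] W ⊗[ℂ] U}
    (h : ∀ t, τ (θ t) = t) {R : Submodule ℂ (U ⊗[ℂ] U)}
    (hR : ∀ w, ∀ r ∈ R, swapRight θ (r ⊗ₜ w) ∈ LinearMap.range (R.subtype.lTensor W))
    (w : W) {r : U ⊗[ℂ] U} (hr : r ∈ R) :
    swapLeft τ (w ⊗ₜ r) ∈ LinearMap.range (R.subtype.rTensor W) := by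
  have hinj : Function.Injective (swapRight θ) :=
    Function.LeftInverse.injective (swapLeft_swapRight h)
  have hl : Function.Injective (R.subtype.lTensor W) :=
    Module.Flat.lTensor_preserves_injective_linearMap _ R.subtype_injective
  have hr' : Function.Injective (R.subtype.rTensor W) :=
    Module.Flat.rTensor_preserves_injective_linearMap _ R.subtype_injective
  have h1 : (LinearMap.range (R.subtype.rTensor W)).map (swapRight θ) ≤
      LinearMap.range (R.subtype.lTensor W) := by
    rintro _ ⟨_, ⟨t, rfl⟩, rfl⟩
    induction t with
    | zero => simp
    | add a b ha hb => rw [map_add, map_add]; exact add_mem ha hb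
    | tmul a b => exact hR b a a.2
  have hi : Function.Injective (swapRight θ ∘ₗ R.subtype.rTensor W) := hinj.comp hr'
  -- `swapRight θ` is injective and maps `R ⊗ W` into `W ⊗ R`, which has the same finite dimension,
  -- hence onto it.
  have h2 := Submodule.eq_of_le_of_finrank_eq h1 (by
    rw [← LinearMap.range_comp, LinearMap.finrank_range_of_inj hi, 
      LinearMap.finrank_range_of_inj hl, Module.finrank_tensorProduct,
      Module.finrank_tensorProduct, mul_comm])
  have h3 : w ⊗ₜ[ℂ] r ∈ LinearMap.range (R.subtype.lTensor W) := ⟨w ⊗ₜ ⟨r, hr⟩, rfl⟩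
  rw [← h2] at h3
  obtain ⟨x, hx, hxr⟩ := h3
  rw [← hxr, swapLeft_swapRight h]
  exact hx

/-- Moving `U` past `W ⊗ W`, when the map `W ⊗ U → U ⊗ W` is given by a coaction. -/
theorem swapRight_map {G E : Type*} [Ring G] [HopfAlgebra ℂ G] [AddCommGroup E] [Module ℂ E]
    {c : E →ₗ[ℂ] G ⊗[ℂ] E} {τ : W ⊗[ℂ] U →ₗ[ℂ] U ⊗[ℂ] W} {A : G →ₗ[ℂ] U} {s : E →ₗ[ℂ] W}
    (hτ : ∀ e h, τ (s e ⊗ₜ A h) + TensorProduct.map (A ∘ₗ LinearMap.mulRight ℂ h) s (c e) = 0)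
    (t : E ⊗[ℂ] E) : swapRight τ (TensorProduct.map s s t ⊗ₜ A 1) =
      TensorProduct.map A (TensorProduct.map s s) (diagCoact c c t) := by
  replace hτ := fun e h => eq_neg_of_add_eq_zero_left (hτ e h)
  induction t with
  | zero => simp
  | add x y hx hy => simp only [map_add, TensorProduct.add_tmul, hx, hy]
  | tmul e f =>
    have h1 : TensorProduct.map (A ∘ₗ LinearMap.mulRight ℂ 1) s (c f) =
        TensorProduct.map A s (c f) := by
      rw [LinearMap.mulRight_one, LinearMap.comp_id]
    simp only [swapRight, LinearMap.comp_apply, LinearEquiv.coe_coe, TensorProduct.map_tmul,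
      TensorProduct.assoc_tmul, LinearMap.lTensor_tmul, hτ, h1, diagCoact_tmul]
    generalize c f = z
    induction z with
    | zero => simp
    | add x y hx hy =>
      simp only [map_add, TensorProduct.tmul_add, neg_add] at hx hy ⊢
      rw [hx, hy]
    | tmul h x =>
      -- Each of the two exchanges contributes a sign, and the signs cancel.
      rw [TensorProduct.map_tmul, TensorProduct.tmul_neg, map_neg, map_neg,
        TensorProduct.assoc_symm_tmul, LinearMap.rTensor_tmul, hτ, TensorProduct.neg_tmul, map_neg,
        map_neg, neg_neg]
      generalize c e = y
      induction y with
      | zero => simp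
      | add a b ha hb => simp only [map_add, TensorProduct.add_tmul, ha, hb]
      | tmul g x' => simp [diagMul_tmul]

theorem map_mem_range_lTensor {G F : Type*} [Ring G] [HopfAlgebra ℂ G] [AddCommGroup F] [Module ℂ F]
    {S : Submodule ℂ F} {R : Submodule ℂ W} (A : G →ₗ[ℂ] U) {k : F →ₗ[ℂ] W}
    (hk : ∀ s ∈ S, k s ∈ R) {z : G ⊗[ℂ] F} (hz : z ∈ gTensor G S) :
    TensorProduct.map A k z ∈ LinearMap.range (R.subtype.lTensor U) := by
  have h1 : gTensor G S ≤ (LinearMap.range (R.subtype.lTensor U)).comap (TensorProduct.map A k) :=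
    gTensor_le fun g s hs => by
      rw [Submodule.mem_comap, TensorProduct.map_tmul]
      exact ⟨A g ⊗ₜ ⟨k s, hk s hs⟩, LinearMap.lTensor_tmul _ _ _ _⟩
  exact h1 hz

theorem comm_map_mem_range_rTensor {G F : Type*} [Ring G] [HopfAlgebra ℂ G] [AddCommGroup F]
    [Module ℂ F] {S : Submodule ℂ F} {R : Submodule ℂ W} (A : G →ₗ[ℂ] U) {k : F →ₗ[ℂ] W}
    (hk : ∀ s ∈ S, k s ∈ R) {z : G ⊗[ℂ] F} (hz : z ∈ gTensor G S) :
    TensorProduct.comm ℂ U W (TensorProduct.map A k z) ∈ LinearMap.range (R.subtype.rTensor U) := by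
  have h1 : gTensor G S ≤ (LinearMap.range (R.subtype.rTensor U)).comap
      ((TensorProduct.comm ℂ U W).toLinearMap ∘ₗ TensorProduct.map A k) :=
    gTensor_le fun g s hs => by
      rw [Submodule.mem_comap, LinearMap.comp_apply, TensorProduct.map_tmul, LinearEquiv.coe_coe,
        TensorProduct.comm_tmul]
      exact ⟨⟨k s, hk s hs⟩ ⊗ₜ A g, LinearMap.rTensor_tmul _ _ _ _⟩
  exact h1 hz

end Twist

/-! ### Bijective antipodes. -/

section Antipode

variable {G : Type*} [Ring G] [HopfAlgebra ℂ G]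

/-- The inverse `T` of the antipode satisfies `g₂ T(g₁) = ε(g)`. -/
theorem exists_inverse_antipode
    (hS : Function.Bijective (HopfAlgebraStruct.antipode ℂ : G →ₗ[ℂ] G)) :
    ∃ T : G →ₗ[ℂ] G, ∀ g, LinearMap.mul' ℂ G (TensorProduct.comm ℂ G G
      (T.rTensor G (Coalgebra.comul (R := ℂ) g))) = algebraMap ℂ G (Coalgebra.counit (R := ℂ) g) := by
  obtain ⟨T, hT⟩ : ∃ T : G →ₗ[ℂ] G, ∀ g, HopfAlgebraStruct.antipode ℂ (T g) = g :=
    ⟨(LinearEquiv.ofBijective _ hS).symm.toLinearMap, fun g =>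
      (LinearEquiv.ofBijective _ hS).apply_symm_apply g⟩
  refine ⟨T, fun g => hS.1 ?_⟩
  -- The antipode is injective and reverses products, so it turns `g₂ T(g₁)` into `g₁ S(g₂)`.
  have h1 : ∀ s : G ⊗[ℂ] G, HopfAlgebraStruct.antipode ℂ (LinearMap.mul' ℂ G
      (TensorProduct.comm ℂ G G (T.rTensor G s))) =
      LinearMap.mul' ℂ G ((HopfAlgebraStruct.antipode ℂ).lTensor G s) := by
    intro s
    induction s with
    | zero => simp
    | add a b ha hb => simp only [map_add, ha, hb]
    | tmul a b => simp [HopfAlgebra.antipode_mul_antidistrib, hT]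
  rw [h1, HopfAlgebra.mul_antipode_lTensor_comul_apply, Algebra.algebraMap_eq_smul_one, map_smul,
    HopfAlgebra.antipode_one]

/-- Cancellation in `x₋₁ T(x₋₂) ⊗ x₀`. -/
theorem map_coact_eq {F P Q : Type*} [AddCommGroup F] [Module ℂ F]
    [AddCommGroup P] [Module ℂ P] [AddCommGroup Q] [Module ℂ Q] {c : F →ₗ[ℂ] G ⊗[ℂ] F}
    (hc : ∀ x, TensorProduct.lid ℂ F ((Coalgebra.counit (R := ℂ)).rTensor F (c x)) = x)
    (hc' : ∀ x, TensorProduct.assoc ℂ G G F ((Coalgebra.comul (R := ℂ)).rTensor F (c x)) =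
      c.lTensor G (c x))
    {T : G →ₗ[ℂ] G} (hT : ∀ g, LinearMap.mul' ℂ G (TensorProduct.comm ℂ G G
      (T.rTensor G (Coalgebra.comul (R := ℂ) g))) = algebraMap ℂ G (Coalgebra.counit (R := ℂ) g))
    (A : G →ₗ[ℂ] P) (k : F →ₗ[ℂ] Q) {Φ : G ⊗[ℂ] F →ₗ[ℂ] P ⊗[ℂ] Q}
    (hΦ : ∀ h y, Φ (h ⊗ₜ y) =
      TensorProduct.map (A ∘ₗ LinearMap.mulRight ℂ (T h)) k (c y)) (x : F) :
    Φ (c x) = A 1 ⊗ₜ k x := by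
  obtain ⟨M, hM⟩ : ∃ M : G ⊗[ℂ] G →ₗ[ℂ] G, M = LinearMap.mul' ℂ G ∘ₗ
    (TensorProduct.comm ℂ G G).toLinearMap ∘ₗ T.rTensor G := ⟨_, rfl⟩
  have hM1 : ∀ g g', M (g ⊗ₜ g') = g' * T g := fun g g' => by rw [hM]; rfl
  have hM2 : M ∘ₗ Coalgebra.comul = Algebra.linearMap ℂ G ∘ₗ Coalgebra.counit := by
    rw [hM]; exact LinearMap.ext hT
  obtain ⟨Ψ, hΨ⟩ : ∃ Ψ : G ⊗[ℂ] (G ⊗[ℂ] F) →ₗ[ℂ] P ⊗[ℂ] Q, Ψ = TensorProduct.map A k ∘ₗ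
    M.rTensor F ∘ₗ (TensorProduct.assoc ℂ G G F).symm.toLinearMap := ⟨_, rfl⟩
  have h1 : Φ = Ψ ∘ₗ c.lTensor G := by
    refine TensorProduct.ext' fun h y => ?_
    rw [hΦ, LinearMap.comp_apply, LinearMap.lTensor_tmul]
    generalize c y = z
    induction z with
    | zero => simp
    | add a b ha hb => rw [map_add, TensorProduct.tmul_add, map_add, ha, hb]
    | tmul g e => simp [hΨ, hM1]
  have h2 : (Coalgebra.counit (R := ℂ)).rTensor F (c x) = (1 : ℂ) ⊗ₜ x := by
    rw [← hc x]
    exact ((TensorProduct.lid ℂ F).symm_apply_apply _).symm.trans (by rw [hc]; rfl)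
  rw [h1, LinearMap.comp_apply, ← hc', hΨ]
  simp only [LinearMap.comp_apply, LinearEquiv.coe_coe, LinearEquiv.symm_apply_apply]
  rw [← LinearMap.comp_apply (M.rTensor F), ← LinearMap.rTensor_comp, hM2, LinearMap.rTensor_comp,
    LinearMap.comp_apply, h2]
  simp

end Antipode

/-! ### Classes of adjoint translates in `V`. -/

section Class

variable {G H : Type*} [Ring G] [HopfAlgebra ℂ G] [Ring H] [HopfAlgebra ℂ H] {π : G →ₐc[ℂ] H}
variable {Ω : Type*} [AddCommGroup Ω] [Module ℂ Ω]
  [Module (coinv π) Ω] [IsScalarTower ℂ (coinv π) Ω]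
  [Module (coinv π)ᵐᵒᵖ Ω] [IsScalarTower ℂ (coinv π)ᵐᵒᵖ Ω]
  [SMulCommClass (coinv π) (coinv π)ᵐᵒᵖ Ω]

/-- The map `g ⊗ m ↦ (g ▷ b) m` recovers the product by `b` from the coproduct. -/
theorem sum_adM_mul (b m : coinv π) :
    TensorProduct.lift ((LinearMap.mul ℂ (coinv π)) ∘ₗ (adM π).flip b) (coactM π m) = m * b := by
  apply Subtype.val_injective
  have h1 := lift_coactM π ((coinv π).val.toLinearMap ∘ₗ
    TensorProduct.lift ((LinearMap.mul ℂ (coinv π)) ∘ₗ (adM π).flip b))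
    (LinearMap.mul' ℂ G ∘ₗ (ad.flip (b : G)).rTensor G) (fun g m => rfl) m
  exact h1.trans (sum_ad_mul (b : G) (m : G))

theorem lTensor_formMap_diagMul (C : CovariantCalculus π Ω) (s t : G ⊗[ℂ] coinv π) :
    C.formMap.lTensor G (diagMul (s ⊗ₜ t)) = tensorAct π Ω s (C.d.lTensor G t) := by
  refine ext_diag (p := C.formMap.lTensor G ∘ₗ diagMul)
    (q := TensorProduct.lift ((tensorAct π Ω).compl₂ (C.d.lTensor G))) (fun g m g' m' => ?_) s t
  rw [LinearMap.comp_apply, diagMul_tmul, LinearMap.lTensor_tmul, C.formMap_tmul]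
  rfl

namespace CovariantCalculus

variable (C : CovariantCalculus π Ω)

/-- The class of `g ▷ b` in `V`. -/
def adClass (b : coinv π) : G →ₗ[ℂ] C.V := C.sigmaMk ∘ₗ C.d ∘ₗ (adM π).flip b

theorem adClass_apply (b : coinv π) (g : G) : C.adClass b g = C.sigmaMk (C.d (adM π g b)) := rfl

theorem adClass_one (b : coinv π) : C.adClass b 1 = C.sigmaMk (C.d b) := by
  rw [adClass_apply, adM_one]

theorem adClass_mul (b : coinv π) (g h : G) : C.adClass b (g * h) = C.adClass (adM π h b) g := by
  rw [adClass_apply, adM_mul]; rfl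

theorem adClass_comp_mulRight (b : coinv π) (h : G) :
    C.adClass b ∘ₗ LinearMap.mulRight ℂ h = C.adClass (adM π h b) :=
  LinearMap.ext fun g => C.adClass_mul b g h

theorem sigmaMk_d_mul (h0 : IsInM0 π Ω) (x y : coinv π) : C.sigmaMk (C.d (x * y)) =
    counitM π x • C.sigmaMk (C.d y) + counitM π y • C.sigmaMk (C.d x) := by
  rw [C.leibniz, map_add, sigmaMk_smul, C.sigmaMk_op_smul_eq h0]

theorem exists_sigmaMk_d (v : C.V) : ∃ b, counitM π b = 0 ∧ C.sigmaMk (C.d b) = v := by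
  obtain ⟨n, rfl⟩ := C.I.mkQ_surjective v
  refine ⟨n, n.2, ?_⟩
  rw [sigmaMk_d]
  congr 1
  apply Subtype.val_injective
  have h : counitM π (n : coinv π) = 0 := n.2
  rw [coe_toPlus, h, map_zero, sub_zero]

end CovariantCalculus

end Class

/-! ### Commutation of forms with functions and its consequence in degree two. -/

section Formula

variable {G H : Type u} [Ring G] [HopfAlgebra ℂ G] [Ring H] [HopfAlgebra ℂ H] {π : G →ₐc[ℂ] H}
variable {Ω : Type u} [AddCommGroup Ω] [Module ℂ Ω]
  [Module (coinv π) Ω] [IsScalarTower ℂ (coinv π) Ω]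
  [Module (coinv π)ᵐᵒᵖ Ω] [IsScalarTower ℂ (coinv π)ᵐᵒᵖ Ω]
  [SMulCommClass (coinv π) (coinv π)ᵐᵒᵖ Ω]

namespace CovariantCalculus

variable {C : CovariantCalculus π Ω}

/-- The right multiplication on `Ω` in terms of the left one. -/
theorem op_smul_eq_sum (hff : IsFaithfullyFlatRight π) (h0 : IsInM0 π Ω) (b : coinv π) (ω : Ω) :
    MulOpposite.op b • ω = TensorProduct.lift
      ((Algebra.lsmul ℂ ℂ Ω).toLinearMap ∘ₗ (adM π).flip b) (C.coact ω) := by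
  -- In `G ⊗ V` both sides multiply the `G`-leg by `b` from the right: the left one because the
  -- fibre sees only `ε(b₂)`, the right one by `(g₁ ▷ b) g₂ = g b`.
  apply C.rho_injective hff
  have h1 : ∀ (s : G ⊗[ℂ] coinv π) (z : G ⊗[ℂ] Ω), C.sigmaMk.lTensor G (tensorActR π Ω s z) =
      TensorProduct.map (LinearMap.mulRight ℂ
        (TensorProduct.rid ℂ G ((counitM π).toLinearMap.lTensor G s))) C.sigmaMk z := by
    intro s z
    induction z with
    | zero => simp
    | add x y hx hy => simp only [map_add, hx, hy]
    | tmul h e =>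
      induction s with
      | zero => simp
      | add x y hx hy =>
        simp only [map_add, LinearMap.add_apply, hx, hy, TensorProduct.map_tmul,
          LinearMap.mulRight_apply, mul_add, TensorProduct.add_tmul]
      | tmul g m =>
        rw [tensorActR_tmul, LinearMap.lTensor_tmul, C.sigmaMk_op_smul_eq h0]
        simp [TensorProduct.smul_tmul]
  have h2 : C.rho (MulOpposite.op b • ω) = (LinearMap.mulRight ℂ (b : G)).rTensor C.V (C.rho ω) := by
    rw [rho_apply, coact_op_smul, h1, QHom.counit_coactM, TensorProduct.rid_tmul,
      one_smul, rho_apply, ← LinearMap.rTensor_comp_lTensor]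
    rfl
  obtain ⟨F, hF⟩ : ∃ F : G ⊗[ℂ] (G ⊗[ℂ] C.V) →ₗ[ℂ] G ⊗[ℂ] C.V,
      ∀ g h v, F (g ⊗ₜ (h ⊗ₜ v)) = (ad g (b : G) * h) ⊗ₜ v :=
    ⟨(LinearMap.mul' ℂ G ∘ₗ (ad.flip (b : G)).rTensor G).rTensor C.V ∘ₗ
      (TensorProduct.assoc ℂ G G C.V).symm.toLinearMap, fun _ _ _ => rfl⟩
  have h3 : C.rho ∘ₗ TensorProduct.lift
      ((Algebra.lsmul ℂ ℂ Ω).toLinearMap ∘ₗ (adM π).flip b) = F ∘ₗ C.rho.lTensor G := by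
    refine TensorProduct.ext' fun g x => ?_
    rw [LinearMap.comp_apply, LinearMap.comp_apply, LinearMap.lTensor_tmul]
    change C.rho (adM π g b • x) = _
    rw [rho_smul]
    generalize C.rho x = z
    induction z with
    | zero => simp
    | add x y hx hy => rw [smul_add, TensorProduct.tmul_add, map_add, hx, hy]
    | tmul h v => rw [coinv_smul_tmul, hF, coe_adM]
  have h4 : ∀ z, F ((freeRelHopf π C.V).coact z) = (LinearMap.mulRight ℂ (b : G)).rTensor C.V z := by
    intro z
    induction z with
    | zero => simp
    | add x y hx hy => simp only [map_add, hx, hy]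
    | tmul g v =>
      rw [freeRelHopf_coact_tmul, LinearMap.rTensor_tmul, LinearMap.mulRight_apply,
        ← sum_ad_mul (b : G) g]
      generalize Coalgebra.comul (R := ℂ) g = s
      induction s with
      | zero => simp
      | add x y hx hy => simp only [map_add, TensorProduct.add_tmul, hx, hy]
      | tmul g h => rw [TensorProduct.assoc_tmul, hF]; rfl
  rw [h2, ← h4, coact_rho]
  exact (congrArg (fun f => f (C.coact ω)) h3).symm

/-- The relations in degree two arising from the commutation of forms with functions. -/
theorem tmul_add_mem_ITwo (hff : IsFaithfullyFlatRight π) (h0 : IsInM0 π Ω) {b : coinv π}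
    (hb : counitM π b = 0) (ω : Ω) :
    C.sigmaMk ω ⊗ₜ C.sigmaMk (C.d b) +
      TensorProduct.map (C.adClass b) C.sigmaMk (C.coact ω) ∈ C.ITwo h0 := by
  have h : ω ∈ Submodule.span ℂ {ω : Ω | ∃ a b : coinv π, ω = a • C.d b} := by
    rw [C.span_d]; trivial
  induction h using Submodule.span_induction with
  | zero => simp
  | add x y _ _ hx hy =>
    rw [map_add, map_add, map_add, TensorProduct.add_tmul, add_add_add_comm]
    exact add_mem hx hy
  | smul c x _ hx =>
    rw [map_smul, map_smul, map_smul, ← TensorProduct.smul_tmul', ← smul_add]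
    exact Submodule.smul_mem _ c hx
  | mem x hx =>
    obtain ⟨a, c, rfl⟩ := hx
    obtain ⟨D, hD⟩ : ∃ D : G ⊗[ℂ] (coinv π ⊗[ℂ] coinv π),
      D = diagMul (coactM π a ⊗ₜ coactM π c) := ⟨_, rfl⟩
    obtain ⟨L, hL⟩ : ∃ L : G ⊗[ℂ] (coinv π ⊗[ℂ] coinv π) →ₗ[ℂ] coinv π ⊗[ℂ] coinv π,
        ∀ g m m', L (g ⊗ₜ (m ⊗ₜ m')) = (adM π g b * m) ⊗ₜ m' :=
      ⟨(TensorProduct.lift ((LinearMap.mul ℂ (coinv π)) ∘ₗ (adM π).flip b)).rTensor (coinv π) ∘ₗ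
        (TensorProduct.assoc ℂ G _ _).symm.toLinearMap, fun _ _ _ => rfl⟩
    have hext : ∀ {P : Type u} [AddCommGroup P] [Module ℂ P]
        {p q : G ⊗[ℂ] (coinv π ⊗[ℂ] coinv π) →ₗ[ℂ] P}
        (h : ∀ g m m', p (g ⊗ₜ (m ⊗ₜ m')) = q (g ⊗ₜ (m ⊗ₜ m'))), p = q := fun h =>
      TensorProduct.ext (LinearMap.ext fun g => TensorProduct.ext' fun m m' => h g m m')
    have e1 : LinearMap.mul' ℂ (coinv π) (L D) = a * c * b := by
      have h1 : LinearMap.mul' ℂ (coinv π) ∘ₗ L = TensorProduct.lift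
          ((LinearMap.mul ℂ (coinv π)) ∘ₗ (adM π).flip b) ∘ₗ
          (LinearMap.mul' ℂ (coinv π)).lTensor G := hext fun g m m' => by
        rw [LinearMap.comp_apply, hL]
        exact mul_assoc _ _ _
      rw [← LinearMap.comp_apply, h1, LinearMap.comp_apply, hD, ← mul_eq_lTensor_diagMul,
        ← coactM_mul, sum_adM_mul]
    have e0 : C.formMap.lTensor G D = C.coact (a • C.d c) := by
      rw [hD, lTensor_formMap_diagMul, C.coact_smul_d]
    have e2 : C.formMap (L D) = MulOpposite.op b • a • C.d c := by
      have h1 : C.formMap ∘ₗ L = TensorProduct.lift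
          ((Algebra.lsmul ℂ ℂ Ω).toLinearMap ∘ₗ (adM π).flip b) ∘ₗ C.formMap.lTensor G :=
        hext fun g m m' => by
          rw [LinearMap.comp_apply, hL, C.formMap_tmul, LinearMap.comp_apply,
            LinearMap.lTensor_tmul, C.formMap_tmul, mul_smul]
          rfl
      rw [← LinearMap.comp_apply, h1, LinearMap.comp_apply, e0, op_smul_eq_sum hff h0]
    have e3 : C.sigmaSq (TensorProduct.map C.d C.d (L D)) =
        TensorProduct.map (C.adClass b) C.sigmaMk (C.coact (a • C.d c)) := by
      have h1 : C.sigmaSq ∘ₗ TensorProduct.map C.d C.d ∘ₗ L =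
          TensorProduct.map (C.adClass b) C.sigmaMk ∘ₗ C.formMap.lTensor G :=
        hext fun g m m' => by
          rw [LinearMap.comp_apply, LinearMap.comp_apply, hL, TensorProduct.map_tmul, sigmaSq_tmul,
            sigmaMk_d_mul C h0, counitM_adM, hb, mul_zero, zero_smul, zero_add, LinearMap.comp_apply,
            LinearMap.lTensor_tmul, C.formMap_tmul, TensorProduct.map_tmul, sigmaMk_smul,
            TensorProduct.smul_tmul]
          rfl
      rw [← e0]
      exact congrArg (fun f => f D) h1
    -- For `ω = a dc` this lifts `a d(cb) - ac db = ω b = (ω₋₁ ▷ b) ω₀` to `M ⊗ M`. The term `acb ⊗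
    -- 1` does not change the form, as `d1 = 0`, and brings the product to zero.
    obtain ⟨n, hn⟩ : ∃ n : coinv π ⊗[ℂ] coinv π,
      n = (a * c * b) ⊗ₜ 1 + a ⊗ₜ (c * b) - (a * c) ⊗ₜ b - L D := ⟨_, rfl⟩
    have hnN : n ∈ C.N := by
      constructor
      · change LinearMap.mul' ℂ (coinv π) n = 0
        rw [hn]
        simp only [map_add, map_sub, LinearMap.mul'_apply, e1, mul_one, mul_assoc]
        abel
      · change C.formMap n = 0
        rw [hn]
        simp only [map_add, map_sub, C.formMap_tmul, e2, C.d_one, C.leibniz, smul_add, smul_zero,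
          mul_smul]
        rw [← smul_comm a (MulOpposite.op b)]
        abel
    rw [ITwo_eq]
    -- In `V ⊗ V` the terms with the factor `ε(b)` drop out and the two terms `ε(c) σ[da] ⊗ σ[db]`
    -- cancel, leaving the claim up to sign.
    refine ⟨- TensorProduct.map C.d C.d n, neg_mem (C.map_d_mem_relTwo hnN), ?_⟩
    have hac := C.sigmaMk_smul a (C.d c)
    rw [hn, map_neg]
    simp only [map_add, map_sub, TensorProduct.map_tmul, sigmaSq_tmul, e3, C.d_one,
      TensorProduct.tmul_zero, zero_add, sigmaMk_d_mul C h0, hb, zero_smul, add_zero, hac,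
      TensorProduct.add_tmul, TensorProduct.tmul_smul, TensorProduct.smul_tmul]
    abel

end CovariantCalculus

end Formula

/-! ### Exchange maps given by a coaction. -/

section Swap

variable {G : Type*} [Ring G] [HopfAlgebra ℂ G] {E : Type*} [AddCommGroup E] [Module ℂ E]
  {c : E →ₗ[ℂ] G ⊗[ℂ] E} {S : Submodule ℂ (E ⊗[ℂ] E)}

section Maps

variable {U W : Type*} [AddCommGroup U] [Module ℂ U] [AddCommGroup W] [Module ℂ W]
  {τ : W ⊗[ℂ] U →ₗ[ℂ] U ⊗[ℂ] W} {s : E →ₗ[ℂ] W} {R : Submodule ℂ (W ⊗[ℂ] W)}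
  (hS : ∀ t ∈ S, diagCoact c c t ∈ gTensor G S)
  (hR : ∀ r ∈ R, ∃ t ∈ S, TensorProduct.map s s t = r) (hR' : ∀ t ∈ S, TensorProduct.map s s t ∈ R)
  (hA : ∀ u, ∃ A : G →ₗ[ℂ] U, A 1 = u ∧ ∀ e h,
    τ (s e ⊗ₜ A h) + TensorProduct.map (A ∘ₗ LinearMap.mulRight ℂ h) s (c e) = 0)

include hS hR hR' hA

/-- A map `W ⊗ U → U ⊗ W` given by a coaction preserves relations which are stable under it. -/
theorem swapRight_mem (u : U) {r : W ⊗[ℂ] W} (hr : r ∈ R) :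
    swapRight τ (r ⊗ₜ u) ∈ LinearMap.range (R.subtype.lTensor U) := by
  obtain ⟨A, rfl, hAu⟩ := hA u
  obtain ⟨t, ht, rfl⟩ := hR r hr
  rw [swapRight_map hAu]
  exact map_mem_range_lTensor A hR' (hS t ht)

/-- If the antipode is bijective, then the inverse of `swapRight` preserves the relations. -/
theorem swapLeft_mem_of_bijective
    (hG : Function.Bijective (HopfAlgebraStruct.antipode ℂ : G →ₗ[ℂ] G))
    (hc : ∀ x, TensorProduct.lid ℂ _ ((Coalgebra.counit (R := ℂ)).rTensor _ (diagCoact c c x)) = x)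
    (hc' : ∀ x, TensorProduct.assoc ℂ G G _ ((Coalgebra.comul (R := ℂ)).rTensor _
      (diagCoact c c x)) = (diagCoact c c).lTensor G (diagCoact c c x))
    {θ : U ⊗[ℂ] W →ₗ[ℂ] W ⊗[ℂ] U} (hθ : ∀ t, θ (τ t) = t) (u : U) {r : W ⊗[ℂ] W} (hr : r ∈ R) :
    swapLeft θ (u ⊗ₜ r) ∈ LinearMap.range (R.subtype.rTensor U) := by
  obtain ⟨A, rfl, hAu⟩ := hA u
  obtain ⟨t, ht, rfl⟩ := hR r hr
  obtain ⟨T, hT⟩ := exists_inverse_antipode hG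
  -- A preimage of `u ⊗ r` under `swapRight τ` is `t₀ ⊗ A(T(t₋₁))`, with `t` standing for its image
  -- under `s ⊗ s`: exchanging gives `A(t₋₁ T(t₋₂)) ⊗ t₀`, and this is `A(1) ⊗ t`.
  have key := map_coact_eq hc hc' hT A (TensorProduct.map s s) (Φ := swapRight τ ∘ₗ
    (TensorProduct.comm ℂ _ _).toLinearMap ∘ₗ TensorProduct.map (A ∘ₗ T) (TensorProduct.map s s))
    (fun g y => ?_) t
  · rw [← key, LinearMap.comp_apply, swapLeft_swapRight hθ]
    exact comm_map_mem_range_rTensor _ hR' (hS t ht)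
  · have h1 := swapRight_map (τ := τ) (A := A ∘ₗ LinearMap.mulRight ℂ (T g)) (s := s) (c := c)
      (fun e h => ?_) y
    · rw [← h1]
      simp
    · rw [← hAu e (h * T g)]
      congr 2
      ext g'
      simp [mul_assoc]

end Maps

section Subspaces

variable {V : Type*} [AddCommGroup V] [Module ℂ V] {U W : Submodule ℂ V} {h : IsCompl U W}
  {I : Submodule ℂ (V ⊗[ℂ] V)} (hI : IsSplitHomogeneous h I) {σ : E →ₗ[ℂ] V}
  (hSI : S.map (TensorProduct.map σ σ) = I)

include hSI in
theorem exists_map_eq_of_mem_subRel {r : W ⊗[ℂ] W} (hr : r ∈ subRel I W) : ∃ t ∈ S,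
    TensorProduct.map (W.projectionOnto U h.symm ∘ₗ σ) (W.projectionOnto U h.symm ∘ₗ σ) t = r := by
  have h1 : TensorProduct.map W.subtype W.subtype r ∈ I := hr
  rw [← hSI] at h1
  obtain ⟨t, ht, htr⟩ := h1
  refine ⟨t, ht, ?_⟩
  rw [TensorProduct.map_comp, LinearMap.comp_apply, htr, ← LinearMap.comp_apply,
    ← TensorProduct.map_comp]
  have h2 : W.projectionOnto U h.symm ∘ₗ W.subtype = LinearMap.id :=
    LinearMap.ext fun y => Submodule.projectionOnto_apply_left _ y
  rw [h2, TensorProduct.map_id]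
  rfl

include hSI hI in
theorem map_mem_subRel {t : E ⊗[ℂ] E} (ht : t ∈ S) :
    TensorProduct.map (W.projectionOnto U h.symm ∘ₗ σ) (W.projectionOnto U h.symm ∘ₗ σ) t ∈
      subRel I W := by
  rw [TensorProduct.map_comp, LinearMap.comp_apply]
  exact hI.symm.map_mem_subRel (by rw [← hSI]; exact ⟨t, ht, rfl⟩)

/-- The swap map is given by the coaction. -/
theorem exists_swap_eq (hI : IsSplitHomogeneous h I)
    (hd : Disjoint (Submodule.map₂ (TensorProduct.mk ℂ V V) U W) I)
    {τ : W ⊗[ℂ] U →ₗ[ℂ] U ⊗[ℂ] W} (hτ : ∀ t, TensorProduct.map W.subtype U.subtype t -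
      TensorProduct.map U.subtype W.subtype (τ t) ∈ I) {q : E →ₗ[ℂ] E}
    (hq : ∀ e, c (q e) = q.lTensor G (c e)) (hqσ : ∀ e, σ (q e) = W.projection U h.symm (σ e))
    (hα : ∀ v, ∃ α : G →ₗ[ℂ] V, α 1 = v ∧ ∀ e g,
      σ e ⊗ₜ α g + TensorProduct.map (α ∘ₗ LinearMap.mulRight ℂ g) σ (c e) ∈ I) (u : U) :
    ∃ A : G →ₗ[ℂ] U, A 1 = u ∧ ∀ e g, τ ((W.projectionOnto U h.symm ∘ₗ σ) e ⊗ₜ A g) +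
      TensorProduct.map (A ∘ₗ LinearMap.mulRight ℂ g) (W.projectionOnto U h.symm ∘ₗ σ) (c e) = 0 := by
  obtain ⟨α, hα1, hα⟩ := hα u
  refine ⟨U.projectionOnto W h ∘ₗ α, ?_, fun e g => ?_⟩
  · rw [LinearMap.comp_apply, hα1]
    exact Submodule.projectionOnto_apply_left _ u
  apply swap_add_eq_zero hd hτ
  -- The relation is applied to the `W`-component `q e`. Its mixed part, which stays in `I` by
  -- homogeneity, is one term in `W ⊗ U` plus one in `U ⊗ W`.
  have h1 := (hI _ (hα (q e) g)).2.1
  rw [hq] at h1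
  simp only [map_add, TensorProduct.map_tmul] at h1
  have hPQ : ∀ v, U.projection W h (W.projection U h.symm v) = 0 :=
    fun v => projection_eq_zero_of_mem h (Submodule.projection_apply_mem _ _)
  have hQQ : ∀ v, W.projection U h.symm (W.projection U h.symm v) = W.projection U h.symm v :=
    fun v => projection_eq_of_mem h.symm (Submodule.projection_apply_mem _ _)
  have h2 : ∀ z : G ⊗[ℂ] E, TensorProduct.map (U.projection W h) (W.projection U h.symm)
      (TensorProduct.map (α ∘ₗ LinearMap.mulRight ℂ g) σ (q.lTensor G z)) =
      TensorProduct.map U.subtype W.subtype (TensorProduct.map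
        ((U.projectionOnto W h ∘ₗ α) ∘ₗ LinearMap.mulRight ℂ g)
        (W.projectionOnto U h.symm ∘ₗ σ) z) := by
    intro z
    induction z with
    | zero => simp
    | add x y hx hy => simp only [map_add, hx, hy]
    | tmul g x =>
      rw [LinearMap.lTensor_tmul, TensorProduct.map_tmul, TensorProduct.map_tmul, hqσ, hQQ]
      rfl
  have h3 : ∀ z : G ⊗[ℂ] E, TensorProduct.map (W.projection U h.symm) (U.projection W h)
      (TensorProduct.map (α ∘ₗ LinearMap.mulRight ℂ g) σ (q.lTensor G z)) = 0 := by
    intro z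
    induction z with
    | zero => simp
    | add x y hx hy => simp only [map_add, hx, hy, add_zero]
    | tmul g x =>
      rw [LinearMap.lTensor_tmul, TensorProduct.map_tmul, TensorProduct.map_tmul, hqσ, hPQ,
        TensorProduct.tmul_zero]
  rw [h2, h3, hqσ, hPQ, hQQ, TensorProduct.zero_tmul, zero_add, add_zero, add_comm] at h1
  exact h1

/-- The two maps `swapRight` and `swapLeft` preserve the relations. -/
theorem swap_mem_of_coaction (hUW : Disjoint (Submodule.map₂ (TensorProduct.mk ℂ V V) U W) I)
    (hI : IsSplitHomogeneous h I) (hSI : S.map (TensorProduct.map σ σ) = I)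
    (hS : ∀ t ∈ S, diagCoact c c t ∈ gTensor G S)
    {τ : W ⊗[ℂ] U →ₗ[ℂ] U ⊗[ℂ] W} (hτ : ∀ t, TensorProduct.map W.subtype U.subtype t -
      TensorProduct.map U.subtype W.subtype (τ t) ∈ I) {q : E →ₗ[ℂ] E}
    (hq : ∀ e, c (q e) = q.lTensor G (c e)) (hqσ : ∀ e, σ (q e) = W.projection U h.symm (σ e))
    (hα : ∀ v, ∃ α : G →ₗ[ℂ] V, α 1 = v ∧ ∀ e g,
      σ e ⊗ₜ α g + TensorProduct.map (α ∘ₗ LinearMap.mulRight ℂ g) σ (c e) ∈ I)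
    (hc : ∀ x, TensorProduct.lid ℂ _ ((Coalgebra.counit (R := ℂ)).rTensor _ (diagCoact c c x)) = x)
    (hc' : ∀ x, TensorProduct.assoc ℂ G G _ ((Coalgebra.comul (R := ℂ)).rTensor _
      (diagCoact c c x)) = (diagCoact c c).lTensor G (diagCoact c c x))
    {θ : U ⊗[ℂ] W →ₗ[ℂ] W ⊗[ℂ] U} (hθ : ∀ t, θ (τ t) = t)
    (hfin : Function.Bijective (HopfAlgebraStruct.antipode ℂ : G →ₗ[ℂ] G) ∨
      FiniteDimensional ℂ V) (u : U) {r : W ⊗[ℂ] W} (hr : r ∈ subRel I W) :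
    swapRight τ (r ⊗ₜ u) ∈ LinearMap.range ((subRel I W).subtype.lTensor U) ∧
      swapLeft θ (u ⊗ₜ r) ∈ LinearMap.range ((subRel I W).subtype.rTensor U) := by
  have hA := exists_swap_eq hI hUW hτ hq hqσ hα
  have hR := fun r hr => exists_map_eq_of_mem_subRel (h := h) (U := U) (W := W) hSI (r := r) hr
  have hR' := fun t ht => map_mem_subRel hI hSI (t := t) ht
  have h1 := fun u r hr => swapRight_mem (r := r) hS hR hR' hA u hr
  refine ⟨h1 u r hr, ?_⟩
  rcases hfin with hG | hV
  · exact swapLeft_mem_of_bijective hS hR hR' hA hG hc hc' hθ u hr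
  · exact swapLeft_mem_of_finite hθ h1 u hr

end Subspaces

end Swap

/-! ### From fibres to forms in all bidegrees. -/

section Converse

variable {G H : Type u} [Ring G] [HopfAlgebra ℂ G] [Ring H] [HopfAlgebra ℂ H] {π : G →ₐc[ℂ] H}
variable {Ω : Type u} [AddCommGroup Ω] [Module ℂ Ω]
  [Module (coinv π) Ω] [IsScalarTower ℂ (coinv π) Ω]
  [Module (coinv π)ᵐᵒᵖ Ω] [IsScalarTower ℂ (coinv π)ᵐᵒᵖ Ω]
  [SMulCommClass (coinv π) (coinv π)ᵐᵒᵖ Ω]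

namespace CovariantCalculus

variable {C : CovariantCalculus π Ω} {X Y : Submodule ℂ Ω}

/-- Every element of `V` is the value at `1` of a map `G → V` describing the relations `I²`. -/
theorem exists_adClass (hff : IsFaithfullyFlatRight π) (h0 : IsInM0 π Ω) (v : C.V) :
    ∃ α : G →ₗ[ℂ] C.V, α 1 = v ∧ ∀ e g, C.sigmaMk e ⊗ₜ α g +
      TensorProduct.map (α ∘ₗ LinearMap.mulRight ℂ g) C.sigmaMk (C.coact e) ∈ C.ITwo h0 := by
  obtain ⟨b, hb, rfl⟩ := C.exists_sigmaMk_d v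
  refine ⟨C.adClass b, C.adClass_one b, fun e g => ?_⟩
  rw [adClass_comp_mulRight]
  exact tmul_add_mem_ITwo hff h0
    (show counitM π (adM π g b) = 0 by rw [counitM_adM, hb, mul_zero]) e

variable {𝒜 : ℕ × ℕ → Submodule ℂ C.MaximalProlongation}

/-- The two isomorphisms supply mutually inverse exchange maps `τ` and `θ`, both given by the
coaction. Moving `U` past the relations of `W` is then immediate. Moving `W` past those of `U` means
inverting `swapRight θ` on relations, and only this uses the bijective antipode or the finite
dimension. -/
theorem IsBigrading.isIsoOnto_wedge_of_wedgeSigma (hff : IsFaithfullyFlatRight π)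
    (h0 : IsInM0 π Ω) (hXY : (X, Y) ∈ C.formDecompositions) (hA : C.IsBigrading X Y 𝒜)
    (hS : Function.Bijective (HopfAlgebraStruct.antipode ℂ : G →ₗ[ℂ] G) ∨ FiniteDimensional ℂ C.V)
    (hσ : C.WedgeSigmaCondition h0 X Y) (p q : ℕ) :
    IsIsoOnto (C.wedge (𝒜 (p, 0)) (𝒜 (0, q))) (𝒜 (p, q)) := by
  obtain ⟨hX, hY, h⟩ := id hXY
  have hI : IsSplitHomogeneous (isCompl_toV hX hY h) (C.ITwo h0) :=
    (isHomogeneousITwo_iff hX hY h h0).1 ((exists_isBigrading_iff hff h0 hXY).1 ⟨𝒜, hA⟩)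
  obtain ⟨hσ1, hσ2⟩ := hσ
  rw [VTwo11_comm] at hσ2
  obtain ⟨hd, hle⟩ := (C.isIsoOnto_wedgeSigmaRes_iff h0 X Y).1 hσ1
  obtain ⟨hd', hle'⟩ := (C.isIsoOnto_wedgeSigmaRes_iff h0 Y X).1 hσ2
  obtain ⟨τ, hτ⟩ := exists_swap hd hle
  obtain ⟨θ, hθ⟩ := exists_swap hd' hle'
  have hτθ : ∀ t, τ (θ t) = t := fun t => swap_eq hd hτ (by
    rw [← neg_sub]; exact neg_mem (hθ t))
  have hθτ : ∀ t, θ (τ t) = t := fun t => swap_eq hd' hθ (by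
    rw [← neg_sub]; exact neg_mem (hτ t))
  have hSI : (C.relTwo.restrictScalars ℂ).map C.sigmaSq = C.ITwo h0 := (C.ITwo_eq h0).symm
  have hα := exists_adClass hff h0 (C := C)
  have h2 := swap_mem_of_coaction hd hI hSI (fun t ht => C.coact_mem_relTwo ht) hτ
    (coact_projection hY hX h.symm) (sigmaMk_projection hY hX h.symm) hα
    C.twoRelHopf.counit_coact C.twoRelHopf.coassoc hθτ hS
  have h3 := swap_mem_of_coaction hd' hI.symm hSI (fun t ht => C.coact_mem_relTwo ht) hθ
    (coact_projection hX hY h) (sigmaMk_projection hX hY h) hα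
    C.twoRelHopf.counit_coact C.twoRelHopf.coassoc hτθ hS
  exact hA.isIsoOnto_wedge hff h0 hXY hle (fun t ht ht0 => C.map_mk_eq_zero h0 hI hd hτ
    (fun w r hr => (h3 w hr).2) (fun u r hr => (h2 u hr).1) ht ht0) p q

/-- If the restrictions of `∧_σ` are isomorphisms, then the wedge condition holds, provided that the
antipode is bijective or that `V` is finite-dimensional. -/
theorem WedgeSigmaCondition.wedgeCondition (hff : IsFaithfullyFlatRight π)
    (h0 : IsInM0 π Ω) (hXY : (X, Y) ∈ C.formDecompositions) (hA : C.IsBigrading X Y 𝒜)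
    (hS : Function.Bijective (HopfAlgebraStruct.antipode ℂ : G →ₗ[ℂ] G) ∨ FiniteDimensional ℂ C.V)
    (hσ : C.WedgeSigmaCondition h0 X Y) : C.WedgeCondition 𝒜 := by
  have hσ' : C.WedgeSigmaCondition h0 Y X := by
    refine ⟨?_, ?_⟩
    · rw [VTwo11_comm]; exact hσ.2
    · rw [VTwo11_comm]; exact hσ.1
  -- The second isomorphism is the first one for the exchanged summands, so `p` and `q` trade
  -- places.
  exact fun p q => ⟨hA.isIsoOnto_wedge_of_wedgeSigma hff h0 hXY hS hσ p q,
    hA.swap.isIsoOnto_wedge_of_wedgeSigma hff h0 ⟨hXY.2.1, hXY.1, hXY.2.2.symm⟩ hS hσ' q p⟩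

end CovariantCalculus

end Converse

end QHom

end

theorem mainTheorem4 {G H Ω : Type u} [Ring G] [HopfAlgebra ℂ G] [Ring H] [HopfAlgebra ℂ H]
    (π : G →ₐc[ℂ] H) (hff : QHom.IsFaithfullyFlatRight π)
    [AddCommGroup Ω] [Module ℂ Ω]
    [Module (QHom.coinv π) Ω] [IsScalarTower ℂ (QHom.coinv π) Ω]
    [Module (QHom.coinv π)ᵐᵒᵖ Ω] [IsScalarTower ℂ (QHom.coinv π)ᵐᵒᵖ Ω]
    [SMulCommClass (QHom.coinv π) (QHom.coinv π)ᵐᵒᵖ Ω]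
    (C : QHom.CovariantCalculus π Ω) :
    Set.BijOn (Prod.map C.toV C.toV) C.formDecompositions C.cotangentDecompositions ∧
    ∀ h0 : QHom.IsInM0 π Ω,
      Set.BijOn (Prod.map C.toV C.toV) C.formDecompositions C.comoduleDecompositions ∧
      ∀ Ω₁₀ Ω₀₁ : Submodule ℂ Ω, (Ω₁₀, Ω₀₁) ∈ C.formDecompositions →
        ((∃ 𝒜, C.IsBigrading Ω₁₀ Ω₀₁ 𝒜) ↔
          C.IsHomogeneousITwo h0 Ω₁₀ Ω₀₁) ∧
        ∀ 𝒜, C.IsBigrading Ω₁₀ Ω₀₁ 𝒜 →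
          (C.WedgeCondition 𝒜 → C.WedgeSigmaCondition h0 Ω₁₀ Ω₀₁) ∧
          (Function.Bijective (HopfAlgebraStruct.antipode ℂ : G →ₗ[ℂ] G) ∨
              FiniteDimensional ℂ C.V →
            C.WedgeSigmaCondition h0 Ω₁₀ Ω₀₁ → C.WedgeCondition 𝒜) := by
  refine ⟨C.bijOn_cotangentDecompositions hff, fun h0 =>
    ⟨C.bijOn_comoduleDecompositions hff h0, fun X Y hXY =>
      ⟨QHom.CovariantCalculus.exists_isBigrading_iff hff h0 hXY, fun 𝒜 hA =>
        ⟨fun hW => hW.wedgeSigmaCondition hff h0 hXY hA,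
          fun hS hσ => hσ.wedgeCondition hff h0 hXY hA hS⟩⟩⟩⟩
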